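/- Let $N\ge 1$ and let $P$ be the permutation operator on $\mathbb C^N\otimes\mathbb C^N$. Let $g(u)=1+\sum_{i\ge1}g_iu^{-i}\in\mathbb C[[u^{-1}]]$ be the unique series of this form with $g(u+N)=g(u)(1-u^{-2})$, and set $$R(u)=1-P\,h\,u^{-1},\qquad \overline R(u)=g(u/h)\,R(u).$$ The double Yangian $\mathrm{DY}(\mathfrak{gl}_N)$ is the associative algebra over $\mathbb C[[h]]$ generated by a central element $C$ and elements $t_{ij}^{(r)}$, $t_{ij}^{(-r)}$ with $1\le i,j\le N$, $r\ge1$, with the defining relations $$R(u-v)T_1(u)T_2(v)=T_2(v)T_1(u)R(u-v),\qquad R(u-v)T^+_1(u)T^+_2(v)=T^+_2(v)T^+_1(u)R(u-v),$$ $$\overline R(u-v+hC/2)\,T_1(u)T^+_2(v)=T^+_2(v)T_1(u)\,\overline R(u-v-hC/2),$$ where $T(u)=\sum e_{ij}\otimes t_{ij}(u)$, $T^+(u)=\sum e_{ij}\otimes t^+_{ij}(u)$ with $$t_{ij}(u)=\delta_{ij}+h\sum_{r\ge1}t_{ij}^{(r)}u^{-r},\qquad t^+_{ij}(u)=\delta_{ij}-h\sum_{r\ge1}t_{ij}^{(-r)}u^{r-1};$$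 in the last relation $\overline R$ is expanded in nonpositive powers of $u$ and nonnegative powers of $v$, and each relation between the generators is understood after division by the common factor $h^2$. For $c\in\mathbb C$ let $\mathrm{DY}_c(\mathfrak{gl}_N)$ be the quotient of $\mathrm{DY}(\mathfrak{gl}_N)$ by the ideal generated by $C-c$, let $I_p$ ($p\ge1$) be its left ideal generated by all $t_{ij}^{(r)}$ with $r\ge p$, and let $\widetilde{\mathrm{DY}}_c(\mathfrak{gl}_N)$ be the $h$-adic completion of $\varprojlim_p\mathrm{DY}_c(\mathfrak{gl}_N)/I_p$, that is, the completion of the algebra $\mathrm{DY}_c(\mathfrak{gl}_N)$ in the topology in which the left ideals $I_p+h^n\,\mathrm{DY}_c(\mathfrak{gl}_N)$ ($p\ge 1$, $n\ge 0$) form a basis of neighbourhoods of zero. Let $\mu$ be a Young diagram with $m$ boxes and at most $N$ rows, and let $\mathcal U$ be a standard tableau of shape $\mu$ with entries $1,\dots,m$. Put $c_a=j-i$ if $a$ occupies the box $(i,j)$ of $\mathcal U$. Let $e_{\mathcal U}\in\mathbb C[\mathfrak S_m]$ be the primitive idempotent associated with $\mathcal U$ through the Young bases of the irreducible representations of $\mathfrak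 S_m$, that is, the product over $a=1,\dots,m$ of the spectral projections of the Jucys–Murphy elements $x_a=\sum_{b<a}(b\,a)$ for the eigenvalues $c_a$, and let $\mathcal E_{\mathcal U}$ be the operator by which $e_{\mathcal U}$ acts on $(\mathbb C^N)^{\otimes m}$ when $\mathfrak S_m$ permutes the tensor factors. Consider at the critical level $c=-N$ the series $$\widetilde{\mathbb T}_\mu(u)=\mathrm{tr}_{1,\dots,m}\,\mathcal E_{\mathcal U}\,T^+_1(u+hc_1)\cdots T^+_m(u+hc_m)\,T_m(u+hc_m-hN/2)^{-1}\cdots T_1(u+hc_1-hN/2)^{-1},$$ where the shifted series $T_a^+$ are expanded in nonnegative powers of $u$ and the shifted series $T_a$ in nonpositive powers of $u$. Theorem. The coefficient of each power $u^d$, $d\in\mathbb Z$, in $\widetilde{\mathbb T}_\mu(u)$ is a well-defined (convergent) element of $\widetilde{\mathrm{DY}}_{-N}(\mathfrak{gl}_N)$, and it belongs to the center of the algebra $\widetilde{\mathrm{DY}}_{-N}(\mathfrak{gl}_N)$. -/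

import Mathlib

/-! ## The ground ring and the normalizing series -/

namespace DoubleYangian

noncomputable section

/-- The ground ring `ℂ[[h]]`. -/
abbrev Base : Type := PowerSeries ℂ

/-- The formal parameter `h`. -/
def hbar : Base := PowerSeries.X

/-- The scalar `z * h` of `ℂ[[h]]`, for a complex number `z`. -/
def hMul (z : ℂ) : Base := PowerSeries.C z * hbar

/-- The shift `f(u) ↦ f(u + a)` of a formal power series `f(u) = ∑ fᵢ u⁻ⁱ` in `u⁻¹`, where
`(u + a)⁻ⁱ` is expanded in nonpositive powers of `u`. The power series variable stands
for `u⁻¹`. -/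
def invShift {R : Type*} [Ring R] (a : R) (f : PowerSeries R) : PowerSeries R :=
  PowerSeries.mk fun k => ∑ i ∈ Finset.range (k + 1),
    (Nat.choose (k - 1) (k - i) : R) * (-a) ^ (k - i) * PowerSeries.coeff i f

/-- The shift `f(u) ↦ f(u + a)` of a formal power series `f(u) = ∑ fᵢ uⁱ` in `u` with coefficients
in a topological ring, where `(u + a)ⁱ` is expanded in nonnegative powers of `u`. -/
def plusShift {R : Type*} [Ring R] [TopologicalSpace R] (a : R) (f : PowerSeries R) :
    PowerSeries R :=
  PowerSeries.mk fun k => ∑' j : ℕ,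
    (Nat.choose (k + j) k : R) * a ^ j * PowerSeries.coeff (k + j) f

/-- The coefficients `gᵢ` of the normalizing series `g(u) = 1 + g₁ u⁻¹ + g₂ u⁻² + ⋯`, obtained by
solving `g(u + N) = g(u) (1 - u⁻²)` for one coefficient after the other. -/
def gCoeff (N : ℕ) : ℕ → ℂ
  | 0 => 1
  | k + 1 => (gCoeff N k + ∑ i : Fin (k + 1),
      (Nat.choose (k + 1) (k + 2 - i) : ℂ) * (-(N : ℂ)) ^ (k + 2 - (i : ℕ)) * gCoeff N i) /
        ((k + 1) * N)

/-- The normalizing series `g(u)`, as a power series in `u⁻¹`. -/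
def gSeries (N : ℕ) : PowerSeries ℂ := PowerSeries.mk (gCoeff N)

theorem constantCoeff_gSeries (N : ℕ) : PowerSeries.constantCoeff (gSeries N) = 1 := by
  rw [← PowerSeries.coeff_zero_eq_constantCoeff_apply, gSeries, PowerSeries.coeff_mk, gCoeff]

/-- The functional equation `g(u + N) = g(u) (1 - u⁻²)`. -/
theorem invShift_gSeries {N : ℕ} (hN : 1 ≤ N) :
    invShift (N : ℂ) (gSeries N) = gSeries N * (1 - PowerSeries.X ^ 2) := by
  have hN' : (N : ℂ) ≠ 0 := by exact_mod_cast (by omega : N ≠ 0)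
  ext k
  rw [mul_sub, mul_one, map_sub, PowerSeries.coeff_mul_X_pow', invShift, PowerSeries.coeff_mk]
  simp only [gSeries, PowerSeries.coeff_mk]
  rcases k with _ | _ | k
  · simp
  · simp [Finset.sum_range_succ]
  · rw [Finset.sum_range_succ, Finset.sum_range_succ]
    have hk : ((k : ℂ) + 1) ≠ 0 := by exact_mod_cast Nat.succ_ne_zero k
    have key : ((k : ℂ) + 1) * N * gCoeff N (k + 1) = gCoeff N k + ∑ i ∈ Finset.range (k + 1),
        (Nat.choose (k + 1) (k + 2 - i) : ℂ) * (-(N : ℂ)) ^ (k + 2 - i) * gCoeff N i := by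
      rw [gCoeff, Finset.sum_range]
      field_simp
    have e1 : k + 1 + 1 - (k + 1) = 1 := by omega
    have e2 : k + 1 + 1 - 1 = k + 1 := by omega
    have e3 : k + 1 + 1 - 2 = k := by omega
    simp only [e1, e2, e3, Nat.sub_self, Nat.choose_zero_right, Nat.choose_one_right, pow_zero,
      pow_one, show 2 ≤ k + 1 + 1 by omega, if_true]
    push_cast
    have e4 : ∀ i, k + 1 + 1 - i = k + 2 - i := fun i => rfl
    simp only [e4]
    linear_combination (-1 : ℂ) * key

/-! ## The double Yangian over `ℂ[[h]]` -/

/-- The generators of the double Yangian. For `r : ℕ`, the constructor `t i j r` stands for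
`t_{ij}^{(r+1)}` and `tPlus i j r` stands for `t_{ij}^{(-r-1)}`. -/
inductive Gen (N : ℕ) : Type
  | central : Gen N
  | t (i j : Fin N) (r : ℕ) : Gen N
  | tPlus (i j : Fin N) (r : ℕ) : Gen N

/-- Given elements `x i j r` in the role of the `t_{ij}^{(r+1)}`, the coefficient of `u⁻ʳ` in
`t_{ij}(u) = δ_{ij} + h ∑_{r ≥ 1} t_{ij}^{(r)} u⁻ʳ`. -/
def tCoeff {N : ℕ} {B : Type*} [Ring B] [Algebra Base B] (x : Fin N → Fin N → ℕ → B)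
    (i j : Fin N) : ℕ → B
  | 0 => if i = j then 1 else 0
  | r + 1 => hbar • x i j r

/-- Given elements `y i j r` in the role of the `t_{ij}^{(-r-1)}`, the coefficient of `uʳ` in
`t⁺_{ij}(u) = δ_{ij} - h ∑_{r ≥ 1} t_{ij}^{(-r)} u^{r-1}`. -/
def tPlusCoeff {N : ℕ} {B : Type*} [Ring B] [Algebra Base B] (y : Fin N → Fin N → ℕ → B)
    (i j : Fin N) (r : ℕ) : B :=
  (if r = 0 ∧ i = j then 1 else 0) - hbar • y i j r

/-- The free associative algebra over `ℂ[[h]]` on the generators. -/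
abbrev Free (N : ℕ) : Type := FreeAlgebra Base (Gen N)

/-- The free generator `C`. -/
def genC (N : ℕ) : Free N := FreeAlgebra.ι Base Gen.central

/-- The free generator `t_{ij}^{(r+1)}`. -/
def genT {N : ℕ} (i j : Fin N) (r : ℕ) : Free N := FreeAlgebra.ι Base (Gen.t i j r)

/-- The free generator `t_{ij}^{(-r-1)}`. -/
def genTPlus {N : ℕ} (i j : Fin N) (r : ℕ) : Free N := FreeAlgebra.ι Base (Gen.tPlus i j r)

/-- For a series `q(x) = ∑ qᵢ x⁻ⁱ`, the coefficient of `u⁻ᵃ vᵇ` in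
`q((u - v + κ) / h) = ∑ qᵢ hⁱ (u - v + κ)⁻ⁱ`, expanded in nonpositive powers of `u` and
nonnegative powers of `v`. -/
def kernel {N : ℕ} (q : PowerSeries ℂ) (κ : Free N) (a b : ℕ) : Free N :=
  ∑ i ∈ Finset.range (a + 1),
    (PowerSeries.C (PowerSeries.coeff i q * Nat.choose (a - 1) (a - i) * Nat.choose (a - i) b) *
      hbar ^ i) • (-κ) ^ (a - i - b)

/-- The coefficient of `u⁻ʳ v⁻ˢ` in the difference of the two sides of
`(u - v) [t_{ij}(u), t_{kl}(v)] = h (t_{kj}(u) t_{il}(v) - t_{kj}(v) t_{il}(u))`, that is, of the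
`(i,j;k,l)` entry of `(u - v) R(u - v) T₁(u) T₂(v) = (u - v) T₂(v) T₁(u) R(u - v)`. (The
coefficients of `u v⁻ˢ` and `u⁻ʳ v` vanish identically.) -/
def rttCoeff {N : ℕ} (i j k l : Fin N) (r s : ℕ) : Free N :=
  let τ : Fin N → Fin N → ℕ → Free N := tCoeff genT
  (τ i j (r + 1) * τ k l s - τ k l s * τ i j (r + 1)) -
    (τ i j r * τ k l (s + 1) - τ k l (s + 1) * τ i j r) -
    hbar • (τ k j r * τ i l s - τ k j s * τ i l r)

/-- The coefficient of `uʳ vˢ` in the difference of the two sides of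
`(u - v) [t⁺_{ij}(u), t⁺_{kl}(v)] = h (t⁺_{kj}(u) t⁺_{il}(v) - t⁺_{kj}(v) t⁺_{il}(u))`, that is,
of the `(i,j;k,l)` entry of
`(u - v) R(u - v) T⁺₁(u) T⁺₂(v) = (u - v) T⁺₂(v) T⁺₁(u) R(u - v)`. -/
def rttPlusCoeff {N : ℕ} (i j k l : Fin N) (r s : ℕ) : Free N :=
  let τ : Fin N → Fin N → ℕ → Free N := tPlusCoeff genTPlus
  (if r = 0 then 0 else τ i j (r - 1) * τ k l s - τ k l s * τ i j (r - 1)) -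
    (if s = 0 then 0 else τ i j r * τ k l (s - 1) - τ k l (s - 1) * τ i j r) -
    hbar • (τ k j r * τ i l s - τ k j s * τ i l r)

/-- The coefficient of `u⁻ʳ vˢ` in the difference of the two sides of the `(i,j;k,l)` entry of
`R̄(u - v + h C / 2) T₁(u) T⁺₂(v) = T⁺₂(v) T₁(u) R̄(u - v - h C / 2)`, where
`R̄(u) = g(u / h) (1 - P h u⁻¹)`, that is, of
`g(w₊ / h) (t_{ij}(u) t⁺_{kl}(v) - (h / w₊) t_{kj}(u) t⁺_{il}(v)) =
g(w₋ / h) (t⁺_{kl}(v) t_{ij}(u) - (h / w₋) t⁺_{kj}(v) t_{il}(u))` with `w₊ = u - v + h C / 2` and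
`w₋ = u - v - h C / 2`. -/
def rttMixedCoeff {N : ℕ} (i j k l : Fin N) (r s : ℕ) : Free N :=
  let τ : Fin N → Fin N → ℕ → Free N := tCoeff genT
  let τp : Fin N → Fin N → ℕ → Free N := tPlusCoeff genTPlus
  let κ : Free N := hMul (1 / 2) • genC N
  let g : PowerSeries ℂ := gSeries N
  ∑ a ∈ Finset.range (r + 1), ∑ b ∈ Finset.range (s + 1),
    ((kernel g κ a b * (τ i j (r - a) * τp k l (s - b)) -
        kernel (PowerSeries.X * g) κ a b * (τ k j (r - a) * τp i l (s - b))) -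
      (kernel g (-κ) a b * (τp k l (s - b) * τ i j (r - a)) -
        kernel (PowerSeries.X * g) (-κ) a b * (τp k j (s - b) * τ i l (r - a))))

/-- The defining relations of the double Yangian. Since `T(u) = 1 + h(⋯)` and `T⁺(u) = 1 - h(⋯)`,
every coefficient of the matrix relations is divisible by `h²` in the (torsion free) free algebra;
the relation between the generators is the coefficient divided by `h²`. -/
inductive Rel (N : ℕ) : Free N → Free N → Prop
  | central (x : Gen N) :
      Rel N (genC N * FreeAlgebra.ι Base x) (FreeAlgebra.ι Base x * genC N)
  | rtt (i j k l : Fin N) (r s : ℕ) (x : Free N)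
      (hx : hbar ^ 2 • x = rttCoeff i j k l r s) : Rel N x 0
  | rttPlus (i j k l : Fin N) (r s : ℕ) (x : Free N)
      (hx : hbar ^ 2 • x = rttPlusCoeff i j k l r s) : Rel N x 0
  | rttMixed (i j k l : Fin N) (r s : ℕ) (x : Free N)
      (hx : hbar ^ 2 • x = rttMixedCoeff i j k l r s) : Rel N x 0

/-- The double Yangian `DY(gl_N)` over `ℂ[[h]]`. -/
def DY (N : ℕ) : Type := RingQuot (Rel N)

instance (N : ℕ) : Ring (DY N) := inferInstanceAs (Ring (RingQuot (Rel N)))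

instance (N : ℕ) : Algebra Base (DY N) := inferInstanceAs (Algebra Base (RingQuot (Rel N)))

/-- The projection of the free algebra onto the double Yangian. -/
def DY.proj (N : ℕ) : Free N →ₐ[Base] DY N := RingQuot.mkAlgHom Base (Rel N)

/-- The relation `C = c`. -/
inductive LevelRel (N : ℕ) (c : ℂ) : DY N → DY N → Prop
  | level : LevelRel N c (DY.proj N (genC N)) (algebraMap Base (DY N) (PowerSeries.C c))

/-- The double Yangian `DY_c(gl_N)` at the level `c`: the quotient of `DY(gl_N)` by the ideal
generated by `C - c`. -/
def DYLevel (N : ℕ) (c : ℂ) : Type := RingQuot (LevelRel N c)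

namespace DYLevel

variable {N : ℕ} {c : ℂ}

instance : Ring (DYLevel N c) := inferInstanceAs (Ring (RingQuot (LevelRel N c)))

instance : Algebra Base (DYLevel N c) := inferInstanceAs (Algebra Base (RingQuot (LevelRel N c)))

/-- The projection of the free algebra onto the double Yangian at the level `c`. -/
def proj (N : ℕ) (c : ℂ) : Free N →ₐ[Base] DYLevel N c :=
  (RingQuot.mkAlgHom Base (LevelRel N c) : DY N →ₐ[Base] DYLevel N c).comp (DY.proj N)

/-- The element `t_{ij}^{(r+1)}` of `DY_c(gl_N)`. -/
def t (N : ℕ) (c : ℂ) (i j : Fin N) (r : ℕ) : DYLevel N c := proj N c (genT i j r)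

/-- The element `t_{ij}^{(-r-1)}` of `DY_c(gl_N)`. -/
def tPlus (N : ℕ) (c : ℂ) (i j : Fin N) (r : ℕ) : DYLevel N c := proj N c (genTPlus i j r)

/-! ### The completion -/

/-- The left ideal `I_p` of `DY_c(gl_N)` generated by all `t_{ij}^{(r)}` with `r ≥ p`. -/
def leftIdeal (N : ℕ) (c : ℂ) (p : ℕ) : Ideal (DYLevel N c) :=
  Ideal.span {x | ∃ (i j : Fin N) (r : ℕ), p ≤ r + 1 ∧ x = t N c i j r}

/-- The left ideal `I_p + hⁿ DY_c(gl_N)`. -/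
def nbhd (N : ℕ) (c : ℂ) (p n : ℕ) : Ideal (DYLevel N c) :=
  leftIdeal N c p ⊔ Ideal.span {algebraMap Base (DYLevel N c) (hbar ^ n)}

theorem proj_surjective : Function.Surjective (proj N c) :=
  (RingQuot.mkAlgHom_surjective Base (LevelRel N c)).comp
    (RingQuot.mkAlgHom_surjective Base (Rel N))

theorem proj_eq {x y : Free N} (h : Rel N x y) : proj N c x = proj N c y :=
  congrArg (RingQuot.mkAlgHom Base (LevelRel N c)) (RingQuot.mkAlgHom_rel Base h)

theorem t_mem {p n r : ℕ} (h : p ≤ r + 1) (i j : Fin N) : t N c i j r ∈ nbhd N c p n :=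
  Submodule.mem_sup_left (Ideal.subset_span ⟨i, j, r, h, rfl⟩)

theorem hbar_smul_mem {p n m : ℕ} (h : n ≤ m) (x : DYLevel N c) :
    hbar ^ m • x ∈ nbhd N c p n := by
  obtain ⟨d, rfl⟩ := Nat.exists_eq_add_of_le h
  refine Submodule.mem_sup_right (Ideal.mem_span_singleton'.2 ⟨hbar ^ d • x, ?_⟩)
  rw [← Algebra.commutes, ← Algebra.smul_def, smul_smul, pow_add]

theorem smul_mem' {p n : ℕ} (a : Base) {x : DYLevel N c} (h : x ∈ nbhd N c p n) :
    a • x ∈ nbhd N c p n := by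
  rw [Algebra.smul_def]
  exact Ideal.mul_mem_left _ _ h

theorem hbar_smul_mem_succ {p n : ℕ} {x : DYLevel N c} (h : x ∈ nbhd N c p n) :
    hbar • x ∈ nbhd N c p (n + 1) := by
  obtain ⟨y, hy, z, hz, rfl⟩ := Submodule.mem_sup.1 h
  obtain ⟨w, rfl⟩ := Ideal.mem_span_singleton'.1 hz
  rw [smul_add]
  refine add_mem (Submodule.mem_sup_left ?_) ?_
  · rw [Algebra.smul_def]
    exact Ideal.mul_mem_left _ _ hy
  · rw [← Algebra.commutes, ← Algebra.smul_def, smul_smul, ← pow_succ']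
    exact hbar_smul_mem le_rfl _

theorem nbhd_anti {p q n m : ℕ} (hpq : p ≤ q) (hnm : n ≤ m) :
    nbhd N c q m ≤ nbhd N c p n := by
  refine sup_le ?_ ?_
  · refine Ideal.span_le.2 ?_
    rintro _ ⟨i, j, r, hr, rfl⟩
    exact t_mem (hpq.trans hr) i j
  · refine Ideal.span_le.2 ?_
    rintro _ rfl
    have := hbar_smul_mem (N := N) (c := c) (p := p) hnm 1
    rwa [Algebra.smul_def, mul_one] at this

theorem t_mul_t_mem (p n s : ℕ) : ∀ (i j k l : Fin N) (r : ℕ), p ≤ r →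
    t N c i j r * t N c k l s ∈ nbhd N c p n := by
  induction s with
  | zero =>
    intro i j k l r hr
    have h0 := proj_eq (c := c) (Rel.rtt i j k l (r + 1) 0
      (-(genT i j r * genT k l 0 - genT k l 0 * genT i j r) -
        (genT k j r * (if i = l then 1 else 0) - (if k = j then 1 else 0) * genT i l r)) (by
        simp only [rttCoeff, tCoeff]
        split_ifs <;> simp [smul_sub, smul_smul, pow_two]))
    have h1 : t N c i j r * t N c k l 0 = t N c k l 0 * t N c i j r -
        (t N c k j r * (if i = l then 1 else 0) - (if k = j then 1 else 0) * t N c i l r) := by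
      have e1 : proj N c (if i = l then 1 else 0) = if i = l then 1 else 0 := by
        split_ifs <;> simp
      have e2 : proj N c (if k = j then 1 else 0) = if k = j then 1 else 0 := by
        split_ifs <;> simp
      generalize (if i = l then (1 : DYLevel N c) else 0) = d₁ at e1 ⊢
      generalize (if k = j then (1 : DYLevel N c) else 0) = d₂ at e2 ⊢
      simp only [map_sub, map_neg, map_mul, map_zero, e1, e2] at h0
      rw [← sub_eq_zero, ← neg_eq_zero, ← h0]
      simp only [t]
      abel
    rw [h1]
    refine sub_mem (Ideal.mul_mem_left _ _ (t_mem (by omega) _ _)) (sub_mem ?_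
      (Ideal.mul_mem_left _ _ (t_mem (by omega) _ _)))
    split_ifs
    · simpa using t_mem (by omega) _ _
    · simp
  | succ s ih =>
    intro i j k l r hr
    have h0 := proj_eq (c := c) (Rel.rtt i j k l (r + 1) (s + 1)
      ((genT i j (r + 1) * genT k l s - genT k l s * genT i j (r + 1)) -
        (genT i j r * genT k l (s + 1) - genT k l (s + 1) * genT i j r) -
        hbar • (genT k j r * genT i l s - genT k j s * genT i l r)) (by
        simp only [rttCoeff, tCoeff]
        simp only [smul_sub, smul_smul, pow_two, smul_mul_assoc, mul_smul_comm, mul_assoc]))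
    have h1 : t N c i j r * t N c k l (s + 1) =
        (t N c i j (r + 1) * t N c k l s - t N c k l s * t N c i j (r + 1)) +
          t N c k l (s + 1) * t N c i j r -
          hbar • (t N c k j r * t N c i l s - t N c k j s * t N c i l r) := by
      simp only [map_sub, map_smul, map_mul, map_zero] at h0
      rw [← sub_eq_zero, ← neg_eq_zero, ← h0]
      simp only [t]
      abel
    rw [h1]
    refine sub_mem (add_mem (sub_mem (ih _ _ _ _ _ (by omega))
      (Ideal.mul_mem_left _ _ (t_mem (by omega) _ _)))
      (Ideal.mul_mem_left _ _ (t_mem (by omega) _ _))) (smul_mem' _ (sub_mem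
        (ih _ _ _ _ _ (by omega)) (Ideal.mul_mem_left _ _ (t_mem (by omega) _ _))))

theorem kernel_zero_zero (q : PowerSeries ℂ) (κ : Free N) :
    kernel q κ 0 0 = (PowerSeries.C (PowerSeries.constantCoeff q) : Base) • (1 : Free N) := by
  simp [kernel]

theorem kernel_eq_zero (q : PowerSeries ℂ) (κ : Free N) {a b : ℕ} (h : a ≤ b)
    (hab : a ≠ 0 ∨ b ≠ 0) : kernel q κ a b = 0 := by
  refine Finset.sum_eq_zero fun i hi => ?_
  rcases Nat.eq_zero_or_pos i with rfl | hpos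
  · rcases Nat.eq_zero_or_pos a with rfl | ha
    · rw [Nat.choose_eq_zero_of_lt (show 0 - 0 < b by omega)]
      simp
    · rw [Nat.choose_eq_zero_of_lt (show a - 1 < a - 0 by omega)]
      simp
  · rcases Nat.eq_zero_or_pos a with rfl | ha
    · simp only [zero_add, Finset.range_one, Finset.mem_singleton] at hi
      omega
    · rw [Nat.choose_eq_zero_of_lt (show a - i < b by omega)]
      simp

theorem kernel_eq_smul (q : PowerSeries ℂ) (κ : Free N) (a b : ℕ) :
    ∃ x, kernel q (hbar • κ) a b = hbar ^ (a - b) • x := by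
  refine ⟨∑ i ∈ Finset.range (a + 1), (PowerSeries.C (PowerSeries.coeff i q *
    Nat.choose (a - 1) (a - i) * Nat.choose (a - i) b) : Base) • (-κ) ^ (a - i - b), ?_⟩
  rw [kernel, Finset.smul_sum]
  refine Finset.sum_congr rfl fun i hi => ?_
  rw [Finset.mem_range] at hi
  by_cases h : b ≤ a - i
  · have e : -(hbar • κ) = hbar • (-κ) := (smul_neg _ _).symm
    rw [e, smul_pow, smul_smul, smul_smul, mul_assoc, ← pow_add,
      show i + (a - i - b) = a - b by omega, mul_comm]
  · rw [Nat.choose_eq_zero_of_lt (show a - i < b by omega)]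
    simp

/-- The elements `h² x` of the free algebra such that the image of `x` lies in `I_p + hⁿ DY_c`. -/
def divSubgroup (N : ℕ) (c : ℂ) (p n : ℕ) : AddSubgroup (Free N) :=
  ((nbhd N c p n).toAddSubgroup.comap (proj N c : Free N →+ DYLevel N c)).map
    (DistribSMul.toAddMonoidHom (Free N) (hbar ^ 2))

theorem mem_divSubgroup {p n : ℕ} {y : Free N} :
    y ∈ divSubgroup N c p n ↔ ∃ x, proj N c x ∈ nbhd N c p n ∧ hbar ^ 2 • x = y := Iff.rfl

theorem kernel_term_mem {p n s : ℕ}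
    (hq : ∃ q, ∀ s' ≤ s, ∀ (i j k l : Fin N) (r : ℕ), q ≤ r →
      t N c i j r * tPlus N c k l s' ∈ nbhd N c p n) :
    ∃ q, ∀ s' ≤ s, ∀ (w : PowerSeries ℂ) (κ : Free N) (i j k l : Fin N) (r a b : ℕ), q ≤ r →
      a ≤ r → b ≤ s' → (a ≠ 0 ∨ b ≠ 0) →
      kernel w (hbar • κ) a b * (tCoeff genT i j (r - a) * tPlusCoeff genTPlus k l (s' - b)) ∈
        divSubgroup N c p (n + 1) ∧
      kernel w (hbar • κ) a b * (tPlusCoeff genTPlus k l (s' - b) * tCoeff genT i j (r - a)) ∈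
        divSubgroup N c p (n + 1) := by
  obtain ⟨q, hq⟩ := hq
  refine ⟨q + p + n + s + 4, fun s' hs' w κ i j k l r a b hr ha hb hab => ?_⟩
  rcases le_or_gt a b with h | h
  · rw [kernel_eq_zero _ _ h hab, zero_mul, zero_mul]
    exact ⟨zero_mem _, zero_mem _⟩
  obtain ⟨x, hx⟩ := kernel_eq_smul w κ a b
  rw [hx]
  simp only [smul_mul_assoc]
  rcases Nat.eq_zero_or_pos (r - a) with h0 | h0
  · have key : ∀ y : Free N, hbar ^ (a - b) • y ∈ divSubgroup N c p (n + 1) := fun y =>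
      ⟨hbar ^ (a - b - 2) • y, by
        simpa using hbar_smul_mem (by omega) (proj N c y), by
        simp only [DistribSMul.toAddMonoidHom_apply]
        rw [smul_smul, ← pow_add]
        congr 2
        omega⟩
    exact ⟨key _, key _⟩
  · obtain ⟨m, hm⟩ : ∃ m, r - a = m + 1 := ⟨r - a - 1, by omega⟩
    rw [hm]
    have key : ∀ y : Free N, (n + 1 ≤ a - b - 1 ∨ proj N c y ∈ nbhd N c p (n + 1)) →
        hbar ^ (a - b) • hbar • y ∈ divSubgroup N c p (n + 1) := fun y hy =>
      ⟨hbar ^ (a - b - 1) • y, by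
        rcases hy with hy | hy
        · simpa using hbar_smul_mem hy (proj N c y)
        · simpa using smul_mem' _ hy, by
        simp only [DistribSMul.toAddMonoidHom_apply]
        rw [smul_smul, smul_smul, ← pow_add, ← pow_succ]
        congr 2
        omega⟩
    simp only [tCoeff, smul_mul_assoc, mul_smul_comm]
    refine ⟨key _ ?_, key _ ?_⟩
    · by_cases hn : n + 1 ≤ a - b - 1
      · exact Or.inl hn
      · right
        rw [map_mul]
        refine Ideal.mul_mem_left _ _ ?_
        rw [tPlusCoeff, mul_sub, map_sub, mul_smul_comm, map_smul, map_mul _ (genT i j m)]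
        refine sub_mem ?_ (hbar_smul_mem_succ ?_)
        · split_ifs
          · rw [map_one, mul_one]
            exact t_mem (by omega) _ _
          · simp
        · have := hq (s' - b) (by omega) i j k l m (by omega)
          simpa [t, tPlus] using this
    · by_cases hn : n + 1 ≤ a - b - 1
      · exact Or.inl hn
      · right
        rw [map_mul, map_mul]
        exact Ideal.mul_mem_left _ _ (Ideal.mul_mem_left _ _ (t_mem (by omega) _ _))

theorem t_mul_tPlus_mem (p n : ℕ) : ∀ s : ℕ, ∃ q, ∀ s' ≤ s, ∀ (i j k l : Fin N) (r : ℕ), q ≤ r →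
    t N c i j r * tPlus N c k l s' ∈ nbhd N c p n := by
  induction n with
  | zero =>
    intro s
    refine ⟨0, fun s' _ i j k l r _ => ?_⟩
    simpa using hbar_smul_mem (p := p) (le_refl 0) (t N c i j r * tPlus N c k l s')
  | succ n ih =>
    intro s
    obtain ⟨q, hq⟩ := kernel_term_mem (ih s)
    refine ⟨q + p, fun s' hs' i j k l r hr => ?_⟩
    have hmul : hMul (1 / 2) • genC N =
        hbar • ((PowerSeries.C (1 / 2) : Base) • genC N) := by
      rw [smul_smul, hMul, mul_comm]
    have hmul' : -(hMul (1 / 2) • genC N) =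
        hbar • (-((PowerSeries.C (1 / 2) : Base) • genC N)) := by
      rw [smul_neg, hmul]
    set y : Free N := rttMixedCoeff i j k l (r + 1) s' +
      hbar ^ 2 • (genT i j r * genTPlus k l s') with hy
    have hmem : y ∈ divSubgroup N c p (n + 1) := by
      have hsum : rttMixedCoeff i j k l (r + 1) s' - (tCoeff genT i j (r + 1) *
          tPlusCoeff genTPlus k l s' - tPlusCoeff genTPlus k l s' * tCoeff genT i j (r + 1)) ∈
            divSubgroup N c p (n + 1) := by
        simp only [rttMixedCoeff]
        rw [← Finset.sum_product', ← Finset.add_sum_erase _ _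
          (show ((0, 0) : ℕ × ℕ) ∈ Finset.range (r + 1 + 1) ×ˢ Finset.range (s' + 1) by simp)]
        simp only [kernel_zero_zero, Nat.sub_zero, map_mul, constantCoeff_gSeries,
          PowerSeries.constantCoeff_X, zero_mul, map_zero, zero_smul, sub_zero, map_one, one_smul,
          one_mul]
        rw [add_sub_cancel_left]
        refine sum_mem fun ab hab => ?_
        simp only [Finset.mem_erase, Finset.mem_product, Finset.mem_range, ne_eq,
          Prod.ext_iff, not_and_or] at hab
        obtain ⟨hne, ha, hb⟩ := hab
        rw [hmul', hmul]
        refine sub_mem (sub_mem ?_ ?_) (sub_mem ?_ ?_)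
        · exact (hq s' hs' _ _ _ _ _ _ _ _ _ (by omega) (by omega) (by omega) hne).1
        · exact (hq s' hs' _ _ _ _ _ _ _ _ _ (by omega) (by omega) (by omega) hne).1
        · exact (hq s' hs' _ _ _ _ _ _ _ _ _ (by omega) (by omega) (by omega) hne).2
        · exact (hq s' hs' _ _ _ _ _ _ _ _ _ (by omega) (by omega) (by omega) hne).2
      have hlead : hbar ^ 2 • (genTPlus k l s' * genT i j r) ∈ divSubgroup N c p (n + 1) :=
        ⟨_, by
          change proj N c _ ∈ nbhd N c p (n + 1)
          rw [map_mul]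
          exact Ideal.mul_mem_left _ _ (t_mem (by omega) _ _), rfl⟩
      have := add_mem hsum hlead
      convert this using 1
      rw [hy]
      simp only [tCoeff, tPlusCoeff]
      split_ifs <;>
      simp only [mul_sub, sub_mul, smul_mul_assoc, mul_smul_comm, smul_smul, pow_two, one_mul,
        mul_one, zero_mul, mul_zero, smul_sub, smul_zero] <;> abel
    obtain ⟨x, hx, hxy⟩ := mem_divSubgroup.1 hmem
    have h0 := proj_eq (c := c) (Rel.rttMixed i j k l (r + 1) s'
      (x - genT i j r * genTPlus k l s') (by
        rw [smul_sub, hxy, hy]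
        abel))
    rw [map_sub, map_zero, sub_eq_zero, map_mul] at h0
    change proj N c _ * proj N c _ ∈ _
    rw [← h0]
    exact hx

theorem commutes_genC (x : Gen N) : proj N c (genC N) * proj N c (FreeAlgebra.ι Base x) =
    proj N c (FreeAlgebra.ι Base x) * proj N c (genC N) := by
  rw [← map_mul, ← map_mul]
  exact proj_eq (Rel.central x)

/-- Right multiplication by a fixed element is continuous at zero. -/
theorem exists_nbhd_mul_mem (x : DYLevel N c) :
    ∀ p n, ∃ q, ∀ z ∈ nbhd N c q n, z * x ∈ nbhd N c p n := by
  have aux : ∀ x : DYLevel N c, (∀ p n, ∃ q, ∀ (i j : Fin N) (r : ℕ), q ≤ r + 1 →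
      t N c i j r * x ∈ nbhd N c p n) → ∀ p n, ∃ q, ∀ z ∈ nbhd N c q n, z * x ∈ nbhd N c p n := by
    intro x hx p n
    obtain ⟨q, hq⟩ := hx p n
    refine ⟨q, fun z hz => ?_⟩
    have hle : nbhd N c q n ≤ Submodule.comap
        (LinearMap.toSpanSingleton (DYLevel N c) (DYLevel N c) x) (nbhd N c p n) := by
      refine sup_le (Ideal.span_le.2 ?_) (Ideal.span_le.2 ?_)
      · rintro _ ⟨i, j, r, hr, rfl⟩
        exact hq i j r hr
      · rintro _ rfl
        change algebraMap Base (DYLevel N c) (hbar ^ n) * x ∈ nbhd N c p n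
        rw [← Algebra.smul_def]
        exact hbar_smul_mem le_rfl x
    exact hle hz
  obtain ⟨f, rfl⟩ := proj_surjective x
  induction f using FreeAlgebra.induction with
  | grade0 a =>
    intro p n
    refine ⟨p, fun z hz => ?_⟩
    rw [AlgHom.commutes, ← Algebra.commutes]
    exact Ideal.mul_mem_left _ _ hz
  | grade1 g =>
    cases g with
    | central =>
      intro p n
      refine aux _ (fun p n => ⟨p, fun i j r hr => ?_⟩) p n
      rw [t, genT]
      change _ * proj N c (genC N) ∈ _
      rw [← commutes_genC]
      exact Ideal.mul_mem_left _ _ (t_mem hr i j)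
    | t k l s =>
      exact aux _ fun p n => ⟨p + 1, fun i j r hr => t_mul_t_mem p n s i j k l r (by omega)⟩
    | tPlus k l s =>
      refine aux _ fun p n => ?_
      obtain ⟨q, hq⟩ := t_mul_tPlus_mem (N := N) (c := c) p n s
      exact ⟨q + 1, fun i j r hr => hq s le_rfl i j k l r (by omega)⟩
  | mul a b ha hb =>
    intro p n
    obtain ⟨q, hq⟩ := hb p n
    obtain ⟨q', hq'⟩ := ha q n
    refine ⟨q', fun z hz => ?_⟩
    rw [map_mul, ← mul_assoc]
    exact hq _ (hq' z hz)
  | add a b ha hb =>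
    intro p n
    obtain ⟨q, hq⟩ := ha p n
    obtain ⟨q', hq'⟩ := hb p n
    refine ⟨max q q', fun z hz => ?_⟩
    rw [map_add, mul_add]
    exact add_mem (hq z (nbhd_anti (le_max_left _ _) le_rfl hz))
      (hq' z (nbhd_anti (le_max_right _ _) le_rfl hz))

/-- The left ideals `I_p + hⁿ DY_c(gl_N)` form a basis of neighbourhoods of zero of a ring
topology. -/
theorem isBasis (N : ℕ) (c : ℂ) :
    RingSubgroupsBasis fun pn : ℕ × ℕ => (nbhd N c pn.1 pn.2).toAddSubgroup where
  inter i j := ⟨i ⊔ j, le_inf (nbhd_anti (le_max_left _ _) (le_max_left _ _))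
    (nbhd_anti (le_max_right _ _) (le_max_right _ _))⟩
  mul i := ⟨i, by
    rintro _ ⟨x, _, y, hy, rfl⟩
    exact Ideal.mul_mem_left _ x hy⟩
  leftMul x i := ⟨i, fun _ hy => Ideal.mul_mem_left _ x hy⟩
  rightMul x i := by
    obtain ⟨q, hq⟩ := exists_nbhd_mul_mem x i.1 i.2
    exact ⟨(q, i.2), fun z hz => hq z hz⟩

instance : TopologicalSpace (DYLevel N c) := (isBasis N c).topology

instance : NonarchimedeanRing (DYLevel N c) := (isBasis N c).nonarchimedean

instance : UniformSpace (DYLevel N c) := IsTopologicalAddGroup.rightUniformSpace (DYLevel N c)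

instance : IsUniformAddGroup (DYLevel N c) := isUniformAddGroup_of_addCommGroup

end DYLevel

/-- The completed double Yangian at the level `c`: the completion of `DY_c(gl_N)` for the topology
with the basis `I_p + hⁿ DY_c(gl_N)` of neighbourhoods of zero. As an additive group this is the
inverse limit over `p` and `n` of the quotients `DY_c(gl_N) / (I_p + hⁿ DY_c(gl_N))`, that is, the
`h`-adic completion of the inverse limit of the quotients `DY_c(gl_N) / I_p`; the product extends
the product of `DY_c(gl_N)` by continuity. -/
abbrev CompletedDY (N : ℕ) (c : ℂ) : Type := UniformSpace.Completion (DYLevel N c)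

/-- The structure map of the completed double Yangian as an algebra over `ℂ[[h]]`. -/
def scalar (N : ℕ) (c : ℂ) : Base →+* CompletedDY N c :=
  UniformSpace.Completion.coeRingHom.comp (algebraMap Base (DYLevel N c))

/-- The series `t_{ij}(u)` over the completed double Yangian, a power series in `u⁻¹`. -/
def tSeries (N : ℕ) (c : ℂ) (i j : Fin N) : PowerSeries (CompletedDY N c) :=
  PowerSeries.mk fun r => ((tCoeff (DYLevel.t N c) i j r : DYLevel N c) : CompletedDY N c)

/-- The series `t⁺_{ij}(u)` over the completed double Yangian, a power series in `u`. -/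
def tPlusSeries (N : ℕ) (c : ℂ) (i j : Fin N) : PowerSeries (CompletedDY N c) :=
  PowerSeries.mk fun r =>
    ((tPlusCoeff (DYLevel.tPlus N c) i j r : DYLevel N c) : CompletedDY N c)

/-- The series defining the coefficients of `f(u + z h)` converge for each power series `f(u)` with
coefficients in `DY_c(gl_N)`, so that `plusShift` has its intended meaning for `t⁺_{ij}(u)`. -/
theorem summable_plusShift (N : ℕ) (c z : ℂ) (f : ℕ → DYLevel N c) (k : ℕ) :
    Summable fun j : ℕ => (Nat.choose (k + j) k : CompletedDY N c) * scalar N c (hMul z) ^ j *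
      ((f (k + j) : DYLevel N c) : CompletedDY N c) := by
  apply NonarchimedeanAddGroup.summable_of_tendsto_cofinite_zero
  have e : ∀ j : ℕ, (Nat.choose (k + j) k : CompletedDY N c) * scalar N c (hMul z) ^ j *
      ((f (k + j) : DYLevel N c) : CompletedDY N c) =
      ((hbar ^ j • ((Nat.choose (k + j) k : DYLevel N c) *
        (algebraMap Base (DYLevel N c) (PowerSeries.C z ^ j) * f (k + j))) : DYLevel N c) :
          CompletedDY N c) := by
    intro j
    have e1 : (Nat.choose (k + j) k : CompletedDY N c) =
        ((Nat.choose (k + j) k : DYLevel N c) : CompletedDY N c) :=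
      (map_natCast UniformSpace.Completion.coeRingHom _).symm
    have e2 : scalar N c (hMul z) ^ j =
        ((algebraMap Base (DYLevel N c) (hMul z ^ j) : DYLevel N c) : CompletedDY N c) := by
      rw [← map_pow]
      rfl
    rw [e1, e2, ← UniformSpace.Completion.coe_mul, ← UniformSpace.Completion.coe_mul]
    congr 1
    rw [hMul, mul_pow, mul_comm (PowerSeries.C z ^ j), map_mul, Algebra.smul_def, mul_assoc,
      mul_assoc, ← mul_assoc _ (algebraMap Base (DYLevel N c) (hbar ^ j)),
      ← Algebra.commutes (hbar ^ j), mul_assoc]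
  simp only [e]
  rw [Nat.cofinite_eq_atTop]
  have h0 : Filter.Tendsto (fun j : ℕ => hbar ^ j • ((Nat.choose (k + j) k : DYLevel N c) *
      (algebraMap Base (DYLevel N c) (PowerSeries.C z ^ j) * f (k + j)))) Filter.atTop
      (nhds 0) := by
    refine ((DYLevel.isBasis N c).hasBasis_nhds_zero.tendsto_right_iff).2 fun pn _ => ?_
    filter_upwards [Filter.eventually_ge_atTop pn.2] with j hj
    exact DYLevel.hbar_smul_mem hj _
  have := (UniformSpace.Completion.continuous_coe (DYLevel N c)).tendsto 0
  rw [UniformSpace.Completion.coe_zero] at this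
  exact this.comp h0

/-! ## Standard tableaux and primitive idempotents -/

/-- A standard tableau of shape `μ`: the boxes of `μ` are filled bijectively with the
numbers `0, …, m - 1` (in place of `1, …, m`), increasingly along the rows and down the columns. -/
structure StandardTableau (μ : YoungDiagram) where
  /-- The number occupying a box. -/
  entry : {x // x ∈ μ.cells} ≃ Fin μ.card
  row_lt : ∀ x y : {x // x ∈ μ.cells}, x.1.1 = y.1.1 → x.1.2 < y.1.2 → entry x < entry y
  col_lt : ∀ x y : {x // x ∈ μ.cells}, x.1.2 = y.1.2 → x.1.1 < y.1.1 → entry x < entry y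

/-- The content `j - i` of the box `(i, j)` occupied by `a`. -/
def StandardTableau.content {μ : YoungDiagram} (U : StandardTableau μ) (a : Fin μ.card) : ℤ :=
  ((U.entry.symm a).1.2 : ℤ) - ((U.entry.symm a).1.1 : ℤ)

/-- The Jucys–Murphy element `x_a = ∑_{b < a} (b a)` of the group algebra of the symmetric
group. -/
def jucysMurphy {m : ℕ} (a : Fin m) : MonoidAlgebra ℂ (Equiv.Perm (Fin m)) :=
  ∑ b ∈ Finset.univ.filter (· < a), MonoidAlgebra.of ℂ (Equiv.Perm (Fin m)) (Equiv.swap b a)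

/-- The primitive idempotent `e_U` of the group algebra of the symmetric group. The Young basis of
the irreducible representations is the common eigenbasis of the Jucys–Murphy elements, the
eigenvalue of `x_a` on the vector of a tableau being the content of `a` in that tableau; `e_U` is
the projection onto the vector of `U` which annihilates all the other vectors of the Young bases,
that is, the product over `a` of the spectral projections of `x_a` for the eigenvalues `c_a(U)`.
The eigenvalues of each `x_a` are integers between `-(m - 1)` and `m - 1`, so that the spectral
projection is the value at `x_a` of the Lagrange polynomial of the node `c_a(U)`. -/
def StandardTableau.idempotent {μ : YoungDiagram} (U : StandardTableau μ) :
    MonoidAlgebra ℂ (Equiv.Perm (Fin μ.card)) :=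
  (List.ofFn fun a : Fin μ.card =>
    Polynomial.aeval (jucysMurphy a)
      (Lagrange.basis (Finset.Ioo (-(μ.card : ℤ)) μ.card) (fun k : ℤ => (k : ℂ))
        (U.content a))).prod

/-- Matrices on `(ℂ^N)^{⊗ m}` with entries in `B`, that is, elements of
`(End ℂ^N)^{⊗ m} ⊗ B`. -/
abbrev TensorMat (m N : ℕ) (B : Type*) : Type _ := Matrix (Fin m → Fin N) (Fin m → Fin N) B

/-- The action of the symmetric group on `(ℂ^N)^{⊗ m}` by permutations of the tensor factors: the
`a`-th factor of a tensor becomes the `s a`-th factor of its image under `s`. -/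
def permAction (m N : ℕ) : Equiv.Perm (Fin m) →* TensorMat m N ℂ where
  toFun s := Matrix.of fun f g => if f ∘ s = g then 1 else 0
  map_one' := by
    ext f g
    simp [Matrix.one_apply]
  map_mul' s s' := by
    ext f g
    rw [Matrix.mul_apply, Finset.sum_eq_single (f ∘ s)]
    · by_cases h : f ∘ s ∘ s' = g <;> simp [Function.comp_assoc, h]
    · intro j _ hj
      simp [Ne.symm hj]
    · simp

/-- The operator `E_U` on `(ℂ^N)^{⊗ m}`: the image of the primitive idempotent `e_U`. -/
def StandardTableau.operator {μ : YoungDiagram} (N : ℕ) (U : StandardTableau μ) :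
    TensorMat μ.card N ℂ :=
  MonoidAlgebra.lift ℂ (TensorMat μ.card N ℂ) (Equiv.Perm (Fin μ.card)) (permAction μ.card N)
    U.idempotent

/-! ## The series `T̃_μ(u)` -/

/-- The element `∑ 1^{⊗ (a-1)} ⊗ e_{ij} ⊗ 1^{⊗ (m-a)} ⊗ X_{ij}` for a matrix `X = (X_{ij})`. -/
def slot {m N : ℕ} {B : Type*} [Ring B] (a : Fin m) (X : Matrix (Fin N) (Fin N) B) :
    TensorMat m N B :=
  Matrix.of fun f g => if ∀ b, b ≠ a → f b = g b then X (f a) (g a) else 0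

/-- The series `T⁺_a(u + z h)` in the variable `u`. -/
def tPlusMat {N : ℕ} (c : ℂ) {m : ℕ} (a : Fin m) (z : ℂ) :
    PowerSeries (TensorMat m N (CompletedDY N c)) :=
  PowerSeries.mk fun k => slot a (Matrix.of fun i j =>
    PowerSeries.coeff k (plusShift (scalar N c (hMul z)) (tPlusSeries N c i j)))

/-- The series `T_a(u + z h)` in the variable `u⁻¹`. -/
def tMat {N : ℕ} (c : ℂ) {m : ℕ} (a : Fin m) (z : ℂ) :
    PowerSeries (TensorMat m N (CompletedDY N c)) :=
  PowerSeries.mk fun k => slot a (Matrix.of fun i j =>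
    PowerSeries.coeff k (invShift (scalar N c (hMul z)) (tSeries N c i j)))

theorem constantCoeff_tMat {N : ℕ} (c : ℂ) {m : ℕ} (a : Fin m) (z : ℂ) :
    PowerSeries.constantCoeff (tMat (N := N) c a z) = 1 := by
  rw [← PowerSeries.coeff_zero_eq_constantCoeff_apply, tMat, PowerSeries.coeff_mk]
  ext f g
  simp only [slot, invShift, tSeries, Matrix.of_apply, PowerSeries.coeff_mk, zero_add,
    Finset.range_one, Finset.sum_singleton, Nat.sub_self, Nat.choose_self, Nat.cast_one, pow_zero,
    one_mul, tCoeff, Matrix.one_apply]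
  by_cases h : f = g
  · subst h
    simp [UniformSpace.Completion.coe_one]
  · rw [if_neg h]
    split_ifs with h1 h2
    · exact absurd (funext fun b => if hb : b = a then hb ▸ h2 else h1 b hb) h
    · exact UniformSpace.Completion.coe_zero
    · rfl

/-- The inverse `T_a(u + z h)⁻¹`, a power series in `u⁻¹`. -/
def tMatInv {N : ℕ} (c : ℂ) {m : ℕ} (a : Fin m) (z : ℂ) :
    PowerSeries (TensorMat m N (CompletedDY N c)) :=
  PowerSeries.invOfUnit (tMat c a z) 1

theorem tMat_mul_tMatInv {N : ℕ} (c : ℂ) {m : ℕ} (a : Fin m) (z : ℂ) :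
    tMat (N := N) c a z * tMatInv c a z = 1 :=
  PowerSeries.mul_invOfUnit _ _ (constantCoeff_tMat c a z)

/-- The product `T⁺_1(u + h c_1) ⋯ T⁺_m(u + h c_m)`, a power series in `u`. -/
def plusProduct (N : ℕ) (c : ℂ) {μ : YoungDiagram} (U : StandardTableau μ) :
    PowerSeries (TensorMat μ.card N (CompletedDY N c)) :=
  (List.ofFn fun a : Fin μ.card => tPlusMat c a (U.content a)).prod

/-- The product `T_m(u + h c_m - h N / 2)⁻¹ ⋯ T_1(u + h c_1 - h N / 2)⁻¹`, a power series
in `u⁻¹`. -/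
def invProduct (N : ℕ) (c : ℂ) {μ : YoungDiagram} (U : StandardTableau μ) :
    PowerSeries (TensorMat μ.card N (CompletedDY N c)) :=
  (List.ofFn fun a : Fin μ.card => tMatInv c a (U.content a - N / 2)).reverse.prod

/-- The contribution of the powers `u^{d+l}` and `u⁻ˡ` of the two products to the coefficient
of `u^d` in `T̃_μ(u)`. -/
def traceTerm (N : ℕ) (c : ℂ) {μ : YoungDiagram} (U : StandardTableau μ) (d : ℤ) (l : ℕ) :
    CompletedDY N c :=
  if 0 ≤ d + l then
    Matrix.trace ((U.operator N).map (fun z => scalar N c (PowerSeries.C z)) *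
      PowerSeries.coeff (d + l).toNat (plusProduct N c U) *
      PowerSeries.coeff l (invProduct N c U))
  else 0

/-- The coefficient of `u^d` in the series
`T̃_μ(u) = tr_{1,…,m} E_U T⁺_1(u + h c_1) ⋯ T⁺_m(u + h c_m)
  T_m(u + h c_m - h N / 2)⁻¹ ⋯ T_1(u + h c_1 - h N / 2)⁻¹`. -/
def traceCoeff (N : ℕ) (c : ℂ) {μ : YoungDiagram} (U : StandardTableau μ) (d : ℤ) :
    CompletedDY N c :=
  ∑' l : ℕ, traceTerm N c U d l

end

end DoubleYangian

/-!
The theorem has two halves: convergence, and centrality at the critical level `c = -N`.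

*Convergence.* The completed algebra carries a topology defined by left ideals, so that a sum
`∑ xₙ yₙ` converges as soon as `yₙ → 0`, whatever the `xₙ` are (`PairingAlgebra`). The coefficients
of `T(u)⁻¹`, and those of its products and shifts, tend to zero (`isTraceData_tMatInv`), while the
coefficients of the products of the `T⁺(u)` are arbitrary; a coefficient of the trace is a sum of
this type (`hasSum_traceTerm`).

*Centrality.* The generators generate a dense subalgebra, so it is enough that the coefficients of
the trace commute with them (`mem_center_of_commute`). The proof of this has four ingredients.

* The normalizing series disappears at the critical level: as `g(u + N) = g(u) (1 - u⁻²)`, the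
  mixed relation at `c = -N`, divided by `h`, becomes a polynomial relation between `T⁺(v)` and
  `∑ t^{(r)} u⁻ʳ` (`mixed_relation`). The algebra may have `h`-torsion, so that commuting with
  `T(v) = 1 + h ∑ t^{(r)} v⁻ʳ` would say too little about the `t^{(r)}`. The relations are therefore
  carried over to a ring extension `Lift` with a parameter `η` satisfying `η² = h η`: there
  `1 + η ∑ t^{(r)} v⁻ʳ` satisfies relations of the same form, and commuting with it does give
  commuting with the `t^{(r)}`.

* The idempotent absorbs the ordered products. The Jucys–Murphy operators on the tensor power are
  Hermitian with integral spectrum, and `contentProj` is the projection to a joint eigenspace. If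
  operators `X(κ)`, depending on the sequence `κ` of contents, satisfy the two-factor `R`-matrix
  relation whenever two neighbours of `κ` are exchanged (`IsCovariant`), then `∑ E_κ X(κ)` commutes
  with the permutations of the factors, whence `E_κ X(κ) = E_κ X(κ) E_κ`
  (`contentProj_mul_covariant`). This plays the role of the fusion procedure; it applies to the
  products of the `T⁺_a(u + h κ_a)`, to those of the `T_a⁻¹`, and to the products of the polynomials
  `α - β u + ε P_a` in which an auxiliary tensor factor is permuted with the factor `a`.

* The series `T(v)` or `T⁺(v)`, acting in the auxiliary factor, is moved through the product under
  the trace by exchange relations (`IsExchange`), at the cost of such polynomial factors on both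
  sides. Taking the trace with `E_κ` and transposing partially in the factors `1, …, m`, the two
  families of polynomials meet in products which are scalar because their shifts differ by `h N`
  (`transpose_legFlip_mul`); this is where the level and the shift of the `T_a` matter once more.
  The outcome is that a product of polynomials in `u` and `v` annihilates the commutator with the
  trace (`lact_commutator_trace`).

* Those polynomials are products of factors `1 - v⁻¹ (u + w h)` in the case of `T(v)`, and of
  factors `f = v - u - w h` and `f² - η²` in the case of `T⁺(v)`, with `w ∈ ℂ`. All of these act
  injectively on bilateral series in `u` whose coefficients are power series in `v⁻¹`, respectively
  in `v` (`actsInjectively_one_sub`, `actsInjectively_sub`, `ActsInjectively.sq_sub_sq`). So the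
  commutator vanishes (`IsTraceData.commute_t`, `IsTraceData.commute_tPlus`).
-/

set_option linter.unusedSectionVars false

namespace DoubleYangian

/-! ### Jucys–Murphy operators -/

section JucysMurphy

variable {m : ℕ} {R : Type*} [Ring R] (ρ : Equiv.Perm (Fin m) →* R)

/-- The image `∑_{b < a} ρ (b a)` of the Jucys–Murphy element `x_a` under a representation `ρ`. -/
def jm (a : Fin m) : R := ∑ b ∈ Finset.univ.filter (· < a), ρ (Equiv.swap b a)

/-- The image of the adjacent transposition `(i i+1)`. -/
def adj (i : ℕ) (hi : i + 1 < m) : R := ρ (Equiv.swap ⟨i, by omega⟩ ⟨i + 1, hi⟩)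

variable {ρ}

theorem adj_mul_adj (i : ℕ) (hi : i + 1 < m) : adj ρ i hi * adj ρ i hi = 1 := by
  rw [adj, ← map_mul, Equiv.swap_mul_self, map_one]

theorem jm_zero (h : 0 < m) : jm ρ ⟨0, h⟩ = 0 := by
  refine Finset.sum_eq_zero fun b hb => ?_
  simp [Fin.lt_def] at hb

theorem conj_swap (σ : Equiv.Perm (Fin m)) (a b : Fin m) :
    ρ σ * ρ (Equiv.swap a b) = ρ (Equiv.swap (σ a) (σ b)) * ρ σ := by
  rw [← map_mul, ← map_mul, Equiv.mul_swap_eq_swap_mul]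

theorem jm_succ (i : ℕ) (hi : i + 1 < m) :
    jm ρ ⟨i + 1, hi⟩ = adj ρ i hi * jm ρ ⟨i, by omega⟩ * adj ρ i hi + adj ρ i hi := by
  have h : (Finset.univ.filter (· < (⟨i + 1, hi⟩ : Fin m))) =
      insert ⟨i, by omega⟩ (Finset.univ.filter (· < (⟨i, by omega⟩ : Fin m))) := by
    ext b
    simp only [Finset.mem_filter, Finset.mem_univ, true_and, Finset.mem_insert, Fin.ext_iff,
      Fin.lt_def]
    omega
  rw [jm, h, Finset.sum_insert (by simp), add_comm, jm, Finset.mul_sum, Finset.sum_mul]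
  congr 1
  refine Finset.sum_congr rfl fun b hb => ?_
  simp only [Finset.mem_filter, Finset.mem_univ, true_and, Fin.lt_def] at hb
  rw [adj, conj_swap, mul_assoc, ← map_mul ρ, Equiv.swap_mul_self, map_one, mul_one,
    Equiv.swap_apply_left, Equiv.swap_apply_of_ne_of_ne]
  · exact Fin.ne_of_val_ne (by simp; omega)
  · exact Fin.ne_of_val_ne (by simp; omega)

theorem adj_mul_jm_of_ne (i : ℕ) (hi : i + 1 < m) (a : Fin m) (h1 : (a : ℕ) ≠ i)
    (h2 : (a : ℕ) ≠ i + 1) : adj ρ i hi * jm ρ a = jm ρ a * adj ρ i hi := by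
  rw [jm, Finset.mul_sum, Finset.sum_mul]
  have ha : Equiv.swap (⟨i, by omega⟩ : Fin m) ⟨i + 1, hi⟩ a = a :=
    Equiv.swap_apply_of_ne_of_ne (Fin.ne_of_val_ne h1) (Fin.ne_of_val_ne h2)
  refine Finset.sum_equiv (Equiv.swap (⟨i, by omega⟩ : Fin m) ⟨i + 1, hi⟩) (fun b => ?_)
    fun b _ => ?_
  · simp only [Finset.mem_filter, Finset.mem_univ, true_and, Equiv.swap_apply_def]
    split_ifs with h3 h4
    · subst h3; simp only [Fin.lt_def]; omega
    · subst h4; simp only [Fin.lt_def]; omega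
    · rfl
  · rw [adj, conj_swap, ha]

theorem commute_jm_of_lt (a : Fin m) : ∀ (b : ℕ) (hb : b < m), b < a →
    Commute (jm ρ a) (jm ρ ⟨b, hb⟩) := by
  intro b
  induction b with
  | zero => intro hb _; rw [jm_zero]; exact Commute.zero_right _
  | succ b ih =>
    intro hb hba
    rw [jm_succ]
    have h := adj_mul_jm_of_ne (ρ := ρ) b hb a (by omega) (by omega)
    have h' : Commute (jm ρ a) (adj ρ b hb) := h.symm
    exact ((h'.mul_right (ih (by omega) (by omega))).mul_right h').add_right h'

theorem commute_jm (a b : Fin m) : Commute (jm ρ a) (jm ρ b) := by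
  rcases lt_trichotomy a b with h | h | h
  · exact (commute_jm_of_lt b a a.2 h).symm
  · rw [h]
  · exact commute_jm_of_lt a b b.2 h

theorem jm_mul_adj (i : ℕ) (hi : i + 1 < m) :
    jm ρ ⟨i, by omega⟩ * adj ρ i hi = adj ρ i hi * jm ρ ⟨i + 1, hi⟩ - 1 := by
  have h := adj_mul_adj (ρ := ρ) i hi
  rw [jm_succ, mul_add, h, ← mul_assoc, ← mul_assoc, h, one_mul, add_sub_cancel_right]

theorem adj_mul_jm (i : ℕ) (hi : i + 1 < m) :
    adj ρ i hi * jm ρ ⟨i, by omega⟩ = jm ρ ⟨i + 1, hi⟩ * adj ρ i hi - 1 := by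
  have h := adj_mul_adj (ρ := ρ) i hi
  rw [jm_succ, add_mul, h, mul_assoc, h, mul_one, add_sub_cancel_right]

/-- The intertwiner `s (x_i - x_{i+1}) + 1`, where `s` is the transposition `(i i+1)`. -/
def intertwiner (ρ : Equiv.Perm (Fin m) →* R) (i : ℕ) (hi : i + 1 < m) : R :=
  adj ρ i hi * (jm ρ ⟨i, by omega⟩ - jm ρ ⟨i + 1, hi⟩) + 1

theorem intertwiner_eq (i : ℕ) (hi : i + 1 < m) : intertwiner ρ i hi =
    (jm ρ ⟨i + 1, hi⟩ - jm ρ ⟨i, by omega⟩) * adj ρ i hi - 1 := by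
  have h1 := adj_mul_jm (ρ := ρ) i hi
  have h2 := jm_mul_adj (ρ := ρ) i hi
  rw [intertwiner, mul_sub, sub_mul, h1, h2]
  abel

theorem intertwiner_mul_left (i : ℕ) (hi : i + 1 < m) :
    intertwiner ρ i hi * jm ρ ⟨i, by omega⟩ = jm ρ ⟨i + 1, hi⟩ * intertwiner ρ i hi := by
  have h1 := adj_mul_jm (ρ := ρ) i hi
  have h3 := (commute_jm (ρ := ρ) ⟨i, by omega⟩ ⟨i + 1, hi⟩).eq
  rw [intertwiner]
  set x := jm ρ ⟨i, by omega⟩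
  set y := jm ρ ⟨i + 1, hi⟩
  set s := adj ρ i hi
  calc (s * (x - y) + 1) * x = (s * x) * (x - y) + x + s * (x * y - y * x) := by noncomm_ring
    _ = y * (s * (x - y) + 1) := by rw [h1, h3]; noncomm_ring

theorem intertwiner_mul_right (i : ℕ) (hi : i + 1 < m) :
    intertwiner ρ i hi * jm ρ ⟨i + 1, hi⟩ = jm ρ ⟨i, by omega⟩ * intertwiner ρ i hi := by
  have h2 := jm_mul_adj (ρ := ρ) i hi
  have h3 := (commute_jm (ρ := ρ) ⟨i, by omega⟩ ⟨i + 1, hi⟩).eq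
  rw [intertwiner]
  set x := jm ρ ⟨i, by omega⟩
  set y := jm ρ ⟨i + 1, hi⟩
  set s := adj ρ i hi
  have e : x * (s * (x - y) + 1) = (x * s) * (x - y) + x := by noncomm_ring
  rw [e, h2]
  calc (s * (x - y) + 1) * y = s * (x * y) - s * (y * y) + y := by noncomm_ring
    _ = (s * y - 1) * (x - y) + x := by rw [h3]; noncomm_ring

/-- The intertwiner carries an eigenvector of one of two neighbouring Jucys–Murphy operators to one
of the other, unless the eigenvalues differ by `±1`, where its square vanishes. This is how the
integrality of the spectrum propagates from each operator to the next. -/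
theorem intertwiner_sq (i : ℕ) (hi : i + 1 < m) :
    intertwiner ρ i hi * intertwiner ρ i hi =
      1 - (jm ρ ⟨i + 1, hi⟩ - jm ρ ⟨i, by omega⟩) ^ 2 := by
  have h3 := intertwiner_eq (ρ := ρ) i hi
  have h4 := adj_mul_adj (ρ := ρ) i hi
  have h5 := adj_mul_jm (ρ := ρ) i hi
  have h6 := jm_mul_adj (ρ := ρ) i hi
  nth_rw 1 [h3]
  rw [intertwiner]
  set x := jm ρ ⟨i, by omega⟩
  set y := jm ρ ⟨i + 1, hi⟩
  set s := adj ρ i hi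
  have e : (y - x) * s - s * (x - y) = 1 + 1 := by
    rw [sub_mul, h6, mul_sub, h5]; noncomm_ring
  calc ((y - x) * s - 1) * (s * (x - y) + 1)
      = (y - x) * (s * s) * (x - y) + ((y - x) * s - s * (x - y)) - 1 := by noncomm_ring
    _ = 1 - (y - x) ^ 2 := by
      rw [h4, e, add_sub_assoc, add_sub_cancel_right]; noncomm_ring

theorem intertwiner_mul_of_ne (i : ℕ) (hi : i + 1 < m) (a : Fin m) (h1 : (a : ℕ) ≠ i)
    (h2 : (a : ℕ) ≠ i + 1) : Commute (intertwiner ρ i hi) (jm ρ a) := by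
  have h : Commute (adj ρ i hi) (jm ρ a) := adj_mul_jm_of_ne i hi a h1 h2
  exact (h.mul_left ((commute_jm _ _).sub_left (commute_jm _ _))).add_left (Commute.one_left _)

end JucysMurphy

/-! ### The spectrum of the Jucys–Murphy operators -/

open Polynomial in
/-- The polynomial `∏_{|k| ≤ n} (X - k)`. -/
noncomputable def nodePoly (n : ℕ) : Polynomial ℤ := ∏ k ∈ Finset.Icc (-(n : ℤ)) n, (X - C k)

/-- The value of an integral polynomial at an element of a ring. -/
noncomputable def intEval {R : Type*} [Ring R] (x : R) : Polynomial ℤ →+* R :=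
  (Polynomial.aeval x : Polynomial ℤ →ₐ[ℤ] R)

theorem intEval_X {R : Type*} [Ring R] (x : R) : intEval x Polynomial.X = x :=
  Polynomial.aeval_X x

theorem intEval_C {R : Type*} [Ring R] (x : R) (k : ℤ) : intEval x (Polynomial.C k) = k := by
  rw [eq_intCast Polynomial.C, map_intCast]

theorem intEval_eq_sum {R : Type*} [Ring R] (x : R) (p : Polynomial ℤ) :
    intEval x p = ∑ i ∈ Finset.range (p.natDegree + 1), p.coeff i • x ^ i :=
  Polynomial.aeval_eq_sum_range _

theorem pow_mul_eq_zero_of_prod {R : Type*} [Ring R] {x G : R} (hc : Commute x G)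
    (S : Finset ℤ) (hG : ∀ k ∈ S, ∀ w, (x - (k : R)) * w = 0 → G * w = 0) :
    ∀ w, intEval x (∏ k ∈ S, (Polynomial.X - Polynomial.C k)) * w = 0 →
      G ^ S.card * w = 0 := by
  induction S using Finset.induction_on with
  | empty => intro w hw; simpa using hw
  | insert k S hk ih =>
    intro w hw
    rw [Finset.prod_insert hk, mul_comm, map_mul, mul_assoc] at hw
    have h1 := ih (fun k hk => hG k (Finset.mem_insert_of_mem hk)) _ hw
    rw [map_sub, intEval_X, intEval_C] at h1
    rw [Finset.card_insert_of_notMem hk, pow_succ', mul_assoc]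
    refine hG k (Finset.mem_insert_self _ _) _ ?_
    have hc' : Commute (x - (k : R)) (G ^ S.card) :=
      (hc.sub_left (Int.cast_commute k G)).pow_right _
    rw [← mul_assoc, hc'.eq, mul_assoc, h1]

theorem isSelfAdjoint_intEval {R : Type*} [Ring R] [StarRing R] {y : R} (hy : IsSelfAdjoint y)
    (q : Polynomial ℤ) : IsSelfAdjoint (intEval y q) := by
  rw [intEval_eq_sum]
  refine isSelfAdjoint_sum _ fun i _ => ?_
  rw [zsmul_eq_mul, isSelfAdjoint_iff, star_mul, star_pow, hy.star_eq, star_intCast]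
  exact ((Int.cast_commute _ _).eq).symm

open scoped ComplexOrder in
theorem eq_zero_of_isHermitian_of_pow {n : Type*} [Fintype n] [DecidableEq n]
    {A : Matrix n n ℂ} (hA : IsSelfAdjoint A) {k : ℕ} (hk : A ^ k = 0) : A = 0 := by
  have key : ∀ j : ℕ, A ^ 2 ^ j = 0 → A = 0 := by
    intro j
    induction j with
    | zero => simp
    | succ j ih =>
      intro h
      refine ih ?_
      have h1 : IsSelfAdjoint (A ^ 2 ^ j) := hA.pow _
      rw [pow_succ, mul_two, pow_add] at h
      nth_rw 1 [← h1.star_eq] at h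
      exact Matrix.conjTranspose_mul_self_eq_zero.1 h
  exact key k (pow_eq_zero_of_le (Nat.lt_two_pow_self).le hk)

variable {m N : ℕ}

theorem star_permAction (σ : Equiv.Perm (Fin m)) :
    star (permAction m N σ) = permAction m N σ⁻¹ := by
  ext f g
  simp only [Matrix.star_apply, permAction, MonoidHom.coe_mk, OneHom.coe_mk, Matrix.of_apply]
  have : g ∘ σ = f ↔ f ∘ (σ⁻¹ : Equiv.Perm (Fin m)) = g := by
    constructor
    · rintro rfl; ext a; simp
    · rintro rfl; ext a; simp
  simp only [this]
  split_ifs <;> simp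

theorem isSelfAdjoint_jm (a : Fin m) : IsSelfAdjoint (jm (permAction m N) a) := by
  refine isSelfAdjoint_sum _ fun b _ => ?_
  rw [isSelfAdjoint_iff, star_permAction, Equiv.swap_inv]

theorem intEval_mul_of_intertwine {R : Type*} [Ring R] {φ x y : R} (h : φ * x = y * φ)
    (p : Polynomial ℤ) : φ * intEval x p = intEval y p * φ := by
  have hn : ∀ n : ℕ, φ * x ^ n = y ^ n * φ := fun n => by
    have : SemiconjBy φ x y := h
    exact (this.pow_right n).eq
  rw [intEval_eq_sum, intEval_eq_sum, Finset.mul_sum,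
    Finset.sum_mul]
  exact Finset.sum_congr rfl fun n _ => by rw [mul_smul_comm, hn, smul_mul_assoc]

theorem X_sub_C_dvd_nodePoly {n : ℕ} {k : ℤ} (h1 : -(n : ℤ) ≤ k) (h2 : k ≤ n) :
    Polynomial.X - Polynomial.C k ∣ nodePoly n :=
  Finset.dvd_prod_of_mem _ (Finset.mem_Icc.2 ⟨h1, h2⟩)

theorem nodePoly_dvd {n l : ℕ} (h : n ≤ l) : nodePoly n ∣ nodePoly l :=
  Finset.prod_dvd_prod_of_subset _ _ _ (Finset.Icc_subset_Icc (by omega) (by omega))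

/-- The eigenvalues of the Jucys–Murphy operator `x_n` are integers between `-n` and `n`, and it
is semisimple. If `x = x_n` and `y = x_{n+1}`, the intertwiner `φ` satisfies `φ x = y φ` and
`φ² = 1 - (y - x)²`, so that each eigenvalue of `y` is an eigenvalue of `x` or differs from one by
`1`; semisimplicity holds because the operators are Hermitian. -/
theorem intEval_jm_nodePoly : ∀ (n : ℕ) (hn : n < m),
    intEval (jm (permAction m N) ⟨n, hn⟩) (nodePoly n) = 0 := by
  intro n
  induction n with
  | zero => intro hn; rw [jm_zero]; simp [nodePoly, intEval_X]
  | succ n ih =>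
    intro hn
    have hx := ih (by omega)
    have hφ := intertwiner_mul_left (ρ := permAction m N) n hn
    have hφ2 := intertwiner_sq (ρ := permAction m N) n hn
    have hxy := commute_jm (ρ := permAction m N) ⟨n, by omega⟩ ⟨n + 1, hn⟩
    have hsa := isSelfAdjoint_jm (N := N) (⟨n + 1, hn⟩ : Fin m)
    set x := jm (permAction m N) ⟨n, by omega⟩
    set y := jm (permAction m N) ⟨n + 1, hn⟩
    have h1 : intEval y (nodePoly n) * (1 - (y - x) ^ 2) = 0 := by
      rw [← hφ2, ← mul_assoc, ← intEval_mul_of_intertwine hφ, hx, mul_zero, zero_mul]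
    set G := intEval y (nodePoly (n + 1) ^ 3) with hG
    have hc : Commute x G := by
      rw [hG, intEval_eq_sum]
      exact Commute.sum_right _ _ _ fun i _ => (hxy.pow_right i).smul_right _
    have h2 : ∀ k ∈ Finset.Icc (-(n : ℤ)) n, ∀ w,
        (x - (k : TensorMat m N ℂ)) * w = 0 → G * w = 0 := by
      intro k hk w hw
      rw [Finset.mem_Icc] at hk
      have h3 : x * w = (k : TensorMat m N ℂ) * w := by rwa [sub_mul, sub_eq_zero] at hw
      have h4 : intEval y (nodePoly n * ((Polynomial.X - Polynomial.C (k - 1)) *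
          (Polynomial.X - Polynomial.C (k + 1)))) * w = 0 := by
        have h5 : (1 - (y - x) ^ 2) * w = (1 - (y - (k : TensorMat m N ℂ)) ^ 2) * w := by
          have e1 : (1 - (y - x) ^ 2) * w = w - y * y * w + y * (x * w) + (x * y) * w -
            x * (x * w) := by noncomm_ring
          have e3 : x * ((k : TensorMat m N ℂ) * w) = (k : TensorMat m N ℂ) * (x * w) := by
            rw [← mul_assoc, ← mul_assoc, (Int.cast_commute k x).eq]
          rw [e1, hxy.eq, mul_assoc y x w, h3, e3, h3]
          have e2 : y * ((k : TensorMat m N ℂ) * w) = (k : TensorMat m N ℂ) * (y * w) := by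
            rw [← mul_assoc, ← mul_assoc, (Int.cast_commute k y).eq]
          have e4 : (1 - (y - (k : TensorMat m N ℂ)) ^ 2) * w = w - y * y * w +
            y * ((k : TensorMat m N ℂ) * w) + (k : TensorMat m N ℂ) * (y * w) -
            (k : TensorMat m N ℂ) * ((k : TensorMat m N ℂ) * w) := by noncomm_ring
          rw [e4, e2]
        have h6 : intEval y ((Polynomial.X - Polynomial.C (k - 1)) *
            (Polynomial.X - Polynomial.C (k + 1))) =
              -(1 - (y - (k : TensorMat m N ℂ)) ^ 2) := by
          rw [map_mul, map_sub (intEval y), map_sub (intEval y), intEval_X,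
            intEval_C, intEval_C]
          have e2 := (Int.cast_commute k y).eq
          push_cast
          calc (y - ((k : TensorMat m N ℂ) - 1)) * (y - ((k : TensorMat m N ℂ) + 1))
              = y * y - y * k - k * y + k * k - 1 := by noncomm_ring
            _ = _ := by noncomm_ring
        rw [map_mul, h6, mul_assoc, neg_mul, ← h5, mul_neg, ← mul_assoc, h1, zero_mul, neg_zero]
      obtain ⟨q, hq⟩ : nodePoly n * ((Polynomial.X - Polynomial.C (k - 1)) *
          (Polynomial.X - Polynomial.C (k + 1))) ∣ nodePoly (n + 1) ^ 3 := by
        rw [pow_succ', pow_two]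
        exact mul_dvd_mul (nodePoly_dvd (by omega)) (mul_dvd_mul
          (X_sub_C_dvd_nodePoly (by push_cast; omega) (by push_cast; omega))
          (X_sub_C_dvd_nodePoly (by push_cast; omega) (by push_cast; omega)))
      rw [hG, hq, mul_comm _ q, map_mul, mul_assoc, h4, mul_zero]
    have h7 := pow_mul_eq_zero_of_prod hc _ h2 1 (by rw [mul_one]; exact hx)
    rw [mul_one, hG, ← map_pow, ← pow_mul, map_pow] at h7
    exact eq_zero_of_isHermitian_of_pow (isSelfAdjoint_intEval hsa _) h7

/-! ### Common spectral projections and the fusion principle -/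

theorem finRange_eq_append {m : ℕ} (i : ℕ) (hi : i + 1 < m) : ∃ pre post : List (Fin m),
    List.finRange m = pre ++ ⟨i, by omega⟩ :: ⟨i + 1, hi⟩ :: post ∧
      (∀ a ∈ pre, (a : ℕ) ≠ i ∧ (a : ℕ) ≠ i + 1) ∧
      ∀ a ∈ post, (a : ℕ) ≠ i ∧ (a : ℕ) ≠ i + 1 := by
  have h : List.finRange m = (List.finRange m).take i ++ ⟨i, by omega⟩ :: ⟨i + 1, hi⟩ ::
      (List.finRange m).drop (i + 2) := by
    conv_lhs => rw [← List.take_append_drop i (List.finRange m)]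
    congr 1
    rw [List.drop_eq_getElem_cons (by simp; omega), List.drop_eq_getElem_cons (by simp; omega)]
    simp
  refine ⟨_, _, h, ?_, ?_⟩
  all_goals
    intro a ha
    have hnd := List.nodup_finRange m
    rw [h] at hnd
    have h1 := List.nodup_append.1 hnd
    simp only [List.nodup_cons, List.mem_cons, not_or] at h1
    constructor
    all_goals
      intro hai
      first
      | exact h1.2.2 a ha _ (Or.inl rfl) (Fin.ext hai)
      | exact h1.2.2 a ha _ (Or.inr (Or.inl rfl)) (Fin.ext hai)
      | exact h1.2.1.1.2 (by rwa [show (⟨i, _⟩ : Fin m) = a from Fin.ext hai.symm])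
      | exact h1.2.1.2.1 (by rwa [show (⟨i + 1, _⟩ : Fin m) = a from Fin.ext hai.symm])

section Idempotents

variable {m N : ℕ}

/-- The spectral projection of the operator `x_a` for the eigenvalue `k`. -/
noncomputable def specProj (N : ℕ) (a : Fin m) (k : ℤ) : TensorMat m N ℂ :=
  Polynomial.aeval (jm (permAction m N) a)
    (Lagrange.basis (Finset.Ioo (-(m : ℤ)) m) (fun k : ℤ => (k : ℂ)) k)

/-- The projection onto the common eigenspace of the Jucys–Murphy operators with the eigenvalues
`κ_a`. -/
noncomputable def contentProj (N : ℕ) (κ : Fin m → ℤ) : TensorMat m N ℂ :=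
  (List.ofFn fun a => specProj N a (κ a)).prod

theorem operator_eq_contentProj {μ : YoungDiagram} (U : StandardTableau μ) :
    U.operator N = contentProj N U.content := by
  rw [StandardTableau.operator, StandardTableau.idempotent, map_list_prod, List.map_ofFn,
    contentProj]
  congr 2
  funext a
  rw [Function.comp_apply, ← Polynomial.aeval_algHom_apply, specProj]
  simp [jucysMurphy, jm]

theorem aeval_jm_map_nodePoly (a : Fin m) : Polynomial.aeval (jm (permAction m N) a)
    ((nodePoly a).map (Int.castRingHom ℂ)) = 0 := by
  rw [← intEval_jm_nodePoly a a.2, intEval_eq_sum, ← algebraMap_int_eq,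
    Polynomial.aeval_map_algebraMap, Polynomial.aeval_eq_sum_range]

/-- As `nodePoly a` annihilates the operator `jm a`, its spectral projections are the values of the
Lagrange basis polynomials of any larger set of nodes. -/
theorem jm_mul_specProj (a : Fin m) {k : ℤ} (hk : k ∈ Finset.Ioo (-(m : ℤ)) m) :
    jm (permAction m N) a * specProj N a k = (k : ℂ) • specProj N a k := by
  -- the polynomial `(X - k) ℓ_k(X)`, for the Lagrange basis polynomial `ℓ_k`, is a multiple of
  -- `nodePoly a`
  suffices h : Polynomial.aeval (jm (permAction m N) a) ((Polynomial.X - Polynomial.C (k : ℂ)) *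
      Lagrange.basis (Finset.Ioo (-(m : ℤ)) m) (fun k : ℤ => (k : ℂ)) k) = 0 by
    rwa [map_mul, map_sub, Polynomial.aeval_X, Polynomial.aeval_C, sub_mul, sub_eq_zero,
      ← Algebra.smul_def] at h
  have hdvd : (nodePoly a).map (Int.castRingHom ℂ) ∣ (Polynomial.X - Polynomial.C (k : ℂ)) *
      Lagrange.basis (Finset.Ioo (-(m : ℤ)) m) (fun k : ℤ => (k : ℂ)) k := by
    have h1 : ((Polynomial.X - Polynomial.C (k : ℂ)) *
        Lagrange.basis (Finset.Ioo (-(m : ℤ)) m) (fun k : ℤ => (k : ℂ)) k) =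
        (∏ j ∈ (Finset.Ioo (-(m : ℤ)) m).erase k, Polynomial.C (((k : ℂ) - (j : ℂ))⁻¹)) *
          ∏ j ∈ Finset.Ioo (-(m : ℤ)) m, (Polynomial.X - Polynomial.C (j : ℂ)) := by
      rw [Lagrange.basis, ← Finset.mul_prod_erase _ _ hk]
      simp only [Lagrange.basisDivisor]
      rw [Finset.prod_mul_distrib]
      ring
    rw [h1]
    refine Dvd.dvd.mul_left ?_ _
    have h2 : (nodePoly a).map (Int.castRingHom ℂ) =
        ∏ k ∈ Finset.Icc (-((a : ℕ) : ℤ)) a, (Polynomial.X - Polynomial.C (k : ℂ)) := by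
      rw [nodePoly, Polynomial.map_prod]
      exact Finset.prod_congr rfl fun k _ => by
        rw [Polynomial.map_sub, Polynomial.map_X, Polynomial.map_C, eq_intCast]
    rw [h2]
    exact Finset.prod_dvd_prod_of_subset _ _ _ fun j hj => by
      rw [Finset.mem_Icc] at hj
      rw [Finset.mem_Ioo]
      have := a.2
      omega
  obtain ⟨q, hq⟩ := hdvd
  rw [hq, map_mul, aeval_jm_map_nodePoly, zero_mul]

theorem commute_jm_aeval (a b : Fin m) (p : Polynomial ℂ) : Commute (jm (permAction m N) a)
    (Polynomial.aeval (jm (permAction m N) b) p) := by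
  rw [Polynomial.aeval_eq_sum_range]
  exact Commute.sum_right _ _ _ fun i _ => ((commute_jm a b).pow_right i).smul_right _

theorem commute_aeval_jm (a b : Fin m) (p q : Polynomial ℂ) : Commute
    (Polynomial.aeval (jm (permAction m N) a) q) (Polynomial.aeval (jm (permAction m N) b) p) := by
  rw [Polynomial.aeval_eq_sum_range (p := q)]
  exact Commute.sum_left _ _ _ fun i _ => ((commute_jm_aeval a b p).pow_left i).smul_left _

theorem commute_list_prod {M : Type*} [Monoid M] {x : M} {l : List M}
    (h : ∀ y ∈ l, Commute x y) : Commute x l.prod := Commute.list_prod_right l x h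

theorem commute_jm_contentProj (a : Fin m) (κ : Fin m → ℤ) :
    Commute (jm (permAction m N) a) (contentProj N κ) := by
  refine commute_list_prod fun y hy => ?_
  obtain ⟨b, rfl⟩ := List.mem_ofFn.1 hy
  exact commute_jm_aeval a b _

theorem jm_mul_contentProj (a : Fin m) {κ : Fin m → ℤ}
    (hκ : κ a ∈ Finset.Ioo (-(m : ℤ)) m) :
    jm (permAction m N) a * contentProj N κ = (κ a : ℂ) • contentProj N κ := by
  obtain ⟨pre, post, h⟩ := List.append_of_mem (List.mem_finRange a)
  rw [contentProj, List.ofFn_eq_map, h, List.map_append, List.map_cons, List.prod_append,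
    List.prod_cons, ← mul_assoc, ← mul_assoc]
  have hc : Commute (jm (permAction m N) a) (pre.map fun a => specProj N a (κ a)).prod := by
    refine commute_list_prod fun y hy => ?_
    obtain ⟨b, -, rfl⟩ := List.mem_map.1 hy
    exact commute_jm_aeval a b _
  rw [hc.eq, mul_assoc _ (jm _ a), jm_mul_specProj a hκ, mul_smul_comm, smul_mul_assoc, mul_assoc]

theorem contentProj_mul_jm (a : Fin m) {κ : Fin m → ℤ}
    (hκ : κ a ∈ Finset.Ioo (-(m : ℤ)) m) :
    contentProj N κ * jm (permAction m N) a = (κ a : ℂ) • contentProj N κ := by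
  rw [← (commute_jm_contentProj a κ).eq, jm_mul_contentProj a hκ]

theorem contentProj_mul_aeval (a : Fin m) {κ : Fin m → ℤ}
    (hκ : κ a ∈ Finset.Ioo (-(m : ℤ)) m) (p : Polynomial ℂ) :
    contentProj N κ * Polynomial.aeval (jm (permAction m N) a) p =
      p.eval (κ a : ℂ) • contentProj N κ := by
  have hn : ∀ n : ℕ, contentProj N κ * jm (permAction m N) a ^ n =
      (κ a : ℂ) ^ n • contentProj N κ := by
    intro n
    induction n with
    | zero => simp
    | succ n ih => rw [pow_succ, ← mul_assoc, ih, smul_mul_assoc, contentProj_mul_jm a hκ,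
        smul_smul, pow_succ]
  rw [Polynomial.aeval_eq_sum_range, Finset.mul_sum, Polynomial.eval_eq_sum_range, Finset.sum_smul]
  exact Finset.sum_congr rfl fun i _ => by rw [mul_smul_comm, hn, smul_smul]

theorem contentProj_mul_contentProj {κ l : Fin m → ℤ}
    (hκ : ∀ a, κ a ∈ Finset.Ioo (-(m : ℤ)) m) :
    contentProj N κ * contentProj N l = if κ = l then contentProj N κ else 0 := by
  have key : ∀ L : List (Fin m), contentProj N κ * (L.map fun a => specProj N a (l a)).prod =
      (L.map fun a => if κ a = l a then (1 : ℂ) else 0).prod • contentProj N κ := by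
    intro L
    induction L with
    | nil => simp
    | cons a L ih =>
      rw [List.map_cons, List.prod_cons, ← mul_assoc, specProj, contentProj_mul_aeval a (hκ a),
        smul_mul_assoc, ih, smul_smul, List.map_cons, List.prod_cons]
      congr 2
      split_ifs with h
      · rw [← h]
        exact Lagrange.eval_basis_self (fun x _ y _ hxy => by exact_mod_cast hxy) (hκ a)
      · exact Lagrange.eval_basis_of_ne (v := fun k : ℤ => (k : ℂ)) (Ne.symm h) (hκ a)
  conv_lhs => rw [contentProj.eq_def (κ := l), List.ofFn_eq_map]
  rw [key]
  split_ifs with h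
  · subst h
    simp
  · obtain ⟨a, ha⟩ := Function.ne_iff.1 h
    rw [List.prod_eq_zero, zero_smul]
    exact List.mem_map.2 ⟨a, List.mem_finRange a, if_neg ha⟩

theorem semiconj_aeval {φ x y : TensorMat m N ℂ} (h : φ * x = y * φ) (p : Polynomial ℂ) :
    φ * Polynomial.aeval x p = Polynomial.aeval y p * φ := by
  have hn : ∀ n : ℕ, φ * x ^ n = y ^ n * φ := fun n => by
    have : SemiconjBy φ x y := h
    exact (this.pow_right n).eq
  rw [Polynomial.aeval_eq_sum_range, Polynomial.aeval_eq_sum_range, Finset.mul_sum,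
    Finset.sum_mul]
  exact Finset.sum_congr rfl fun n _ => by rw [mul_smul_comm, hn, smul_mul_assoc]

/-- The content vector with the entries `κ_i` and `κ_{i+1}` exchanged. -/
def swapAt (i : ℕ) (hi : i + 1 < m) (κ : Fin m → ℤ) : Fin m → ℤ :=
  κ ∘ Equiv.swap ⟨i, by omega⟩ ⟨i + 1, hi⟩

theorem swapAt_left (i : ℕ) (hi : i + 1 < m) (κ : Fin m → ℤ) :
    swapAt i hi κ ⟨i, by omega⟩ = κ ⟨i + 1, hi⟩ := by simp [swapAt]

theorem swapAt_right (i : ℕ) (hi : i + 1 < m) (κ : Fin m → ℤ) :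
    swapAt i hi κ ⟨i + 1, hi⟩ = κ ⟨i, by omega⟩ := by simp [swapAt]

theorem swapAt_of_ne (i : ℕ) (hi : i + 1 < m) (κ : Fin m → ℤ) {a : Fin m} (h1 : (a : ℕ) ≠ i)
    (h2 : (a : ℕ) ≠ i + 1) : swapAt i hi κ a = κ a := by
  rw [swapAt, Function.comp_apply, Equiv.swap_apply_of_ne_of_ne (Fin.ne_of_val_ne h1)
    (Fin.ne_of_val_ne h2)]

theorem swapAt_swapAt (i : ℕ) (hi : i + 1 < m) (κ : Fin m → ℤ) :
    swapAt i hi (swapAt i hi κ) = κ := by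
  funext a; simp [swapAt]

/-- The intertwiner exchanges the adjacent operators `jm i` and `jm (i + 1)`, hence also their
spectral projections. -/
theorem intertwiner_mul_contentProj (i : ℕ) (hi : i + 1 < m) (κ : Fin m → ℤ) :
    intertwiner (permAction m N) i hi * contentProj N κ =
      contentProj N (swapAt i hi κ) * intertwiner (permAction m N) i hi := by
  obtain ⟨pre, post, h, hpre, hpost⟩ := finRange_eq_append i hi
  -- the intertwiner commutes with the projections of the other Jucys–Murphy operators
  have hL : ∀ L : List (Fin m), (∀ a ∈ L, (a : ℕ) ≠ i ∧ (a : ℕ) ≠ i + 1) →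
      intertwiner (permAction m N) i hi * (L.map fun a => specProj N a (κ a)).prod =
      (L.map fun a => specProj N a (swapAt i hi κ a)).prod *
        intertwiner (permAction m N) i hi := by
    intro L hL
    have e : (L.map fun a => specProj N a (swapAt i hi κ a)) =
        L.map fun a => specProj N a (κ a) :=
      List.map_congr_left fun a ha => by rw [swapAt_of_ne i hi κ (hL a ha).1 (hL a ha).2]
    rw [e]
    refine (commute_list_prod fun y hy => ?_).eq
    obtain ⟨b, hb, rfl⟩ := List.mem_map.1 hy
    exact semiconj_aeval (intertwiner_mul_of_ne i hi b (hL b hb).1 (hL b hb).2).eq _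
  rw [contentProj, contentProj, List.ofFn_eq_map, List.ofFn_eq_map, h]
  simp only [List.map_append, List.map_cons, List.prod_append, List.prod_cons]
  rw [← mul_assoc, hL pre hpre, mul_assoc, swapAt_left, swapAt_right, mul_assoc]
  congr 1
  rw [← mul_assoc (intertwiner _ i hi), specProj, semiconj_aeval (intertwiner_mul_left i hi),
    mul_assoc, ← mul_assoc (intertwiner _ i hi), specProj,
    semiconj_aeval (intertwiner_mul_right i hi),
    mul_assoc _ (intertwiner _ i hi), hL post hpost, ← mul_assoc, ← mul_assoc, ← mul_assoc,
    (commute_aeval_jm _ _ _ _).eq]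
  rfl

/-- The action of an adjacent transposition on a common spectral projection. -/
theorem adj_mul_contentProj (i : ℕ) (hi : i + 1 < m) {κ : Fin m → ℤ}
    (hκ : ∀ a, κ a ∈ Finset.Ioo (-(m : ℤ)) m) :
    ((κ ⟨i, by omega⟩ : ℂ) - κ ⟨i + 1, hi⟩) • (adj (permAction m N) i hi * contentProj N κ) +
        contentProj N κ =
      ((κ ⟨i, by omega⟩ : ℂ) - κ ⟨i + 1, hi⟩) •
          (contentProj N (swapAt i hi κ) * adj (permAction m N) i hi) -
        contentProj N (swapAt i hi κ) := by
  have h := intertwiner_mul_contentProj (N := N) i hi κ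
  have h' : ∀ a, swapAt i hi κ a ∈ Finset.Ioo (-(m : ℤ)) m := fun a => hκ _
  conv_rhs at h => rw [intertwiner_eq]
  rw [intertwiner, add_mul, mul_assoc, sub_mul, jm_mul_contentProj _ (hκ _),
    jm_mul_contentProj _ (hκ _), ← sub_smul, mul_smul_comm, one_mul, mul_sub, mul_one, ← mul_assoc,
    mul_sub, contentProj_mul_jm _ (h' _), contentProj_mul_jm _ (h' _), ← sub_smul, swapAt_left,
    swapAt_right, smul_mul_assoc] at h
  exact h

theorem contentProj_eq_zero (i : ℕ) (hi : i + 1 < m) {κ : Fin m → ℤ}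
    (hκ : ∀ a, κ a ∈ Finset.Ioo (-(m : ℤ)) m) (h : κ ⟨i, by omega⟩ = κ ⟨i + 1, hi⟩) :
    contentProj N κ = 0 := by
  have h1 := adj_mul_contentProj (N := N) i hi hκ
  have h2 : swapAt i hi κ = κ := by
    funext a
    by_cases ha : (a : ℕ) = i
    · rw [show a = ⟨i, by omega⟩ from Fin.ext ha, swapAt_left, h]
    · by_cases ha' : (a : ℕ) = i + 1
      · rw [show a = ⟨i + 1, hi⟩ from Fin.ext ha', swapAt_right, h]
      · exact swapAt_of_ne i hi κ ha ha'
  rw [h2, h, sub_self, zero_smul, zero_smul, zero_add, zero_sub] at h1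
  ext f g
  exact self_eq_neg.1 (congrFun (congrFun h1 f) g)

variable {R : Type*} [Ring R] [Algebra ℂ R]

/-- A family `X(κ)` is `S_m`-covariant if `d (s X(κ) - X(s κ) s) = X(κ) - X(s κ)` for each adjacent
transposition `s = (i i+1)`, where `d = κ_i - κ_{i+1}`. This is the relation which the `R`-matrix
relation imposes on the products `T₁(u + h κ₁) ⋯ T_m(u + h κ_m)`. -/
def IsCovariant (j : TensorMat m N ℂ →ₐ[ℂ] R) (X : (Fin m → ℤ) → R) : Prop :=
  ∀ (i : ℕ) (hi : i + 1 < m) (κ : Fin m → ℤ),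
    (κ ⟨i, by omega⟩ - κ ⟨i + 1, hi⟩) • (j (adj (permAction m N) i hi) * X κ -
      X (swapAt i hi κ) * j (adj (permAction m N) i hi)) = X κ - X (swapAt i hi κ)

/-- The projection `E_κ` is absorbed by the members of a covariant family: the sum
`Φ = ∑ E_κ X(κ)` over all the content vectors commutes with the adjacent transpositions, hence with
`E_κ`, while `E_κ Φ = E_κ X(κ)`. -/
theorem contentProj_mul_covariant {j : TensorMat m N ℂ →ₐ[ℂ] R} {X : (Fin m → ℤ) → R}
    (hX : IsCovariant j X) {κ : Fin m → ℤ} (hκ : ∀ a, κ a ∈ Finset.Ioo (-(m : ℤ)) m) :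
    j (contentProj N κ) * X κ = j (contentProj N κ) * X κ * j (contentProj N κ) := by
  classical
  set S : Finset (Fin m → ℤ) := Fintype.piFinset fun _ => Finset.Ioo (-(m : ℤ)) m with hS
  have hmem : ∀ κ, κ ∈ S ↔ ∀ a, κ a ∈ Finset.Ioo (-(m : ℤ)) m := fun κ => by
    rw [hS, Fintype.mem_piFinset]
  set Φ : R := ∑ l ∈ S, j (contentProj N l) * X l with hΦ
  have hs : ∀ (i : ℕ) (hi : i + 1 < m), Commute Φ (j (adj (permAction m N) i hi)) := by
    intro i hi
    set s := j (adj (permAction m N) i hi) with hsdef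
    have hss : s * s = 1 := by rw [hsdef, ← map_mul, adj_mul_adj, map_one]
    let d : (Fin m → ℤ) → ℂ := fun l => (l ⟨i, by omega⟩ : ℂ) - l ⟨i + 1, hi⟩
    let G : (Fin m → ℤ) → R := fun l => j (contentProj N (swapAt i hi l)) * s * X l -
      (d l)⁻¹ • (j (contentProj N (swapAt i hi l)) * X l)
    have hterm : ∀ l ∈ S, s * (j (contentProj N l) * X l) - j (contentProj N l) * X l * s =
        G l - G (swapAt i hi l) := by
      intro l hl
      have hl' := (hmem l).1 hl
      have hl'' : ∀ a, swapAt i hi l a ∈ Finset.Ioo (-(m : ℤ)) m := fun a => hl' _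
      by_cases hd : l ⟨i, by omega⟩ = l ⟨i + 1, hi⟩
      · have h1 := contentProj_eq_zero (N := N) i hi hl' hd
        have h2 : contentProj N (swapAt i hi l) = 0 :=
          contentProj_eq_zero i hi hl'' (by rw [swapAt_left, swapAt_right, hd])
        simp only [G, swapAt_swapAt, h1, h2, map_zero, zero_mul, mul_zero, sub_self, smul_zero]
      · have hd' : d l ≠ 0 := sub_ne_zero.2 (by exact_mod_cast hd)
        -- `d` is the difference of the two contents exchanged; `f1` and `f2` move `s` through
        -- the projection and through `X`, with correction terms proportional to `d⁻¹`
        have hdd : d (swapAt i hi l) = -d l := by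
          simp only [d, swapAt_left, swapAt_right]; ring
        have e1 := congrArg j (adj_mul_contentProj (N := N) i hi hl')
        have e2 := hX i hi (swapAt i hi l)
        rw [swapAt_swapAt, swapAt_left, swapAt_right] at e2
        simp only [map_add, map_sub, map_smul, map_mul] at e1
        rw [← Int.cast_smul_eq_zsmul ℂ] at e2
        push_cast at e2
        change d l • (s * _) + _ = d l • (_ * s) - _ at e1
        rw [← neg_sub ((l ⟨i, _⟩ : ℂ)), ← hsdef] at e2
        change (-d l) • _ = _ at e2
        simp only [G, swapAt_swapAt, hdd]
        have f1 : s * j (contentProj N l) = j (contentProj N (swapAt i hi l)) * s -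
            (d l)⁻¹ • (j (contentProj N l) + j (contentProj N (swapAt i hi l))) := by
          rw [eq_sub_iff_add_eq, ← (smul_right_injective R hd').eq_iff]
          simp only [smul_add, smul_smul, mul_inv_cancel₀ hd', one_smul]
          rw [← add_assoc, e1]
          abel
        have f2 : X l * s = s * X (swapAt i hi l) +
            (d l)⁻¹ • (X (swapAt i hi l) - X l) := by
          rw [← (smul_right_injective R hd').eq_iff]
          simp only [smul_add, smul_smul, mul_inv_cancel₀ hd', one_smul]
          rw [← e2, neg_smul, smul_sub]
          abel
        rw [← mul_assoc, f1, mul_assoc _ (X l) s, f2]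
        simp only [sub_mul, mul_add, add_mul, smul_mul_assoc, mul_smul_comm, mul_sub, mul_assoc,
          smul_sub, smul_add, inv_neg, neg_smul]
        abel
    -- the correction terms for `l` and for `swapAt l` cancel in the sum
    have hsum : s * Φ - Φ * s = 0 := by
      rw [hΦ, Finset.mul_sum, Finset.sum_mul, ← Finset.sum_sub_distrib,
        Finset.sum_congr rfl hterm, Finset.sum_sub_distrib, sub_eq_zero]
      refine Finset.sum_nbij' (swapAt i hi) (swapAt i hi) ?_ ?_ ?_ ?_ ?_
      · exact fun l hl => (hmem _).2 fun a => (hmem l).1 hl _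
      · exact fun l hl => (hmem _).2 fun a => (hmem l).1 hl _
      · exact fun l _ => swapAt_swapAt i hi l
      · exact fun l _ => swapAt_swapAt i hi l
      · exact fun l _ => by rw [swapAt_swapAt]
    exact (sub_eq_zero.1 hsum).symm
  -- the Jucys–Murphy operators are polynomials in the adjacent transpositions
  have hjm : ∀ (a : ℕ) (ha : a < m), Commute Φ (j (jm (permAction m N) ⟨a, ha⟩)) := by
    intro a
    induction a with
    | zero => intro ha; rw [jm_zero, map_zero]; exact Commute.zero_right _
    | succ a ih =>
      intro ha
      rw [jm_succ, map_add, map_mul, map_mul]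
      exact (((hs a ha).mul_right (ih (by omega))).mul_right (hs a ha)).add_right (hs a ha)
  have hE : Commute Φ (j (contentProj N κ)) := by
    rw [contentProj, map_list_prod, List.map_ofFn]
    refine commute_list_prod fun y hy => ?_
    obtain ⟨b, rfl⟩ := List.mem_ofFn.1 hy
    rw [Function.comp_apply, specProj, ← Polynomial.aeval_algHom_apply,
      Polynomial.aeval_eq_sum_range]
    exact Commute.sum_right _ _ _ fun i _ => ((hjm b b.2).pow_right i).smul_right _
  -- orthogonality of the projections singles out the summand for `κ`
  have hEΦ : j (contentProj N κ) * Φ = j (contentProj N κ) * X κ := by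
    rw [hΦ, Finset.mul_sum, Finset.sum_eq_single κ]
    · rw [← mul_assoc, ← map_mul, contentProj_mul_contentProj hκ, if_pos rfl]
    · intro l _ hl
      rw [← mul_assoc, ← map_mul, contentProj_mul_contentProj hκ, if_neg (Ne.symm hl), map_zero,
        zero_mul]
    · exact fun h => absurd ((hmem κ).2 hκ) h
  rw [← hEΦ, mul_assoc, hE.eq, ← mul_assoc, ← map_mul, contentProj_mul_contentProj hκ, if_pos rfl]

end Idempotents

/-- The contents are among the nodes at which the spectral projections are taken: a diagram which
contains the box `(i, j)` has more than `i` and more than `j` boxes. -/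
theorem StandardTableau.content_mem {μ : YoungDiagram} (U : StandardTableau μ) (a : Fin μ.card) :
    U.content a ∈ Finset.Ioo (-(μ.card : ℤ)) μ.card := by
  have h : ∀ p : ℕ × ℕ, p ∈ μ.cells → p.1 < μ.card ∧ p.2 < μ.card := by
    rintro ⟨i, j⟩ hp
    constructor
    · have h1 : (Finset.range (i + 1)).image (fun k => (k, j)) ⊆ μ.cells := by
        intro q hq
        obtain ⟨k, hk, rfl⟩ := Finset.mem_image.1 hq
        exact μ.up_left_mem (by simpa [Nat.lt_succ_iff] using hk) le_rfl hp
      have h2 := Finset.card_le_card h1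
      rw [Finset.card_image_of_injective _ fun a b hab => (Prod.ext_iff.1 hab).1,
        Finset.card_range] at h2
      exact h2
    · have h1 : (Finset.range (j + 1)).image (fun k => (i, k)) ⊆ μ.cells := by
        intro q hq
        obtain ⟨k, hk, rfl⟩ := Finset.mem_image.1 hq
        exact μ.up_left_mem le_rfl (by simpa [Nat.lt_succ_iff] using hk) hp
      have h2 := Finset.card_le_card h1
      rw [Finset.card_image_of_injective _ fun a b hab => (Prod.ext_iff.1 hab).2,
        Finset.card_range] at h2
      exact h2
  obtain ⟨h1, h2⟩ := h _ (U.entry.symm a).2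
  rw [StandardTableau.content, Finset.mem_Ioo]
  omega

/-! ### Matrices acting in one or two tensor factors -/

section Slots

variable {m N : ℕ} {A : Type*} [Ring A]

theorem slot_apply (a : Fin m) (X : Matrix (Fin N) (Fin N) A) (f g : Fin m → Fin N) :
    slot a X f g = if ∀ b, b ≠ a → f b = g b then X (f a) (g a) else 0 := rfl

theorem sum_eq_sum_update {M : Type*} [AddCommMonoid M] (a : Fin m) (f : Fin m → Fin N)
    (F : (Fin m → Fin N) → M) (hF : ∀ g, (¬ ∀ b, b ≠ a → f b = g b) → F g = 0) :
    ∑ g, F g = ∑ x, F (Function.update f a x) := by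
  classical
  rw [← Finset.sum_filter_of_ne (p := fun g => ∀ b, b ≠ a → f b = g b)
    (fun g _ hg => by_contra fun h => hg (hF g h))]
  refine Finset.sum_bij' (fun g _ => g a) (fun x _ => Function.update f a x) ?_ ?_ ?_ ?_ ?_
  · simp
  · intro x _
    simp only [Finset.mem_filter, Finset.mem_univ, true_and]
    intro b hb
    rw [Function.update_of_ne hb]
  · intro g hg
    simp only [Finset.mem_filter, Finset.mem_univ, true_and] at hg
    funext b
    by_cases hb : b = a
    · subst hb; simp
    · rw [Function.update_of_ne hb, hg b hb]
  · simp
  · intro g hg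
    simp only [Finset.mem_filter, Finset.mem_univ, true_and] at hg
    congr 1
    funext b
    by_cases hb : b = a
    · subst hb; simp
    · rw [Function.update_of_ne hb, hg b hb]

theorem slot_mul_apply (a : Fin m) (X : Matrix (Fin N) (Fin N) A) (Z : TensorMat m N A)
    (f g : Fin m → Fin N) :
    (slot a X * Z) f g = ∑ x, X (f a) x * Z (Function.update f a x) g := by
  rw [Matrix.mul_apply, sum_eq_sum_update a f]
  · refine Finset.sum_congr rfl fun x _ => ?_
    rw [slot_apply, if_pos fun b hb => by rw [Function.update_of_ne hb], Function.update_self]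
  · intro h hh
    rw [slot_apply, if_neg hh, zero_mul]

/-- `slot a` as a ring homomorphism. -/
def slotHom (a : Fin m) : Matrix (Fin N) (Fin N) A →+* TensorMat m N A where
  toFun := slot a
  map_one' := by
    ext f g
    simp only [slot_apply, Matrix.one_apply]
    by_cases h : f = g
    · subst h; simp
    · rw [if_neg h]
      split_ifs with h1 h2
      · exact absurd (funext fun b => if hb : b = a then hb ▸ h2 else h1 b hb) h
      · rfl
      · rfl
  map_zero' := by
    ext f g
    simp [slot_apply]
  map_add' X Y := by
    ext f g
    simp only [slot_apply, Matrix.add_apply]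
    split_ifs <;> simp
  map_mul' X Y := by
    ext f g
    rw [slot_mul_apply, slot_apply, Matrix.mul_apply]
    split_ifs with h
    · refine Finset.sum_congr rfl fun x _ => ?_
      rw [slot_apply, if_pos fun b hb => by rw [Function.update_of_ne hb, h b hb],
        Function.update_self]
    · refine (Finset.sum_eq_zero fun x _ => ?_).symm
      rw [slot_apply, if_neg, mul_zero]
      intro h'
      exact h fun b hb => by rw [← h' b hb, Function.update_of_ne hb]

theorem slotHom_apply (a : Fin m) (X : Matrix (Fin N) (Fin N) A) : slotHom a X = slot a X := rfl

theorem slot_map {A' : Type*} [Ring A'] (φ : A →+* A') (a : Fin m)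
    (X : Matrix (Fin N) (Fin N) A) : (slot a X).map φ = slot a (X.map φ) := by
  ext f g
  simp only [slot_apply, Matrix.map_apply]
  split_ifs <;> simp

theorem slot_mul_slot_apply {a b : Fin m} (hab : a ≠ b) (X Y : Matrix (Fin N) (Fin N) A)
    (f g : Fin m → Fin N) : (slot a X * slot b Y) f g =
      if ∀ c, c ≠ a → c ≠ b → f c = g c then X (f a) (g a) * Y (f b) (g b) else 0 := by
  rw [slot_mul_apply]
  split_ifs with h
  · rw [Finset.sum_eq_single (g a)]
    · rw [slot_apply, if_pos, Function.update_of_ne hab.symm]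
      intro c hc
      by_cases hca : c = a
      · subst hca; simp
      · rw [Function.update_of_ne hca, h c hca hc]
    · intro x _ hx
      rw [slot_apply, if_neg, mul_zero]
      intro h'
      exact hx (by simpa using h' a hab)
    · simp
  · refine Finset.sum_eq_zero fun x _ => ?_
    rw [slot_apply, if_neg, mul_zero]
    intro h'
    exact h fun c hca hcb => by rw [← h' c hcb, Function.update_of_ne hca]

theorem commute_slot {a b : Fin m} (hab : a ≠ b) {X Y : Matrix (Fin N) (Fin N) A}
    (h : ∀ i j k l, Commute (X i j) (Y k l)) : Commute (slot a X) (slot b Y) := by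
  ext f g
  rw [slot_mul_slot_apply hab, slot_mul_slot_apply hab.symm]
  have e : (∀ c, c ≠ a → c ≠ b → f c = g c) ↔ ∀ c, c ≠ b → c ≠ a → f c = g c :=
    ⟨fun h c h1 h2 => h c h2 h1, fun h c h1 h2 => h c h2 h1⟩
  simp only [e, (h _ _ _ _).eq]

/-- The matrix of the permutation of the tensor factors over an arbitrary `ℂ`-algebra. -/
def permMat (m N : ℕ) (A : Type*) [Ring A] [Algebra ℂ A] (σ : Equiv.Perm (Fin m)) :
    TensorMat m N A := (permAction m N σ).map (algebraMap ℂ A)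

theorem permMat_apply [Algebra ℂ A] (σ : Equiv.Perm (Fin m)) (f g : Fin m → Fin N) :
    permMat m N A σ f g = if f ∘ σ = g then 1 else 0 := by
  simp only [permMat, Matrix.map_apply, permAction, MonoidHom.coe_mk, OneHom.coe_mk,
    Matrix.of_apply]
  split_ifs <;> simp

theorem permMat_mul_apply [Algebra ℂ A] (σ : Equiv.Perm (Fin m)) (Z : TensorMat m N A)
    (f g : Fin m → Fin N) : (permMat m N A σ * Z) f g = Z (f ∘ σ) g := by
  rw [Matrix.mul_apply, Finset.sum_eq_single (f ∘ σ)]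
  · rw [permMat_apply, if_pos rfl, one_mul]
  · intro h _ hh
    rw [permMat_apply, if_neg (Ne.symm hh), zero_mul]
  · simp

theorem mul_permMat_apply [Algebra ℂ A] (σ : Equiv.Perm (Fin m)) (Z : TensorMat m N A)
    (f g : Fin m → Fin N) : (Z * permMat m N A σ) f g = Z f (g ∘ σ.symm) := by
  rw [Matrix.mul_apply, Finset.sum_eq_single (g ∘ σ.symm)]
  · rw [permMat_apply, if_pos (by funext a; simp), mul_one]
  · intro h _ hh
    rw [permMat_apply, if_neg, mul_zero]
    rintro rfl
    exact hh (by funext a; simp)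
  · simp

theorem permMat_mul_slot [Algebra ℂ A] (σ : Equiv.Perm (Fin m)) (a : Fin m)
    (X : Matrix (Fin N) (Fin N) A) :
    permMat m N A σ * slot a X = slot (σ a) X * permMat m N A σ := by
  ext f g
  rw [permMat_mul_apply, mul_permMat_apply, slot_apply, slot_apply]
  have e : (∀ b, b ≠ a → (f ∘ σ) b = g b) ↔ ∀ b, b ≠ σ a → f b = (g ∘ σ.symm) b := by
    constructor
    · intro h b hb
      have := h (σ.symm b) (fun h' => hb (by rw [← h']; simp))
      simpa using this
    · intro h b hb
      have := h (σ b) (fun h' => hb (σ.injective h'))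
      simpa using this
  simp only [e]
  simp

/-- The algebra `End ℂ^N ⊗ End ℂ^N ⊗ A`: the inner indices are those of the tensor factor `0`,
the outer indices are those of the tensor factor `1`. -/
abbrev TwoMat (N : ℕ) (A : Type*) : Type _ :=
  Matrix (Fin N) (Fin N) (Matrix (Fin N) (Fin N) A)

/-- A matrix acting in the tensor factor `0`. -/
def leg0 (N : ℕ) (A : Type*) [Ring A] : Matrix (Fin N) (Fin N) A →+* TwoMat N A :=
  Matrix.scalar (Fin N)

/-- A matrix acting in the tensor factor `1`. -/
def leg1 (N : ℕ) (A : Type*) [Ring A] : Matrix (Fin N) (Fin N) A →+* TwoMat N A :=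
  (Matrix.scalar (Fin N) : A →+* _).mapMatrix

/-- The permutation operator `P` exchanging the tensor factors `0` and `1`. -/
def flip (N : ℕ) (A : Type*) [Ring A] : TwoMat N A :=
  Matrix.of fun k l => Matrix.single l k 1

theorem leg0_apply (X : Matrix (Fin N) (Fin N) A) (k l i j : Fin N) :
    leg0 N A X k l i j = if k = l then X i j else 0 := by
  rw [leg0, Matrix.scalar_apply, Matrix.diagonal_apply]
  split_ifs <;> rfl

theorem leg1_apply (X : Matrix (Fin N) (Fin N) A) (k l i j : Fin N) :
    leg1 N A X k l i j = if i = j then X k l else 0 := by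
  rw [leg1, RingHom.mapMatrix_apply, Matrix.map_apply, Matrix.scalar_apply, Matrix.diagonal_apply]

theorem flip_apply (k l i j : Fin N) :
    flip N A k l i j = if l = i ∧ k = j then 1 else 0 := by
  rw [flip, Matrix.of_apply, Matrix.single_apply]

theorem twoMat_mul_apply (X Y : TwoMat N A) (k l i j : Fin N) :
    (X * Y) k l i j = ∑ p, ∑ q, X k p i q * Y p l q j := by
  rw [Matrix.mul_apply, Matrix.sum_apply]
  simp only [Matrix.mul_apply]

theorem flip_mul_apply (Z : TwoMat N A) (k l i j : Fin N) :
    (flip N A * Z) k l i j = Z i l k j := by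
  rw [twoMat_mul_apply, Finset.sum_eq_single i, Finset.sum_eq_single k]
  · simp [flip_apply]
  · intro q _ hq; simp [flip_apply, Ne.symm hq]
  · simp
  · intro q _ hq
    exact Finset.sum_eq_zero fun p _ => by simp [flip_apply, hq]
  · simp

theorem mul_flip_apply (Z : TwoMat N A) (k l i j : Fin N) :
    (Z * flip N A) k l i j = Z k j i l := by
  rw [twoMat_mul_apply, Finset.sum_eq_single j, Finset.sum_eq_single l]
  · simp [flip_apply]
  · intro q _ hq; simp [flip_apply, Ne.symm hq]
  · simp
  · intro q _ hq
    exact Finset.sum_eq_zero fun p _ => by simp [flip_apply, hq]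
  · simp

theorem flip_mul_flip : flip N A * flip N A = 1 := by
  ext k l i j
  rw [flip_mul_apply, flip_apply, Matrix.one_apply]
  by_cases h : k = l
  · subst h; simp [Matrix.one_apply]
  · simp [h, Ne.symm h]

theorem leg0_mul_leg1_apply (X Y : Matrix (Fin N) (Fin N) A) (k l i j : Fin N) :
    (leg0 N A X * leg1 N A Y) k l i j = X i j * Y k l := by
  rw [twoMat_mul_apply, Finset.sum_eq_single k, Finset.sum_eq_single j]
  · simp [leg0_apply, leg1_apply]
  · intro q _ hq; simp [leg1_apply, hq]
  · simp
  · intro q _ hq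
    exact Finset.sum_eq_zero fun p _ => by simp [leg0_apply, Ne.symm hq]
  · simp

theorem leg1_mul_leg0_apply (X Y : Matrix (Fin N) (Fin N) A) (k l i j : Fin N) :
    (leg1 N A Y * leg0 N A X) k l i j = Y k l * X i j := by
  rw [twoMat_mul_apply, Finset.sum_eq_single l, Finset.sum_eq_single i]
  · simp [leg0_apply, leg1_apply]
  · intro q _ hq; simp [leg1_apply, Ne.symm hq]
  · simp
  · intro q _ hq
    exact Finset.sum_eq_zero fun p _ => by simp [leg0_apply, hq]
  · simp

/-- The operator on `(ℂ^N)^{⊗ m}` acting in the factors `a` and `b` as a given operator acts in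
the factors `0` and `1`. -/
def twoSlot {a b : Fin m} (hab : a ≠ b) : TwoMat N A →+* TensorMat m N A where
  toFun Z := Matrix.of fun f g =>
    if ∀ c, c ≠ a → c ≠ b → f c = g c then Z (f b) (g b) (f a) (g a) else 0
  map_one' := by
    ext f g
    simp only [Matrix.of_apply, Matrix.one_apply]
    by_cases h : f = g
    · subst h; simp
    · rw [if_neg h]
      split_ifs with h1 h2
      · rw [Matrix.one_apply, if_neg]
        intro h3
        refine h (funext fun c => ?_)
        by_cases hc : c = a
        · rw [hc, h3]
        · by_cases hc' : c = b
          · rw [hc', h2]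
          · exact h1 c hc hc'
      · rfl
      · rfl
  map_zero' := by
    ext f g
    simp
  map_add' X Y := by
    ext f g
    simp only [Matrix.of_apply, Matrix.add_apply]
    split_ifs <;> simp
  map_mul' X Y := by
    ext f g
    rw [Matrix.mul_apply, Matrix.of_apply]
    have e : ∀ x y : Fin N, ∀ c, c ≠ a → c ≠ b →
        Function.update (Function.update f a x) b y c = f c := fun x y c h1 h2 => by
      rw [Function.update_of_ne h2, Function.update_of_ne h1]
    have hsum : ∀ F : (Fin m → Fin N) → A,
        (∀ g, (¬ ∀ c, c ≠ a → c ≠ b → f c = g c) → F g = 0) →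
        ∑ g, F g = ∑ p, ∑ q, F (Function.update (Function.update f a q) b p) := by
      classical
      intro F hF
      rw [← Finset.sum_filter_of_ne (p := fun g => ∀ c, c ≠ a → c ≠ b → f c = g c)
        (fun g _ hg => by_contra fun h => hg (hF g h)), ← Finset.sum_product']
      have e3 : ∀ g : Fin m → Fin N, (∀ c, c ≠ a → c ≠ b → f c = g c) →
          Function.update (Function.update f a (g a)) b (g b) = g := by
        intro g hg
        funext c
        by_cases hc' : c = b
        · subst hc'; simp
        · by_cases hc : c = a
          · subst hc; rw [Function.update_of_ne hc', Function.update_self]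
          · rw [e _ _ c hc hc', hg c hc hc']
      refine Finset.sum_bij' (fun g _ => (g b, g a))
        (fun x _ => Function.update (Function.update f a x.2) b x.1) ?_ ?_ ?_ ?_ ?_
      · simp
      · intro x _
        simp only [Finset.mem_filter, Finset.mem_univ, true_and]
        exact fun c h1 h2 => (e _ _ c h1 h2).symm
      · intro g hg
        simp only [Finset.mem_filter, Finset.mem_univ, true_and] at hg
        exact e3 g hg
      · intro x _
        simp [Function.update_of_ne hab]
      · intro g hg
        simp only [Finset.mem_filter, Finset.mem_univ, true_and] at hg
        rw [e3 g hg]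
    rw [hsum]
    · simp only [Matrix.of_apply]
      split_ifs with h
      · rw [twoMat_mul_apply]
        refine Finset.sum_congr rfl fun p _ => Finset.sum_congr rfl fun q _ => ?_
        rw [if_pos fun c h1 h2 => (e q p c h1 h2).symm,
          if_pos fun c h1 h2 => (e q p c h1 h2).trans (h c h1 h2)]
        simp [Function.update_of_ne hab]
      · refine (Finset.sum_eq_zero fun p _ => Finset.sum_eq_zero fun q _ => ?_).symm
        have h1 : ¬ ∀ c, c ≠ a → c ≠ b →
            Function.update (Function.update f a q) b p c = g c := fun h' =>
          h fun c h1 h2 => by rw [← h' c h1 h2, e _ _ c h1 h2]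
        rw [if_neg h1, mul_zero]
    · intro g' hg'
      rw [Matrix.of_apply, if_neg hg', zero_mul]

theorem twoSlot_apply {a b : Fin m} (hab : a ≠ b) (Z : TwoMat N A) (f g : Fin m → Fin N) :
    twoSlot hab Z f g =
      if ∀ c, c ≠ a → c ≠ b → f c = g c then Z (f b) (g b) (f a) (g a) else 0 := rfl

theorem twoSlot_leg0 {a b : Fin m} (hab : a ≠ b) (X : Matrix (Fin N) (Fin N) A) :
    twoSlot hab (leg0 N A X) = slot a X := by
  ext f g
  rw [twoSlot_apply, slot_apply, leg0_apply]
  by_cases h : ∀ c, c ≠ a → f c = g c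
  · rw [if_pos h, if_pos fun c h1 _ => h c h1, if_pos (h b hab.symm)]
  · rw [if_neg h]
    split_ifs with h1 h2
    · exact absurd (fun c hc => if hcb : c = b then hcb ▸ h2 else h1 c hc hcb) h
    · rfl
    · rfl

theorem twoSlot_leg1 {a b : Fin m} (hab : a ≠ b) (X : Matrix (Fin N) (Fin N) A) :
    twoSlot hab (leg1 N A X) = slot b X := by
  ext f g
  rw [twoSlot_apply, slot_apply, leg1_apply]
  by_cases h : ∀ c, c ≠ b → f c = g c
  · rw [if_pos h, if_pos fun c _ h1 => h c h1, if_pos (h a hab)]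
  · rw [if_neg h]
    split_ifs with h1 h2
    · exact absurd (fun c hc => if hca : c = a then hca ▸ h2 else h1 c hca hc) h
    · rfl
    · rfl

theorem twoSlot_flip [Algebra ℂ A] {a b : Fin m} (hab : a ≠ b) :
    twoSlot hab (flip N A) = permMat m N A (Equiv.swap a b) := by
  ext f g
  rw [twoSlot_apply, permMat_apply, flip_apply]
  have e : f ∘ Equiv.swap a b = g ↔
      (∀ c, c ≠ a → c ≠ b → f c = g c) ∧ (g b = f a ∧ f b = g a) := by
    constructor
    · rintro rfl
      refine ⟨fun c h1 h2 => ?_, ?_, ?_⟩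
      · simp [Equiv.swap_apply_of_ne_of_ne h1 h2]
      · simp
      · simp
    · rintro ⟨h1, h2, h3⟩
      funext c
      by_cases hc : c = a
      · subst hc; simp [h3]
      · by_cases hc' : c = b
        · subst hc'; simp [h2]
        · simp [Equiv.swap_apply_of_ne_of_ne hc hc', h1 c hc hc']
  by_cases h1 : ∀ c, c ≠ a → c ≠ b → f c = g c
  · rw [if_pos h1]
    by_cases h2 : g b = f a ∧ f b = g a
    · rw [if_pos h2, if_pos (e.2 ⟨h1, h2⟩)]
    · rw [if_neg h2, if_neg fun h => h2 (e.1 h).2]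
  · rw [if_neg h1, if_neg fun h => h1 (e.1 h).1]

end Slots

/-! ### Covariance of ordered products -/

section Covariance

variable {m N : ℕ} {R : Type*} [Ring R] [Algebra ℂ R] {j : TensorMat m N ℂ →ₐ[ℂ] R}

/-- The compatibility of a family `F_a(k)` with the permutations of the tensor factors. -/
structure IsSlotFamily (j : TensorMat m N ℂ →ₐ[ℂ] R) (F : Fin m → ℤ → R) : Prop where
  of_ne : ∀ (i : ℕ) (hi : i + 1 < m) (a : Fin m) (k : ℤ), (a : ℕ) ≠ i → (a : ℕ) ≠ i + 1 →
    j (adj (permAction m N) i hi) * F a k = F a k * j (adj (permAction m N) i hi)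
  left : ∀ (i : ℕ) (hi : i + 1 < m) (k : ℤ),
    j (adj (permAction m N) i hi) * F ⟨i, by omega⟩ k =
      F ⟨i + 1, hi⟩ k * j (adj (permAction m N) i hi)

theorem adj_map_sq (i : ℕ) (hi : i + 1 < m) :
    j (adj (permAction m N) i hi) * j (adj (permAction m N) i hi) = 1 := by
  rw [← map_mul, adj_mul_adj, map_one]

theorem IsSlotFamily.right {F : Fin m → ℤ → R} (hF : IsSlotFamily j F) (i : ℕ) (hi : i + 1 < m)
    (k : ℤ) : j (adj (permAction m N) i hi) * F ⟨i + 1, hi⟩ k =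
      F ⟨i, by omega⟩ k * j (adj (permAction m N) i hi) := by
  have h := hF.left i hi k
  have hs := adj_map_sq (j := j) i hi
  set s := j (adj (permAction m N) i hi)
  calc s * F ⟨i + 1, hi⟩ k = s * (F ⟨i + 1, hi⟩ k * s) * s := by
        rw [mul_assoc, mul_assoc, hs, mul_one]
    _ = F ⟨i, by omega⟩ k * s := by rw [← h, ← mul_assoc, hs, one_mul]

/-- Ordered products of a family satisfying the two-factor relation
`(d - s) F_i(k) F_{i+1}(l) = F_{i+1}(l) F_i(k) (d - s)`, `d = k - l`, are covariant. -/
theorem isCovariant_prod {F : Fin m → ℤ → R} (hF : IsSlotFamily j F)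
    (h : ∀ (i : ℕ) (hi : i + 1 < m) (k l : ℤ),
      (k - l) • (F ⟨i, by omega⟩ k * F ⟨i + 1, hi⟩ l - F ⟨i + 1, hi⟩ l * F ⟨i, by omega⟩ k) =
        j (adj (permAction m N) i hi) * (F ⟨i, by omega⟩ k * F ⟨i + 1, hi⟩ l) -
          F ⟨i + 1, hi⟩ l * F ⟨i, by omega⟩ k * j (adj (permAction m N) i hi)) :
    IsCovariant j fun κ => (List.ofFn fun a => F a (κ a)).prod := by
  intro i hi κ
  obtain ⟨pre, post, hl, hpre, hpost⟩ := finRange_eq_append i hi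
  have hL : ∀ L : List (Fin m), (∀ a ∈ L, (a : ℕ) ≠ i ∧ (a : ℕ) ≠ i + 1) →
      (L.map fun a => F a (swapAt i hi κ a)).prod = (L.map fun a => F a (κ a)).prod ∧
      Commute (j (adj (permAction m N) i hi)) (L.map fun a => F a (κ a)).prod := by
    intro L hL
    constructor
    · congr 1
      exact List.map_congr_left fun a ha => by rw [swapAt_of_ne i hi κ (hL a ha).1 (hL a ha).2]
    · refine commute_list_prod fun y hy => ?_
      obtain ⟨b, hb, rfl⟩ := List.mem_map.1 hy
      exact hF.of_ne i hi b _ (hL b hb).1 (hL b hb).2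
  simp only [List.ofFn_eq_map, hl, List.map_append, List.map_cons, List.prod_append,
    List.prod_cons, (hL pre hpre).1, (hL post hpost).1, swapAt_left, swapAt_right]
  have c1 := (hL pre hpre).2
  have c2 := (hL post hpost).2
  set p := (pre.map fun a => F a (κ a)).prod
  set q := (post.map fun a => F a (κ a)).prod
  have h1 := h i hi (κ ⟨i, by omega⟩) (κ ⟨i + 1, hi⟩)
  have hs := adj_map_sq (j := j) i hi
  have h2 := hF.left i hi (κ ⟨i + 1, hi⟩)
  have h3 := hF.right i hi (κ ⟨i, by omega⟩)
  have h4 := hF.right i hi (κ ⟨i + 1, hi⟩)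
  have h5 := hF.left i hi (κ ⟨i, by omega⟩)
  set s := j (adj (permAction m N) i hi)
  set x := F ⟨i, by omega⟩ (κ ⟨i, by omega⟩)
  set y := F ⟨i + 1, hi⟩ (κ ⟨i + 1, hi⟩)
  set x' := F ⟨i, by omega⟩ (κ ⟨i + 1, hi⟩)
  set y' := F ⟨i + 1, hi⟩ (κ ⟨i, by omega⟩)
  -- conjugation by `s` turns `y x` into `x' y'`
  have e1 : s * (y * x) = x' * y' * s := by rw [← mul_assoc, h4, mul_assoc, h5, mul_assoc]
  have key := congrArg (s * ·) h1
  simp only [mul_smul_comm, mul_sub] at key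
  rw [e1, ← mul_assoc s s, hs, one_mul, ← mul_assoc s (y * x), e1, mul_assoc (x' * y'), hs,
    mul_one] at key
  calc (κ ⟨i, by omega⟩ - κ ⟨i + 1, hi⟩) •
        (s * (p * (x * (y * q))) - p * (x' * (y' * q)) * s)
      = p * ((κ ⟨i, by omega⟩ - κ ⟨i + 1, hi⟩) • (s * (x * y) - x' * y' * s)) * q := by
        rw [mul_smul_comm, smul_mul_assoc, ← mul_assoc s p, c1.eq]
        congr 1
        rw [mul_sub, sub_mul]
        congr 1
        · simp only [mul_assoc]
        · rw [mul_assoc, mul_assoc x', mul_assoc y' q s, ← c2.eq]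
          simp only [mul_assoc]
    _ = _ := by rw [key]; noncomm_ring

/-- The variant of `isCovariant_prod` for the product in the opposite order. -/
theorem isCovariant_reverse_prod {F : Fin m → ℤ → R} (hF : IsSlotFamily j F)
    (h : ∀ (i : ℕ) (hi : i + 1 < m) (k l : ℤ),
      (k - l) • (F ⟨i + 1, hi⟩ l * F ⟨i, by omega⟩ k - F ⟨i, by omega⟩ k * F ⟨i + 1, hi⟩ l) =
        j (adj (permAction m N) i hi) * (F ⟨i + 1, hi⟩ l * F ⟨i, by omega⟩ k) -
          F ⟨i, by omega⟩ k * F ⟨i + 1, hi⟩ l * j (adj (permAction m N) i hi)) :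
    IsCovariant j fun κ => (List.ofFn fun a => F a (κ a)).reverse.prod := by
  intro i hi κ
  obtain ⟨pre, post, hl, hpre, hpost⟩ := finRange_eq_append i hi
  have hL : ∀ L : List (Fin m), (∀ a ∈ L, (a : ℕ) ≠ i ∧ (a : ℕ) ≠ i + 1) →
      (L.map fun a => F a (swapAt i hi κ a)).reverse.prod =
        (L.map fun a => F a (κ a)).reverse.prod ∧
      Commute (j (adj (permAction m N) i hi)) (L.map fun a => F a (κ a)).reverse.prod := by
    intro L hL
    constructor
    · congr 2
      exact List.map_congr_left fun a ha => by rw [swapAt_of_ne i hi κ (hL a ha).1 (hL a ha).2]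
    · refine commute_list_prod fun y hy => ?_
      obtain ⟨b, hb, rfl⟩ := List.mem_map.1 (List.mem_reverse.1 hy)
      exact hF.of_ne i hi b _ (hL b hb).1 (hL b hb).2
  simp only [List.ofFn_eq_map, hl, List.map_append, List.map_cons, List.reverse_append,
    List.reverse_cons, List.append_assoc, List.prod_append, List.prod_cons, List.prod_nil, mul_one,
    (hL pre hpre).1, (hL post hpost).1, swapAt_left, swapAt_right]
  have c1 := (hL pre hpre).2
  have c2 := (hL post hpost).2
  set p := (pre.map fun a => F a (κ a)).reverse.prod
  set q := (post.map fun a => F a (κ a)).reverse.prod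
  have h1 := h i hi (κ ⟨i, by omega⟩) (κ ⟨i + 1, hi⟩)
  have hs := adj_map_sq (j := j) i hi
  have h4 := hF.right i hi (κ ⟨i + 1, hi⟩)
  have h5 := hF.left i hi (κ ⟨i, by omega⟩)
  set s := j (adj (permAction m N) i hi)
  set x := F ⟨i, by omega⟩ (κ ⟨i, by omega⟩)
  set y := F ⟨i + 1, hi⟩ (κ ⟨i + 1, hi⟩)
  set x' := F ⟨i, by omega⟩ (κ ⟨i + 1, hi⟩)
  set y' := F ⟨i + 1, hi⟩ (κ ⟨i, by omega⟩)
  have e1 : s * (x * y) = y' * x' * s := by rw [← mul_assoc, h5, mul_assoc, h4, mul_assoc]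
  have key := congrArg (s * ·) h1
  simp only [mul_smul_comm, mul_sub] at key
  rw [e1, ← mul_assoc s s, hs, one_mul, ← mul_assoc s (x * y), e1, mul_assoc (y' * x'), hs,
    mul_one] at key
  calc (κ ⟨i, by omega⟩ - κ ⟨i + 1, hi⟩) •
        (s * (q * (y * (x * p))) - q * (y' * (x' * p)) * s)
      = q * ((κ ⟨i, by omega⟩ - κ ⟨i + 1, hi⟩) • (s * (y * x) - y' * x' * s)) * p := by
        rw [mul_smul_comm, smul_mul_assoc, ← mul_assoc s q, c2.eq]
        congr 1
        rw [mul_sub, sub_mul]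
        congr 1
        · simp only [mul_assoc]
        · rw [mul_assoc, mul_assoc y', mul_assoc x' p s, ← c1.eq]
          simp only [mul_assoc]
    _ = _ := by rw [key]; noncomm_ring

/-- The two-factor relation for `X, Y` gives the one for their inverses in the opposite order. -/
theorem inverse_relation {S : Type*} [Ring S] {s X Y X' Y' : S} {d : ℤ}
    (hX : X * X' = 1) (hX' : X' * X = 1) (hY : Y * Y' = 1) (hY' : Y' * Y = 1)
    (h : d • (X * Y - Y * X) = s * (X * Y) - Y * X * s) :
    d • (Y' * X' - X' * Y') = s * (Y' * X') - X' * Y' * s := by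
  have h1 := congrArg (fun z => (X' * Y') * z * (Y' * X')) h
  have e1 : X * Y * (Y' * X') = 1 := by rw [mul_assoc, ← mul_assoc Y, hY, one_mul, hX]
  have e2 : X' * Y' * (Y * X) = 1 := by rw [mul_assoc, ← mul_assoc Y', hY', one_mul, hX']
  simp only [mul_smul_comm, smul_mul_assoc] at h1
  have l : X' * Y' * (X * Y - Y * X) * (Y' * X') = X' * Y' - Y' * X' := by
    calc _ = X' * Y' * (X * Y * (Y' * X')) - (X' * Y' * (Y * X)) * (Y' * X') := by noncomm_ring
      _ = _ := by rw [e1, e2, mul_one, one_mul]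
  have r : X' * Y' * (s * (X * Y) - Y * X * s) * (Y' * X') =
      X' * Y' * s - s * (Y' * X') := by
    calc _ = X' * Y' * s * (X * Y * (Y' * X')) - (X' * Y' * (Y * X)) * s * (Y' * X') := by
          noncomm_ring
      _ = _ := by rw [e1, e2, mul_one, one_mul]
  rw [l, r] at h1
  rw [← neg_inj, ← smul_neg, neg_sub, h1, neg_sub]

end Covariance

/-! ### Partial transposition and the trace -/

section Trace

variable {m N : ℕ} {Q : Type*} [Ring Q]

theorem slot_list_prod_apply (X : Fin m → Matrix (Fin N) (Fin N) Q) (L : List (Fin m))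
    (hL : L.Nodup) : ∀ f g : Fin m → Fin N, (L.map fun a => slot a (X a)).prod f g =
      if ∀ c, c ∉ L → f c = g c then (L.map fun a => X a (f a) (g a)).prod else 0 := by
  induction L with
  | nil =>
    intro f g
    simp only [List.map_nil, List.prod_nil, Matrix.one_apply, List.not_mem_nil, not_false_eq_true,
      true_imp_iff, funext_iff]
  | cons a L ih =>
    intro f g
    obtain ⟨haL, hL'⟩ := List.nodup_cons.1 hL
    rw [List.map_cons, List.prod_cons, slot_mul_apply]
    have e : ∀ x, (L.map fun b => X b (Function.update f a x b) (g b)) =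
        L.map fun b => X b (f b) (g b) := fun x => List.map_congr_left fun b hb => by
      rw [Function.update_of_ne (fun h => haL (by rw [← h]; exact hb))]
    simp only [ih hL', e]
    by_cases h : ∀ c, c ∉ a :: L → f c = g c
    · rw [if_pos h, Finset.sum_eq_single (g a), if_pos, List.map_cons, List.prod_cons]
      · intro c hc
        by_cases hca : c = a
        · subst hca; simp
        · rw [Function.update_of_ne hca, h c (by simp [hca, hc])]
      · intro x _ hx
        rw [if_neg, mul_zero]
        intro h'
        exact hx (by simpa using h' a haL)
      · simp
    · rw [if_neg h]
      refine Finset.sum_eq_zero fun x _ => ?_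
      rw [if_neg, mul_zero]
      intro h'
      refine h fun c hc => ?_
      rw [List.mem_cons, not_or] at hc
      rw [← h' c hc.2, Function.update_of_ne hc.1]

/-- Operators in distinct tensor factors may be transposed factor by factor, even if their entries
do not commute. -/
theorem transpose_slot_list_prod (X : Fin m → Matrix (Fin N) (Fin N) Q) {L : List (Fin m)}
    (hL : L.Nodup) : (L.map fun a => slot a (X a)).prod.transpose =
      (L.map fun a => slot a (X a).transpose).prod := by
  ext f g
  rw [Matrix.transpose_apply, slot_list_prod_apply X L hL,
    slot_list_prod_apply (fun a => (X a).transpose) L hL]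
  simp only [Matrix.transpose_apply, eq_comm]

theorem list_prod_mul_reverse_prod {ι R : Type*} [Monoid R] (x z c : ι → R)
    (h : ∀ a, x a * z a = c a) (hc : ∀ a y, Commute (c a) y) (L : List ι) :
    (L.map x).prod * (L.map z).reverse.prod = (L.map c).prod := by
  induction L with
  | nil => simp
  | cons a L ih =>
    rw [List.map_cons, List.map_cons, List.map_cons, List.reverse_cons, List.prod_append]
    simp only [List.prod_cons, List.prod_nil, mul_one]
    have hcom : ∀ y, Commute (L.map c).prod y := fun y =>
      (commute_list_prod fun w hw => by
        obtain ⟨b, -, rfl⟩ := List.mem_map.1 hw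
        exact (hc b y).symm).symm
    calc x a * (L.map x).prod * ((L.map z).reverse.prod * z a)
        = x a * ((L.map x).prod * (L.map z).reverse.prod) * z a := by simp only [mul_assoc]
      _ = _ := by rw [ih, mul_assoc, (hcom _).eq, ← mul_assoc, h]

theorem transpose_mul_of_commute {n : Type*} [Fintype n] {X Y : Matrix n n Q}
    (h : ∀ i j k l, Commute (X i j) (Y k l)) :
    (X * Y).transpose = Y.transpose * X.transpose := by
  ext i j
  simp only [Matrix.transpose_apply, Matrix.mul_apply]
  exact Finset.sum_congr rfl fun k _ => (h _ _ _ _).eq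

theorem trace_mul_mul_transpose {n : Type*} [Fintype n] {X W B : Matrix n n Q}
    (hX : ∀ i j k l, Commute (W i j) (X k l)) :
    Matrix.trace (X * W * B) = Matrix.trace (W * (X.transpose * B.transpose).transpose) := by
  simp only [Matrix.trace, Matrix.diag_apply, Matrix.mul_apply, Matrix.transpose_apply,
    Finset.sum_mul, Finset.mul_sum]
  have : ∀ i j k, X i k * W k j * B j i = W k j * (X i k * B j i) := fun i j k => by
    rw [← (hX _ _ _ _).eq, mul_assoc]
  simp only [this]
  rw [Finset.sum_comm]
  refine (Finset.sum_congr rfl fun j _ => Finset.sum_comm).trans ?_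
  rw [Finset.sum_comm]

/-- If the partial transposes of `A` and `B` multiply to a scalar `c`, then a projection `E` with
scalar entries which absorbs `A`, `B` and `W` satisfies `tr E A W B = c tr E W`, although the
entries of `A` and of `B` do not commute with each other. -/
theorem trace_projection_mul {n : Type*} [Fintype n] [DecidableEq n] {E A W B : Matrix n n Q}
    {c : Q} (hEc : ∀ i j x, Commute (E i j) x) (hA : E * A = E * A * E)
    (hB : E * B = E * B * E) (hW : E * W = E * W * E)
    (hWA : ∀ i j k l, Commute (W i j) (A k l))
    (hc : ∀ x, Commute c x) (hAB : A.transpose * B.transpose = Matrix.scalar n c) :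
    Matrix.trace (E * A * W * B) = c * Matrix.trace (E * W) := by
  set W' := E * W with hW'
  have hWE : W' * E = W' := hW.symm
  have hcom : ∀ i j k l, Commute (W' i j) ((E * A) k l) := by
    intro i j k l
    rw [hW', Matrix.mul_apply, Matrix.mul_apply]
    exact Commute.sum_left _ _ _ fun p _ => Commute.sum_right _ _ _ fun q _ =>
      ((hEc i p _).mul_left ((hEc k q _).symm.mul_right (hWA _ _ _ _)))
  have hEt : ∀ X : Matrix n n Q, (E * X).transpose = X.transpose * E.transpose := fun X =>
    transpose_mul_of_commute fun i j k l => hEc i j _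
  have hEt' : ∀ X : Matrix n n Q, (X * E).transpose = E.transpose * X.transpose := fun X =>
    transpose_mul_of_commute fun i j k l => (hEc k l _).symm
  have e1 : E * A * W * B = (E * A) * W' * B := by
    calc E * A * W * B = E * A * E * W * B := by rw [← hA]
      _ = _ := by rw [mul_assoc (E * A) E W]
  have e2 : (E * A).transpose * B.transpose = A.transpose * (B * E).transpose := by
    rw [hEt, hEt', mul_assoc]
  have e3 : (W' * (A.transpose * (B * E).transpose).transpose) =
      W' * (A.transpose * (E * B * E).transpose).transpose := by
    have : (A.transpose * (E * B * E).transpose).transpose =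
        E * (A.transpose * (B * E).transpose).transpose := by
      have h : (E * (A.transpose * (B * E).transpose).transpose) =
          ((A.transpose * (B * E).transpose) * E.transpose).transpose := by
        have h' := transpose_mul_of_commute (X := A.transpose * (B * E).transpose)
          (Y := E.transpose) (fun i j k l => (hEc l k _).symm)
        rw [h', Matrix.transpose_transpose]
      rw [h, mul_assoc A.transpose, mul_assoc, hEt]
    rw [this, ← mul_assoc, hWE]
  rw [e1, trace_mul_mul_transpose hcom, e2, e3, ← hB, hEt, ← mul_assoc, hAB]
  have e4 : (Matrix.scalar n c * E.transpose).transpose = Matrix.scalar n c * E := by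
    ext i j
    simp only [Matrix.transpose_apply, Matrix.scalar_apply, Matrix.diagonal_mul]
  rw [e4]
  have e5 : W' * (Matrix.scalar n c * E) = Matrix.scalar n c * (W' * E) := by
    rw [← mul_assoc, ← mul_assoc]
    congr 1
    ext i j
    simp only [Matrix.scalar_apply, Matrix.diagonal_mul, Matrix.mul_diagonal]
    exact (hc _).symm.eq
  rw [e5, hWE]
  simp only [Matrix.trace, Matrix.diag_apply, Matrix.scalar_apply, Matrix.diagonal_mul,
    Finset.mul_sum]

end Trace

noncomputable section

open Filter Topology

/-! ### Topological algebras with convergent pairings -/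

/-- The topological properties of a `ℂ[[h]]`-algebra which are needed to manipulate the infinite
sums: the sums `∑ xₙ yₙ` with `yₙ → 0` converge (whatever the `xₙ`, as the topology is defined by
left ideals), and `hⁿ xₙ → 0` for each sequence `xₙ`. -/
class PairingAlgebra (A : Type*) [Ring A] [Algebra Base A] [TopologicalSpace A] : Prop extends
    IsTopologicalRing A, T2Space A where
  summable_mul : ∀ x y : ℕ → A, Tendsto y atTop (𝓝 0) → Summable fun n => x n * y n
  tendsto_hbar : ∀ x : ℕ → A, Tendsto (fun n => hbar ^ n • x n) atTop (𝓝 0)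

section Matrices

variable {A : Type*} [Ring A] [Algebra Base A] [TopologicalSpace A] [PairingAlgebra A]

theorem tendsto_matrix_iff {n : Type*} {ι : Type*} {l : Filter ι} {f : ι → Matrix n n A}
    {M : Matrix n n A} :
    Tendsto f l (𝓝 M) ↔ ∀ i j, Tendsto (fun k => f k i j) l (𝓝 (M i j)) := by
  rw [show Tendsto f l (𝓝 M) ↔ _ from tendsto_pi_nhds]
  exact forall_congr' fun i => tendsto_pi_nhds

theorem summable_matrix_iff {n : Type*} {ι : Type*} {f : ι → Matrix n n A} :
    Summable f ↔ ∀ i j, Summable fun k => f k i j := by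
  rw [show Summable f ↔ _ from Pi.summable]
  exact forall_congr' fun i => Pi.summable

instance {n : Type*} [Fintype n] [DecidableEq n] : PairingAlgebra (Matrix n n A) where
  summable_mul x y hy := summable_matrix_iff.2 fun i j => by
    simp only [Matrix.mul_apply]
    exact summable_sum fun k _ => PairingAlgebra.summable_mul _ _ (tendsto_matrix_iff.1 hy k j)
  tendsto_hbar x := tendsto_matrix_iff.2 fun i j =>
    PairingAlgebra.tendsto_hbar fun n => x n i j

end Matrices

section Series

open scoped PowerSeries.WithPiTopology

variable {A : Type*} [Ring A] [Algebra Base A] [TopologicalSpace A] [PairingAlgebra A]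

theorem coeff_base_smul {B : Type*} [Ring B] [Algebra Base B] (a : Base) (f : PowerSeries B)
    (n : ℕ) : PowerSeries.coeff n (a • f) = a • PowerSeries.coeff n f := rfl

theorem algebraMap_series {B : Type*} [Ring B] [Algebra Base B] (a : Base) :
    algebraMap Base (PowerSeries B) a = PowerSeries.C (algebraMap Base B a) :=
  PowerSeries.algebraMap_apply

theorem tendsto_series_iff {ι : Type*} {l : Filter ι} {f : ι → PowerSeries A} {g : PowerSeries A} :
    Tendsto f l (𝓝 g) ↔
      ∀ d, Tendsto (fun k => PowerSeries.coeff d (f k)) l (𝓝 (PowerSeries.coeff d g)) :=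
  PowerSeries.WithPiTopology.tendsto_iff_coeff_tendsto A f l g

instance : PairingAlgebra (PowerSeries A) where
  toIsTopologicalRing := PowerSeries.WithPiTopology.instIsTopologicalRing A
  toT2Space := PowerSeries.WithPiTopology.instT2Space A
  summable_mul x y hy := (PowerSeries.WithPiTopology.summable_iff_summable_coeff A).2 fun d => by
    simp only [PowerSeries.coeff_mul]
    refine summable_sum fun k _ => PairingAlgebra.summable_mul _ _ ?_
    simpa using tendsto_series_iff.1 hy k.2
  tendsto_hbar x := tendsto_series_iff.2 fun d => by
    simpa only [coeff_base_smul, map_zero] using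
      PairingAlgebra.tendsto_hbar fun n => PowerSeries.coeff d (x n)

end Series

/-! ### An auxiliary parameter replacing `h` -/

/-- The algebra `B ⊕ B η` with a central element `η` such that `η² = h η`. The elements
`1 + η x` with `x ∈ B` satisfy the same commutation relations as the elements `1 + h x`, but the
coefficient of `η` is not affected by a possible `h`-torsion in `B`. -/
def Lift (B : Type*) : Type _ := B × B

namespace Lift

variable {B : Type*} [Ring B] [Algebra Base B]

instance : AddCommGroup (Lift B) := inferInstanceAs (AddCommGroup (B × B))

instance : Module Base (Lift B) := inferInstanceAs (Module Base (B × B))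

instance : Mul (Lift B) := ⟨fun x y => (x.1 * y.1, x.1 * y.2 + x.2 * y.1 + hbar • (x.2 * y.2))⟩

instance : One (Lift B) := ⟨((1 : B), (0 : B))⟩

theorem ext {x y : Lift B} (h1 : x.1 = y.1) (h2 : x.2 = y.2) : x = y := Prod.ext h1 h2

theorem fst_mul (x y : Lift B) : (x * y).1 = x.1 * y.1 := rfl

theorem snd_mul (x y : Lift B) :
    (x * y).2 = x.1 * y.2 + x.2 * y.1 + hbar • (x.2 * y.2) := rfl

theorem fst_one : (1 : Lift B).1 = 1 := rfl

theorem snd_one : (1 : Lift B).2 = 0 := rfl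

theorem fst_add (x y : Lift B) : (x + y).1 = x.1 + y.1 := rfl

theorem snd_add (x y : Lift B) : (x + y).2 = x.2 + y.2 := rfl

theorem fst_zero : (0 : Lift B).1 = 0 := rfl

theorem snd_zero : (0 : Lift B).2 = 0 := rfl

theorem fst_smul (a : Base) (x : Lift B) : (a • x).1 = a • x.1 := rfl

theorem snd_smul (a : Base) (x : Lift B) : (a • x).2 = a • x.2 := rfl

instance : Ring (Lift B) :=
  { (inferInstance : AddCommGroup (Lift B)), (inferInstance : Mul (Lift B)),
    (inferInstance : One (Lift B)) with
    left_distrib := fun x y z => ext (by simp only [fst_mul, fst_add, mul_add])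
      (by simp only [snd_mul, fst_add, snd_add, mul_add, smul_add]; abel)
    right_distrib := fun x y z => ext (by simp only [fst_mul, fst_add, add_mul])
      (by simp only [snd_mul, fst_add, snd_add, add_mul, smul_add]; abel)
    zero_mul := fun x => ext (by simp only [fst_mul, fst_zero, zero_mul])
      (by simp only [snd_mul, fst_zero, snd_zero, zero_mul, smul_zero, add_zero])
    mul_zero := fun x => ext (by simp only [fst_mul, fst_zero, mul_zero])
      (by simp only [snd_mul, fst_zero, snd_zero, mul_zero, smul_zero, add_zero])
    mul_assoc := fun x y z => ext (by simp only [fst_mul, mul_assoc])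
      (by
        simp only [snd_mul, fst_mul, mul_add, add_mul, smul_add, mul_assoc, smul_mul_assoc,
          mul_smul_comm]
        abel)
    one_mul := fun x => ext (by simp only [fst_mul, fst_one, one_mul])
      (by simp only [snd_mul, fst_one, snd_one, zero_mul, one_mul, smul_zero, add_zero])
    mul_one := fun x => ext (by simp only [fst_mul, fst_one, mul_one])
      (by simp only [snd_mul, fst_one, snd_one, mul_zero, mul_one, zero_add, smul_zero,
        add_zero]) }

instance : Algebra Base (Lift B) :=
  Algebra.ofModule
    (fun r x y => ext (by simp only [fst_mul, fst_smul, smul_mul_assoc])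
      (by simp only [snd_mul, fst_smul, snd_smul, smul_mul_assoc, smul_add, smul_comm r hbar]))
    (fun r x y => ext (by simp only [fst_mul, fst_smul, mul_smul_comm])
      (by simp only [snd_mul, fst_smul, snd_smul, mul_smul_comm, smul_add, smul_comm r hbar]))

/-- The embedding of `B`. -/
def incl (B : Type*) [Ring B] [Algebra Base B] : B →ₐ[Base] Lift B :=
  AlgHom.ofLinearMap (LinearMap.inl Base B B) rfl
    (fun x y => ext rfl (by
      change (0 : B) = x * 0 + 0 * y + hbar • (0 * 0 : B)
      simp))

theorem fst_incl (b : B) : (incl B b).1 = b := rfl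

theorem snd_incl (b : B) : (incl B b).2 = 0 := rfl

/-- The central element `η`. -/
def eta (B : Type*) [Ring B] : Lift B := ((0 : B), (1 : B))

theorem eta_mul (x : Lift B) : eta B * x = ((0 : B), x.1 + hbar • x.2) := by
  refine ext ?_ ?_
  · rw [fst_mul]; exact zero_mul _
  · rw [snd_mul]; change (0 : B) * x.2 + 1 * x.1 + hbar • (1 * x.2) = _; simp

theorem mul_eta (x : Lift B) : x * eta B = ((0 : B), x.1 + hbar • x.2) := by
  refine ext ?_ ?_
  · rw [fst_mul]; exact mul_zero _
  · rw [snd_mul]; change x.1 * 1 + x.2 * 0 + hbar • (x.2 * 1) = _; simp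

theorem commute_eta (x : Lift B) : Commute (eta B) x := by
  rw [Commute, SemiconjBy, eta_mul, mul_eta]

theorem eta_mul_eta : eta B * eta B = hbar • eta B := by
  rw [eta_mul]
  refine ext ?_ ?_
  · rw [fst_smul]; exact (smul_zero _).symm
  · rw [snd_smul]; change (0 : B) + _ = _; rw [zero_add]

/-- If `1 + η t` commutes with an element of `B`, then so does `t`. -/
theorem commute_of_commute_eta {t b : B}
    (h : Commute (eta B * incl B t) (incl B b)) : Commute t b := by
  have h1 := congrArg Prod.snd h.eq
  rw [eta_mul, fst_incl, snd_incl, smul_zero, add_zero] at h1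
  erw [snd_mul, snd_mul] at h1
  rw [Commute, SemiconjBy]
  simpa [fst_incl, snd_incl] using h1

variable [TopologicalSpace B]

instance : TopologicalSpace (Lift B) := inferInstanceAs (TopologicalSpace (B × B))

theorem continuous_incl : Continuous (incl B) :=
  (continuous_id.prodMk continuous_const : Continuous fun b : B => (b, (0 : B)))

theorem tendsto_iff {ι : Type*} {l : Filter ι} {f : ι → Lift B} {x : Lift B} :
    Tendsto f l (𝓝 x) ↔
      Tendsto (fun k => (f k).1) l (𝓝 x.1) ∧ Tendsto (fun k => (f k).2) l (𝓝 x.2) :=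
  ⟨fun h => ⟨(continuous_fst.tendsto x).comp h, (continuous_snd.tendsto x).comp h⟩,
    fun h => h.1.prodMk_nhds h.2⟩

end Lift

theorem continuous_base_smul {B : Type*} [Ring B] [Algebra Base B] [TopologicalSpace B]
    [PairingAlgebra B] (a : Base) : Continuous fun b : B => a • b := by
  simp only [Algebra.smul_def]
  exact continuous_const.mul continuous_id

instance {B : Type*} [Ring B] [Algebra Base B] [TopologicalSpace B] [PairingAlgebra B] :
    PairingAlgebra (Lift B) where
  continuous_add := (continuous_add : Continuous fun p : (B × B) × (B × B) => p.1 + p.2)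
  continuous_neg := (continuous_neg : Continuous fun p : B × B => -p)
  continuous_mul := by
    have h : Continuous fun p : (B × B) × (B × B) => (p.1.1 * p.2.1,
        p.1.1 * p.2.2 + p.1.2 * p.2.1 + hbar • (p.1.2 * p.2.2)) := by
      refine Continuous.prodMk (by fun_prop) (Continuous.add (by fun_prop) ?_)
      exact (continuous_base_smul hbar).comp (by fun_prop)
    exact h
  toT2Space := inferInstanceAs (T2Space (B × B))
  summable_mul x y hy := by
    obtain ⟨h1, h2⟩ := Lift.tendsto_iff.1 hy
    have s1 : Summable fun n => (x n).1 * (y n).1 := PairingAlgebra.summable_mul _ _ h1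
    have s2 : Summable fun n => (x n).1 * (y n).2 + (x n).2 * (y n).1 +
        hbar • ((x n).2 * (y n).2) := by
      refine ((PairingAlgebra.summable_mul _ _ h2).add (PairingAlgebra.summable_mul _ _ h1)).add ?_
      simp only [← smul_mul_assoc]
      exact PairingAlgebra.summable_mul _ _ h2
    obtain ⟨a, ha⟩ := s1
    obtain ⟨b, hb⟩ := s2
    exact ⟨((a, b) : B × B), HasSum.prodMk ha hb⟩
  tendsto_hbar x := Lift.tendsto_iff.2
    ⟨PairingAlgebra.tendsto_hbar fun n => (x n).1, PairingAlgebra.tendsto_hbar fun n => (x n).2⟩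

end

noncomputable section

open Filter Topology

/-! ### The shifts are ring homomorphisms -/

section Substitution

variable {A A' : Type*} [Ring A] [Ring A'] (Y : PowerSeries A')

/-- The power series `Y` separates points: no nonzero series is divisible by all its powers. -/
def Separates : Prop :=
  ∀ z : PowerSeries A', (∀ n, ∃ D, z = Y ^ n * D) → z = 0

theorem exists_eq_C_add_X_mul (f : PowerSeries A) : ∃ (b : A) (f' : PowerSeries A),
    f = PowerSeries.C b + PowerSeries.X * f' := by
  refine ⟨PowerSeries.coeff 0 f, PowerSeries.mk fun n => PowerSeries.coeff (n + 1) f, ?_⟩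
  ext n
  cases n with
  | zero => simp
  | succ n => simp [PowerSeries.coeff_succ_X_mul]

/-- A substitution `X ↦ Y` is multiplicative. -/
theorem substitution_mul {Y : PowerSeries A} (hs : Separates Y)
    {S : PowerSeries A →+ PowerSeries A} (h1 : S 1 = 1)
    (hC : ∀ b f, S (PowerSeries.C b * f) = PowerSeries.C b * S f)
    (hX : ∀ f, S (PowerSeries.X * f) = Y * S f) (f g : PowerSeries A) :
    S (f * g) = S f * S g := by
  rw [← sub_eq_zero]
  refine hs _ fun n => ?_
  induction n generalizing f with
  | zero => exact ⟨_, by rw [pow_zero, one_mul]⟩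
  | succ n ih =>
    obtain ⟨b, f', rfl⟩ := exists_eq_C_add_X_mul f
    obtain ⟨D, hD⟩ := ih f'
    refine ⟨D, ?_⟩
    have e : S (PowerSeries.C b) = PowerSeries.C b := by
      simpa [h1] using hC b 1
    rw [pow_succ', mul_assoc, ← hD, add_mul, map_add, mul_assoc, hC, hX, map_add, hX, e, add_mul,
      mul_sub, mul_assoc]
    abel

/-- A substitution is determined by the series substituted for `X`. -/
theorem substitution_ext {Y : PowerSeries A} (hs : Separates Y)
    {S S' : PowerSeries A →+ PowerSeries A} (h1 : S 1 = 1) (h1' : S' 1 = 1)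
    (hC : ∀ b f, S (PowerSeries.C b * f) = PowerSeries.C b * S f)
    (hC' : ∀ b f, S' (PowerSeries.C b * f) = PowerSeries.C b * S' f)
    (hX : ∀ f, S (PowerSeries.X * f) = Y * S f) (hX' : ∀ f, S' (PowerSeries.X * f) = Y * S' f)
    (f : PowerSeries A) : S f = S' f := by
  rw [← sub_eq_zero]
  refine hs _ fun n => ?_
  induction n generalizing f with
  | zero => exact ⟨_, by rw [pow_zero, one_mul]⟩
  | succ n ih =>
    obtain ⟨b, f', rfl⟩ := exists_eq_C_add_X_mul f
    obtain ⟨D, hD⟩ := ih f'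
    refine ⟨D, ?_⟩
    have e : S (PowerSeries.C b) = PowerSeries.C b := by
      simpa [h1] using hC b 1
    have e' : S' (PowerSeries.C b) = PowerSeries.C b := by
      simpa [h1'] using hC' b 1
    rw [pow_succ', mul_assoc, ← hD, map_add, map_add, hX, hX', e, e', mul_sub]
    abel

end Substitution

section PlusShift

variable {A : Type*} [Ring A] [Algebra Base A] [TopologicalSpace A] [PairingAlgebra A] {a : A}

/-- An element `a` by which power series in `u` may be shifted: it is central and topologically
nilpotent, uniformly in the sense that `aⁿ xₙ → 0` for each sequence `xₙ`. -/
structure IsShift (a : A) : Prop where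
  commute : ∀ x, Commute a x
  tendsto : ∀ x : ℕ → A, Tendsto (fun n => a ^ n * x n) atTop (𝓝 0)

theorem IsShift.summable (ha : IsShift a) (c : ℕ → ℕ) (x : ℕ → A) :
    Summable fun j => (c j : A) * a ^ j * x j := by
  have h := PairingAlgebra.summable_mul (fun j => (c j : A) * x j) (fun j => a ^ j)
    (by simpa using ha.tendsto fun _ => 1)
  refine h.congr fun j => ?_
  rw [mul_assoc, mul_assoc, ((ha.commute (x j)).pow_left j).eq]

theorem coeff_plusShift (f : PowerSeries A) (k : ℕ) : PowerSeries.coeff k (plusShift a f) =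
    ∑' j : ℕ, (Nat.choose (k + j) k : A) * a ^ j * PowerSeries.coeff (k + j) f :=
  PowerSeries.coeff_mk _ _

/-- `plusShift` as an additive homomorphism. -/
def plusShiftAdd (ha : IsShift a) : PowerSeries A →+ PowerSeries A where
  toFun := plusShift a
  map_zero' := by
    ext k
    simp [coeff_plusShift]
  map_add' f g := by
    ext k
    simp only [coeff_plusShift, map_add, mul_add]
    exact (ha.summable _ _).tsum_add (ha.summable _ _)

theorem plusShift_one : plusShift a 1 = 1 := by
  ext k
  rw [coeff_plusShift, tsum_eq_single 0]
  · simp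
  · intro j hj
    rw [PowerSeries.coeff_one, if_neg (by omega), mul_zero]

theorem plusShift_C_mul (ha : IsShift a) (b : A) (f : PowerSeries A) :
    plusShift a (PowerSeries.C b * f) = PowerSeries.C b * plusShift a f := by
  ext k
  simp only [coeff_plusShift, PowerSeries.coeff_C_mul]
  rw [← (ha.summable _ _).tsum_mul_left]
  refine tsum_congr fun j => ?_
  rw [← mul_assoc, ← mul_assoc]
  congr 1
  exact ((Nat.cast_commute _ b).mul_left ((ha.commute b).pow_left j)).eq

/-- Multiplication by `u` turns into multiplication by `u + a`. On coefficients this is the Pascal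
rule. -/
theorem plusShift_X_mul (ha : IsShift a) (f : PowerSeries A) :
    plusShift a (PowerSeries.X * f) = (PowerSeries.X + PowerSeries.C a) * plusShift a f := by
  ext k
  rw [add_mul, map_add, PowerSeries.coeff_C_mul]
  cases k with
  | zero =>
    simp only [coeff_plusShift, PowerSeries.coeff_zero_X_mul, zero_add, Nat.choose_zero_right,
      Nat.cast_one, one_mul]
    have s : ∀ x : ℕ → A, Summable fun j => a ^ j * x j := fun x => by
      simpa using ha.summable (fun _ => 1) x
    rw [(s _).tsum_eq_zero_add, ← (s _).tsum_mul_left]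
    simp only [PowerSeries.coeff_zero_X_mul, mul_zero, zero_add, PowerSeries.coeff_succ_X_mul]
    exact tsum_congr fun j => by rw [pow_succ', mul_assoc]
  | succ k =>
    rw [PowerSeries.coeff_succ_X_mul]
    simp only [coeff_plusShift, show ∀ j, k + 1 + j = k + j + 1 from fun j => by omega,
      PowerSeries.coeff_succ_X_mul, Nat.choose_succ_succ, Nat.cast_add, add_mul]
    simp only [← add_mul, ← Nat.cast_add, ← Nat.choose_succ_succ]
    rw [← (ha.summable _ _).tsum_mul_left]
    have e : ∀ j, ((k + j).choose k + (k + j).choose (k + 1) : ℕ) * a ^ j *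
        PowerSeries.coeff (k + j) f = ((k + j).choose k : A) * a ^ j * PowerSeries.coeff (k + j) f +
          ((k + j).choose (k + 1) : A) * a ^ j * PowerSeries.coeff (k + j) f := fun j => by
      rw [Nat.cast_add, add_mul, add_mul]
    have e' : ∀ j, ((k + j + 1).choose (k + 1) : A) = (((k + j).choose k + (k + j).choose (k + 1) :
        ℕ) : A) := fun j => by rw [Nat.choose_succ_succ]
    simp only [e', e]
    rw [(ha.summable _ _).tsum_add (ha.summable _ _)]
    congr 1
    rw [(ha.summable (fun j => (k + j).choose (k + 1)) _).tsum_eq_zero_add]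
    simp only [add_zero, Nat.choose_succ_self, Nat.cast_zero, zero_mul, zero_add]
    refine tsum_congr fun j => ?_
    rw [← add_assoc, pow_succ', ← Nat.choose_succ_succ, ← mul_assoc, ← mul_assoc, ← mul_assoc,
      (Nat.cast_commute _ a).eq]

/-- The coefficient of `u^k` in a multiple of `(u + a)^(n + k)` is a multiple of `a^n`, which tends
to zero. -/
theorem separates_X_add_C (ha : IsShift a) :
    Separates (PowerSeries.X + PowerSeries.C a : PowerSeries A) := by
  have key : ∀ (k n : ℕ) (D : PowerSeries A), ∃ w, PowerSeries.coeff k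
      ((PowerSeries.X + PowerSeries.C a) ^ (n + k) * D) = a ^ n * w := by
    intro k
    induction k with
    | zero =>
      intro n D
      refine ⟨PowerSeries.coeff 0 D, ?_⟩
      simp [PowerSeries.coeff_zero_eq_constantCoeff_apply]
    | succ k ih =>
      intro n
      induction n with
      | zero => exact fun D => ⟨_, by rw [pow_zero, one_mul]⟩
      | succ n ih' =>
        intro D
        obtain ⟨w, hw⟩ := ih (n + 1) D
        obtain ⟨w', hw'⟩ := ih' D
        refine ⟨w + w', ?_⟩
        rw [show n + 1 + (k + 1) = n + 1 + k + 1 by omega, pow_succ', mul_assoc, add_mul, map_add,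
          PowerSeries.coeff_succ_X_mul, PowerSeries.coeff_C_mul, hw,
          show n + 1 + k = n + (k + 1) by omega, hw', mul_add, pow_succ', mul_assoc, mul_assoc]
  intro z hz
  ext k
  have h : ∀ n, ∃ w, PowerSeries.coeff k z = a ^ n * w := fun n => by
    obtain ⟨D, hD⟩ := hz (n + k)
    obtain ⟨w, hw⟩ := key k n D
    exact ⟨w, by rw [hD, hw]⟩
  choose w hw using h
  have h1 := ha.tendsto w
  simp only [← hw] at h1
  rw [map_zero]
  exact tendsto_nhds_unique tendsto_const_nhds h1

/-- `plusShift` as a ring homomorphism. -/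
def plusShiftHom (ha : IsShift a) : PowerSeries A →+* PowerSeries A where
  toFun := plusShift a
  map_one' := plusShift_one
  map_zero' := (plusShiftAdd ha).map_zero
  map_add' := (plusShiftAdd ha).map_add
  map_mul' f g := substitution_mul (S := plusShiftAdd ha) (separates_X_add_C ha)
    plusShift_one (plusShift_C_mul ha) (plusShift_X_mul ha) f g

theorem plusShiftHom_apply (ha : IsShift a) (f : PowerSeries A) :
    plusShiftHom ha f = plusShift a f := rfl

theorem plusShiftHom_C (ha : IsShift a) (b : A) :
    plusShiftHom ha (PowerSeries.C b) = PowerSeries.C b := by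
  have := plusShift_C_mul ha b 1
  rwa [plusShift_one, mul_one] at this

theorem plusShiftHom_X (ha : IsShift a) :
    plusShiftHom ha PowerSeries.X = PowerSeries.X + PowerSeries.C a := by
  have := plusShift_X_mul ha 1
  rwa [plusShift_one, mul_one, mul_one] at this

theorem plusShift_map {A' : Type*} [Ring A'] [Algebra Base A'] [TopologicalSpace A']
    [PairingAlgebra A'] (φ : A →+* A') (hφ : Continuous φ) (ha : IsShift a)
    (f : PowerSeries A) :
    plusShift (φ a) (PowerSeries.map φ f) = PowerSeries.map φ (plusShift a f) := by
  ext k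
  rw [PowerSeries.coeff_map, coeff_plusShift, coeff_plusShift, (ha.summable _ _).map_tsum φ hφ]
  simp

theorem isShift_algebraMap (z : ℂ) : IsShift (algebraMap Base A (hMul z)) where
  commute x := Algebra.commutes _ _
  tendsto x := by
    have := PairingAlgebra.tendsto_hbar fun n => (PowerSeries.C z : Base) ^ n • x n
    refine this.congr fun n => ?_
    rw [← map_pow (algebraMap Base A), ← Algebra.smul_def, hMul, mul_pow, smul_smul, mul_comm]

end PlusShift

section Diagonal

open scoped PowerSeries.WithPiTopology

variable {A : Type*} [Ring A] [Algebra Base A] [TopologicalSpace A] [PairingAlgebra A]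

theorem isShift_X : IsShift (PowerSeries.X : PowerSeries A) where
  commute f := PowerSeries.X_mul
  tendsto x := tendsto_series_iff.2 fun d => by
    refine tendsto_const_nhds.congr' ?_
    filter_upwards [eventually_gt_atTop d] with n hn
    rw [PowerSeries.coeff_X_pow_mul', if_neg (by omega), map_zero]

/-- The restriction of a double series to the diagonal: both variables are replaced by a single
one. This is the value at `0` of the series shifted by the inner variable. -/
def diagonal : PowerSeries (PowerSeries A) →+* PowerSeries A :=
  PowerSeries.constantCoeff.comp (plusShiftHom isShift_X)

theorem diagonal_C (f : PowerSeries A) : diagonal (PowerSeries.C f) = f := by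
  rw [diagonal, RingHom.comp_apply, plusShiftHom_C, PowerSeries.constantCoeff_C]

theorem diagonal_map_C (f : PowerSeries A) :
    diagonal (PowerSeries.map PowerSeries.C f) = f := by
  rw [diagonal, RingHom.comp_apply, ← PowerSeries.coeff_zero_eq_constantCoeff_apply,
    plusShiftHom_apply, coeff_plusShift]
  have h := PowerSeries.WithPiTopology.hasSum_iff_hasSum_coeff (R := A)
    (f := fun j : ℕ => ((Nat.choose (0 + j) 0 : ℕ) : PowerSeries A) * PowerSeries.X ^ j *
      PowerSeries.coeff (0 + j) (PowerSeries.map PowerSeries.C f)) (g := f)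
  refine (h.2 fun d => ?_).tsum_eq
  have : ∀ j, PowerSeries.coeff d (((Nat.choose (0 + j) 0 : ℕ) : PowerSeries A) *
      PowerSeries.X ^ j * PowerSeries.coeff (0 + j) (PowerSeries.map PowerSeries.C f)) =
      if j = d then PowerSeries.coeff d f else 0 := fun j => by
    rw [zero_add, Nat.choose_zero_right, Nat.cast_one, one_mul, PowerSeries.coeff_map,
      PowerSeries.coeff_mul_C, PowerSeries.coeff_X_pow]
    by_cases hj : j = d
    · subst hj; simp
    · simp [hj, Ne.symm hj]
  simp only [this]
  exact hasSum_ite_eq d _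

end Diagonal

section InvShift

variable {A : Type*} [Ring A] {a : A}

theorem coeff_invShift (f : PowerSeries A) (k : ℕ) : PowerSeries.coeff k (invShift a f) =
    ∑ i ∈ Finset.range (k + 1), (Nat.choose (k - 1) (k - i) : A) * (-a) ^ (k - i) *
      PowerSeries.coeff i f := PowerSeries.coeff_mk _ _

/-- `invShift` as an additive homomorphism. -/
def invShiftAdd (a : A) : PowerSeries A →+ PowerSeries A where
  toFun := invShift a
  map_zero' := by
    ext k
    simp [coeff_invShift]
  map_add' f g := by
    ext k
    simp only [coeff_invShift, map_add, mul_add, Finset.sum_add_distrib]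

theorem invShift_one (a : A) : invShift a 1 = 1 := by
  ext k
  rw [coeff_invShift, Finset.sum_eq_single 0]
  · cases k with
    | zero => simp
    | succ k => simp [PowerSeries.coeff_one]
  · intro i _ hi
    rw [PowerSeries.coeff_one, if_neg hi, mul_zero]
  · simp

theorem invShift_C_mul (ha : ∀ x, Commute a x) (b : A) (f : PowerSeries A) :
    invShift a (PowerSeries.C b * f) = PowerSeries.C b * invShift a f := by
  ext k
  simp only [coeff_invShift, PowerSeries.coeff_C_mul, Finset.mul_sum]
  refine Finset.sum_congr rfl fun j _ => ?_
  rw [← mul_assoc, ← mul_assoc]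
  congr 1
  exact ((Nat.cast_commute _ b).mul_left ((ha b).neg_left.pow_left _)).eq

/-- Multiplication by `u⁻¹` turns into multiplication by `(u + a)⁻¹ = u⁻¹ (1 + a u⁻¹)⁻¹`. -/
theorem invShift_X_mul (f : PowerSeries A) :
    (1 + PowerSeries.C a * PowerSeries.X) * invShift a (PowerSeries.X * f) =
      PowerSeries.X * invShift a f := by
  ext k
  rw [add_mul, one_mul, map_add, mul_assoc, PowerSeries.coeff_C_mul]
  cases k with
  | zero => simp [coeff_invShift, PowerSeries.coeff_zero_X_mul]
  | succ k =>
    rw [PowerSeries.coeff_succ_X_mul, PowerSeries.coeff_succ_X_mul]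
    have e1 : PowerSeries.coeff (k + 1) (invShift a (PowerSeries.X * f)) =
        ∑ i ∈ Finset.range (k + 1), (Nat.choose k (k - i) : A) * (-a) ^ (k - i) *
          PowerSeries.coeff i f := by
      rw [coeff_invShift, Finset.sum_range_succ']
      simp [PowerSeries.coeff_succ_X_mul]
    rw [e1]
    cases k with
    | zero => simp [coeff_invShift, PowerSeries.coeff_zero_X_mul]
    | succ k =>
      have e2 : a * PowerSeries.coeff (k + 1) (invShift a (PowerSeries.X * f)) =
          -∑ i ∈ Finset.range (k + 1), (Nat.choose k (k - i) : A) * (-a) ^ (k + 1 - i) *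
            PowerSeries.coeff i f := by
        rw [coeff_invShift, Finset.sum_range_succ']
        simp only [PowerSeries.coeff_succ_X_mul, PowerSeries.coeff_zero_X_mul, mul_zero, add_zero]
        rw [Finset.mul_sum, ← Finset.sum_neg_distrib]
        refine Finset.sum_congr rfl fun i hi => ?_
        rw [Finset.mem_range] at hi
        rw [show k + 1 - i = k - i + 1 by omega, show k + 1 - (i + 1) = k - i by omega,
          Nat.add_sub_cancel, pow_succ', ← mul_assoc, ← mul_assoc, ← (Nat.cast_commute _ a).eq,
          mul_assoc]
        simp only [neg_mul, mul_neg, neg_neg, mul_assoc]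
      rw [e2, coeff_invShift, Finset.sum_range_succ, Finset.sum_range_succ _ (k + 1)]
      simp only [Nat.sub_self, Nat.choose_zero_right, Nat.add_sub_cancel]
      rw [add_right_comm]
      congr 1
      rw [← sub_eq_add_neg, ← Finset.sum_sub_distrib]
      refine Finset.sum_congr rfl fun i hi => ?_
      rw [Finset.mem_range] at hi
      rw [show k + 1 - i = k - i + 1 by omega, Nat.choose_succ_succ, Nat.cast_add, add_mul, add_mul,
        add_sub_cancel_left]

theorem commute_one_add_C_mul_X (ha : ∀ x, Commute a x) (f : PowerSeries A) :
    Commute (1 + PowerSeries.C a * PowerSeries.X) f := by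
  refine (Commute.one_left f).add_left (Commute.mul_left ?_ (PowerSeries.X_mul (φ := f)))
  ext k
  rw [PowerSeries.coeff_C_mul, PowerSeries.coeff_mul_C, (ha _).eq]

theorem exists_inverse_one_add (a : A) : ∃ W : PowerSeries A,
    W * (1 + PowerSeries.C a * PowerSeries.X) = 1 ∧
      (1 + PowerSeries.C a * PowerSeries.X) * W = 1 := by
  have h : PowerSeries.constantCoeff (1 + PowerSeries.C a * PowerSeries.X) = ((1 : Aˣ) : A) := by
    simp
  exact ⟨_, PowerSeries.invOfUnit_mul _ 1 h, PowerSeries.mul_invOfUnit _ 1 h⟩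

theorem one_add_mul_invShift_X :
    (1 + PowerSeries.C a * PowerSeries.X) * invShift a PowerSeries.X = PowerSeries.X := by
  have h := invShift_X_mul (a := a) 1
  rwa [mul_one, invShift_one, mul_one] at h

theorem one_add_mul_cancel {f g : PowerSeries A}
    (h : (1 + PowerSeries.C a * PowerSeries.X) * f = (1 + PowerSeries.C a * PowerSeries.X) * g) :
    f = g := by
  obtain ⟨W, hW, -⟩ := exists_inverse_one_add a
  rw [← one_mul f, ← hW, mul_assoc, h, ← mul_assoc, hW, one_mul]

theorem invShift_X_mul' (f : PowerSeries A) :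
    invShift a (PowerSeries.X * f) = invShift a PowerSeries.X * invShift a f := by
  refine one_add_mul_cancel (a := a) ?_
  rw [invShift_X_mul, ← mul_assoc, one_add_mul_invShift_X]

theorem separates_invShift_X :
    Separates (invShift a PowerSeries.X : PowerSeries A) := by
  obtain ⟨W, hW, hW'⟩ := exists_inverse_one_add a
  have e : invShift a PowerSeries.X = PowerSeries.X * W := by
    rw [PowerSeries.X_mul]
    refine one_add_mul_cancel (a := a) ?_
    rw [one_add_mul_invShift_X, ← mul_assoc, hW', one_mul]
  intro z hz
  ext k
  obtain ⟨D, hD⟩ := hz (k + 1)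
  rw [hD, e, Commute.mul_pow (PowerSeries.X_mul (φ := W)), mul_assoc,
    PowerSeries.coeff_X_pow_mul', if_neg (by omega), map_zero]

/-- `invShift` as a ring homomorphism. -/
def invShiftHom (ha : ∀ x, Commute a x) : PowerSeries A →+* PowerSeries A where
  toFun := invShift a
  map_one' := invShift_one a
  map_zero' := (invShiftAdd a).map_zero
  map_add' := (invShiftAdd a).map_add
  map_mul' f g := substitution_mul (S := invShiftAdd a) separates_invShift_X
    (invShift_one a) (invShift_C_mul ha) invShift_X_mul' f g

theorem invShiftHom_apply (ha : ∀ x, Commute a x) (f : PowerSeries A) :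
    invShiftHom ha f = invShift a f := rfl

theorem invShiftHom_C (ha : ∀ x, Commute a x) (b : A) :
    invShiftHom ha (PowerSeries.C b) = PowerSeries.C b := by
  have := invShift_C_mul ha b 1
  rwa [invShift_one, mul_one] at this

theorem invShift_map {A' : Type*} [Ring A'] (φ : A →+* A') (a : A) (f : PowerSeries A) :
    invShift (φ a) (PowerSeries.map φ f) = PowerSeries.map φ (invShift a f) := by
  ext k
  simp only [PowerSeries.coeff_map, coeff_invShift, map_sum, map_mul, map_natCast, map_pow, map_neg]

theorem invShift_invShift {b : A} (ha : ∀ x, Commute a x) (hb : ∀ x, Commute b x)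
    (f : PowerSeries A) : invShift a (invShift b f) = invShift (a + b) f := by
  have hab : ∀ x, Commute (a + b) x := fun x => (ha x).add_left (hb x)
  have hY : invShift a (invShift b PowerSeries.X) = invShift (a + b) PowerSeries.X := by
    refine one_add_mul_cancel (a := a + b) ?_
    rw [one_add_mul_invShift_X]
    have h := congrArg (invShiftHom ha) (one_add_mul_invShift_X (a := b))
    rw [map_mul, map_add, map_mul, map_one, invShiftHom_C, invShiftHom_apply,
      invShiftHom_apply] at h
    have h2 := congrArg ((1 + PowerSeries.C a * PowerSeries.X) * ·) h
    simp only [one_add_mul_invShift_X] at h2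
    refine Eq.trans ?_ h2
    rw [← mul_assoc]
    congr 1
    rw [mul_add, mul_one, ← mul_assoc, (commute_one_add_C_mul_X ha _).eq, mul_assoc,
      one_add_mul_invShift_X, map_add, add_mul, add_assoc]
  refine substitution_ext (S := (invShiftAdd a).comp (invShiftAdd b)) (S' := invShiftAdd (a + b))
    separates_invShift_X ?_ (invShift_one _) ?_ (invShift_C_mul hab) ?_
    invShift_X_mul' f
  · change invShift a (invShift b 1) = 1
    rw [invShift_one, invShift_one]
  · intro c f
    change invShift a (invShift b _) = _ * invShift a (invShift b _)
    rw [invShift_C_mul hb, invShift_C_mul ha]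
  · intro f
    change invShift a (invShift b _) = _ * invShift a (invShift b _)
    rw [invShift_X_mul', ← hY]
    exact (invShiftHom ha).map_mul _ _

end InvShift

end

noncomputable section

/-! ### The mixed relation without the normalizing series -/

/-- The elimination of the normalizing series `G` from the mixed relation. Here `Y` and `Y'` are
the inverses of `y = u - v + hc/2` and `y' = u - v - hc/2`, multiplied out as `ỹ Y = U`,
`ỹ' Y' = U`; at the critical level the two values of the normalizing series differ by the
factor `1 - h² Y²`. -/
theorem mixed_elimination {K S ι : Type*} [CommRing K] [Ring S] [Algebra K S]
    {h Y Y' G G' D' γ γ' U y y' : K} {T P : ι → ι → S} {H : ι → ι → ι → ι → S}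
    (hG : G = 1 + h * γ) (hγ : γ' = γ - h * Y ^ 2 * G) (hGG : G' * G = 1)
    (hD : D' * (1 - h ^ 2 * Y ^ 2) = 1) (hy : y * Y = U) (hy' : y' * Y' = U)
    (hH : ∀ i j k l, T i j * P k l - P k l * T i j = h • H i j k l)
    (hE : ∀ i j k l, H i j k l + γ • (T i j * P k l) - γ' • (P k l * T i j) =
      (G * Y) • (T k j * P i l) - (G * (1 - h ^ 2 * Y ^ 2) * Y') • (P k j * T i l))
    (i j k l : ι) : (y' * y) • H i j k l =
      (y' * U) • (P i l * T k j) - (y * U) • (P k j * T i l) - (h * U ^ 2) • (P i j * T k l) := by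
  subst hG
  have hTP : ∀ i j k l, T i j * P k l = P k l * T i j + h • H i j k l := fun i j k l => by
    rw [← hH, add_sub_cancel]
  have e : ∀ i j k l, H i j k l + (h * Y ^ 2) • (P k l * T i j) =
      Y • (P i l * T k j) + (h * Y) • H k j i l -
        ((1 - h ^ 2 * Y ^ 2) * Y') • (P k j * T i l) := by
    intro i j k l
    have h1 := hE i j k l
    rw [hTP, hTP, hγ] at h1
    have h2 : (1 + h * γ) • (H i j k l + (h * Y ^ 2) • (P k l * T i j) - (Y • (P i l * T k j) +
        (h * Y) • H k j i l - ((1 - h ^ 2 * Y ^ 2) * Y') • (P k j * T i l))) = 0 := by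
      rw [← sub_eq_zero] at h1
      rw [← h1]
      module
    have h3 := congrArg (G' • ·) h2
    simp only [smul_smul, hGG, one_smul, smul_zero] at h3
    exact sub_eq_zero.1 h3
  have h1 : (1 - h ^ 2 * Y ^ 2) • (H i j k l - (Y • (P i l * T k j) - Y' • (P k j * T i l) -
      (h * (Y * Y')) • (P i j * T k l))) = 0 := by
    have h1 := e i j k l
    have h2 := e k j i l
    rw [← sub_eq_zero] at h1 h2
    have h3 := congrArg₂ (fun a b : S => a + (h * Y) • b) h1 h2
    simp only [smul_zero, add_zero] at h3
    rw [← h3]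
    module
  have h2 := congrArg (D' • ·) h1
  simp only [smul_smul, hD, one_smul, smul_zero] at h2
  rw [sub_eq_zero.1 h2]
  simp only [smul_sub, smul_smul]
  congr 1
  · congr 1
    · congr 1; linear_combination y' * hy
    · congr 1; linear_combination y * hy'
  · congr 1
    linear_combination h * (y' * Y') * hy + h * U * hy'

section Kernels

/-- The coefficient of `u⁻ᵃ vᵇ` in `(q((u - v + κ) / h) - q₀) / h`. -/
def dividedKernel {F : Type*} [Ring F] [Algebra Base F] (q : PowerSeries ℂ) (κ : F) (a b : ℕ) :
    F :=
  ∑ i ∈ Finset.range a, (PowerSeries.C (PowerSeries.coeff (i + 1) q * Nat.choose (a - 1) (a - 1 - i)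
    * Nat.choose (a - 1 - i) b) * hbar ^ i : Base) • (-κ) ^ (a - 1 - i - b)

theorem kernel_eq_dividedKernel {N : ℕ} (q : PowerSeries ℂ) (κ : Free N) (a b : ℕ) :
    kernel q κ a b =
      (if a = 0 ∧ b = 0 then (PowerSeries.C (PowerSeries.coeff 0 q) : Base) else 0) • (1 : Free N) +
        hbar • dividedKernel q κ a b := by
  rw [kernel, Finset.sum_range_succ']
  cases a with
  | zero =>
    cases b with
    | zero => simp [dividedKernel]
    | succ b => simp [dividedKernel]
  | succ a =>
    rw [dividedKernel, Finset.smul_sum, add_comm]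
    congr 1
    · rw [if_neg (by omega), Nat.choose_eq_zero_of_lt (by omega)]
      simp
    · refine Finset.sum_congr rfl fun i _ => ?_
      rw [show a + 1 - (i + 1) = a + 1 - 1 - i by omega, smul_smul, pow_succ']
      congr 1
      ring

theorem dividedKernel_map {F F' : Type*} [Ring F] [Algebra Base F] [Ring F'] [Algebra Base F']
    (φ : F →ₐ[Base] F') (q : PowerSeries ℂ) (κ : F) (a b : ℕ) :
    φ (dividedKernel q κ a b) = dividedKernel q (φ κ) a b := by
  simp only [dividedKernel, map_sum, map_smul, map_pow, map_neg]

/-- Modulo `h`, the divided kernel does not depend on `κ ∈ h F`. -/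
theorem exists_dividedKernel_eq {F : Type*} [Ring F] [Algebra Base F] (q : PowerSeries ℂ)
    (κ : F) (a b : ℕ) : ∃ x, dividedKernel q (hbar • κ) a b =
      (if a = b + 1 then (PowerSeries.C (PowerSeries.coeff 1 q) : Base) else 0) • (1 : F) +
        hbar • x := by
  have h : ∀ i ∈ Finset.range a, ∃ x : F, (PowerSeries.C (PowerSeries.coeff (i + 1) q *
      Nat.choose (a - 1) (a - 1 - i) * Nat.choose (a - 1 - i) b) * hbar ^ i : Base) •
        (-(hbar • κ)) ^ (a - 1 - i - b) =
      (if i = 0 ∧ a = b + 1 then (PowerSeries.C (PowerSeries.coeff 1 q) : Base) else 0) • (1 : F) +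
        hbar • x := by
    intro i hi
    rw [Finset.mem_range] at hi
    rcases lt_or_ge (a - 1 - i) b with hb | hb
    · refine ⟨0, ?_⟩
      rw [Nat.choose_eq_zero_of_lt hb, if_neg (by omega)]
      simp
    · by_cases h0 : i = 0 ∧ a = b + 1
      · refine ⟨0, ?_⟩
        obtain ⟨rfl, rfl⟩ := h0
        simp
      · obtain ⟨n, hn⟩ : ∃ n, i + (a - 1 - i - b) = n + 1 := ⟨i + (a - 1 - i - b) - 1, by omega⟩
        refine ⟨(PowerSeries.C (PowerSeries.coeff (i + 1) q * Nat.choose (a - 1) (a - 1 - i) *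
          Nat.choose (a - 1 - i) b) * hbar ^ n : Base) • (-κ) ^ (a - 1 - i - b), ?_⟩
        rw [if_neg h0, zero_smul, zero_add, ← smul_neg, smul_pow, smul_smul, smul_smul, mul_assoc,
          ← pow_add, hn, pow_succ]
        congr 1
        ring
  choose! x hx using h
  refine ⟨∑ i ∈ Finset.range a, x i, ?_⟩
  rw [dividedKernel, Finset.sum_congr rfl hx, Finset.sum_add_distrib, Finset.smul_sum]
  congr 1
  rw [← Finset.sum_smul]
  congr 1
  by_cases hab : a = b + 1
  · simp [hab]
  · simp [hab]

end Kernels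

/-- The commutation relation of `t_{ij}^{(r)}` and `t_{kl}^{(-s)}` in the double Yangian at an
arbitrary level: the mixed relation divided by `h`. -/
def dividedCoeff {N : ℕ} {F : Type*} [Ring F] [Algebra Base F] (κ : F)
    (x y : Fin N → Fin N → ℕ → F) (i j k l : Fin N) (r s : ℕ) : F :=
  (if r = 0 then 0 else hbar • (y k l s * x i j (r - 1) - x i j (r - 1) * y k l s)) +
    ∑ a ∈ Finset.range (r + 1), ∑ b ∈ Finset.range (s + 1),
      ((dividedKernel (gSeries N) κ a b * (tCoeff x i j (r - a) * tPlusCoeff y k l (s - b)) -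
        dividedKernel (PowerSeries.X * gSeries N) κ a b *
          (tCoeff x k j (r - a) * tPlusCoeff y i l (s - b))) -
      (dividedKernel (gSeries N) (-κ) a b * (tPlusCoeff y k l (s - b) * tCoeff x i j (r - a)) -
        dividedKernel (PowerSeries.X * gSeries N) (-κ) a b *
          (tPlusCoeff y k j (s - b) * tCoeff x i l (r - a))))

/-- The mixed relation, as it is imposed on the free algebra, is a multiple of `h`: the
constant terms of the kernels contribute the commutator of two generating series, and the remaining
parts of the kernels are multiples of `h`. -/
theorem rttMixedCoeff_eq {N : ℕ} (i j k l : Fin N) (r s : ℕ) :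
    rttMixedCoeff i j k l r s =
      hbar • dividedCoeff (hMul (1 / 2) • genC N) genT genTPlus i j k l r s := by
  have hg : PowerSeries.coeff 0 (gSeries N) = 1 := by
    rw [PowerSeries.coeff_zero_eq_constantCoeff_apply, constantCoeff_gSeries]
  simp only [rttMixedCoeff, dividedCoeff, kernel_eq_dividedKernel, hg,
    PowerSeries.coeff_zero_X_mul, map_zero, ite_self, zero_smul, zero_add, map_one, add_mul]
  have e0 : ∀ (F : ℕ → ℕ → Free N), ∑ a ∈ Finset.range (r + 1), ∑ b ∈ Finset.range (s + 1),
      (if a = 0 ∧ b = 0 then (1 : Base) else 0) • (1 * F a b) = F 0 0 := by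
    intro F
    rw [Finset.sum_eq_single 0, Finset.sum_eq_single 0]
    · simp
    · intro b _ hb; simp [hb]
    · simp
    · intro a _ ha; simp [ha]
    · simp
  simp only [Finset.sum_sub_distrib, Finset.sum_add_distrib, e0, smul_add, smul_sub,
    Finset.smul_sum, smul_mul_assoc, Nat.sub_zero]
  -- the contribution of the constant terms of the kernels
  have e1 : tCoeff genT i j r * tPlusCoeff genTPlus k l s -
      tPlusCoeff genTPlus k l s * tCoeff genT i j r =
      hbar • (if r = 0 then 0 else
        hbar • (genTPlus k l s * genT i j (r - 1) - genT i j (r - 1) * genTPlus k l s)) := by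
    cases r with
    | zero =>
      simp only [tCoeff, if_true, smul_zero]
      split_ifs <;> simp
    | succ r =>
      simp only [tCoeff, tPlusCoeff, Nat.succ_ne_zero, if_false, Nat.add_sub_cancel]
      have : Commute (if s = 0 ∧ k = l then (1 : Free N) else 0) (genT i j r) := by
        split_ifs
        · exact Commute.one_left _
        · exact Commute.zero_left _
      simp only [mul_sub, sub_mul, smul_mul_assoc, mul_smul_comm, smul_sub, this.eq]
      abel
  rw [sub_eq_iff_eq_add] at e1
  rw [e1]
  split_ifs <;> simp only [smul_zero, smul_sub] <;> abel

theorem exists_mul_eq_smul_one_add {K F : Type*} [CommRing K] [Ring F] [Algebra K F]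
    (h α d d' : K) (x y z : F) : ∃ w, (α • 1 + h • x) * ((d • 1 + h • y) * (d' • 1 + h • z)) =
      (α * (d * d')) • 1 + h • w := by
  refine ⟨α • (d • z + d' • y + h • (y * z)) + x * ((d • 1 + h • y) * (d' • 1 + h • z)), ?_⟩
  simp only [add_mul, mul_add, smul_mul_assoc, mul_smul_comm, one_mul, mul_one]
  module

theorem exists_tCoeff_eq {N : ℕ} {F : Type*} [Ring F] [Algebra Base F]
    (x : Fin N → Fin N → ℕ → F) (i j : Fin N) (r : ℕ) : ∃ z, tCoeff x i j r =
      (if r = 0 ∧ i = j then (1 : Base) else 0) • (1 : F) + hbar • z := by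
  cases r with
  | zero => exact ⟨0, by simp [tCoeff]⟩
  | succ r => exact ⟨x i j r, by simp [tCoeff]⟩

theorem exists_tPlusCoeff_eq {N : ℕ} {F : Type*} [Ring F] [Algebra Base F]
    (y : Fin N → Fin N → ℕ → F) (i j : Fin N) (r : ℕ) : ∃ z, tPlusCoeff y i j r =
      (if r = 0 ∧ i = j then (1 : Base) else 0) • (1 : F) + hbar • z :=
  ⟨-y i j r, by simp only [tPlusCoeff]; split_ifs <;> simp [sub_eq_add_neg]⟩

/-- The divided relation is again a multiple of `h`. Modulo `h` the generating series are identity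
matrices and the kernels do not depend on `κ`, so that the four terms cancel in pairs. -/
theorem exists_dividedCoeff_eq_smul {N : ℕ} {F : Type*} [Ring F] [Algebra Base F] (κ : F)
    (x y : Fin N → Fin N → ℕ → F) (i j k l : Fin N) (r s : ℕ) :
    ∃ z, dividedCoeff (hbar • κ) x y i j k l r s = hbar • z := by
  have hT := exists_tCoeff_eq x
  have hP := exists_tPlusCoeff_eq y
  -- the value `d` modulo `h` of a term depends on the indices only through `δ_{ij} δ_{kl}`
  have key : ∀ (q : PowerSeries ℂ) (a b : ℕ) (i j k l : Fin N) (r s : ℕ), ∃ (d : Base),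
      ∀ (i' j' k' l' : Fin N), ∀ (κ : F),
      ((if i' = j' then (1 : Base) else 0) * (if k' = l' then (1 : Base) else 0) =
        (if i = j then (1 : Base) else 0) * (if k = l then (1 : Base) else 0)) →
      ∃ z z', dividedKernel q (hbar • κ) a b * (tCoeff x i' j' r * tPlusCoeff y k' l' s) =
        d • (1 : F) + hbar • z ∧
        dividedKernel q (hbar • κ) a b * (tPlusCoeff y k' l' s * tCoeff x i' j' r) =
        d • (1 : F) + hbar • z' := by
    intro q a b i j k l r s
    refine ⟨(if a = b + 1 then (PowerSeries.C (PowerSeries.coeff 1 q) : Base) else 0) *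
      ((if r = 0 then 1 else 0) * (if s = 0 then 1 else 0) *
        ((if i = j then (1 : Base) else 0) * (if k = l then (1 : Base) else 0))), ?_⟩
    intro i' j' k' l' κ hd
    obtain ⟨z1, h1⟩ := exists_dividedKernel_eq q κ a b
    obtain ⟨z2, h2⟩ := hT i' j' r
    obtain ⟨z3, h3⟩ := hP k' l' s
    have f1 : (if r = 0 ∧ i' = j' then (1 : Base) else 0) =
      (if r = 0 then 1 else 0) * (if i' = j' then 1 else 0) := by split_ifs <;> simp_all
    have f2 : (if s = 0 ∧ k' = l' then (1 : Base) else 0) =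
      (if s = 0 then 1 else 0) * (if k' = l' then 1 else 0) := by split_ifs <;> simp_all
    rw [f1] at h2
    rw [f2] at h3
    rw [h1, h2, h3, ← hd]
    generalize (if a = b + 1 then (PowerSeries.C (PowerSeries.coeff 1 q) : Base) else 0) = α
    generalize (if r = 0 then (1 : Base) else 0) = β₁
    generalize (if s = 0 then (1 : Base) else 0) = β₂
    generalize (if i' = j' then (1 : Base) else 0) = δ₁
    generalize (if k' = l' then (1 : Base) else 0) = δ₂
    obtain ⟨z, hz⟩ := exists_mul_eq_smul_one_add hbar α (β₁ * δ₁) (β₂ * δ₂) z1 z2 z3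
    obtain ⟨z', hz'⟩ := exists_mul_eq_smul_one_add hbar α (β₂ * δ₂) (β₁ * δ₁) z1 z3 z2
    refine ⟨z, z', ?_, ?_⟩
    · rw [hz]; congr 2; ring
    · rw [hz']; congr 2; ring
  have hterm : ∀ a b, ∃ z, ((dividedKernel (gSeries N) (hbar • κ) a b *
        (tCoeff x i j (r - a) * tPlusCoeff y k l (s - b)) -
        dividedKernel (PowerSeries.X * gSeries N) (hbar • κ) a b *
          (tCoeff x k j (r - a) * tPlusCoeff y i l (s - b))) -
      (dividedKernel (gSeries N) (-(hbar • κ)) a b *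
        (tPlusCoeff y k l (s - b) * tCoeff x i j (r - a)) -
        dividedKernel (PowerSeries.X * gSeries N) (-(hbar • κ)) a b *
          (tPlusCoeff y k j (s - b) * tCoeff x i l (r - a)))) = hbar • z := by
    intro a b
    obtain ⟨d, hd⟩ := key (gSeries N) a b i j k l (r - a) (s - b)
    obtain ⟨d', hd'⟩ := key (PowerSeries.X * gSeries N) a b k j i l (r - a) (s - b)
    obtain ⟨z1, -, h1, -⟩ := hd i j k l κ rfl
    obtain ⟨-, z2, -, h2⟩ := hd i j k l (-κ) rfl
    obtain ⟨z3, -, h3, -⟩ := hd' k j i l κ rfl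
    obtain ⟨-, z4, -, h4⟩ := hd' i l k j (-κ) (mul_comm _ _)
    rw [smul_neg] at h2 h4
    rw [h1, h2, h3, h4]
    exact ⟨z1 - z3 - (z2 - z4), by simp only [smul_sub]; abel⟩
  choose z hz using hterm
  have hz' : ∃ z', (if r = 0 then (0 : F) else
      hbar • (y k l s * x i j (r - 1) - x i j (r - 1) * y k l s)) = hbar • z' := by
    split_ifs
    · exact ⟨0, (smul_zero _).symm⟩
    · exact ⟨_, rfl⟩
  obtain ⟨z', hz'⟩ := hz'
  refine ⟨z' + ∑ a ∈ Finset.range (r + 1), ∑ b ∈ Finset.range (s + 1), z a b, ?_⟩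
  rw [dividedCoeff, hz', smul_add, Finset.smul_sum]
  congr 1
  refine Finset.sum_congr rfl fun a _ => ?_
  rw [Finset.smul_sum]
  exact Finset.sum_congr rfl fun b _ => hz a b

theorem dividedCoeff_map {N : ℕ} {F F' : Type*} [Ring F] [Algebra Base F] [Ring F']
    [Algebra Base F'] (φ : F →ₐ[Base] F') (κ : F) (x y : Fin N → Fin N → ℕ → F)
    (i j k l : Fin N) (r s : ℕ) : φ (dividedCoeff κ x y i j k l r s) =
      dividedCoeff (φ κ) (fun i j r => φ (x i j r)) (fun i j r => φ (y i j r)) i j k l r s := by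
  have hT : ∀ i j r, φ (tCoeff x i j r) = tCoeff (fun i j r => φ (x i j r)) i j r := by
    intro i j r
    cases r with
    | zero => simp only [tCoeff]; split_ifs <;> simp
    | succ r => simp [tCoeff]
  have hP : ∀ i j r, φ (tPlusCoeff y i j r) = tPlusCoeff (fun i j r => φ (y i j r)) i j r := by
    intro i j r
    simp only [tPlusCoeff]; split_ifs <;> simp
  simp only [dividedCoeff, map_add, map_sum, map_sub, map_mul, hT, hP, dividedKernel_map, map_neg]
  split_ifs <;> simp

/-- The defining relation says that the mixed relation divided by `h²` vanishes; multiplied by `h`,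
this gives the vanishing of the divided relation in the double Yangian. -/
theorem dividedCoeff_eq_zero {N : ℕ} (c : ℂ) (i j k l : Fin N) (r s : ℕ) :
    dividedCoeff (algebraMap Base (DYLevel N c) (hMul (1 / 2) * PowerSeries.C c))
      (DYLevel.t N c) (DYLevel.tPlus N c) i j k l r s = 0 := by
  have hmul : hMul (1 / 2) • genC N = hbar • ((PowerSeries.C (1 / 2) : Base) • genC N) := by
    rw [smul_smul, hMul, mul_comm]
  obtain ⟨z, hz⟩ := exists_dividedCoeff_eq_smul ((PowerSeries.C (1 / 2) : Base) • genC N)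
    genT genTPlus i j k l r s
  rw [← hmul] at hz
  have h0 := DYLevel.proj_eq (c := c) (Rel.rttMixed i j k l r s z (by
    rw [rttMixedCoeff_eq, hz, smul_smul, pow_two]))
  have hC : DYLevel.proj N c (genC N) = algebraMap Base (DYLevel N c) (PowerSeries.C c) := by
    have := RingQuot.mkAlgHom_rel Base (LevelRel.level (N := N) (c := c))
    rw [AlgHom.commutes] at this
    exact this
  have h1 := congrArg (DYLevel.proj N c) hz
  rw [dividedCoeff_map, map_smul, map_smul, h0, map_zero, smul_zero, hC, Algebra.smul_def,
    ← map_mul] at h1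
  exact h1

end

noncomputable section

section NormalizingSeries

/-- The series `q(u / h)`. -/
def scaled : PowerSeries ℂ →+* PowerSeries (PowerSeries Base) :=
  (PowerSeries.rescale (PowerSeries.C hbar)).comp
    (PowerSeries.map ((PowerSeries.C : Base →+* PowerSeries Base).comp PowerSeries.C))

theorem coeff_scaled (q : PowerSeries ℂ) (i : ℕ) : PowerSeries.coeff i (scaled q) =
    PowerSeries.C (PowerSeries.C (PowerSeries.coeff i q) * hbar ^ i) := by
  simp only [scaled, RingHom.comp_apply, PowerSeries.coeff_rescale, PowerSeries.coeff_map, map_mul,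
    map_pow]
  exact mul_comm _ _

theorem scaled_X : scaled PowerSeries.X = PowerSeries.C (PowerSeries.C hbar) * PowerSeries.X := by
  rw [scaled, RingHom.comp_apply, PowerSeries.map_X, PowerSeries.rescale_X]

theorem invShift_rescale {R : Type*} [CommRing R] (r a : R) (f : PowerSeries R) :
    invShift (r * a) (PowerSeries.rescale r f) = PowerSeries.rescale r (invShift a f) := by
  ext k
  simp only [coeff_invShift, PowerSeries.coeff_rescale, Finset.mul_sum]
  refine Finset.sum_congr rfl fun i hi => ?_
  rw [Finset.mem_range] at hi
  obtain ⟨d, rfl⟩ : ∃ d, k = i + d := ⟨k - i, by omega⟩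
  rw [Nat.add_sub_cancel_left, ← mul_neg, mul_pow, pow_add]
  ring

theorem invShift_scaled (z : ℂ) (q : PowerSeries ℂ) :
    invShift (PowerSeries.C (hMul z)) (scaled q) = scaled (invShift z q) := by
  rw [scaled, RingHom.comp_apply, RingHom.comp_apply, ← invShift_map, ← invShift_rescale]
  congr 1
  rw [RingHom.comp_apply, ← map_mul, hMul, mul_comm]

/-- The double series `(q((u - v + κ) / h) - q₀) / h`, a series in `v` and `u⁻¹`. -/
def dividedSeries (q : PowerSeries ℂ) (κ : Base) : PowerSeries (PowerSeries Base) :=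
  PowerSeries.mk fun a => PowerSeries.mk fun b => dividedKernel q κ a b

theorem dividedSeries_eq (q : PowerSeries ℂ) (κ : Base) :
    PowerSeries.C (PowerSeries.C hbar) * dividedSeries q κ +
        PowerSeries.C (PowerSeries.C (PowerSeries.C (PowerSeries.coeff 0 q))) =
      invShift (PowerSeries.C κ - PowerSeries.X) (scaled q) := by
  have hb : ∀ n b : ℕ, PowerSeries.coeff b ((-(PowerSeries.C κ - PowerSeries.X)) ^ n) =
      (-κ) ^ (n - b) * (n.choose b : Base) := by
    intro n b
    rw [← Polynomial.coeff_X_add_C_pow, ← Polynomial.coeff_coe]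
    congr 1
    rw [Polynomial.coe_pow, Polynomial.coe_add, Polynomial.coe_X, Polynomial.coe_C]
    congr 1
    rw [map_neg]
    ring
  ext1 a
  ext1 b
  have e : PowerSeries.coeff b (PowerSeries.coeff a
      (invShift (PowerSeries.C κ - PowerSeries.X) (scaled q))) =
      ∑ i ∈ Finset.range (a + 1), (Nat.choose (a - 1) (a - i) : Base) * ((-κ) ^ (a - i - b) *
        (Nat.choose (a - i) b : Base)) * (PowerSeries.C (PowerSeries.coeff i q) * hbar ^ i) := by
    rw [coeff_invShift, map_sum]
    refine Finset.sum_congr rfl fun i _ => ?_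
    rw [coeff_scaled, PowerSeries.coeff_mul_C, ← hb, ← map_natCast (PowerSeries.C (R := Base)),
      PowerSeries.coeff_C_mul]
  rw [e, map_add, map_add, PowerSeries.coeff_C_mul, PowerSeries.coeff_C_mul, dividedSeries,
    PowerSeries.coeff_mk, PowerSeries.coeff_mk, Finset.sum_range_succ', dividedKernel,
    Finset.mul_sum]
  congr 1
  · refine Finset.sum_congr rfl fun i _ => ?_
    rw [show a - 1 - i = a - (i + 1) by omega]
    simp only [map_mul, map_natCast, smul_eq_mul, pow_succ]
    ring
  · cases a with
    | zero => cases b <;> simp [PowerSeries.coeff_C]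
    | succ a =>
      rw [Nat.choose_eq_zero_of_lt (show a + 1 - 1 < a + 1 - 0 by omega), PowerSeries.coeff_C,
        if_neg (Nat.succ_ne_zero a)]
      simp

theorem C_C_hbar_ne_zero :
    (PowerSeries.C (PowerSeries.C hbar) : PowerSeries (PowerSeries Base)) ≠ 0 := by
  intro h
  have := congrArg (fun f => PowerSeries.coeff 1 (PowerSeries.coeff 0 (PowerSeries.coeff 0 f))) h
  simp [hbar] at this

theorem dividedSeries_X_mul (q : PowerSeries ℂ) (κ : Base) :
    dividedSeries (PowerSeries.X * q) κ = invShift (PowerSeries.C κ - PowerSeries.X) (scaled q) *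
      invShift (PowerSeries.C κ - PowerSeries.X) PowerSeries.X := by
  have h := dividedSeries_eq (PowerSeries.X * q) κ
  rw [PowerSeries.coeff_zero_X_mul, map_zero, map_zero, map_zero, add_zero, map_mul, scaled_X,
    mul_assoc, invShift_C_mul (fun x => Commute.all _ x), invShift_X_mul'] at h
  rw [mul_left_cancel₀ C_C_hbar_ne_zero h, mul_comm]

/-- At the critical level the two values of the normalizing series in the mixed relation differ by
a rational factor. -/
theorem invShift_scaled_gSeries {N : ℕ} (hN : 1 ≤ N) :
    invShift (PowerSeries.C (hMul (N / 2)) - PowerSeries.X) (scaled (gSeries N)) =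
      invShift (PowerSeries.C (-hMul (N / 2)) - PowerSeries.X) (scaled (gSeries N)) *
        (1 - PowerSeries.C (PowerSeries.C hbar) ^ 2 *
          invShift (PowerSeries.C (-hMul (N / 2)) - PowerSeries.X) PowerSeries.X ^ 2) := by
  set κ : PowerSeries Base := PowerSeries.C (-hMul (N / 2)) - PowerSeries.X with hκ
  have e : (PowerSeries.C (hMul (N / 2)) - PowerSeries.X : PowerSeries Base) =
      κ + PowerSeries.C (hMul N) := by
    have : hMul N = hMul (N / 2) + hMul (N / 2) := by
      rw [hMul, hMul, ← add_mul, ← map_add, add_halves]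
    rw [hκ, this, map_add, map_neg]
    ring
  rw [e, ← invShift_invShift (fun x => Commute.all _ x) (fun x => Commute.all _ x),
    invShift_scaled, invShift_gSeries hN, map_mul, map_sub, map_one, map_pow, scaled_X]
  simp only [← invShiftHom_apply (fun x => Commute.all κ x), map_mul, map_sub, map_one, map_pow,
    invShiftHom_C]
  rw [mul_pow]

end NormalizingSeries

/-! ### Relations between double series -/

section DoubleSeries

variable {F : Type*} [Ring F] [Algebra Base F]

/-- The double series with scalar coefficients. -/
def scalarSeries (F : Type*) [Ring F] [Algebra Base F] :
    PowerSeries (PowerSeries Base) →+* PowerSeries (PowerSeries F) :=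
  PowerSeries.map (PowerSeries.map (algebraMap Base F))

theorem commute_scalarSeries (g : PowerSeries (PowerSeries Base))
    (f : PowerSeries (PowerSeries F)) :
    Commute (scalarSeries F g) f := by
  have h : ∀ (g : PowerSeries Base) (f : PowerSeries F),
      Commute (PowerSeries.map (algebraMap Base F) g) f := fun g f => by
    ext n
    rw [PowerSeries.coeff_mul, PowerSeries.coeff_mul,
      ← Finset.Nat.sum_antidiagonal_swap]
    refine Finset.sum_congr rfl fun p _ => ?_
    simp only [PowerSeries.coeff_map, Prod.fst_swap, Prod.snd_swap]
    exact Algebra.commutes _ _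
  ext1 n
  rw [PowerSeries.coeff_mul, PowerSeries.coeff_mul, ← Finset.Nat.sum_antidiagonal_swap]
  refine Finset.sum_congr rfl fun p _ => ?_
  simp only [scalarSeries, PowerSeries.coeff_map, Prod.fst_swap, Prod.snd_swap]
  exact h _ _

theorem coeff_coeff_scalarSeries_mul (g : PowerSeries (PowerSeries Base))
    (f : PowerSeries (PowerSeries F)) (r s : ℕ) :
    PowerSeries.coeff s (PowerSeries.coeff r (scalarSeries F g * f)) =
      ∑ a ∈ Finset.range (r + 1), ∑ b ∈ Finset.range (s + 1),
        algebraMap Base F (PowerSeries.coeff b (PowerSeries.coeff a g)) *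
          PowerSeries.coeff (s - b) (PowerSeries.coeff (r - a) f) := by
  rw [PowerSeries.coeff_mul, Finset.Nat.sum_antidiagonal_eq_sum_range_succ_mk, map_sum]
  refine Finset.sum_congr rfl fun a _ => ?_
  rw [PowerSeries.coeff_mul, Finset.Nat.sum_antidiagonal_eq_sum_range_succ_mk]
  refine Finset.sum_congr rfl fun b _ => ?_
  simp only [scalarSeries, PowerSeries.coeff_map]

theorem coeff_coeff_map_C_mul_C (f p : PowerSeries F) (r s : ℕ) :
    PowerSeries.coeff s (PowerSeries.coeff r (PowerSeries.map PowerSeries.C f * PowerSeries.C p)) =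
      PowerSeries.coeff r f * PowerSeries.coeff s p := by
  rw [PowerSeries.coeff_mul_C, PowerSeries.coeff_map, PowerSeries.coeff_C_mul]

theorem coeff_coeff_C_mul_map_C (f p : PowerSeries F) (r s : ℕ) :
    PowerSeries.coeff s (PowerSeries.coeff r (PowerSeries.C p * PowerSeries.map PowerSeries.C f)) =
      PowerSeries.coeff s p * PowerSeries.coeff r f := by
  rw [PowerSeries.coeff_C_mul, PowerSeries.coeff_map, PowerSeries.coeff_mul_C]

/-- The series `∑_{r ≥ 1} x^{(r)} u⁻ʳ`, so that `t_{ij}(u) = δ_{ij} + h ∑_{r ≥ 1} t_{ij}^{(r)} u⁻ʳ`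
is built from it. -/
def tailSeries (x : ℕ → F) : PowerSeries F := PowerSeries.X * PowerSeries.mk x

variable {N : ℕ}

theorem mk_tCoeff (x : Fin N → Fin N → ℕ → F) (i j : Fin N) : PowerSeries.mk (tCoeff x i j) =
    (if i = j then 1 else 0) + hbar • tailSeries (x i j) := by
  ext n
  rw [PowerSeries.coeff_mk, map_add, coeff_base_smul, tailSeries]
  cases n with
  | zero => rw [PowerSeries.coeff_zero_X_mul]; split_ifs <;> simp_all [tCoeff]
  | succ n => rw [PowerSeries.coeff_succ_X_mul]; split_ifs <;> simp [tCoeff, PowerSeries.coeff_one]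

theorem mk_tPlusCoeff (y : Fin N → Fin N → ℕ → F) (i j : Fin N) :
    PowerSeries.mk (tPlusCoeff y i j) =
      (if i = j then 1 else 0) + hbar • PowerSeries.mk fun r => -y i j r := by
  ext n
  rw [PowerSeries.coeff_mk, map_add, coeff_base_smul, PowerSeries.coeff_mk, tPlusCoeff, smul_neg,
    sub_eq_add_neg]
  congr 1
  by_cases h : i = j
  · simp [h, PowerSeries.coeff_one]
  · simp [h]

/-- The series `u⁻¹ (u - v + κ)`; the inner variable is `v`, the outer one is `u⁻¹`. -/
def mixedFactor (κ : F) : PowerSeries (PowerSeries F) :=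
  1 + PowerSeries.C (PowerSeries.C κ - PowerSeries.X) * PowerSeries.X

/-- The mixed relation at the critical level. -/
theorem mixed_relation (hN : 1 ≤ N) {x y : Fin N → Fin N → ℕ → F}
    (hxy : ∀ i j k l r s, dividedCoeff (algebraMap Base F (hMul (1 / 2) * PowerSeries.C (-(N : ℂ))))
      x y i j k l r s = 0) (i j k l : Fin N) :
    let T : Fin N → Fin N → PowerSeries (PowerSeries F) := fun i j =>
      PowerSeries.map PowerSeries.C (PowerSeries.mk (tCoeff x i j))
    let P : Fin N → Fin N → PowerSeries (PowerSeries F) := fun i j =>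
      PowerSeries.C (PowerSeries.mk (tPlusCoeff y i j))
    let t := PowerSeries.map PowerSeries.C (tailSeries (x i j))
    mixedFactor (algebraMap Base F (hMul (N / 2))) *
        mixedFactor (algebraMap Base F (-hMul (N / 2))) * (t * P k l - P k l * t) =
      mixedFactor (algebraMap Base F (hMul (N / 2))) * PowerSeries.X * (P i l * T k j) -
        mixedFactor (algebraMap Base F (-hMul (N / 2))) * PowerSeries.X * (P k j * T i l) -
        hbar • (PowerSeries.X ^ 2 * (P i j * T k l)) := by
  intro T P t
  let _ : Algebra (PowerSeries (PowerSeries Base)) (PowerSeries (PowerSeries F)) :=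
    (scalarSeries F).toAlgebra' commute_scalarSeries
  have smul_eq : ∀ (g : PowerSeries (PowerSeries Base)) (f : PowerSeries (PowerSeries F)),
      g • f = scalarSeries F g * f := fun g f => rfl
  have hF : ∀ κ : Base, mixedFactor (algebraMap Base F κ) = scalarSeries F
      (1 + PowerSeries.C (PowerSeries.C κ - PowerSeries.X) * PowerSeries.X) := by
    intro κ
    simp [mixedFactor, scalarSeries]
  have hh : ∀ f : PowerSeries (PowerSeries F),
      hbar • f = scalarSeries F (PowerSeries.C (PowerSeries.C hbar)) * f := by
    intro f
    rw [Algebra.smul_def, algebraMap_series, algebraMap_series]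
    simp [scalarSeries]
  have hX : (PowerSeries.X : PowerSeries (PowerSeries F)) = scalarSeries F PowerSeries.X := by
    simp [scalarSeries]
  set κ : PowerSeries Base := PowerSeries.C (-hMul (N / 2)) - PowerSeries.X with hκ
  set κ' : PowerSeries Base := PowerSeries.C (hMul (N / 2)) - PowerSeries.X with hκ'
  set G := invShift κ (scaled (gSeries N)) with hG
  have hg0 : PowerSeries.coeff 0 (gSeries N) = 1 := by
    rw [PowerSeries.coeff_zero_eq_constantCoeff_apply, constantCoeff_gSeries]
  have hγ := dividedSeries_eq (gSeries N) (-hMul (N / 2))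
  have hγ' := dividedSeries_eq (gSeries N) (hMul (N / 2))
  rw [hg0, map_one, map_one, map_one] at hγ hγ'
  have hG' := invShift_scaled_gSeries hN
  rw [← hγ', ← hκ, ← hG] at hG'
  rw [← hκ, ← hG] at hγ
  have hinv : ∀ g : PowerSeries (PowerSeries Base), PowerSeries.constantCoeff g = 1 →
      ∃ g', g' * g = 1 := fun g hg => ⟨_, PowerSeries.invOfUnit_mul g 1 (by simpa using hg)⟩
  have hY0 : PowerSeries.constantCoeff (invShift κ PowerSeries.X) = 0 := by
    rw [← PowerSeries.coeff_zero_eq_constantCoeff_apply, coeff_invShift]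
    simp
  obtain ⟨Gi, hGi⟩ := hinv G (by
    rw [hG, ← PowerSeries.coeff_zero_eq_constantCoeff_apply, coeff_invShift]
    simp [coeff_scaled, constantCoeff_gSeries])
  obtain ⟨Di, hDi⟩ := hinv (1 - PowerSeries.C (PowerSeries.C hbar) ^ 2 *
    invShift κ PowerSeries.X ^ 2) (by simp [hY0])
  have hκ0 : (hMul (1 / 2) * PowerSeries.C (-(N : ℂ)) : Base) = -hMul (N / 2) := by
    rw [hMul, hMul, mul_right_comm, ← map_mul, ← neg_mul, ← map_neg]
    congr 2
    ring
  have hmain := mixed_elimination (h := PowerSeries.C (PowerSeries.C hbar)) (G := G) (G' := Gi)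
    (D' := Di) (Y := invShift κ PowerSeries.X) (Y' := invShift κ' PowerSeries.X)
    (γ := dividedSeries (gSeries N) (-hMul (N / 2)))
    (γ' := dividedSeries (gSeries N) (hMul (N / 2)))
    (U := PowerSeries.X) (y := 1 + PowerSeries.C κ * PowerSeries.X)
    (y' := 1 + PowerSeries.C κ' * PowerSeries.X) (T := T) (P := P)
    (H := fun i j k l => PowerSeries.map PowerSeries.C (tailSeries (x i j)) * P k l -
      P k l * PowerSeries.map PowerSeries.C (tailSeries (x i j)))
    (by rw [← hγ, add_comm]) (by
      refine mul_left_cancel₀ C_C_hbar_ne_zero ?_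
      linear_combination hG' - hγ) hGi hDi one_add_mul_invShift_X one_add_mul_invShift_X ?_ ?_
      i j k l
  · simp only [smul_eq] at hmain
    rw [hF, hF, ← map_mul, hh, hX]
    simp only [← map_mul, ← map_pow, ← mul_assoc] at hmain ⊢
    exact hmain
  · intro i j k l
    rw [smul_eq, ← hh]
    have e : T i j = (if i = j then 1 else 0) +
        hbar • PowerSeries.map PowerSeries.C (tailSeries (x i j)) := by
      simp only [T, mk_tCoeff]
      rw [map_add]
      congr 1
      · split_ifs <;> simp
      · ext1 n
        rw [PowerSeries.coeff_map, coeff_base_smul, coeff_base_smul, PowerSeries.coeff_map,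
          Algebra.smul_def, Algebra.smul_def, map_mul, algebraMap_series]
    rw [e]
    have : Commute (if i = j then (1 : PowerSeries (PowerSeries F)) else 0) (P k l) := by
      split_ifs
      · exact Commute.one_left _
      · exact Commute.zero_left _
    rw [add_mul, mul_add, this.eq, add_sub_add_left_eq_sub, smul_mul_assoc, mul_smul_comm, smul_sub]
  · intro i j k l
    have hd := hxy i j k l
    rw [hκ0] at hd
    have hk : ∀ (q : PowerSeries ℂ) (κ₀ : Base) (a b : ℕ),
        dividedKernel q (algebraMap Base F κ₀) a b =
          algebraMap Base F (PowerSeries.coeff b (PowerSeries.coeff a (dividedSeries q κ₀))) := by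
      intro q κ₀ a b
      rw [dividedSeries, PowerSeries.coeff_mk, PowerSeries.coeff_mk]
      exact (dividedKernel_map (Algebra.ofId Base F) q κ₀ a b).symm
    rw [← dividedSeries_X_mul, ← hG', hγ', ← hκ', ← dividedSeries_X_mul]
    ext1 r
    ext1 s
    have hd' := hd r s
    simp only [dividedCoeff, ← map_neg, neg_neg, hk, Finset.sum_sub_distrib] at hd'
    simp only [map_add, map_sub, smul_eq, coeff_coeff_scalarSeries_mul]
    simp only [T, P, coeff_coeff_map_C_mul_C, coeff_coeff_C_mul_map_C, PowerSeries.coeff_mk]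
    have e : PowerSeries.coeff r (tailSeries (x i j)) * tPlusCoeff y k l s -
        tPlusCoeff y k l s * PowerSeries.coeff r (tailSeries (x i j)) =
        if r = 0 then 0 else hbar • (y k l s * x i j (r - 1) - x i j (r - 1) * y k l s) := by
      cases r with
      | zero => simp [tailSeries]
      | succ r =>
        rw [tailSeries, PowerSeries.coeff_succ_X_mul, PowerSeries.coeff_mk, if_neg (by omega),
          Nat.add_sub_cancel, tPlusCoeff]
        have : Commute (if s = 0 ∧ k = l then (1 : F) else 0) (x i j r) := by
          split_ifs
          · exact Commute.one_left _
          · exact Commute.zero_left _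
        simp only [mul_sub, sub_mul, smul_mul_assoc, mul_smul_comm, smul_sub, this.eq]
        abel
    rw [e, ← sub_eq_zero]
    refine Eq.trans ?_ hd'
    abel

end DoubleSeries

end

noncomputable section

/-- The coefficient of `u⁻ʳ` in `∑_{r ≥ 1} x^{(r)} u⁻ʳ`. -/
def tail {F : Type*} [Zero F] (x : ℕ → F) : ℕ → F
  | 0 => 0
  | r + 1 => x r

theorem coeff_tailSeries {F : Type*} [Ring F] (x : ℕ → F) (r : ℕ) :
    PowerSeries.coeff r (tailSeries x) = tail x r := by
  cases r with
  | zero => rw [tailSeries, PowerSeries.coeff_zero_X_mul, tail]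
  | succ r => rw [tailSeries, PowerSeries.coeff_succ_X_mul, PowerSeries.coeff_mk, tail]

/-- The relations of the double Yangian at the critical level, divided by `h`, for elements
`x i j r`, `y i j r` of an algebra in the roles of `t_{ij}^{(r+1)}` and `t_{ij}^{(-r-1)}`. -/
structure IsCritical {N : ℕ} {F : Type*} [Ring F] [Algebra Base F] (x y : Fin N → Fin N → ℕ → F) :
    Prop where
  rtt : ∀ i j k l r s, hbar • ((tail (x i j) (r + 1) * tail (x k l) s -
      tail (x k l) s * tail (x i j) (r + 1)) -
      (tail (x i j) r * tail (x k l) (s + 1) - tail (x k l) (s + 1) * tail (x i j) r)) =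
    tCoeff x k j r * tCoeff x i l s - tCoeff x k j s * tCoeff x i l r
  rttPlus : ∀ i j k l r s, hbar • ((if r = 0 then 0 else
      y i j (r - 1) * y k l s - y k l s * y i j (r - 1)) -
      (if s = 0 then 0 else y i j r * y k l (s - 1) - y k l (s - 1) * y i j r)) =
    tPlusCoeff y k j r * tPlusCoeff y i l s - tPlusCoeff y k j s * tPlusCoeff y i l r
  mixed : ∀ i j k l r s, dividedCoeff
    (algebraMap Base F (hMul (1 / 2) * PowerSeries.C (-(N : ℂ)))) x y i j k l r s = 0

theorem exists_mul_sub_mul_eq_smul {K F : Type*} [CommRing K] [Ring F] [Algebra K F]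
    (h d₁ d₂ d₃ d₄ : K) (hd : d₁ * d₂ = d₃ * d₄) (x₁ x₂ x₃ x₄ : F) :
    ∃ w, (d₁ • 1 + h • x₁) * (d₂ • 1 + h • x₂) - (d₃ • 1 + h • x₃) * (d₄ • 1 + h • x₄) = h • w := by
  refine ⟨d₁ • x₂ + d₂ • x₁ + h • (x₁ * x₂) - (d₃ • x₄ + d₄ • x₃ + h • (x₃ * x₄)), ?_⟩
  have e : ∀ (a b : K) (x y : F), (a • 1 + h • x) * (b • 1 + h • y) =
      (a * b) • 1 + h • (a • y + b • x + h • (x * y)) := fun a b x y => by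
    simp only [add_mul, mul_add, smul_mul_assoc, mul_smul_comm, one_mul, mul_one]
    module
  rw [e, e, hd, smul_sub]
  abel

theorem commutator_tCoeff {N : ℕ} {F : Type*} [Ring F] [Algebra Base F]
    (x : Fin N → Fin N → ℕ → F) (i j k l : Fin N) (r s : ℕ) :
    tCoeff x i j r * tCoeff x k l s - tCoeff x k l s * tCoeff x i j r =
      hbar ^ 2 • (tail (x i j) r * tail (x k l) s - tail (x k l) s * tail (x i j) r) := by
  cases r with
  | zero => simp only [tCoeff, tail]; split_ifs <;> simp
  | succ r =>
    cases s with
    | zero => simp only [tCoeff, tail]; split_ifs <;> simp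
    | succ s =>
      simp only [tCoeff, tail, smul_mul_assoc, mul_smul_comm, smul_smul, pow_two, smul_sub]

theorem commutator_tPlusCoeff {N : ℕ} {F : Type*} [Ring F] [Algebra Base F]
    (y : Fin N → Fin N → ℕ → F) (i j k l : Fin N) (r s : ℕ) :
    tPlusCoeff y i j r * tPlusCoeff y k l s - tPlusCoeff y k l s * tPlusCoeff y i j r =
      hbar ^ 2 • (y i j r * y k l s - y k l s * y i j r) := by
  have e : ∀ (p : Prop) [Decidable p] (z : F), Commute (if p then (1 : F) else 0) z := by
    intro p _ z
    split_ifs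
    · exact Commute.one_left _
    · exact Commute.zero_left _
  simp only [tPlusCoeff]
  have h1 := e (r = 0 ∧ i = j) (if s = 0 ∧ k = l then (1 : F) else 0)
  have h2 := e (r = 0 ∧ i = j) (y k l s)
  have h3 := e (s = 0 ∧ k = l) (y i j r)
  generalize (if r = 0 ∧ i = j then (1 : F) else 0) = a at h1 h2 ⊢
  generalize (if s = 0 ∧ k = l then (1 : F) else 0) = b at h1 h3 ⊢
  simp only [sub_mul, mul_sub, smul_mul_assoc, mul_smul_comm, smul_smul, pow_two, smul_sub]
  rw [h1.eq, h2.eq, h3.eq]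
  abel

/-- The defining relations are divided by `h²`, those of `IsCritical` only by `h`; multiplying the
former by `h` gives the latter. -/
theorem isCritical_dyLevel (N : ℕ) :
    IsCritical (DYLevel.t N (-(N : ℂ))) (DYLevel.tPlus N (-(N : ℂ))) where
  rtt i j k l r s := by
    obtain ⟨z1, h1⟩ := exists_tCoeff_eq (genT (N := N)) k j r
    obtain ⟨z2, h2⟩ := exists_tCoeff_eq (genT (N := N)) i l s
    obtain ⟨z3, h3⟩ := exists_tCoeff_eq (genT (N := N)) k j s
    obtain ⟨z4, h4⟩ := exists_tCoeff_eq (genT (N := N)) i l r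
    obtain ⟨w, hw⟩ := exists_mul_sub_mul_eq_smul hbar (if r = 0 ∧ k = j then 1 else 0)
      (if s = 0 ∧ i = l then 1 else 0) (if s = 0 ∧ k = j then 1 else 0)
      (if r = 0 ∧ i = l then 1 else 0)
      (by by_cases hr : r = 0 <;> by_cases hs : s = 0 <;> simp [hr, hs]) z1 z2 z3 z4
    rw [← h1, ← h2, ← h3, ← h4] at hw
    have h0 := DYLevel.proj_eq (c := -(N : ℂ)) (Rel.rtt i j k l r s
      (((tail (genT i j) (r + 1) * tail (genT k l) s -
      tail (genT k l) s * tail (genT i j) (r + 1)) -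
      (tail (genT i j) r * tail (genT k l) (s + 1) - tail (genT k l) (s + 1) * tail (genT i j) r)) -
        w) (by
        simp only [rttCoeff]
        rw [commutator_tCoeff, commutator_tCoeff, hw, smul_sub, smul_sub, smul_smul, pow_two]))
    have hτ : ∀ i j r, DYLevel.proj N (-(N : ℂ)) (tCoeff genT i j r) =
        tCoeff (DYLevel.t N (-(N : ℂ))) i j r := by
      intro i j r
      cases r with
      | zero => simp only [tCoeff]; split_ifs <;> simp
      | succ r => simp [tCoeff, DYLevel.t]
    have hx : ∀ i j r, DYLevel.proj N (-(N : ℂ)) (tail (genT i j) r) =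
        tail (DYLevel.t N (-(N : ℂ)) i j) r := by
      intro i j r
      cases r with
      | zero => simp [tail]
      | succ r => simp [tail, DYLevel.t]
    have h5 := congrArg (DYLevel.proj N (-(N : ℂ))) hw
    rw [map_sub, map_zero, sub_eq_zero] at h0
    rw [map_smul, ← h0] at h5
    simp only [map_sub, map_mul, hτ, hx] at h5
    exact h5.symm
  rttPlus i j k l r s := by
    obtain ⟨z1, h1⟩ := exists_tPlusCoeff_eq (genTPlus (N := N)) k j r
    obtain ⟨z2, h2⟩ := exists_tPlusCoeff_eq (genTPlus (N := N)) i l s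
    obtain ⟨z3, h3⟩ := exists_tPlusCoeff_eq (genTPlus (N := N)) k j s
    obtain ⟨z4, h4⟩ := exists_tPlusCoeff_eq (genTPlus (N := N)) i l r
    obtain ⟨w, hw⟩ := exists_mul_sub_mul_eq_smul hbar (if r = 0 ∧ k = j then 1 else 0)
      (if s = 0 ∧ i = l then 1 else 0) (if s = 0 ∧ k = j then 1 else 0)
      (if r = 0 ∧ i = l then 1 else 0)
      (by by_cases hr : r = 0 <;> by_cases hs : s = 0 <;> simp [hr, hs]) z1 z2 z3 z4
    rw [← h1, ← h2, ← h3, ← h4] at hw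
    have h0 := DYLevel.proj_eq (c := -(N : ℂ)) (Rel.rttPlus i j k l r s
      (((if r = 0 then 0 else
      genTPlus i j (r - 1) * genTPlus k l s - genTPlus k l s * genTPlus i j (r - 1)) -
      (if s = 0 then 0 else genTPlus i j r * genTPlus k l (s - 1) -
        genTPlus k l (s - 1) * genTPlus i j r)) - w) (by
        simp only [rttPlusCoeff]
        rw [commutator_tPlusCoeff, commutator_tPlusCoeff, hw, smul_sub, smul_sub, smul_smul,
          pow_two]
        split_ifs <;> simp))
    have hτ : ∀ i j r, DYLevel.proj N (-(N : ℂ)) (tPlusCoeff genTPlus i j r) =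
        tPlusCoeff (DYLevel.tPlus N (-(N : ℂ))) i j r := by
      intro i j r
      simp only [tPlusCoeff]; split_ifs <;> simp [DYLevel.tPlus]
    have h5 := congrArg (DYLevel.proj N (-(N : ℂ))) hw
    rw [map_sub, map_zero, sub_eq_zero] at h0
    rw [map_smul, ← h0] at h5
    simp only [map_sub, map_mul, hτ] at h5
    refine Eq.trans ?_ h5.symm
    simp only [DYLevel.tPlus]
    split_ifs <;> simp
  mixed := dividedCoeff_eq_zero _

section

variable {N : ℕ} {F F' : Type*} [Ring F] [Algebra Base F] [Ring F'] [Algebra Base F']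
  {x y : Fin N → Fin N → ℕ → F}

theorem map_tCoeff (φ : F →ₐ[Base] F') (i j : Fin N) (r : ℕ) :
    φ (tCoeff x i j r) = tCoeff (fun i j r => φ (x i j r)) i j r := by
  cases r with
  | zero => simp only [tCoeff]; split_ifs <;> simp
  | succ r => simp [tCoeff]

theorem map_tPlusCoeff (φ : F →ₐ[Base] F') (i j : Fin N) (r : ℕ) :
    φ (tPlusCoeff y i j r) = tPlusCoeff (fun i j r => φ (y i j r)) i j r := by
  simp only [tPlusCoeff]; split_ifs <;> simp

theorem map_tail (φ : F →ₐ[Base] F') (x : ℕ → F) (r : ℕ) :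
    φ (tail x r) = tail (fun r => φ (x r)) r := by
  cases r <;> simp [tail]

theorem IsCritical.map (h : IsCritical x y) (φ : F →ₐ[Base] F') :
    IsCritical (fun i j r => φ (x i j r)) (fun i j r => φ (y i j r)) where
  rtt i j k l r s := by
    have := congrArg φ (h.rtt i j k l r s)
    simp only [map_smul, map_sub, map_mul, map_tCoeff] at this
    simp only [map_tail] at this
    exact this
  rttPlus i j k l r s := by
    have := congrArg φ (h.rttPlus i j k l r s)
    simp only [map_smul, map_sub, map_mul, map_tPlusCoeff] at this
    rw [← this]
    split_ifs <;> simp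
  mixed i j k l r s := by
    have := congrArg φ (h.mixed i j k l r s)
    rwa [dividedCoeff_map, map_zero, AlgHom.commutes] at this

/-- The commutation relation of `t_{ij}(z)` and `t_{kl}(u)`, a relation between series in the inner
variable `z⁻¹` and the outer variable `u⁻¹`. -/
theorem IsCritical.rtt_series (h : IsCritical x y) (i j k l : Fin N) :
    let T : Fin N → Fin N → PowerSeries F := fun i j => PowerSeries.mk (tCoeff x i j)
    (PowerSeries.X - PowerSeries.C PowerSeries.X) *
        (PowerSeries.C (tailSeries (x i j)) * PowerSeries.map PowerSeries.C (T k l) -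
          PowerSeries.map PowerSeries.C (T k l) * PowerSeries.C (tailSeries (x i j))) =
      PowerSeries.X * PowerSeries.C PowerSeries.X *
        (PowerSeries.C (T k j) * PowerSeries.map PowerSeries.C (T i l) -
          PowerSeries.map PowerSeries.C (T k j) * PowerSeries.C (T i l)) := by
  intro T
  have hc : ∀ r s, tail (x i j) r * tCoeff x k l s - tCoeff x k l s * tail (x i j) r =
      hbar • (tail (x i j) r * tail (x k l) s - tail (x k l) s * tail (x i j) r) := by
    intro r s
    cases s with
    | zero => simp only [tCoeff, tail]; split_ifs <;> simp
    | succ s => simp only [tCoeff, tail, smul_mul_assoc, mul_smul_comm, smul_sub]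
  ext1 s
  ext1 r
  rw [sub_mul, map_sub, map_sub, PowerSeries.coeff_C_mul, mul_assoc]
  cases s with
  | zero =>
    rw [PowerSeries.coeff_zero_X_mul, PowerSeries.coeff_zero_X_mul, map_zero, zero_sub, neg_eq_zero]
    cases r with
    | zero => rw [PowerSeries.coeff_zero_X_mul]
    | succ r =>
      rw [PowerSeries.coeff_succ_X_mul, map_sub, map_sub, coeff_coeff_C_mul_map_C,
        coeff_coeff_map_C_mul_C, coeff_tailSeries, PowerSeries.coeff_mk, hc]
      simp [tail]
  | succ s =>
    rw [PowerSeries.coeff_succ_X_mul, PowerSeries.coeff_succ_X_mul, PowerSeries.coeff_C_mul]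
    cases r with
    | zero =>
      rw [PowerSeries.coeff_zero_X_mul, PowerSeries.coeff_zero_X_mul, map_sub, map_sub,
        coeff_coeff_C_mul_map_C, coeff_coeff_map_C_mul_C, coeff_tailSeries]
      simp [tail]
    | succ r =>
      rw [PowerSeries.coeff_succ_X_mul, PowerSeries.coeff_succ_X_mul]
      simp only [map_sub, coeff_coeff_C_mul_map_C, coeff_coeff_map_C_mul_C, coeff_tailSeries, T,
        PowerSeries.coeff_mk]
      rw [hc, hc, ← h.rtt, ← smul_sub]

/-- The commutation relation of `t⁺_{ij}(z)` and `t⁺_{kl}(u)`, a relation between series in the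
inner variable `z` and the outer variable `u`. -/
theorem IsCritical.rttPlus_series (h : IsCritical x y) (i j k l : Fin N) :
    let P : Fin N → Fin N → PowerSeries F := fun i j => PowerSeries.mk (tPlusCoeff y i j)
    let p : PowerSeries F := PowerSeries.mk fun r => -y i j r
    (PowerSeries.C PowerSeries.X - PowerSeries.X) *
        (PowerSeries.C p * PowerSeries.map PowerSeries.C (P k l) -
          PowerSeries.map PowerSeries.C (P k l) * PowerSeries.C p) =
      PowerSeries.C (P k j) * PowerSeries.map PowerSeries.C (P i l) -
          PowerSeries.map PowerSeries.C (P k j) * PowerSeries.C (P i l) := by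
  intro P p
  have hc : ∀ r s, -y i j r * tPlusCoeff y k l s - tPlusCoeff y k l s * -y i j r =
      hbar • (y i j r * y k l s - y k l s * y i j r) := by
    intro r s
    simp only [tPlusCoeff]
    have e : Commute (if s = 0 ∧ k = l then (1 : F) else 0) (y i j r) := by
      split_ifs
      · exact Commute.one_left _
      · exact Commute.zero_left _
    simp only [neg_mul, mul_neg, sub_mul, mul_sub, e.eq, smul_mul_assoc, mul_smul_comm, smul_sub,
      smul_neg]
    abel
  have hD : ∀ r s, PowerSeries.coeff r (PowerSeries.coeff s (PowerSeries.C p *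
      PowerSeries.map PowerSeries.C (P k l) - PowerSeries.map PowerSeries.C (P k l) *
        PowerSeries.C p)) = hbar • (y i j r * y k l s - y k l s * y i j r) := by
    intro r s
    rw [map_sub, map_sub, coeff_coeff_C_mul_map_C, coeff_coeff_map_C_mul_C, ← hc,
      PowerSeries.coeff_mk, PowerSeries.coeff_mk]
  generalize PowerSeries.C p * PowerSeries.map PowerSeries.C (P k l) -
    PowerSeries.map PowerSeries.C (P k l) * PowerSeries.C p = D at hD ⊢
  ext1 s
  ext1 r
  have hr := h.rttPlus i j k l r s
  rw [sub_mul, map_sub, map_sub, PowerSeries.coeff_C_mul, map_sub, map_sub,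
    coeff_coeff_C_mul_map_C, coeff_coeff_map_C_mul_C]
  simp only [P, PowerSeries.coeff_mk]
  rw [← hr, smul_sub]
  congr 1
  · cases r with
    | zero => simp [PowerSeries.coeff_zero_X_mul]
    | succ r =>
      rw [PowerSeries.coeff_succ_X_mul, hD, if_neg (by omega), Nat.add_sub_cancel]
  · cases s with
    | zero => simp [PowerSeries.coeff_zero_X_mul]
    | succ s =>
      rw [PowerSeries.coeff_succ_X_mul, hD, if_neg (by omega), Nat.add_sub_cancel]

end

end

noncomputable section

/-! ### Central elements -/

section Center

variable {A : Type*} [Ring A]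

theorem X_mem_center : (PowerSeries.X : PowerSeries A) ∈ Subring.center (PowerSeries A) :=
  Subring.mem_center_iff.2 fun _ => PowerSeries.X_mul.symm

theorem C_mem_center {a : A} (ha : a ∈ Subring.center A) :
    PowerSeries.C a ∈ Subring.center (PowerSeries A) :=
  Subring.mem_center_iff.2 fun f => by
    ext n
    rw [PowerSeries.coeff_C_mul, PowerSeries.coeff_mul_C]
    exact Subring.mem_center_iff.1 ha _

theorem algebraMap_mem_center [Algebra Base A] (a : Base) :
    algebraMap Base A a ∈ Subring.center A :=
  Subring.mem_center_iff.2 fun _ => (Algebra.commutes _ _).symm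

theorem scalar_mem_center {n : Type*} [Fintype n] [DecidableEq n] {a : A}
    (ha : a ∈ Subring.center A) : Matrix.scalar n a ∈ Subring.center (Matrix n n A) :=
  Subring.mem_center_iff.2 fun M => by
    ext i j
    rw [Matrix.scalar_apply, Matrix.mul_diagonal, Matrix.diagonal_mul]
    exact Subring.mem_center_iff.1 ha _

theorem eta_mem_center [Algebra Base A] : Lift.eta A ∈ Subring.center (Lift A) :=
  Subring.mem_center_iff.2 fun x => (Lift.commute_eta x).eq.symm

theorem hbar_smul_eq {A : Type*} [Ring A] [Algebra Base A] (f : PowerSeries A) :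
    hbar • f = PowerSeries.C (algebraMap Base A hbar) * f := by
  rw [Algebra.smul_def, algebraMap_series]

end Center

/-! ### The relations for shifted series -/

section Swap

variable {A : Type*} [Ring A]

/-- The exchange of the two variables of a double series. -/
def swapVars : PowerSeries (PowerSeries A) →+* PowerSeries (PowerSeries A) where
  toFun f := PowerSeries.mk fun r => PowerSeries.mk fun s =>
    PowerSeries.coeff r (PowerSeries.coeff s f)
  map_one' := by
    ext r s
    simp only [PowerSeries.coeff_mk, PowerSeries.coeff_one]
    split_ifs <;> simp_all [PowerSeries.coeff_one]
  map_zero' := by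
    ext r s
    simp
  map_add' f g := by
    ext r s
    simp
  map_mul' f g := by
    ext r s
    simp only [PowerSeries.coeff_mk, PowerSeries.coeff_mul, map_sum]
    exact Finset.sum_comm

theorem coeff_swapVars (f : PowerSeries (PowerSeries A)) (r s : ℕ) :
    PowerSeries.coeff s (PowerSeries.coeff r (swapVars f)) =
      PowerSeries.coeff r (PowerSeries.coeff s f) := by
  simp [swapVars]

theorem swapVars_C (f : PowerSeries A) :
    swapVars (PowerSeries.C f) = PowerSeries.map PowerSeries.C f := by
  ext r s
  rw [coeff_swapVars, PowerSeries.coeff_map, PowerSeries.coeff_C, PowerSeries.coeff_C]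
  split_ifs <;> simp

theorem swapVars_map_C (f : PowerSeries A) :
    swapVars (PowerSeries.map PowerSeries.C f) = PowerSeries.C f := by
  ext r s
  rw [coeff_swapVars, PowerSeries.coeff_map, PowerSeries.coeff_C, PowerSeries.coeff_C]
  split_ifs <;> simp

theorem swapVars_X : swapVars (PowerSeries.X : PowerSeries (PowerSeries A)) =
    PowerSeries.C PowerSeries.X := by
  have := swapVars_map_C (A := A) PowerSeries.X
  rwa [PowerSeries.map_X] at this

theorem swapVars_C_X : swapVars (PowerSeries.C PowerSeries.X : PowerSeries (PowerSeries A)) =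
    PowerSeries.X := by
  rw [swapVars_C, PowerSeries.map_X]

theorem swapVars_C_C (a : A) : swapVars (PowerSeries.C (PowerSeries.C a)) =
    PowerSeries.C (PowerSeries.C a) := by
  rw [swapVars_C, PowerSeries.map_C]

end Swap

section EtaLift

variable {K S ι : Type*} [CommRing K] [Ring S] [Algebra K S] {c c' u h e d : K}
  {t T P Z : ι → ι → S}

/-- The passage from `T = 1 + h t` to `Z = 1 + η t` in the mixed relation. -/
theorem mixed_eta_lift (he : e * e = h * e)
    (hZ : ∀ i j k l, Z i j * P k l - P k l * Z i j = e • (t i j * P k l - P k l * t i j))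
    (hT : ∀ i j, e • T i j = e • Z i j) {i j k l : ι}
    (hE : (c' * c) • (t i j * P k l - P k l * t i j) = (c' * u) • (P i l * T k j) -
      (c * u) • (P k j * T i l) - (h * u ^ 2) • (P i j * T k l)) :
    (c' * c) • (Z i j * P k l - P k l * Z i j) = (c' * (u * e)) • (P i l * Z k j) -
      (c * (u * e)) • (P k j * Z i l) - (u * e) ^ 2 • (P i j * Z k l) := by
  have hPT : ∀ i j k l, e • (P i j * T k l) = e • (P i j * Z k l) := fun i j k l => by
    rw [← mul_smul_comm, hT, mul_smul_comm]
  have e1 : e ^ 2 = h * e := by rw [pow_two, he]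
  calc (c' * c) • (Z i j * P k l - P k l * Z i j)
      = e • ((c' * c) • (t i j * P k l - P k l * t i j)) := by rw [hZ, smul_comm]
    _ = (c' * u) • (e • (P i l * T k j)) - (c * u) • (e • (P k j * T i l)) -
        (h * u ^ 2) • (e • (P i j * T k l)) := by rw [hE]; module
    _ = _ := by rw [hPT, hPT, hPT, mul_pow, e1]; module

theorem mixed_eta_lift' (he : e * e = h * e)
    (hZ : ∀ i j k l, P k l * Z i j - Z i j * P k l = e • (P k l * t i j - t i j * P k l))
    (hT : ∀ i j, e • T i j = e • Z i j) {i j k l : ι}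
    (hE : (c' * c) • (P i j * t k l - t k l * P i j) = (c' * u) • (T i l * P k j) -
      (c * u) • (T k j * P i l) - (h * u ^ 2) • (T i j * P k l)) :
    (c' * c) • (P i j * Z k l - Z k l * P i j) = (c' * (u * e)) • (Z i l * P k j) -
      (c * (u * e)) • (Z k j * P i l) - (u * e) ^ 2 • (Z i j * P k l) := by
  have hPT : ∀ i j k l, e • (T i j * P k l) = e • (Z i j * P k l) := fun i j k l => by
    rw [← smul_mul_assoc, hT, smul_mul_assoc]
  have e1 : e ^ 2 = h * e := by rw [pow_two, he]
  calc (c' * c) • (P i j * Z k l - Z k l * P i j)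
      = e • ((c' * c) • (P i j * t k l - t k l * P i j)) := by rw [hZ, smul_comm]
    _ = (c' * u) • (e • (T i l * P k j)) - (c * u) • (e • (T k j * P i l)) -
        (h * u ^ 2) • (e • (T i j * P k l)) := by rw [hE]; module
    _ = _ := by rw [hPT, hPT, hPT, mul_pow, e1]; module

theorem rtt_eta_lift
    (hZ : ∀ i j k l, Z i j * P k l - P k l * Z i j = e • (t i j * P k l - P k l * t i j))
    (hT : ∀ i j, e • T i j = e • Z i j) {i j k l : ι}
    (hE : c • (t i j * P k l - P k l * t i j) = d • (T k j * P i l - P k j * T i l)) :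
    c • (Z i j * P k l - P k l * Z i j) = (d * e) • (Z k j * P i l - P k j * Z i l) := by
  calc c • (Z i j * P k l - P k l * Z i j)
      = e • (c • (t i j * P k l - P k l * t i j)) := by rw [hZ, smul_comm]
    _ = d • ((e • T k j) * P i l - P k j * (e • T i l)) := by
        rw [hE, smul_mul_assoc, mul_smul_comm]; module
    _ = _ := by rw [hT, hT, smul_mul_assoc, mul_smul_comm]; module

end EtaLift

section ShiftedRelations

open scoped PowerSeries.WithPiTopology

variable {N : ℕ} {F : Type*} [Ring F] [Algebra Base F] [TopologicalSpace F] [PairingAlgebra F]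

/-- The embedding of `F` as the constants of `(Lift F)[[z]]`. -/
def constHom (F : Type*) [Ring F] [Algebra Base F] : F →+* PowerSeries (Lift F) :=
  PowerSeries.C.comp (Lift.incl F).toRingHom

theorem continuous_constHom : Continuous (constHom F) :=
  (PowerSeries.WithPiTopology.continuous_C (R := Lift F)).comp Lift.continuous_incl

theorem constHom_algebraMap (a : Base) :
    constHom F (algebraMap Base F a) = algebraMap Base (PowerSeries (Lift F)) a := by
  rw [algebraMap_series, constHom, RingHom.comp_apply]
  congr 1
  exact (Lift.incl F).commutes a

/-- The series `δ_{ij} + η p(z)`, a constant with respect to the outer variable. -/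
def etaSeries {ι : Type*} [DecidableEq ι] (p : ι → ι → PowerSeries F) (i j : ι) :
    PowerSeries (Lift F) :=
  (if i = j then 1 else 0) +
    PowerSeries.C (Lift.eta F) * PowerSeries.map (Lift.incl F).toRingHom (p i j)

/-- The embedding of double series over `F` into double series over `Lift F`. -/
def doubleIncl (F : Type*) [Ring F] [Algebra Base F] :
    PowerSeries (PowerSeries F) →+* PowerSeries (PowerSeries (Lift F)) :=
  PowerSeries.map (PowerSeries.map (Lift.incl F).toRingHom)

theorem doubleIncl_C (f : PowerSeries F) : doubleIncl F (PowerSeries.C f) =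
    PowerSeries.C (PowerSeries.map (Lift.incl F).toRingHom f) := by
  rw [doubleIncl, PowerSeries.map_C]

theorem doubleIncl_X : doubleIncl F PowerSeries.X = PowerSeries.X := by
  rw [doubleIncl, PowerSeries.map_X]

theorem doubleIncl_map_C (f : PowerSeries F) :
    doubleIncl F (PowerSeries.map PowerSeries.C f) = PowerSeries.map (constHom F) f := by
  ext1 n
  rw [doubleIncl, PowerSeries.coeff_map, PowerSeries.coeff_map, PowerSeries.coeff_map,
    PowerSeries.map_C]
  rfl

theorem commutator_etaSeries {ι : Type*} [DecidableEq ι] (p : ι → ι → PowerSeries F) (i j : ι)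
    (g : PowerSeries (PowerSeries (Lift F))) :
    PowerSeries.C (etaSeries p i j) * g - g * PowerSeries.C (etaSeries p i j) =
      PowerSeries.C (PowerSeries.C (Lift.eta F)) *
        (PowerSeries.C (PowerSeries.map (Lift.incl F).toRingHom (p i j)) * g -
          g * PowerSeries.C (PowerSeries.map (Lift.incl F).toRingHom (p i j))) := by
  have hc := Subring.mem_center_iff.1 (C_mem_center (C_mem_center (eta_mem_center (A := F)))) g
  have h1 : Commute (PowerSeries.C (if i = j then (1 : PowerSeries (Lift F)) else 0)) g := by
    split_ifs
    · rw [map_one]; exact Commute.one_left _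
    · rw [map_zero]; exact Commute.zero_left _
  rw [etaSeries, map_add, map_mul, add_mul, mul_add, h1.eq, add_sub_add_left_eq_sub, mul_sub,
    ← mul_assoc g, hc, mul_assoc, mul_assoc]

theorem eta_mul_etaSeries {ι : Type*} [DecidableEq ι] {p q : ι → ι → PowerSeries F} {i j : ι}
    (hq : q i j = (if i = j then 1 else 0) + hbar • p i j) :
    PowerSeries.C (Lift.eta F) * PowerSeries.map (Lift.incl F).toRingHom (q i j) =
      PowerSeries.C (Lift.eta F) * etaSeries p i j := by
  rw [hq, etaSeries, map_add, mul_add, mul_add, ← mul_assoc (PowerSeries.C (Lift.eta F)), ← map_mul,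
    Lift.eta_mul_eta, hbar_smul_eq, map_mul, PowerSeries.map_C, ← mul_assoc, ← map_mul]
  congr 2
  · split_ifs <;> simp
  · congr 1
    rw [Algebra.smul_def, Algebra.commutes]
    congr 1
    exact (Lift.incl F).commutes hbar

end ShiftedRelations

end

noncomputable section

section ShiftedRelations

variable {N : ℕ} {F : Type*} [Ring F] [Algebra Base F] [TopologicalSpace F] [PairingAlgebra F]
  {x y : Fin N → Fin N → ℕ → F}

open scoped PowerSeries.WithPiTopology

/-- The series `f(u + z h)` for `f ∈ F[[u]]`, with coefficients in the constants of
`(Lift F)[[·]]`. -/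
def shiftedPlus (z : ℂ) (f : PowerSeries F) : PowerSeries (PowerSeries (Lift F)) :=
  PowerSeries.map (constHom F) (plusShift (algebraMap Base F (hMul z)) f)

/-- The series `f(u + z h)` for `f ∈ F[[u⁻¹]]`, with coefficients in the constants of
`(Lift F)[[·]]`. -/
def shiftedInv (z : ℂ) (f : PowerSeries F) : PowerSeries (PowerSeries (Lift F)) :=
  PowerSeries.map (constHom F) (invShift (algebraMap Base F (hMul z)) f)

/-- The shift of the outer variable. -/
def outerPlus (F : Type*) [Ring F] [Algebra Base F] [TopologicalSpace F] [PairingAlgebra F]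
    (z : ℂ) : PowerSeries (PowerSeries F) →+* PowerSeries (PowerSeries (Lift F)) :=
  (plusShiftHom (isShift_algebraMap (A := PowerSeries (Lift F)) z)).comp (doubleIncl F)

theorem commute_algebraMap {A : Type*} [Ring A] [Algebra Base A] (a : Base) (b : A) :
    Commute (algebraMap Base A a) b := Algebra.commutes a b

/-- The shift of the outer variable. -/
def outerInv (F : Type*) [Ring F] [Algebra Base F]
    (z : ℂ) : PowerSeries (PowerSeries F) →+* PowerSeries (PowerSeries (Lift F)) :=
  (invShiftHom (commute_algebraMap (A := PowerSeries (Lift F)) (hMul z))).comp (doubleIncl F)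

theorem outerPlus_C (z : ℂ) (f : PowerSeries F) : outerPlus F z (PowerSeries.C f) =
    PowerSeries.C (PowerSeries.map (Lift.incl F).toRingHom f) := by
  rw [outerPlus, RingHom.comp_apply, doubleIncl_C, plusShiftHom_C]

theorem outerPlus_X (z : ℂ) : outerPlus F z PowerSeries.X =
    PowerSeries.X + PowerSeries.C (algebraMap Base (PowerSeries (Lift F)) (hMul z)) := by
  rw [outerPlus, RingHom.comp_apply, doubleIncl_X, plusShiftHom_X]

theorem outerPlus_map_C (z : ℂ) (f : PowerSeries F) :
    outerPlus F z (PowerSeries.map PowerSeries.C f) = shiftedPlus z f := by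
  rw [outerPlus, RingHom.comp_apply, doubleIncl_map_C, plusShiftHom_apply, ← constHom_algebraMap,
    plusShift_map _ continuous_constHom (isShift_algebraMap z), shiftedPlus]

theorem outerInv_C (z : ℂ) (f : PowerSeries F) : outerInv F z (PowerSeries.C f) =
    PowerSeries.C (PowerSeries.map (Lift.incl F).toRingHom f) := by
  rw [outerInv, RingHom.comp_apply, doubleIncl_C, invShiftHom_C]

theorem mul_outerInv_X (z : ℂ) :
    (1 + PowerSeries.C (algebraMap Base (PowerSeries (Lift F)) (hMul z)) * PowerSeries.X) *
      outerInv F z PowerSeries.X = PowerSeries.X := by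
  rw [outerInv, RingHom.comp_apply, doubleIncl_X, invShiftHom_apply, one_add_mul_invShift_X]

theorem outerInv_map_C (z : ℂ) (f : PowerSeries F) :
    outerInv F z (PowerSeries.map PowerSeries.C f) = shiftedInv z f := by
  rw [outerInv, RingHom.comp_apply, doubleIncl_map_C, invShiftHom_apply, ← constHom_algebraMap,
    invShift_map, shiftedInv]

theorem incl_C_algebraMap (a : Base) : PowerSeries.map (Lift.incl F).toRingHom
    (PowerSeries.C (algebraMap Base F a)) = algebraMap Base (PowerSeries (Lift F)) a := by
  rw [PowerSeries.map_C, algebraMap_series]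
  congr 1
  exact (Lift.incl F).commutes a

/-- The central element `η` of the double series. -/
def etaC (F : Type*) [Ring F] [Algebra Base F] : PowerSeries (PowerSeries (Lift F)) :=
  PowerSeries.C (PowerSeries.C (Lift.eta F))

theorem etaC_mem_center : etaC F ∈ Subring.center (PowerSeries (PowerSeries (Lift F))) :=
  C_mem_center (C_mem_center eta_mem_center)

theorem hbar_mem_center :
    (PowerSeries.C (algebraMap Base (PowerSeries (Lift F)) hbar) :
      PowerSeries (PowerSeries (Lift F))) ∈ Subring.center _ :=
  C_mem_center (algebraMap_mem_center _)

theorem C_X_mem_center : (PowerSeries.C PowerSeries.X : PowerSeries (PowerSeries (Lift F))) ∈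
    Subring.center _ := C_mem_center X_mem_center

theorem etaC_mul_etaC : etaC F * etaC F =
    PowerSeries.C (algebraMap Base (PowerSeries (Lift F)) hbar) * etaC F := by
  rw [etaC, ← map_mul, ← map_mul, Lift.eta_mul_eta, ← map_mul, algebraMap_series, ← map_mul,
    Algebra.smul_def]

/-- The series `t_{ij}(z)` with `h` replaced by `η`, constant in the outer variable. -/
def etaT (x : Fin N → Fin N → ℕ → F) (i j : Fin N) : PowerSeries (Lift F) :=
  etaSeries (fun i j => tailSeries (x i j)) i j

/-- The series `t⁺_{ij}(z)` with `h` replaced by `η`, constant in the outer variable. -/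
def etaTPlus (y : Fin N → Fin N → ℕ → F) (i j : Fin N) : PowerSeries (Lift F) :=
  etaSeries (fun i j => PowerSeries.mk fun r => -y i j r) i j

theorem etaC_mul_etaT (i j : Fin N) : etaC F * PowerSeries.C (PowerSeries.map
    (Lift.incl F).toRingHom (PowerSeries.mk (tCoeff x i j))) =
      etaC F * PowerSeries.C (etaT x i j) := by
  rw [etaC, ← map_mul, ← map_mul, etaT]
  congr 1
  exact eta_mul_etaSeries (p := fun i j => tailSeries (x i j))
    (q := fun i j => PowerSeries.mk (tCoeff x i j)) (mk_tCoeff x i j)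

theorem etaC_mul_etaTPlus (i j : Fin N) : etaC F * PowerSeries.C (PowerSeries.map
    (Lift.incl F).toRingHom (PowerSeries.mk (tPlusCoeff y i j))) =
      etaC F * PowerSeries.C (etaTPlus y i j) := by
  rw [etaC, ← map_mul, ← map_mul, etaTPlus]
  congr 1
  exact eta_mul_etaSeries (p := fun i j => PowerSeries.mk fun r => -y i j r)
    (q := fun i j => PowerSeries.mk (tPlusCoeff y i j)) (mk_tPlusCoeff y i j)

/-- The relation of `T(v)` and `T⁺(u + z h)`, where `v⁻¹` is the inner and `u` the outer
variable, with `h` replaced by `η` in `T(v)`. -/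
theorem IsCritical.shifted_mixed (hN : 1 ≤ N) (H : IsCritical x y) (z : ℂ) (i j k l : Fin N) :
    let S : Fin N → Fin N → PowerSeries (PowerSeries (Lift F)) := fun i j =>
      PowerSeries.C (etaT x i j)
    let P : Fin N → Fin N → PowerSeries (PowerSeries (Lift F)) := fun i j =>
      shiftedPlus z (PowerSeries.mk (tPlusCoeff y i j))
    let f : Base → PowerSeries (PowerSeries (Lift F)) := fun κ =>
      1 + PowerSeries.C PowerSeries.X * (PowerSeries.C (algebraMap Base _ κ) -
        (PowerSeries.X + PowerSeries.C (algebraMap Base _ (hMul z))))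
    f (hMul (N / 2)) * f (-hMul (N / 2)) * (S i j * P k l - P k l * S i j) =
      f (hMul (N / 2)) * (PowerSeries.C PowerSeries.X * etaC F) * (P i l * S k j) -
      f (-hMul (N / 2)) * (PowerSeries.C PowerSeries.X * etaC F) * (P k j * S i l) -
      (PowerSeries.C PowerSeries.X * etaC F) ^ 2 * (P i j * S k l) := by
  intro S P f
  have hf : ∀ κ, f κ ∈ Subring.center (PowerSeries (PowerSeries (Lift F))) := fun κ =>
    add_mem (one_mem _) (mul_mem C_X_mem_center (sub_mem (C_mem_center (algebraMap_mem_center _))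
      (add_mem X_mem_center (C_mem_center (algebraMap_mem_center _)))))
  have hE := congrArg ((outerPlus F z).comp swapVars) (mixed_relation hN H.mixed i j k l)
  have hfac : ∀ κ : Base, (outerPlus F z).comp swapVars (mixedFactor (algebraMap Base F κ)) =
      f κ := by
    intro κ
    simp only [mixedFactor, map_add, map_one, map_mul, map_sub, RingHom.comp_apply, swapVars_C_C,
      swapVars_C_X, swapVars_X, outerPlus_C, outerPlus_X, incl_C_algebraMap, PowerSeries.map_X, f]
    exact congrArg (1 + ·) (Subring.mem_center_iff.1 C_X_mem_center _)
  have hh : (outerPlus F z).comp swapVars (PowerSeries.C (PowerSeries.C (algebraMap Base F hbar))) =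
      PowerSeries.C (algebraMap Base (PowerSeries (Lift F)) hbar) := by
    rw [RingHom.comp_apply, swapVars_C_C, outerPlus_C, incl_C_algebraMap]
  simp only [map_mul, map_sub, map_pow, hfac, Algebra.smul_def hbar, algebraMap_series] at hE
  rw [hh] at hE
  simp only [RingHom.comp_apply, swapVars_X, swapVars_map_C, outerPlus_C, swapVars_C,
    outerPlus_map_C, PowerSeries.map_X] at hE
  have := mixed_eta_lift (K := Subring.center (PowerSeries (PowerSeries (Lift F))))
    (c := ⟨_, hf (-hMul (N / 2))⟩) (c' := ⟨_, hf (hMul (N / 2))⟩) (u := ⟨_, C_X_mem_center⟩)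
    (h := ⟨_, hbar_mem_center⟩) (e := ⟨_, etaC_mem_center⟩)
    (t := fun i j => PowerSeries.C (PowerSeries.map (Lift.incl F).toRingHom (tailSeries (x i j))))
    (T := fun i j => PowerSeries.C (PowerSeries.map (Lift.incl F).toRingHom
      (PowerSeries.mk (tCoeff x i j)))) (P := P) (Z := S) (Subtype.ext etaC_mul_etaC)
    (fun i j k l => commutator_etaSeries _ i j _) etaC_mul_etaT (i := i) (j := j) (k := k) (l := l)
    (hE.trans (congrArg₂ HSub.hSub rfl (mul_assoc _ _ _).symm))
  exact this

/-- The relation of `T⁺(v)` and `T(u + z h)`, where `v` is the inner and `u⁻¹` the outer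
variable, with `h` replaced by `η` in `T⁺(v)`. -/
theorem IsCritical.shifted_mixed' (hN : 1 ≤ N) (H : IsCritical x y) (z : ℂ) (i j k l : Fin N) :
    let S : Fin N → Fin N → PowerSeries (PowerSeries (Lift F)) := fun i j =>
      PowerSeries.C (etaTPlus y i j)
    let T : Fin N → Fin N → PowerSeries (PowerSeries (Lift F)) := fun i j =>
      shiftedInv z (PowerSeries.mk (tCoeff x i j))
    let f : Base → PowerSeries (PowerSeries (Lift F)) := fun κ =>
      1 + PowerSeries.C (algebraMap Base _ (hMul z)) * PowerSeries.X +
        (PowerSeries.C (algebraMap Base _ κ) - PowerSeries.C PowerSeries.X) * PowerSeries.X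
    f (hMul (N / 2)) * f (-hMul (N / 2)) * (T i j * S k l - S k l * T i j) =
      f (hMul (N / 2)) * (PowerSeries.X * etaC F) * (S i l * T k j) -
      f (-hMul (N / 2)) * (PowerSeries.X * etaC F) * (S k j * T i l) -
      (PowerSeries.X * etaC F) ^ 2 * (S i j * T k l) := by
  intro S T f
  have hf : ∀ κ, f κ ∈ Subring.center (PowerSeries (PowerSeries (Lift F))) := fun κ =>
    add_mem (add_mem (one_mem _) (mul_mem (C_mem_center (algebraMap_mem_center _)) X_mem_center))
      (mul_mem (sub_mem (C_mem_center (algebraMap_mem_center _)) C_X_mem_center) X_mem_center)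
  have ht : PowerSeries.map PowerSeries.C (tailSeries (x i j)) *
        PowerSeries.C (PowerSeries.mk (tPlusCoeff y k l)) -
      PowerSeries.C (PowerSeries.mk (tPlusCoeff y k l)) *
        PowerSeries.map PowerSeries.C (tailSeries (x i j)) =
      PowerSeries.map PowerSeries.C (PowerSeries.mk (tCoeff x i j)) *
        PowerSeries.C (PowerSeries.mk fun r => -y k l r) -
      PowerSeries.C (PowerSeries.mk fun r => -y k l r) *
        PowerSeries.map PowerSeries.C (PowerSeries.mk (tCoeff x i j)) := by
    have e1 : ∀ (p : Prop) [Decidable p] (g : PowerSeries F),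
        Commute (if p then (1 : PowerSeries F) else 0) g := by
      intro p _ g
      split_ifs
      · exact Commute.one_left _
      · exact Commute.zero_left _
    ext1 r
    ext1 s
    simp only [map_sub, coeff_coeff_C_mul_map_C, coeff_coeff_map_C_mul_C]
    rw [mk_tPlusCoeff, mk_tCoeff, map_add, map_add, coeff_base_smul, coeff_base_smul]
    have e2 : ∀ (p : Prop) [Decidable p] (n : ℕ) (g : F),
        Commute (PowerSeries.coeff n (if p then (1 : PowerSeries F) else 0)) g := by
      intro p _ n g
      split_ifs
      · rw [PowerSeries.coeff_one]
        split_ifs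
        · exact Commute.one_left _
        · exact Commute.zero_left _
      · rw [map_zero]; exact Commute.zero_left _
    rw [mul_add, add_mul, mul_add, add_mul, (e2 _ s _).eq, (e2 _ r _).eq, add_sub_add_left_eq_sub,
      add_sub_add_left_eq_sub, mul_smul_comm, smul_mul_assoc, mul_smul_comm, smul_mul_assoc]
  have hE0 := mixed_relation hN H.mixed i j k l
  simp only [ht] at hE0
  have hE1 := congrArg (outerInv F z) hE0
  set q : PowerSeries (PowerSeries (Lift F)) :=
    1 + PowerSeries.C (algebraMap Base _ (hMul z)) * PowerSeries.X with hq
  have hqc : q ∈ Subring.center (PowerSeries (PowerSeries (Lift F))) :=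
    add_mem (one_mem _) (mul_mem (C_mem_center (algebraMap_mem_center _)) X_mem_center)
  have hfac : ∀ κ : Base, q * outerInv F z (mixedFactor (algebraMap Base F κ)) = f κ := by
    intro κ
    simp only [mixedFactor, map_add, map_one, map_mul, map_sub, outerInv_C, incl_C_algebraMap,
      PowerSeries.map_X]
    rw [mul_add, mul_one, ← mul_assoc, ← Subring.mem_center_iff.1 hqc, mul_assoc, hq,
      mul_outerInv_X]
  simp only [map_mul, map_sub, map_pow, Algebra.smul_def hbar, algebraMap_series] at hE1
  simp only [outerInv_C, outerInv_map_C, incl_C_algebraMap] at hE1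
  set a := outerInv F z (mixedFactor (algebraMap Base F (hMul (N / 2)))) with ha
  set b := outerInv F z (mixedFactor (algebraMap Base F (-hMul (N / 2)))) with hb
  set X' := outerInv F z PowerSeries.X with hX'
  have hqX : q * X' = PowerSeries.X := mul_outerInv_X z
  have hqq : ∀ v w, q * (v * w) = v * (q * w) := fun v w => by
    rw [← mul_assoc, ← Subring.mem_center_iff.1 hqc, mul_assoc]
  have hE := congrArg (fun v => q * (q * v)) hE1
  simp only [mul_sub] at hE
  have hE' : f (hMul (N / 2)) * f (-hMul (N / 2)) * (T i j * PowerSeries.C (PowerSeries.map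
      (Lift.incl F).toRingHom (PowerSeries.mk fun r => -y k l r)) - PowerSeries.C (PowerSeries.map
      (Lift.incl F).toRingHom (PowerSeries.mk fun r => -y k l r)) * T i j) =
      f (hMul (N / 2)) * PowerSeries.X * (PowerSeries.C (PowerSeries.map
      (Lift.incl F).toRingHom (PowerSeries.mk (tPlusCoeff y i l))) * T k j) -
      f (-hMul (N / 2)) * PowerSeries.X * (PowerSeries.C (PowerSeries.map
      (Lift.incl F).toRingHom (PowerSeries.mk (tPlusCoeff y k j))) * T i l) -
      PowerSeries.C (algebraMap Base _ hbar) * (PowerSeries.X ^ 2 * (PowerSeries.C (PowerSeries.map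
      (Lift.incl F).toRingHom (PowerSeries.mk (tPlusCoeff y i j))) * T k l)) := by
    rw [mul_sub]
    have e1 : ∀ v, f (hMul (N / 2)) * f (-hMul (N / 2)) * v = q * (q * (a * b * v)) := fun v => by
      rw [← hfac, ← hfac, ← ha, ← hb]
      simp only [mul_assoc]
      rw [← hqq a]
    have e2 : ∀ κ v, f κ * PowerSeries.X * v =
        q * (q * (outerInv F z (mixedFactor (algebraMap Base F κ)) * X' * v)) := fun κ v => by
      rw [← hfac, ← hqX]
      simp only [mul_assoc]
      rw [← hqq (outerInv F z _)]
    have e3 : ∀ v w, v * (PowerSeries.X ^ 2 * w) = q * (q * (v * (X' ^ 2 * w))) := fun v w => by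
      rw [← hqX, pow_two, pow_two, hqq v, hqq v]
      simp only [mul_assoc]
      rw [← hqq X']
    rw [e1, e1, e2, e2, e3]
    exact hE
  have := mixed_eta_lift' (K := Subring.center (PowerSeries (PowerSeries (Lift F))))
    (c := ⟨_, hf (-hMul (N / 2))⟩) (c' := ⟨_, hf (hMul (N / 2))⟩) (u := ⟨_, X_mem_center⟩)
    (h := ⟨_, hbar_mem_center⟩) (e := ⟨_, etaC_mem_center⟩)
    (t := fun i j => PowerSeries.C (PowerSeries.map (Lift.incl F).toRingHom
      (PowerSeries.mk fun r => -y i j r)))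
    (T := fun i j => PowerSeries.C (PowerSeries.map (Lift.incl F).toRingHom
      (PowerSeries.mk (tPlusCoeff y i j)))) (P := T) (Z := S) (Subtype.ext etaC_mul_etaC)
    (fun i j k l => by
      have h1 := commutator_etaSeries (fun i j => PowerSeries.mk fun r => -y i j r) i j (T k l)
      have h2 := congrArg (-·) h1
      simp only [neg_sub, ← mul_neg] at h2
      exact h2) etaC_mul_etaTPlus (i := i) (j := j) (k := k) (l := l)
    (hE'.trans (congrArg₂ HSub.hSub rfl (mul_assoc _ _ _).symm))
  exact this

/-- The relation of `T(v)` and `T(u + z h)`, where `v⁻¹` is the inner and `u⁻¹` the outer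
variable, with `h` replaced by `η` in `T(v)`. -/
theorem IsCritical.shifted_rtt (H : IsCritical x y) (z : ℂ) (i j k l : Fin N) :
    let S : Fin N → Fin N → PowerSeries (PowerSeries (Lift F)) := fun i j =>
      PowerSeries.C (etaT x i j)
    let T : Fin N → Fin N → PowerSeries (PowerSeries (Lift F)) := fun i j =>
      shiftedInv z (PowerSeries.mk (tCoeff x i j))
    (PowerSeries.X - PowerSeries.C PowerSeries.X *
      (1 + PowerSeries.C (algebraMap Base _ (hMul z)) * PowerSeries.X)) *
        (S i j * T k l - T k l * S i j) =
      PowerSeries.X * PowerSeries.C PowerSeries.X * etaC F * (S k j * T i l - T k j * S i l) := by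
  intro S T
  have hE1 := congrArg (outerInv F z) (H.rtt_series i j k l)
  set q : PowerSeries (PowerSeries (Lift F)) :=
    1 + PowerSeries.C (algebraMap Base _ (hMul z)) * PowerSeries.X with hq
  have hqc : q ∈ Subring.center (PowerSeries (PowerSeries (Lift F))) :=
    add_mem (one_mem _) (mul_mem (C_mem_center (algebraMap_mem_center _)) X_mem_center)
  simp only [map_mul, map_sub, outerInv_C, outerInv_map_C, PowerSeries.map_X] at hE1
  have hqX : q * outerInv F z PowerSeries.X = PowerSeries.X := mul_outerInv_X z
  have hE := congrArg (q * ·) hE1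
  simp only [← mul_assoc, hqX, mul_sub q] at hE
  rw [← Subring.mem_center_iff.1 hqc (PowerSeries.C PowerSeries.X)] at hE
  exact rtt_eta_lift (K := Subring.center (PowerSeries (PowerSeries (Lift F))))
    (c := ⟨_, sub_mem X_mem_center (mul_mem C_X_mem_center hqc)⟩)
    (d := ⟨_, mul_mem X_mem_center C_X_mem_center⟩) (e := ⟨_, etaC_mem_center⟩)
    (t := fun i j => PowerSeries.C (PowerSeries.map (Lift.incl F).toRingHom (tailSeries (x i j))))
    (T := fun i j => PowerSeries.C (PowerSeries.map (Lift.incl F).toRingHom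
      (PowerSeries.mk (tCoeff x i j)))) (P := T) (Z := S)
    (fun i j k l => commutator_etaSeries _ i j _) etaC_mul_etaT (i := i) (j := j) (k := k) (l := l)
    hE

/-- The relation of `T⁺(v)` and `T⁺(u + z h)`, where `v` is the inner and `u` the outer
variable, with `h` replaced by `η` in `T⁺(v)`. -/
theorem IsCritical.shifted_rttPlus (H : IsCritical x y) (z : ℂ) (i j k l : Fin N) :
    let S : Fin N → Fin N → PowerSeries (PowerSeries (Lift F)) := fun i j =>
      PowerSeries.C (etaTPlus y i j)
    let P : Fin N → Fin N → PowerSeries (PowerSeries (Lift F)) := fun i j =>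
      shiftedPlus z (PowerSeries.mk (tPlusCoeff y i j))
    (PowerSeries.C PowerSeries.X -
      (PowerSeries.X + PowerSeries.C (algebraMap Base _ (hMul z)))) *
        (S i j * P k l - P k l * S i j) =
      etaC F * (S k j * P i l - P k j * S i l) := by
  intro S P
  have hE := congrArg (outerPlus F z) (H.rttPlus_series i j k l)
  simp only [map_mul, map_sub, outerPlus_C, outerPlus_X, outerPlus_map_C, PowerSeries.map_X] at hE
  have := rtt_eta_lift (K := Subring.center (PowerSeries (PowerSeries (Lift F))))
    (c := ⟨_, sub_mem C_X_mem_center (add_mem X_mem_center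
      (C_mem_center (algebraMap_mem_center (hMul z))))⟩)
    (d := 1) (e := ⟨_, etaC_mem_center⟩)
    (t := fun i j => PowerSeries.C (PowerSeries.map (Lift.incl F).toRingHom
      (PowerSeries.mk fun r => -y i j r)))
    (T := fun i j => PowerSeries.C (PowerSeries.map (Lift.incl F).toRingHom
      (PowerSeries.mk (tPlusCoeff y i j)))) (P := P) (Z := S)
    (fun i j k l => commutator_etaSeries _ i j _) etaC_mul_etaTPlus
    (i := i) (j := j) (k := k) (l := l) (hE.trans (one_smul _ _).symm)
  rw [one_mul] at this
  exact this

end ShiftedRelations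

end

noncomputable section

/-! ### Matrices of series and series of matrices -/

section MatrixSeries

variable {A : Type*} [Ring A] {n : Type*} [Fintype n] [DecidableEq n]

/-- A matrix of power series, as a power series of matrices. -/
def seriesEquiv (n A : Type*) [Ring A] [Fintype n] [DecidableEq n] :
    Matrix n n (PowerSeries A) ≃+* PowerSeries (Matrix n n A) where
  toFun M := PowerSeries.mk fun k => M.map (PowerSeries.coeff k)
  invFun f := Matrix.of fun i j => PowerSeries.mk fun k => PowerSeries.coeff k f i j
  left_inv M := by
    ext i j k
    simp
  right_inv f := by
    ext k i j
    simp
  map_mul' M M' := by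
    ext k i j
    simp only [PowerSeries.coeff_mk, PowerSeries.coeff_mul, Matrix.map_apply, Matrix.mul_apply,
      map_sum, Matrix.sum_apply]
    exact Finset.sum_comm
  map_add' M M' := by
    ext k i j
    simp

theorem coeff_seriesEquiv (M : Matrix n n (PowerSeries A)) (k : ℕ) (i j : n) :
    PowerSeries.coeff k (seriesEquiv n A M) i j = PowerSeries.coeff k (M i j) := by
  simp [seriesEquiv]

theorem coeff_seriesEquiv_symm (f : PowerSeries (Matrix n n A)) (k : ℕ) (i j : n) :
    PowerSeries.coeff k ((seriesEquiv n A).symm f i j) = PowerSeries.coeff k f i j := by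
  simp [seriesEquiv]

theorem coeff_trace_seriesEquiv_symm (f : PowerSeries (Matrix n n A)) (k : ℕ) :
    PowerSeries.coeff k (Matrix.trace ((seriesEquiv n A).symm f)) =
      Matrix.trace (PowerSeries.coeff k f) := by
  simp only [Matrix.trace, Matrix.diag_apply, map_sum, coeff_seriesEquiv_symm]

theorem seriesEquiv_map_C (M : Matrix n n A) :
    seriesEquiv n A (M.map PowerSeries.C) = PowerSeries.C M := by
  ext k i j
  rw [coeff_seriesEquiv, Matrix.map_apply, PowerSeries.coeff_C, PowerSeries.coeff_C]
  split_ifs <;> rfl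

theorem seriesEquiv_scalar_C (a : A) :
    seriesEquiv n A (Matrix.scalar n (PowerSeries.C a)) = PowerSeries.C (Matrix.scalar n a) := by
  rw [← seriesEquiv_map_C]
  congr 1
  ext1 i j
  simp only [Matrix.scalar_apply, Matrix.map_apply, Matrix.diagonal_apply]
  split_ifs <;> simp

theorem seriesEquiv_scalar_X :
    seriesEquiv n A (Matrix.scalar n PowerSeries.X) = PowerSeries.X := by
  ext k i j
  rw [coeff_seriesEquiv, Matrix.scalar_apply, Matrix.diagonal_apply, PowerSeries.coeff_X]
  by_cases h : i = j
  · subst h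
    rw [if_pos rfl, PowerSeries.coeff_X]
    split_ifs <;> simp
  · rw [if_neg h, map_zero]
    split_ifs <;> simp [h]

end MatrixSeries

/-! ### Series with coefficients in the operators on the tensor product -/

section Transport

variable {m N : ℕ} {A : Type*} [Ring A]

/-- The algebra `End (ℂ^N)^{⊗ m} ⊗ End ℂ^N ⊗ A`, where the auxiliary tensor factor `End ℂ^N` is put
into the entries. -/
abbrev AuxMat (m N : ℕ) (A : Type*) : Type _ := TensorMat m N (Matrix (Fin N) (Fin N) A)

/-- The embedding of `End ℂ^N ⊗ End ℂ^N ⊗ A[[u]]`, where the factor `0` becomes the auxiliary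
factor and the factor `1` becomes the `a`-th one. -/
def auxHom (N : ℕ) (A : Type*) [Ring A] (a : Fin m) :
    TwoMat N (PowerSeries A) →+* PowerSeries (AuxMat m N A) :=
  ((PowerSeries.map (slotHom (m := m) a)).comp
    (seriesEquiv (Fin N) (Matrix (Fin N) (Fin N) A)).toRingHom).comp
      (seriesEquiv (Fin N) A).toRingHom.mapMatrix

theorem auxHom_apply (a : Fin m) (Z : TwoMat N (PowerSeries A)) : auxHom N A a Z =
    PowerSeries.map (slotHom a) (seriesEquiv (Fin N) (Matrix (Fin N) (Fin N) A)
      (Z.map (seriesEquiv (Fin N) A))) := rfl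

/-- Scalars, as operators on the tensor product. -/
def auxScalar (m N : ℕ) (A : Type*) [Ring A] : A →+* AuxMat m N A :=
  (Matrix.scalar (Fin m → Fin N)).comp (Matrix.scalar (Fin N))

/-- Operators in the auxiliary tensor factor. -/
def auxLeg (m N : ℕ) (A : Type*) [Ring A] : Matrix (Fin N) (Fin N) A →+* AuxMat m N A :=
  Matrix.scalar (Fin m → Fin N)

/-- The permutation operator of the auxiliary and of the `a`-th tensor factor. -/
def auxFlip (N : ℕ) (A : Type*) [Ring A] (a : Fin m) : AuxMat m N A := slot a (flip N A)

theorem slot_scalar {B : Type*} [Ring B] (a : Fin m) (b : B) :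
    slot a (Matrix.scalar (Fin N) b) = Matrix.scalar (Fin m → Fin N) b := by
  ext f g
  rw [slot_apply, Matrix.scalar_apply, Matrix.scalar_apply, Matrix.diagonal_apply,
    Matrix.diagonal_apply]
  by_cases h : f = g
  · subst h
    simp
  · rw [if_neg h]
    split_ifs with h1 h2
    · exact absurd (funext fun b => if hb : b = a then hb ▸ h2 else h1 b hb) h
    · rfl
    · rfl

theorem auxHom_scalar_C (a : Fin m) (c : A) :
    auxHom N A a (Matrix.scalar _ (Matrix.scalar _ (PowerSeries.C c))) =
      PowerSeries.C (auxScalar m N A c) := by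
  have e : (Matrix.scalar (Fin N) (Matrix.scalar (Fin N) (PowerSeries.C c))).map
      (seriesEquiv (Fin N) A) =
      Matrix.scalar (Fin N) (PowerSeries.C (Matrix.scalar (Fin N) c)) := by
    rw [← seriesEquiv_scalar_C]
    ext1 i j
    simp only [Matrix.map_apply, Matrix.scalar_apply, Matrix.diagonal_apply]
    split_ifs <;> simp
  rw [auxHom_apply, e, seriesEquiv_scalar_C, PowerSeries.map_C, slotHom_apply, slot_scalar]
  rfl

theorem auxHom_scalar_X (a : Fin m) :
    auxHom N A a (Matrix.scalar _ (Matrix.scalar _ PowerSeries.X)) = PowerSeries.X := by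
  have e : (Matrix.scalar (Fin N) (Matrix.scalar (Fin N) (PowerSeries.X : PowerSeries A))).map
      (seriesEquiv (Fin N) A) = Matrix.scalar (Fin N) PowerSeries.X := by
    rw [← seriesEquiv_scalar_X]
    ext1 i j
    simp only [Matrix.map_apply, Matrix.scalar_apply, Matrix.diagonal_apply]
    split_ifs <;> simp
  rw [auxHom_apply, e, seriesEquiv_scalar_X, PowerSeries.map_X]

theorem auxHom_leg0_C (a : Fin m) (T : Matrix (Fin N) (Fin N) A) :
    auxHom N A a (leg0 N (PowerSeries A) (T.map PowerSeries.C)) =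
      PowerSeries.C (auxLeg m N A T) := by
  have e : (leg0 N (PowerSeries A) (T.map PowerSeries.C)).map (seriesEquiv (Fin N) A) =
      Matrix.scalar (Fin N) (PowerSeries.C T) := by
    rw [← seriesEquiv_map_C]
    ext1 i j
    simp only [leg0, Matrix.map_apply, Matrix.scalar_apply, Matrix.diagonal_apply]
    split_ifs <;> simp
  rw [auxHom_apply, e, seriesEquiv_scalar_C, PowerSeries.map_C, slotHom_apply, slot_scalar]
  rfl

theorem auxHom_flip (a : Fin m) : auxHom N A a (flip N (PowerSeries A)) =
    PowerSeries.C (auxFlip N A a) := by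
  have e : (flip N (PowerSeries A)).map (seriesEquiv (Fin N) A) =
      (flip N A).map PowerSeries.C := by
    ext1 i j
    simp only [Matrix.map_apply]
    rw [← seriesEquiv_map_C]
    congr 1
    ext1 k l
    rw [flip_apply, Matrix.map_apply, flip_apply]
    split_ifs <;> simp
  rw [auxHom_apply, e, seriesEquiv_map_C, PowerSeries.map_C, slotHom_apply, auxFlip]

/-- The series `∑ e_{ij} ⊗ w_{ij}(u)` acting in the `a`-th tensor factor. -/
def slotSeries {B : Type*} [Ring B] (a : Fin m) (w : Fin N → Fin N → PowerSeries B) :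
    PowerSeries (TensorMat m N B) :=
  PowerSeries.mk fun k => slot a (Matrix.of fun i j => PowerSeries.coeff k (w i j))

/-- The embedding of the operators with entries in `B` into those with an auxiliary tensor
factor. -/
def auxIncl {B : Type*} [Ring B] (m N : ℕ) (φ : B →+* A) : TensorMat m N B →+* AuxMat m N A :=
  ((Matrix.scalar (Fin N)).comp φ).mapMatrix

theorem auxHom_leg1 {B : Type*} [Ring B] (φ : B →+* A) (a : Fin m)
    (w : Fin N → Fin N → PowerSeries B) :
    auxHom N A a (leg1 N (PowerSeries A) (Matrix.of fun i j => PowerSeries.map φ (w i j))) =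
      PowerSeries.map (auxIncl m N φ) (slotSeries a w) := by
  ext1 k
  rw [auxHom_apply, PowerSeries.coeff_map, PowerSeries.coeff_map, slotSeries, PowerSeries.coeff_mk,
    auxIncl, RingHom.mapMatrix_apply, slot_map, slotHom_apply]
  congr 1
  ext1 i j
  ext p q
  rw [coeff_seriesEquiv, Matrix.map_apply, coeff_seriesEquiv]
  simp only [leg1, RingHom.mapMatrix_apply, Matrix.map_apply, Matrix.of_apply, RingHom.comp_apply,
    Matrix.scalar_apply, Matrix.diagonal_apply]
  split_ifs <;> simp

end Transport

end

noncomputable section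

/-! ### The relations in matrix form -/

section ExchangeAlgebra

variable {K S : Type*} [CommRing K] [Ring S] [Algebra K S] {f f' g e x y : K} {P Z W T Y : S}

theorem mixed_exchange
    (h : (f' * f) • (Z * W - W * Z) = (f' * e) • (P * (W * Z)) - (f * e) • (W * Z * P) -
      e ^ 2 • (P * (W * Z) * P)) :
    (f * f') • (Z * W) = (f • 1 + e • P) * (W * (Z * (f' • 1 - e • P))) := by
  have e1 : (f • 1 + e • P) * (W * (Z * (f' • 1 - e • P))) = (f' * f) • (W * Z) +
      ((f' * e) • (P * (W * Z)) - (f * e) • (W * Z * P) - e ^ 2 • (P * (W * Z) * P)) := by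
    simp only [add_mul, mul_sub, smul_mul_assoc, mul_smul_comm, one_mul, mul_one, smul_add,
      smul_smul, mul_assoc]
    module
  rw [e1, ← h]
  module

theorem rtt_exchange (h : g • (Z * T - T * Z) = e • (P * (Z * T) - T * Z * P)) :
    (g • 1 - e • P) * (Z * T) = T * Z * (g • 1 - e • P) := by
  simp only [sub_mul, mul_sub, smul_mul_assoc, mul_smul_comm, one_mul, mul_one, smul_sub] at h ⊢
  rw [sub_eq_sub_iff_add_eq_add] at h ⊢
  rw [h, add_comm]

theorem rtt_exchange_inverse (h : g • (Z * T - T * Z) = e • (P * (Z * T) - T * Z * P))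
    (h1 : T * Y = 1) (h2 : Y * T = 1) :
    Z * ((g • 1 - e • P) * Y) = Y * ((g • 1 - e • P) * Z) := by
  have h0 := rtt_exchange h
  calc Z * ((g • 1 - e • P) * Y) = Y * T * Z * (g • 1 - e • P) * Y := by
        rw [h2, one_mul, mul_assoc]
    _ = Y * (T * Z * (g • 1 - e • P)) * Y := by simp only [mul_assoc]
    _ = Y * ((g • 1 - e • P) * Z) * (T * Y) := by rw [← h0]; simp only [mul_assoc]
    _ = _ := by rw [h1, mul_one]

theorem smul_add_mul_smul_sub (hP : P * P = 1) :
    (g • 1 + e • P) * (g • 1 - e • P) = (g ^ 2 - e ^ 2) • (1 : S) := by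
  simp only [add_mul, mul_sub, smul_mul_assoc, mul_smul_comm, one_mul, mul_one, hP]
  module

theorem rtt_exchange_mul (h : g • (Z * T - T * Z) = e • (P * (Z * T) - T * Z * P))
    (hP : P * P = 1) :
    (g ^ 2 - e ^ 2) • (Z * T) = (g • 1 + e • P) * (T * (Z * (g • 1 - e • P))) := by
  rw [← mul_assoc T, ← rtt_exchange h, ← mul_assoc, smul_add_mul_smul_sub hP, smul_mul_assoc,
    one_mul]

theorem mixed_exchange_inverse
    (h : (y * x) • (T * Z - Z * T) = -((y * e) • (P * (Z * T))) + (x * e) • (Z * T * P) -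
      e ^ 2 • (P * (Z * T) * P)) (hP : P * P = 1) (h1 : T * Y = 1) (h2 : Y * T = 1) :
    (x * y) • (Z * ((y • 1 - e • P) * Y)) = (y ^ 2 - e ^ 2) • (Y * ((x • 1 - e • P) * Z)) := by
  -- the mixed relation, with its two `R`-matrices on the two sides of `Z T`
  have h0 : (x * y) • (T * Z) = (x • 1 - e • P) * (Z * T) * (y • 1 + e • P) := by
    have e1 : (x • 1 - e • P) * (Z * T) * (y • 1 + e • P) = (y * x) • (Z * T) +
        (-((y * e) • (P * (Z * T))) + (x * e) • (Z * T * P) - e ^ 2 • (P * (Z * T) * P)) := by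
      simp only [sub_mul, mul_add, smul_mul_assoc, mul_smul_comm, one_mul, mul_one,
        smul_sub, smul_smul, mul_assoc]
      module
    rw [e1, ← h]
    module
  calc (x * y) • (Z * ((y • 1 - e • P) * Y))
      = Y * ((x * y) • (T * Z)) * ((y • 1 - e • P) * Y) := by
        rw [mul_smul_comm, ← mul_assoc Y, h2, one_mul, smul_mul_assoc]
    _ = Y * ((x • 1 - e • P) * (Z * T)) * ((y • 1 + e • P) * (y • 1 - e • P)) * Y := by
        rw [h0]; simp only [mul_assoc]
    _ = (y ^ 2 - e ^ 2) • (Y * ((x • 1 - e • P) * Z) * (T * Y)) := by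
        rw [smul_add_mul_smul_sub hP, mul_smul_comm, mul_one, smul_mul_assoc]
        simp only [mul_assoc]
    _ = _ := by rw [h1, mul_one]

end ExchangeAlgebra

section TwoMatRelations

variable {N : ℕ} {G : Type*} [Ring G] {Z W : Matrix (Fin N) (Fin N) G}

/-- Scalars in `End ℂ^N ⊗ End ℂ^N ⊗ G`. -/
def twoScalar (N : ℕ) (G : Type*) [Ring G] : G →+* TwoMat N G :=
  (Matrix.scalar (Fin N)).comp (Matrix.scalar (Fin N))

theorem twoScalar_mul_apply (c : G) (M : TwoMat N G) (k l i j : Fin N) :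
    (twoScalar N G c * M) k l i j = c * M k l i j := by
  simp only [twoScalar, RingHom.comp_apply, Matrix.scalar_apply]
  rw [Matrix.diagonal_mul, Matrix.diagonal_mul]

theorem mixed_matrix {f f' e : G}
    (h : ∀ i j k l, f' * f * (Z i j * W k l - W k l * Z i j) = f' * e * (W i l * Z k j) -
      f * e * (W k j * Z i l) - e ^ 2 * (W i j * Z k l)) :
    twoScalar N G (f' * f) * (leg0 N G Z * leg1 N G W - leg1 N G W * leg0 N G Z) =
      twoScalar N G (f' * e) * (flip N G * (leg1 N G W * leg0 N G Z)) -
      twoScalar N G (f * e) * (leg1 N G W * leg0 N G Z * flip N G) -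
      twoScalar N G (e ^ 2) * (flip N G * (leg1 N G W * leg0 N G Z) * flip N G) := by
  ext k l i j
  simp only [Matrix.sub_apply, twoScalar_mul_apply, leg0_mul_leg1_apply, leg1_mul_leg0_apply,
    flip_mul_apply, mul_flip_apply]
  exact h i j k l

theorem mixed_matrix' {f f' e : G}
    (h : ∀ i j k l, f' * f * (W i j * Z k l - Z k l * W i j) = f' * e * (Z i l * W k j) -
      f * e * (Z k j * W i l) - e ^ 2 * (Z i j * W k l)) :
    twoScalar N G (f' * f) * (leg1 N G W * leg0 N G Z - leg0 N G Z * leg1 N G W) =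
      twoScalar N G (f' * e) * (flip N G * (leg0 N G Z * leg1 N G W)) -
      twoScalar N G (f * e) * (leg0 N G Z * leg1 N G W * flip N G) -
      twoScalar N G (e ^ 2) * (flip N G * (leg0 N G Z * leg1 N G W) * flip N G) := by
  ext k l i j
  simp only [Matrix.sub_apply, twoScalar_mul_apply, leg0_mul_leg1_apply, leg1_mul_leg0_apply,
    flip_mul_apply, mul_flip_apply]
  exact h k l i j

theorem rtt_matrix {g e : G}
    (h : ∀ i j k l, g * (Z i j * W k l - W k l * Z i j) =
      e * (Z k j * W i l - W k j * Z i l)) :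
    twoScalar N G g * (leg0 N G Z * leg1 N G W - leg1 N G W * leg0 N G Z) =
      twoScalar N G e * (flip N G * (leg0 N G Z * leg1 N G W) -
        leg1 N G W * leg0 N G Z * flip N G) := by
  ext k l i j
  simp only [Matrix.sub_apply, twoScalar_mul_apply, leg0_mul_leg1_apply, leg1_mul_leg0_apply,
    flip_mul_apply, mul_flip_apply]
  exact h i j k l

end TwoMatRelations

section Exchange

open Polynomial

/-- The polynomial `α - β u`. -/
def lin {K : Type*} [CommRing K] (α β : K) : K[X] := C α - C β * X

theorem reflect_lin {K : Type*} [CommRing K] (α β : K) :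
    (lin α β).reflect 1 = C α * X - C β := by
  have h1 := reflect_C_mul_X_pow 1 1 (c := β)
  rw [revAt_le le_rfl, pow_one, Nat.sub_self, pow_zero, mul_one] at h1
  rw [lin, reflect_sub, reflect_C, h1, pow_one]

theorem natDegree_lin_le {K : Type*} [CommRing K] (α β : K) : (lin α β).natDegree ≤ 1 := by
  rw [lin]
  compute_degree

theorem reflect_lin_mul_lin {K : Type*} [CommRing K] (α β α' β' : K) :
    (lin α β * lin α' β').reflect 2 = (lin α β).reflect 1 * (lin α' β').reflect 1 :=
  reflect_mul _ _ (natDegree_lin_le _ _) (natDegree_lin_le _ _)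

variable {m N : ℕ} {A : Type*} [Ring A]

/-- A polynomial, as a power series. -/
abbrev toSeries (R : Type*) [Ring R] : R[X] →+* PowerSeries R := coeToPowerSeries.ringHom

/-- A polynomial with central scalar coefficients, as a polynomial with operator coefficients. -/
def scalarPoly (m N : ℕ) (A : Type*) [Ring A] : (Subring.center A)[X] →+* (AuxMat m N A)[X] :=
  mapRingHom ((auxScalar m N A).comp (Subring.center A).subtype)

/-- The operator `ε P`, where `P` is the permutation operator of the auxiliary and of the `a`-th
tensor factor. -/
def scaledFlip (N : ℕ) (ε : Subring.center A) (a : Fin m) : AuxMat m N A :=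
  auxScalar m N A ε * auxFlip N A a

/-- The polynomial `α - β u + ε P`, where `P` is the permutation operator of the auxiliary and of
the `a`-th tensor factor. -/
def linFlip (N : ℕ) (α β ε : Subring.center A) (a : Fin m) : (AuxMat m N A)[X] :=
  scalarPoly m N A (lin α β) + C (scaledFlip N ε a)

/-- The relations by which an operator `T` in the auxiliary tensor factor passes through the series
`X(u)` and `Y(u⁻¹)` acting in another tensor factor: `q T X = L X T R'` and `p T R' Y = r Y R T`.
In the second relation, which is one between series in `u⁻¹`, the polynomials are divided by
powers of `u` not less than their degrees. -/
structure IsExchange (T : AuxMat m N A) (X Y : PowerSeries (AuxMat m N A))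
    (q p r : (Subring.center A)[X]) (L R' R : (AuxMat m N A)[X]) : Prop where
  left : toSeries _ (scalarPoly m N A q) * (PowerSeries.C T * X) =
    toSeries _ L * (X * (PowerSeries.C T * toSeries _ R'))
  right : toSeries _ (scalarPoly m N A (p.reflect 2)) *
      (PowerSeries.C T * (toSeries _ (R'.reflect 1) * Y)) =
    toSeries _ (scalarPoly m N A (r.reflect 2)) *
      (Y * (toSeries _ (R.reflect 1) * PowerSeries.C T))

theorem auxScalar_mem_center {a : A} (ha : a ∈ Subring.center A) :
    auxScalar m N A a ∈ Subring.center (AuxMat m N A) :=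
  scalar_mem_center (scalar_mem_center ha)

theorem toSeries_scalarPoly_mem_center (q : (Subring.center A)[X]) :
    toSeries _ (scalarPoly m N A q) ∈ Subring.center (PowerSeries (AuxMat m N A)) := by
  induction q using Polynomial.induction_on' with
  | add p q hp hq => rw [map_add, map_add]; exact add_mem hp hq
  | monomial n a =>
    rw [← C_mul_X_pow_eq_monomial, map_mul, map_mul, map_pow, map_pow, scalarPoly,
      coe_mapRingHom, map_C, map_X, coeToPowerSeries.ringHom_apply, coeToPowerSeries.ringHom_apply,
      coe_C, coe_X]
    exact mul_mem (C_mem_center (auxScalar_mem_center a.2)) (pow_mem X_mem_center n)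

theorem auxHom_twoScalar (a : Fin m) (q : (Subring.center A)[X]) :
    auxHom N A a (twoScalar N _ (toSeries A (mapRingHom (Subring.center A).subtype q))) =
      toSeries _ (scalarPoly m N A q) := by
  have : ((auxHom N A a).comp (twoScalar N _)).comp ((toSeries A).comp
      (mapRingHom (Subring.center A).subtype)) = (toSeries _).comp (scalarPoly m N A) := by
    refine Polynomial.ringHom_ext (fun c => ?_) ?_
    · simp only [RingHom.comp_apply, scalarPoly, coe_mapRingHom, map_C,
        coeToPowerSeries.ringHom_apply, coe_C]
      exact auxHom_scalar_C _ _
    · simp only [RingHom.comp_apply, scalarPoly, coe_mapRingHom, map_X,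
        coeToPowerSeries.ringHom_apply, coe_X]
      exact auxHom_scalar_X _
  exact RingHom.congr_fun this q

theorem toSeries_linFlip (α β ε : Subring.center A) (a : Fin m) :
    toSeries _ (linFlip N α β ε a) = toSeries _ (scalarPoly m N A (lin α β)) +
      toSeries _ (scalarPoly m N A (C ε)) * PowerSeries.C (auxFlip N A a) := by
  rw [linFlip, map_add, coeToPowerSeries.ringHom_apply (φ := C _), coe_C, scaledFlip, map_mul,
    scalarPoly, coe_mapRingHom, map_C, coeToPowerSeries.ringHom_apply (φ := C _), coe_C]
  rfl

theorem scalarPoly_reflect (q : (Subring.center A)[X]) (n : ℕ) :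
    (scalarPoly m N A q).reflect n = scalarPoly m N A (q.reflect n) := by
  rw [scalarPoly, coe_mapRingHom, reflect_map]

theorem toSeries_reflect_linFlip (α β ε : Subring.center A) (a : Fin m) :
    toSeries _ ((linFlip N α β ε a).reflect 1) =
      toSeries _ (scalarPoly m N A ((lin α β).reflect 1)) +
      toSeries _ (scalarPoly m N A (C ε * X)) * PowerSeries.C (auxFlip N A a) := by
  rw [linFlip, reflect_add, reflect_C, map_add, scalarPoly_reflect, map_mul, map_mul, map_mul,
    coeToPowerSeries.ringHom_apply (φ := C _), coe_C, scaledFlip, map_mul, scalarPoly,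
    coe_mapRingHom, map_C, coeToPowerSeries.ringHom_apply (φ := C _), coe_C, pow_one, map_X,
    coeToPowerSeries.ringHom_apply (φ := X), coe_X]
  rw [mul_assoc, mul_assoc, PowerSeries.X_mul]
  rfl

theorem auxFlip_mul_auxFlip (a : Fin m) : auxFlip N A a * auxFlip N A a = 1 := by
  rw [auxFlip, ← slotHom_apply, ← map_mul, flip_mul_flip, map_one]

end Exchange

end

noncomputable section

open Polynomial

/-! ### The exchange relations -/

section Exchange

variable {m N : ℕ} {A : Type*} [Ring A]

/-- Polynomials with central coefficients, as power series. -/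
def centerSeries (A : Type*) [Ring A] : (Subring.center A)[X] →+* PowerSeries A :=
  (toSeries A).comp (mapRingHom (Subring.center A).subtype)

theorem centerSeries_C (c : Subring.center A) : centerSeries A (C c) = PowerSeries.C (c : A) := by
  simp only [centerSeries, RingHom.comp_apply, coe_mapRingHom, map_C,
    coeToPowerSeries.ringHom_apply, coe_C]
  rfl

theorem centerSeries_X : centerSeries A X = PowerSeries.X := by
  simp only [centerSeries, RingHom.comp_apply, coe_mapRingHom, map_X,
    coeToPowerSeries.ringHom_apply, coe_X]

variable {Z : Matrix (Fin N) (Fin N) A} {W V : Matrix (Fin N) (Fin N) (PowerSeries A)} {a : Fin m}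
  {Y : PowerSeries (AuxMat m N A)} {α α' β ε : Subring.center A}

/-- `A[[u]]` as an algebra over the polynomials with central scalar coefficients. -/
@[reducible]
def scalarAlgebra (m N : ℕ) (A : Type*) [Ring A] :
    Algebra (Subring.center A)[X] (PowerSeries (AuxMat m N A)) :=
  ((toSeries _).comp (scalarPoly m N A)).toAlgebra' fun q x =>
    (Subring.mem_center_iff.1 (toSeries_scalarPoly_mem_center q) x).symm

theorem auxHom_centerSeries (q : (Subring.center A)[X]) (Q : TwoMat N (PowerSeries A)) :
    auxHom N A a (twoScalar N _ (centerSeries A q) * Q) =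
      toSeries _ (scalarPoly m N A q) * auxHom N A a Q := by
  rw [map_mul, centerSeries, RingHom.comp_apply, auxHom_twoScalar]

/-- The exchange relations of the series `T(v)` with `T⁺(u + h k)` and `T(u + h k - h N / 2)⁻¹`. -/
theorem isExchange_of_mixed_of_rtt
    (hW : ∀ i j k l, centerSeries A (lin α' β) * centerSeries A (lin α β) *
      (PowerSeries.C (Z i j) * W k l - W k l * PowerSeries.C (Z i j)) =
        centerSeries A (lin α' β) * centerSeries A (C ε) * (W i l * PowerSeries.C (Z k j)) -
        centerSeries A (lin α β) * centerSeries A (C ε) * (W k j * PowerSeries.C (Z i l)) -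
        centerSeries A (C ε) ^ 2 * (W i j * PowerSeries.C (Z k l)))
    (hV : ∀ i j k l, centerSeries A ((lin α' β).reflect 1) *
      (PowerSeries.C (Z i j) * V k l - V k l * PowerSeries.C (Z i j)) =
        centerSeries A (C ε * X) * (PowerSeries.C (Z k j) * V i l - V k j * PowerSeries.C (Z i l)))
    (h1 : auxHom N A a (leg1 N _ V) * Y = 1) (h2 : Y * auxHom N A a (leg1 N _ V) = 1) :
    IsExchange (auxLeg m N A Z) (auxHom N A a (leg1 N _ W)) Y (lin α β * lin α' β) 1 1
      (linFlip N α β ε a) (linFlip N α' β (-ε) a) (linFlip N α' β (-ε) a) where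
  left := by
    let := scalarAlgebra m N A
    have e := congrArg (auxHom N A a) (mixed_matrix (Z := Z.map PowerSeries.C) (W := W)
      (by simpa only [Matrix.map_apply] using hW))
    simp only [← map_mul (centerSeries A), ← map_pow (centerSeries A), map_sub (auxHom N A a),
      auxHom_centerSeries] at e
    simp only [map_mul (auxHom N A a), auxHom_leg0_C, auxHom_flip] at e
    have key := mixed_exchange (K := (Subring.center A)[X]) e
    refine key.trans ?_
    rw [toSeries_linFlip, toSeries_linFlip, C_neg, map_neg, map_neg, neg_mul, ← sub_eq_add_neg]
    simp only [Algebra.smul_def, mul_one]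
    rfl
  right := by
    let := scalarAlgebra m N A
    have e := congrArg (auxHom N A a) (rtt_matrix (Z := Z.map PowerSeries.C) (W := V)
      (by simpa only [Matrix.map_apply] using hV))
    simp only [map_sub (auxHom N A a),
      auxHom_centerSeries] at e
    simp only [map_mul (auxHom N A a), auxHom_leg0_C, auxHom_flip] at e
    have key := rtt_exchange_inverse (K := (Subring.center A)[X]) e h1 h2
    refine congrArg (_ * ·) ?_
    rw [toSeries_reflect_linFlip, C_neg, neg_mul, map_neg, map_neg, neg_mul, ← sub_eq_add_neg]
    simp only [Algebra.smul_def, mul_one] at key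
    exact key

/-- The exchange relations of the series `T⁺(v)` with `T⁺(u + h k)` and
`T(u + h k - h N / 2)⁻¹`. -/
theorem isExchange_of_rtt_of_mixed
    (hW : ∀ i j k l, centerSeries A (lin α β) *
      (PowerSeries.C (Z i j) * W k l - W k l * PowerSeries.C (Z i j)) =
        centerSeries A (C ε) * (PowerSeries.C (Z k j) * W i l - W k j * PowerSeries.C (Z i l)))
    (hV : ∀ i j k l, centerSeries A ((lin α β).reflect 1) *
      centerSeries A ((lin α' β).reflect 1) *
      (V i j * PowerSeries.C (Z k l) - PowerSeries.C (Z k l) * V i j) =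
        -(centerSeries A ((lin α β).reflect 1) * centerSeries A (C ε * X) *
          (PowerSeries.C (Z i l) * V k j)) +
        centerSeries A ((lin α' β).reflect 1) * centerSeries A (C ε * X) *
          (PowerSeries.C (Z k j) * V i l) -
        centerSeries A (C ε * X) ^ 2 * (PowerSeries.C (Z i j) * V k l))
    (h1 : auxHom N A a (leg1 N _ V) * Y = 1) (h2 : Y * auxHom N A a (leg1 N _ V) = 1) :
    IsExchange (auxLeg m N A Z) (auxHom N A a (leg1 N _ W)) Y (lin α β ^ 2 - C ε ^ 2)
      (lin α' β * lin α β) (lin α β ^ 2 - C ε ^ 2)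
      (linFlip N α β ε a) (linFlip N α β (-ε) a) (linFlip N α' β (-ε) a) where
  left := by
    let := scalarAlgebra m N A
    have e := congrArg (auxHom N A a) (rtt_matrix (Z := Z.map PowerSeries.C) (W := W)
      (by simpa only [Matrix.map_apply] using hW))
    simp only [map_sub (auxHom N A a),
      auxHom_centerSeries] at e
    simp only [map_mul (auxHom N A a), auxHom_leg0_C, auxHom_flip] at e
    have hP : PowerSeries.C (auxFlip N A a) * PowerSeries.C (auxFlip N A a) = 1 := by
      rw [← map_mul, auxFlip_mul_auxFlip, map_one]
    have key := rtt_exchange_mul (K := (Subring.center A)[X]) e hP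
    refine key.trans ?_
    rw [toSeries_linFlip, toSeries_linFlip, C_neg, map_neg, map_neg, neg_mul, ← sub_eq_add_neg]
    simp only [Algebra.smul_def, mul_one]
    rfl
  right := by
    let := scalarAlgebra m N A
    have e := congrArg (auxHom N A a) (mixed_matrix' (Z := Z.map PowerSeries.C) (W := V)
      (f := -centerSeries A ((lin α' β).reflect 1)) (f' := -centerSeries A ((lin α β).reflect 1))
      (e := centerSeries A (C ε * X)) (by
        intro i j k l
        rw [Matrix.map_apply, Matrix.map_apply, Matrix.map_apply, Matrix.map_apply, neg_mul_neg, hV]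
        simp only [neg_mul]
        abel))
    rw [neg_mul_neg, neg_mul, neg_mul, map_neg (twoScalar N _), map_neg (twoScalar N _), neg_mul,
      neg_mul, sub_neg_eq_add] at e
    simp only [← map_mul (centerSeries A), ← map_pow (centerSeries A), map_sub (auxHom N A a),
      map_neg (auxHom N A a), map_add (auxHom N A a), auxHom_centerSeries] at e
    simp only [map_mul (auxHom N A a), auxHom_leg0_C, auxHom_flip] at e
    have hP : PowerSeries.C (auxFlip N A a) * PowerSeries.C (auxFlip N A a) = 1 := by
      rw [← map_mul, auxFlip_mul_auxFlip, map_one]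
    have key := mixed_exchange_inverse (K := (Subring.center A)[X]) e hP h1 h2
    have hq : (lin α β ^ 2 - C ε ^ 2).reflect 2 = (lin α β).reflect 1 ^ 2 - (C ε * X) ^ 2 := by
      rw [pow_two, pow_two, reflect_sub, reflect_lin_mul_lin, ← C_mul, reflect_C, C_mul]
      ring
    rw [hq, reflect_lin_mul_lin, toSeries_reflect_linFlip, toSeries_reflect_linFlip, C_neg, neg_mul,
      map_neg, map_neg, neg_mul, ← sub_eq_add_neg, ← sub_eq_add_neg]
    simp only [Algebra.smul_def, mul_one] at key
    exact key

end Exchange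

section Critical

variable {m N : ℕ} {F : Type*} [Ring F] [Algebra Base F] [TopologicalSpace F] [PairingAlgebra F]
  {x y : Fin N → Fin N → ℕ → F}

open scoped PowerSeries.WithPiTopology

/-- An element of `ℂ[[h]]`, as a central element. -/
def cBase (F : Type*) [Ring F] [Algebra Base F] (b : Base) :
    Subring.center (PowerSeries (Lift F)) :=
  ⟨algebraMap Base _ b, algebraMap_mem_center b⟩

/-- The element `η`, as a central element. -/
def cEta (F : Type*) [Ring F] [Algebra Base F] : Subring.center (PowerSeries (Lift F)) :=
  ⟨PowerSeries.C (Lift.eta F), C_mem_center eta_mem_center⟩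

/-- The variable, as a central element. -/
def cX (F : Type*) [Ring F] [Algebra Base F] : Subring.center (PowerSeries (Lift F)) :=
  ⟨PowerSeries.X, X_mem_center⟩

theorem cBase_add (b b' : Base) : cBase F (b + b') = cBase F b + cBase F b' :=
  Subtype.ext (map_add _ _ _)

theorem cBase_neg (b : Base) : cBase F (-b) = -cBase F b :=
  Subtype.ext (map_neg _ _)

theorem cEta_mul_cEta : cEta F * cEta F = cBase F hbar * cEta F := by
  refine Subtype.ext ?_
  change PowerSeries.C (Lift.eta F) * PowerSeries.C (Lift.eta F) =
    algebraMap Base (PowerSeries (Lift F)) hbar * PowerSeries.C (Lift.eta F)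
  rw [← map_mul, Lift.eta_mul_eta, algebraMap_series, ← map_mul, Algebra.smul_def]

theorem hMul_add (z w : ℂ) : hMul (z + w) = hMul z + hMul w := by
  simp only [hMul, map_add, add_mul]

theorem hMul_neg (z : ℂ) : hMul (-z) = -hMul z := by
  simp only [hMul, map_neg, neg_mul]

/-- The series `T⁺_a(u + z h)`. -/
def plusSlot (y : Fin N → Fin N → ℕ → F) (a : Fin m) (z : ℂ) : PowerSeries (TensorMat m N F) :=
  slotSeries a fun i j => plusShift (algebraMap Base F (hMul z)) (PowerSeries.mk (tPlusCoeff y i j))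

/-- The series `T_a(u + z h)`. -/
def invSlot (x : Fin N → Fin N → ℕ → F) (a : Fin m) (z : ℂ) : PowerSeries (TensorMat m N F) :=
  slotSeries a fun i j => invShift (algebraMap Base F (hMul z)) (PowerSeries.mk (tCoeff x i j))

/-- The embedding of series of operators over `F`. -/
def seriesIncl (m N : ℕ) (F : Type*) [Ring F] [Algebra Base F] :
    PowerSeries (TensorMat m N F) →+* PowerSeries (AuxMat m N (PowerSeries (Lift F))) :=
  PowerSeries.map (auxIncl m N (constHom F))

/-- The series `1 + η ∑ t^{(r)} v⁻ʳ` passes through `T⁺_a(u + z h)` by the mixed relation and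
through `T_a(u + (z - N/2) h)⁻¹` by the `RTT` relation. The variable `cX` stands for `v⁻¹`, so that
the polynomials are those in `v - u`, divided by `v`. -/
theorem isExchange_etaT (hN : 1 ≤ N) (H : IsCritical x y) (a : Fin m) (z : ℂ)
    {Y : PowerSeries (TensorMat m N F)} (h1 : invSlot x a (z - N / 2) * Y = 1)
    (h2 : Y * invSlot x a (z - N / 2) = 1) :
    let α := 1 - cX F * cBase F (hMul (N / 2) + hMul z)
    let α' := 1 - cX F * cBase F (-hMul (N / 2) + hMul z)
    let ε := cEta F * cX F
    IsExchange (auxLeg m N _ (Matrix.of (etaT x))) (seriesIncl m N F (plusSlot y a z))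
      (seriesIncl m N F Y) (lin α (cX F) * lin α' (cX F)) 1 1 (linFlip N α (cX F) ε a)
      (linFlip N α' (cX F) (-ε) a) (linFlip N α' (cX F) (-ε) a) := by
  intro α α' ε
  rw [seriesIncl, plusSlot, ← auxHom_leg1]
  -- the scalar series of the relations, as values of polynomials with central coefficients
  have hC : ∀ b : Base, PowerSeries.C (algebraMap Base (PowerSeries (Lift F)) b) =
      centerSeries _ (C (cBase F b)) := fun b => by rw [centerSeries_C]; rfl
  have hX : PowerSeries.C (PowerSeries.X : PowerSeries (Lift F)) = centerSeries _ (C (cX F)) := by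
    rw [centerSeries_C]; rfl
  have hη : etaC F = centerSeries _ (C (cEta F)) := by rw [centerSeries_C]; rfl
  refine isExchange_of_mixed_of_rtt (V := Matrix.of fun i j => PowerSeries.map (constHom F)
    (invShift (algebraMap Base F (hMul (z - N / 2))) (PowerSeries.mk (tCoeff x i j)))) ?_ ?_ ?_ ?_
  · intro i j k l
    have e := H.shifted_mixed hN z i j k l
    simp only [hC, hX, hη, ← centerSeries_X (A := PowerSeries (Lift F)),
      ← map_one (centerSeries (PowerSeries (Lift F))),
      ← map_mul (centerSeries (PowerSeries (Lift F))),
      ← map_add (centerSeries (PowerSeries (Lift F))),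
      ← map_sub (centerSeries (PowerSeries (Lift F))),
      ← map_pow (centerSeries (PowerSeries (Lift F)))] at e
    have e1 : ∀ b, 1 + C (cX F) * (C (cBase F b) - (X + C (cBase F (hMul z)))) =
        lin (1 - cX F * cBase F (-b + hMul z)) (cX F) := fun b => by
      rw [lin, cBase_add, cBase_neg]
      simp only [map_sub, map_mul, map_one, map_add, map_neg]
      ring
    rw [e1, e1, neg_neg] at e
    simp only [← map_mul (centerSeries (PowerSeries (Lift F))),
      ← map_pow (centerSeries (PowerSeries (Lift F)))]
    rw [show C ε = C (cX F) * C (cEta F) by rw [mul_comm, ← C_mul]]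
    exact e
  · intro i j k l
    have e := H.shifted_rtt (z - N / 2) i j k l
    simp only [hC, hX, hη, ← centerSeries_X (A := PowerSeries (Lift F)),
      ← map_one (centerSeries (PowerSeries (Lift F))),
      ← map_mul (centerSeries (PowerSeries (Lift F))),
      ← map_add (centerSeries (PowerSeries (Lift F))),
      ← map_sub (centerSeries (PowerSeries (Lift F)))] at e
    have e1 : X - C (cX F) * (1 + C (cBase F (hMul (z - N / 2))) * X) =
        (lin α' (cX F)).reflect 1 := by
      rw [reflect_lin, sub_eq_add_neg z, hMul_add, hMul_neg, cBase_add]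
      simp only [α', cBase_add, map_sub, map_mul, map_one, map_add]
      ring
    have e2 : X * C (cX F) * C (cEta F) = C ε * X := by
      simp only [ε, map_mul]
      ring
    rw [e1, e2] at e
    exact e
  · rw [auxHom_leg1, ← map_mul]
    exact (congrArg _ h1).trans (map_one _)
  · rw [auxHom_leg1, ← map_mul]
    exact (congrArg _ h2).trans (map_one _)

/-- The series `1 - η ∑ t^{(-r)} vʳ⁻¹` passes through `T⁺_a(u + z h)` by the `RTT` relation and
through `T_a(u + (z - N/2) h)⁻¹` by the mixed relation. The variable `cX` stands for `v`. -/
theorem isExchange_etaTPlus (hN : 1 ≤ N) (H : IsCritical x y) (a : Fin m) (z : ℂ)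
    {Y : PowerSeries (TensorMat m N F)} (h1 : invSlot x a (z - N / 2) * Y = 1)
    (h2 : Y * invSlot x a (z - N / 2) = 1) :
    let α := cX F - cBase F (hMul z)
    let α' := cX F - cBase F (hMul z) + cBase F (hMul N)
    let ε := cEta F
    IsExchange (auxLeg m N _ (Matrix.of (etaTPlus y))) (seriesIncl m N F (plusSlot y a z))
      (seriesIncl m N F Y) (lin α 1 ^ 2 - C ε ^ 2) (lin α' 1 * lin α 1) (lin α 1 ^ 2 - C ε ^ 2)
      (linFlip N α 1 ε a) (linFlip N α 1 (-ε) a) (linFlip N α' 1 (-ε) a) := by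
  intro α α' ε
  rw [seriesIncl, plusSlot, ← auxHom_leg1]
  have hC : ∀ b : Base, PowerSeries.C (algebraMap Base (PowerSeries (Lift F)) b) =
      centerSeries _ (C (cBase F b)) := fun b => by rw [centerSeries_C]; rfl
  have hX : PowerSeries.C (PowerSeries.X : PowerSeries (Lift F)) = centerSeries _ (C (cX F)) := by
    rw [centerSeries_C]; rfl
  have hη : etaC F = centerSeries _ (C (cEta F)) := by rw [centerSeries_C]; rfl
  refine isExchange_of_rtt_of_mixed (V := Matrix.of fun i j => PowerSeries.map (constHom F)
    (invShift (algebraMap Base F (hMul (z - N / 2))) (PowerSeries.mk (tCoeff x i j)))) ?_ ?_ ?_ ?_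
  · intro i j k l
    have e := H.shifted_rttPlus z i j k l
    simp only [hC, hX, hη, ← centerSeries_X (A := PowerSeries (Lift F)),
      ← map_add (centerSeries (PowerSeries (Lift F))),
      ← map_sub (centerSeries (PowerSeries (Lift F)))] at e
    have e1 : C (cX F) - (X + C (cBase F (hMul z))) = lin α 1 := by
      simp only [lin, α, map_sub, map_one]
      ring
    rw [e1] at e
    exact e
  · intro i j k l
    have e := H.shifted_mixed' hN (z - N / 2) i j k l
    simp only [hC, hX, hη, ← centerSeries_X (A := PowerSeries (Lift F)),
      ← map_one (centerSeries (PowerSeries (Lift F))),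
      ← map_mul (centerSeries (PowerSeries (Lift F))),
      ← map_add (centerSeries (PowerSeries (Lift F))),
      ← map_sub (centerSeries (PowerSeries (Lift F))),
      ← map_pow (centerSeries (PowerSeries (Lift F)))] at e
    have hz : cBase F (hMul (z - N / 2)) = cBase F (hMul z) - cBase F (hMul (N / 2)) := by
      rw [sub_eq_add_neg z, hMul_add, hMul_neg, cBase_add, cBase_neg, sub_eq_add_neg]
    have hN2 : cBase F (hMul N) = cBase F (hMul (N / 2)) + cBase F (hMul (N / 2)) := by
      rw [← cBase_add, ← hMul_add, add_halves]
    have e1 : 1 + C (cBase F (hMul (z - N / 2))) * X +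
        (C (cBase F (hMul (N / 2))) - C (cX F)) * X = -(lin α 1).reflect 1 := by
      rw [reflect_lin, hz]
      simp only [α, map_sub, map_one]
      ring
    have e2 : 1 + C (cBase F (hMul (z - N / 2))) * X +
        (C (cBase F (-hMul (N / 2))) - C (cX F)) * X = -(lin α' 1).reflect 1 := by
      rw [reflect_lin, hz]
      simp only [α', hN2, map_sub, map_one, map_add, cBase_neg, map_neg]
      ring
    rw [e1, e2, neg_mul_neg] at e
    simp only [← map_mul (centerSeries (PowerSeries (Lift F))),
      ← map_pow (centerSeries (PowerSeries (Lift F)))]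
    rw [neg_mul, neg_mul, map_neg, map_neg, neg_mul, neg_mul, sub_neg_eq_add,
      X_mul] at e
    exact e
  · rw [auxHom_leg1, ← map_mul]
    exact (congrArg _ h1).trans (map_one _)
  · rw [auxHom_leg1, ← map_mul]
    exact (congrArg _ h2).trans (map_one _)

end Critical

end

noncomputable section

open Polynomial Filter Topology

/-! ### Products of a series in `u` and a series in `u⁻¹` -/

section Pairing

variable {R : Type*} [Ring R]

/-- The coefficient of `u^e` in a power series in `u`, for an integer `e`. -/
def zcoeff (Z : PowerSeries R) (e : ℤ) : R :=
  if 0 ≤ e then PowerSeries.coeff e.toNat Z else 0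

theorem zcoeff_natCast (Z : PowerSeries R) (n : ℕ) : zcoeff Z n = PowerSeries.coeff n Z := by
  simp [zcoeff]

theorem zcoeff_of_neg (Z : PowerSeries R) {e : ℤ} (he : e < 0) : zcoeff Z e = 0 :=
  if_neg (not_le.2 he)

theorem zcoeff_add (Z Z' : PowerSeries R) (e : ℤ) :
    zcoeff (Z + Z') e = zcoeff Z e + zcoeff Z' e := by
  simp only [zcoeff]
  split_ifs <;> simp

theorem zcoeff_C_mul (a : R) (Z : PowerSeries R) (e : ℤ) :
    zcoeff (PowerSeries.C a * Z) e = a * zcoeff Z e := by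
  simp only [zcoeff]
  split_ifs <;> simp

theorem zcoeff_mul_C (a : R) (Z : PowerSeries R) (e : ℤ) :
    zcoeff (Z * PowerSeries.C a) e = zcoeff Z e * a := by
  simp only [zcoeff]
  split_ifs <;> simp

theorem zcoeff_X_pow_mul (i : ℕ) (Z : PowerSeries R) (e : ℤ) :
    zcoeff (PowerSeries.X ^ i * Z) e = zcoeff Z (e - i) := by
  rcases lt_or_ge e 0 with he | he
  · rw [zcoeff_of_neg _ he, zcoeff_of_neg _ (by omega)]
  obtain ⟨n, rfl⟩ := Int.eq_ofNat_of_zero_le he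
  rw [zcoeff_natCast, PowerSeries.coeff_X_pow_mul']
  split_ifs with h
  · obtain ⟨k, rfl⟩ := Nat.exists_eq_add_of_le h
    rw [show ((i + k : ℕ) : ℤ) - i = (k : ℤ) by push_cast; ring, zcoeff_natCast,
      Nat.add_sub_cancel_left]
  · rw [zcoeff_of_neg]
    omega

/-- The shift `D(u) ↦ u D(u)` of bilateral series. -/
def shiftEnd (R : Type*) [Ring R] : AddMonoid.End (ℤ → R) where
  toFun D d := D (d - 1)
  map_zero' := rfl
  map_add' _ _ := rfl

theorem commute_shiftEnd (a : R) :
    Commute (Module.toAddMonoidEnd R (ℤ → R) a) (shiftEnd R) := rfl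

/-- The action of the polynomials in `u` on bilateral series from the left. -/
def lact (R : Type*) [Ring R] : R[X] →+* AddMonoid.End (ℤ → R) :=
  eval₂RingHom' (Module.toAddMonoidEnd R (ℤ → R)) (shiftEnd R) commute_shiftEnd

theorem lact_add_apply (f g : R[X]) (D : ℤ → R) : lact R (f + g) D = lact R f D + lact R g D := by
  rw [map_add]; rfl

theorem lact_mul_apply (f g : R[X]) (D : ℤ → R) : lact R (f * g) D = lact R f (lact R g D) := by
  rw [map_mul]; rfl

theorem lact_C (a : R) (D : ℤ → R) (d : ℤ) : lact R (C a) D d = a * D d := by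
  rw [lact, eval₂RingHom'_apply, eval₂_C]
  rfl

theorem lact_X (D : ℤ → R) (d : ℤ) : lact R X D d = D (d - 1) := by
  rw [lact, eval₂RingHom'_apply, eval₂_X]
  rfl

theorem lact_X_pow (i : ℕ) (D : ℤ → R) (d : ℤ) : lact R (X ^ i) D d = D (d - i) := by
  induction i generalizing d with
  | zero => rw [pow_zero, map_one, Nat.cast_zero, sub_zero]; rfl
  | succ i ih =>
    rw [pow_succ', lact_mul_apply, lact_X, ih]
    congr 1
    push_cast
    ring

theorem lact_monomial (i : ℕ) (a : R) (D : ℤ → R) (d : ℤ) :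
    lact R (monomial i a) D d = a * D (d - i) := by
  rw [← C_mul_X_pow_eq_monomial, lact_mul_apply, lact_C, lact_X_pow]

theorem lact_apply (f : R[X]) (D : ℤ → R) (d : ℤ) :
    lact R f D d = f.sum fun i a => a * D (d - i) := by
  induction f using Polynomial.induction_on' with
  | add p q hp hq =>
    rw [lact_add_apply, Pi.add_apply, hp, hq, sum_add_index]
    · exact fun _ => zero_mul _
    · exact fun _ _ _ => add_mul _ _ _
  | monomial n a => rw [lact_monomial, sum_monomial_index]; exact zero_mul _

/-- The action of the polynomials in `u` on bilateral series from the right. -/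
def ract (f : R[X]) (D : ℤ → R) (d : ℤ) : R := f.sum fun i b => D (d - i) * b

theorem ract_C_mul_X_pow (i : ℕ) (a : R) (D : ℤ → R) (d : ℤ) :
    ract (C a * X ^ i) D d = D (d - i) * a := by
  rw [C_mul_X_pow_eq_monomial, ract, sum_monomial_index]
  exact mul_zero _

/-- The actions of polynomials on bilateral series, in terms of products of power series. -/
theorem coeff_toSeries_mul_mul_toSeries (f g : R[X]) (D : ℤ → R) (d : ℤ) {n : ℕ}
    (hn : f.natDegree + g.natDegree ≤ n) :
    PowerSeries.coeff n (toSeries R f * (PowerSeries.mk fun k => D (d - n + k)) * toSeries R g) =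
      lact R f (ract g D) d := by
  rw [mul_assoc, PowerSeries.coeff_mul, Finset.Nat.sum_antidiagonal_eq_sum_range_succ_mk,
    lact_apply, sum_over_range' _ (fun _ => zero_mul _) (n + 1) (by omega)]
  refine Finset.sum_congr rfl fun i hi => ?_
  rw [coeToPowerSeries.ringHom_apply, coeff_coe]
  by_cases hi' : f.natDegree < i
  · rw [coeff_eq_zero_of_natDegree_lt hi', zero_mul, zero_mul]
  congr 1
  rw [Finset.mem_range] at hi
  rw [PowerSeries.coeff_mul, ← Finset.Nat.sum_antidiagonal_swap,
    Finset.Nat.sum_antidiagonal_eq_sum_range_succ_mk, ract,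
    sum_over_range' _ (fun _ => mul_zero _) (n - i + 1) (by omega)]
  refine Finset.sum_congr rfl fun j hj => ?_
  rw [Finset.mem_range] at hj
  simp only [Prod.snd_swap, Prod.fst_swap]
  rw [PowerSeries.coeff_mk, coeToPowerSeries.ringHom_apply, coeff_coe]
  congr 2
  omega

variable [TopologicalSpace R]

/-- The series `∑ Y_l u⁻ˡ` whose coefficients converge to zero. -/
def Null (Y : PowerSeries R) : Prop :=
  Tendsto (fun n => PowerSeries.coeff n Y) atTop (𝓝 0)

/-- The coefficient of `u^d` in the product of a power series in `u` and a power series in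
`u⁻¹`. -/
def pair (Z Y : PowerSeries R) (d : ℤ) : R :=
  ∑' l : ℕ, zcoeff Z (d + l) * PowerSeries.coeff l Y

variable [Algebra Base R] [PairingAlgebra R] {Y : PowerSeries R}

theorem summable_pair (hY : Null Y) (Z : PowerSeries R) (d : ℤ) :
    Summable fun l : ℕ => zcoeff Z (d + l) * PowerSeries.coeff l Y :=
  PairingAlgebra.summable_mul _ _ hY

theorem Null.add {Y' : PowerSeries R} (hY : Null Y) (hY' : Null Y') : Null (Y + Y') := by
  have := Tendsto.add hY hY'
  rw [add_zero] at this
  simpa only [Null, map_add] using this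

theorem Null.C_mul (hY : Null Y) (a : R) : Null (PowerSeries.C a * Y) := by
  have := Tendsto.const_mul a hY
  rw [mul_zero] at this
  simpa only [Null, PowerSeries.coeff_C_mul] using this

theorem Null.mul_C (hY : Null Y) (a : R) : Null (Y * PowerSeries.C a) := by
  have := Tendsto.mul_const a hY
  rw [zero_mul] at this
  simpa only [Null, PowerSeries.coeff_mul_C] using this

theorem Null.X_pow_mul (hY : Null Y) (k : ℕ) : Null (PowerSeries.X ^ k * Y) := by
  refine (tendsto_add_atTop_iff_nat k).1 ?_
  simp only [PowerSeries.coeff_X_pow_mul]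
  exact hY

theorem null_zero : Null (0 : PowerSeries R) := by
  simpa only [Null, map_zero] using tendsto_const_nhds

theorem Null.toSeries_mul (hY : Null Y) (f : R[X]) : Null (toSeries R f * Y) := by
  induction f using Polynomial.induction_on' with
  | add p q hp hq => rw [map_add, add_mul]; exact hp.add hq
  | monomial n a =>
    rw [← C_mul_X_pow_eq_monomial, map_mul, map_pow, coeToPowerSeries.ringHom_apply,
      coeToPowerSeries.ringHom_apply, coe_C, coe_X, mul_assoc]
    exact (hY.X_pow_mul n).C_mul a

theorem Null.mul_toSeries (hY : Null Y) (f : R[X]) : Null (Y * toSeries R f) := by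
  induction f using Polynomial.induction_on' with
  | add p q hp hq => rw [map_add, mul_add]; exact hp.add hq
  | monomial n a =>
    rw [← C_mul_X_pow_eq_monomial, map_mul, map_pow, coeToPowerSeries.ringHom_apply,
      coeToPowerSeries.ringHom_apply, coe_C, coe_X, ← mul_assoc, ← PowerSeries.X_pow_mul]
    exact (hY.mul_C a).X_pow_mul n

theorem pair_add_left (hY : Null Y) (Z Z' : PowerSeries R) :
    pair (Z + Z') Y = pair Z Y + pair Z' Y := by
  funext d
  simp only [pair, Pi.add_apply, zcoeff_add, add_mul]
  exact (summable_pair hY Z d).tsum_add (summable_pair hY Z' d)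

theorem pair_add_right {Y' : PowerSeries R} (hY : Null Y) (hY' : Null Y') (Z : PowerSeries R) :
    pair Z (Y + Y') = pair Z Y + pair Z Y' := by
  funext d
  simp only [pair, Pi.add_apply, map_add, mul_add]
  exact (summable_pair hY Z d).tsum_add (summable_pair hY' Z d)

theorem pair_C_mul (hY : Null Y) (a : R) (Z : PowerSeries R) (d : ℤ) :
    pair (PowerSeries.C a * Z) Y d = a * pair Z Y d := by
  simp only [pair, zcoeff_C_mul, mul_assoc]
  exact (summable_pair hY Z d).tsum_mul_left a

theorem pair_mul_C (a : R) (Z : PowerSeries R) :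
    pair (Z * PowerSeries.C a) Y = pair Z (PowerSeries.C a * Y) := by
  funext d
  simp only [pair, zcoeff_mul_C, PowerSeries.coeff_C_mul, mul_assoc]

theorem pair_mul_C_right (hY : Null Y) (a : R) (Z : PowerSeries R) (d : ℤ) :
    pair Z (Y * PowerSeries.C a) d = pair Z Y d * a := by
  simp only [pair, PowerSeries.coeff_mul_C, ← mul_assoc]
  exact (summable_pair hY Z d).tsum_mul_right a

theorem pair_X_pow_mul (i : ℕ) (Z : PowerSeries R) (d : ℤ) :
    pair (PowerSeries.X ^ i * Z) Y d = pair Z Y (d - i) := by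
  simp only [pair, zcoeff_X_pow_mul]
  refine tsum_congr fun l => ?_
  rw [add_sub_right_comm]

theorem pair_X_pow_mul_right (k : ℕ) (Z : PowerSeries R) (d : ℤ) :
    pair Z (PowerSeries.X ^ k * Y) d = pair Z Y (d + k) := by
  rw [pair, pair, ← (add_left_injective k).tsum_eq]
  · refine tsum_congr fun l => ?_
    rw [PowerSeries.coeff_X_pow_mul]
    push_cast
    rw [add_assoc, add_comm (k : ℤ)]
  · intro l hl
    by_contra h
    refine hl ?_
    beta_reduce
    rw [PowerSeries.coeff_X_pow_mul', if_neg, mul_zero]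
    intro hk
    exact h ⟨l - k, Nat.sub_add_cancel hk⟩

theorem pair_toSeries_mul (hY : Null Y) (f : R[X]) (Z : PowerSeries R) :
    pair (toSeries R f * Z) Y = lact R f (pair Z Y) := by
  induction f using Polynomial.induction_on' with
  | add p q hp hq => rw [map_add, add_mul, pair_add_left hY, hp, hq, map_add]; rfl
  | monomial n a =>
    funext d
    rw [lact_monomial, ← C_mul_X_pow_eq_monomial, map_mul, map_pow, coeToPowerSeries.ringHom_apply,
      coeToPowerSeries.ringHom_apply, coe_C, coe_X, mul_assoc, pair_C_mul hY, pair_X_pow_mul]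

theorem pair_zero_left : pair 0 Y = 0 := by
  funext d
  simp [pair, zcoeff]

theorem pair_zero_right (Z : PowerSeries R) : pair Z 0 = 0 := by
  funext d
  simp [pair]

/-- A polynomial in `u` may be moved from the left factor of the product `Z(u) Y(u⁻¹)` to the right
one, where it is divided by `uⁿ`. -/
theorem pair_mul_toSeries (hY : Null Y) {n : ℕ} (f : R[X]) (hf : f.natDegree ≤ n)
    (Z : PowerSeries R) (d : ℤ) :
    pair (Z * toSeries R f) Y d = pair Z (toSeries R (f.reflect n) * Y) (d - n) := by
  revert d
  refine induction_with_natDegree_le (fun f => ∀ d, pair (Z * toSeries R f) Y d =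
    pair Z (toSeries R (f.reflect n) * Y) (d - n)) n ?_ ?_ ?_ f hf
  · intro d
    simp only [reflect_zero, map_zero, mul_zero, zero_mul, pair_zero_left, pair_zero_right,
      Pi.zero_apply]
  · intro i a _ hi d
    rw [reflect_C_mul_X_pow, revAt_le hi]
    simp only [map_mul, map_pow, coeToPowerSeries.ringHom_apply, coe_C, coe_X]
    rw [← mul_assoc, ← PowerSeries.X_pow_mul, pair_X_pow_mul, pair_mul_C,
      ← PowerSeries.X_pow_mul, mul_assoc, pair_X_pow_mul_right]
    congr 1
    push_cast [hi]
    ring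
  · intro p q _ _ hp hq d
    rw [map_add, mul_add, pair_add_left hY, Pi.add_apply, hp, hq, reflect_add, map_add, add_mul,
      pair_add_right (hY.toSeries_mul _) (hY.toSeries_mul _), Pi.add_apply]

theorem pair_mul_toSeries_right (hY : Null Y) {n : ℕ} (f : R[X]) (hf : f.natDegree ≤ n)
    (Z : PowerSeries R) (d : ℤ) :
    pair Z (Y * toSeries R (f.reflect n)) (d - n) = ract f (pair Z Y) d := by
  revert d
  refine induction_with_natDegree_le (fun f => ∀ d,
    pair Z (Y * toSeries R (f.reflect n)) (d - n) = ract f (pair Z Y) d) n ?_ ?_ ?_ f hf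
  · intro d
    simp only [reflect_zero, map_zero, mul_zero, pair_zero_right, Pi.zero_apply, ract,
      sum_zero_index]
  · intro i a _ hi d
    rw [reflect_C_mul_X_pow, revAt_le hi, ract_C_mul_X_pow]
    simp only [map_mul, map_pow, coeToPowerSeries.ringHom_apply, coe_C, coe_X]
    rw [← mul_assoc, ← PowerSeries.X_pow_mul, pair_X_pow_mul_right, pair_mul_C_right hY]
    congr 2
    push_cast [hi]
    ring
  · intro p q _ _ hp hq d
    rw [reflect_add, map_add, mul_add, pair_add_right (hY.mul_toSeries _) (hY.mul_toSeries _),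
      Pi.add_apply, hp, hq, ract, ract, ract, sum_add_index]
    · exact fun _ => mul_zero _
    · exact fun _ _ _ => mul_add _ _ _

end Pairing

end

noncomputable section

open Polynomial

/-! ### Exchange relations for ordered products -/

section Lists

variable {ι S : Type*} [Ring S] {t : S} {q p r x y l r' b : ι → S}

theorem list_prod_central {q : ι → S} (hq : ∀ a, q a ∈ Subring.center S) (L : List ι) :
    (L.map q).prod ∈ Subring.center S :=
  list_prod_mem fun c hc => by
    obtain ⟨a, -, rfl⟩ := List.mem_map.1 hc
    exact hq a

/-- An operator `t` which passes through each of the `x a` passes through their product; the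
factors `r' a` which appear on the right come out in the opposite order. -/
theorem exchange_list_prod (hq : ∀ a, q a ∈ Subring.center S)
    (h : ∀ a, q a * (t * x a) = l a * (x a * (t * r' a)))
    (hl : ∀ a c, a ≠ c → Commute (l a) (x c)) (hr : ∀ a c, a ≠ c → Commute (r' a) (x c))
    {L : List ι} (hL : L.Nodup) :
    (L.map q).prod * (t * (L.map x).prod) =
      (L.map l).prod * ((L.map x).prod * (t * (L.map r').reverse.prod)) := by
  induction L with
  | nil => simp
  | cons a L ih =>
    obtain ⟨ha, hL⟩ := List.nodup_cons.1 hL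
    have hne : ∀ c ∈ L, a ≠ c := fun c hc h => ha (h ▸ hc)
    rw [List.map_cons, List.map_cons, List.map_cons, List.map_cons, List.reverse_cons,
      List.prod_append]
    simp only [List.prod_cons, List.prod_nil, mul_one]
    have hQ := Subring.mem_center_iff.1 (list_prod_central hq L)
    have c1 : Commute (r' a) (L.map x).prod := commute_list_prod fun w hw => by
      obtain ⟨c, hc, rfl⟩ := List.mem_map.1 hw
      exact hr a c (hne c hc)
    have c2 : Commute (x a) (L.map l).prod := commute_list_prod fun w hw => by
      obtain ⟨c, hc, rfl⟩ := List.mem_map.1 hw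
      exact (hl c a (hne c hc).symm).symm
    calc q a * (L.map q).prod * (t * (x a * (L.map x).prod))
        = (L.map q).prod * (q a * (t * x a)) * (L.map x).prod := by
          rw [hQ (q a)]
          simp only [mul_assoc]
      _ = (L.map q).prod * (l a * (x a * t)) * (r' a * (L.map x).prod) := by
          rw [h]
          simp only [mul_assoc]
      _ = l a * x a * ((L.map q).prod * (t * (L.map x).prod)) * r' a := by
          rw [c1.eq, ← hQ]
          simp only [mul_assoc]
          rw [← mul_assoc t (L.map q).prod, hQ t]
          simp only [mul_assoc]
      _ = l a * (x a * (L.map l).prod) * ((L.map x).prod * (t * (L.map r').reverse.prod)) *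
          r' a := by
          rw [ih hL]
          simp only [mul_assoc]
      _ = _ := by
          rw [c2.eq]
          simp only [mul_assoc]

/-- The companion of `exchange_list_prod`: the factors `r' a` are absorbed when `t` passes through
the product of the `y a` in the opposite order, and the factors `b a` appear. -/
theorem exchange_list_reverse_prod (hp : ∀ a, p a ∈ Subring.center S)
    (hr : ∀ a, r a ∈ Subring.center S)
    (h : ∀ a, p a * (t * (r' a * y a)) = r a * (y a * (b a * t)))
    (hr' : ∀ a c, a ≠ c → Commute (r' a) (y c)) (hb : ∀ a c, a ≠ c → Commute (b a) (y c))
    {L : List ι} (hL : L.Nodup) :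
    (L.map p).prod * (t * ((L.map r').reverse.prod * (L.map y).reverse.prod)) =
      (L.map r).prod * ((L.map y).reverse.prod * ((L.map b).reverse.prod * t)) := by
  induction L with
  | nil => simp
  | cons a L ih =>
    obtain ⟨ha, hL⟩ := List.nodup_cons.1 hL
    have hne : ∀ c ∈ L, a ≠ c := fun c hc h => ha (h ▸ hc)
    simp only [List.map_cons, List.reverse_cons, List.prod_append]
    simp only [List.prod_cons, List.prod_nil, mul_one]
    have hP := Subring.mem_center_iff.1 (hp a)
    have hR := Subring.mem_center_iff.1 (hr a)
    have c1 : Commute (r' a) (L.map y).reverse.prod := commute_list_prod fun w hw => by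
      obtain ⟨c, hc, rfl⟩ := List.mem_map.1 (List.mem_reverse.1 hw)
      exact hr' a c (hne c hc)
    have c2 : Commute (y a) (L.map b).reverse.prod := commute_list_prod fun w hw => by
      obtain ⟨c, hc, rfl⟩ := List.mem_map.1 (List.mem_reverse.1 hw)
      exact (hb c a (hne c hc).symm).symm
    calc p a * (L.map p).prod * (t * ((L.map r').reverse.prod * r' a *
          ((L.map y).reverse.prod * y a)))
        = p a * ((L.map p).prod * (t * ((L.map r').reverse.prod * (L.map y).reverse.prod))) *
            (r' a * y a) := by
          simp only [mul_assoc]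
          rw [← mul_assoc (r' a), c1.eq]
          simp only [mul_assoc]
      _ = (L.map r).prod * ((L.map y).reverse.prod * (L.map b).reverse.prod) *
            (p a * (t * (r' a * y a))) := by
          rw [ih hL, ← hP]
          simp only [mul_assoc]
          rw [← mul_assoc t (p a), hP t]
          simp only [mul_assoc]
      _ = r a * (L.map r).prod * ((L.map y).reverse.prod * ((L.map b).reverse.prod * y a) *
            (b a * t)) := by
          rw [h, ← mul_assoc _ (r a), hR]
          simp only [mul_assoc]
      _ = _ := by
          rw [← c2.eq]
          simp only [mul_assoc]

end Lists

/-! ### Ordered products of the polynomials `α - β u + ε P` -/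

section Flips

variable {m N : ℕ} {A : Type*} [Ring A]

theorem auxFlip_mul_apply_leg :
    leg0 N (Matrix (Fin N) (Fin N) A) (flip N A) * leg1 N _ (flip N A) =
      leg1 N _ (flip N A) * flip N _ := by
  ext1 k l
  ext1 i j
  rw [leg0_mul_leg1_apply, mul_flip_apply, leg1_apply]
  change Matrix.single j i 1 * Matrix.single l k 1 = if i = l then Matrix.single j k 1 else 0
  split_ifs with h
  · rw [h, Matrix.single_mul_single_same, one_mul]
  · exact Matrix.single_mul_single_of_ne (h := h) ..

variable [Algebra ℂ A]

theorem auxFlip_mul_auxFlip_of_ne {a b : Fin m} (hab : a ≠ b) :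
    auxFlip N A a * auxFlip N A b =
      auxFlip N A b * permMat m N (Matrix (Fin N) (Fin N) A) (Equiv.swap a b) := by
  have := congrArg (twoSlot hab) (auxFlip_mul_apply_leg (N := N) (A := A))
  rwa [map_mul, map_mul, twoSlot_leg0, twoSlot_leg1, twoSlot_flip] at this

/-- The two-factor relation for the linear polynomials `g - k b + e p`, where `p` and `p'` are the
transpositions of the auxiliary factor with two others, and `s = p p' p` exchanges these two. -/
theorem flip_relation {K S : Type*} [CommRing K] [Ring S] [Algebra K S] {s p p' : S}
    {g e b : K} (k l : ℤ) (he : e * e = b * e) (h1 : s * p = p' * s) (h2 : s * p' = p * s)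
    (h3 : p * p' = p' * s) (h4 : p' * p = p * s) :
    (k - l) • (((g - k • b) • 1 + e • p) * ((g - l • b) • 1 + e • p') -
      ((g - l • b) • 1 + e • p') * ((g - k • b) • 1 + e • p)) =
      s * (((g - k • b) • 1 + e • p) * ((g - l • b) • 1 + e • p')) -
      ((g - l • b) • 1 + e • p') * ((g - k • b) • 1 + e • p) * s := by
  have h5 : s * (p * p') = p' * p * s := by rw [h3, ← mul_assoc, h2, h4]
  -- both differences are multiples of `p' s - p s`; `e² = b e` makes the factors agree
  have e1 : ∀ x y : K, (x • 1 + e • p) * (y • 1 + e • p') - (y • 1 + e • p') * (x • 1 + e • p) =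
      (b * e) • (p' * s - p * s) := fun x y => by
    rw [← h3, ← h4, ← he]
    simp only [add_mul, mul_add, smul_mul_assoc, mul_smul_comm, one_mul, mul_one]
    module
  have e2 : ∀ x y : K, s * ((x • 1 + e • p) * (y • 1 + e • p')) -
      (y • 1 + e • p') * (x • 1 + e • p) * s = ((y - x) * e) • (p' * s - p * s) := fun x y => by
    simp only [add_mul, mul_add, smul_mul_assoc, mul_smul_comm, one_mul, mul_one, h1, h2, h5]
    module
  rw [e1, e2, ← Int.cast_smul_eq_zsmul K, smul_smul, zsmul_eq_mul, zsmul_eq_mul]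
  congr 1
  push_cast
  ring

theorem flip_relation_reverse {K S : Type*} [CommRing K] [Ring S] [Algebra K S] {s p p' : S}
    {g e b : K} (k l : ℤ) (he : e * e = -(b * e)) (h1 : s * p = p' * s) (h2 : s * p' = p * s)
    (h3 : p * p' = p' * s) (h4 : p' * p = p * s) :
    (k - l) • (((g - l • b) • 1 + e • p') * ((g - k • b) • 1 + e • p) -
      ((g - k • b) • 1 + e • p) * ((g - l • b) • 1 + e • p')) =
      s * (((g - l • b) • 1 + e • p') * ((g - k • b) • 1 + e • p)) -
      ((g - k • b) • 1 + e • p) * ((g - l • b) • 1 + e • p') * s := by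
  have := flip_relation (g := g) (b := -b) (-l) (-k) (by rw [he, neg_mul]) h2 h1 h4 h3
  simpa only [neg_smul, smul_neg, neg_neg, sub_neg_eq_add, neg_add_eq_sub] using this

/-- Matrices of complex numbers, as constant series of operators. -/
def seriesMat (m N : ℕ) (A : Type*) [Ring A] [Algebra ℂ A] :
    TensorMat m N ℂ →ₐ[ℂ] PowerSeries (TensorMat m N A) :=
  { PowerSeries.C.comp (algebraMap ℂ A).mapMatrix with
    commutes' := fun c => by
      change PowerSeries.C ((algebraMap ℂ (TensorMat m N ℂ) c).map (algebraMap ℂ A)) = _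
      rw [PowerSeries.algebraMap_apply, Matrix.algebraMap_eq_diagonal,
        Matrix.algebraMap_eq_diagonal, Matrix.diagonal_map (map_zero _)]
      rfl }

theorem seriesMat_apply (M : TensorMat m N ℂ) :
    seriesMat m N A M = PowerSeries.C (M.map (algebraMap ℂ A)) := rfl

theorem seriesMat_permAction (σ : Equiv.Perm (Fin m)) :
    seriesMat m N A (permAction m N σ) = PowerSeries.C (permMat m N A σ) := rfl

variable {α β ε b : Subring.center A}

theorem toSeries_linFlip_sub (k : ℤ) (a : Fin m) :
    toSeries _ (linFlip N (α - k • b) β ε a) =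
      toSeries _ (scalarPoly m N A (lin α β - k • C b)) * 1 +
      toSeries _ (scalarPoly m N A (C ε)) * PowerSeries.C (auxFlip N A a) := by
  rw [toSeries_linFlip, mul_one]
  congr 3
  simp only [lin, map_sub, map_zsmul]
  ring

theorem permMat_mul_auxFlip (σ : Equiv.Perm (Fin m)) (a : Fin m) :
    seriesMat m N (Matrix (Fin N) (Fin N) A) (permAction m N σ) * PowerSeries.C (auxFlip N A a) =
      PowerSeries.C (auxFlip N A (σ a)) * seriesMat m N _ (permAction m N σ) := by
  rw [seriesMat_permAction, ← map_mul, ← map_mul, auxFlip, permMat_mul_slot, auxFlip]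

theorem seriesMat_mul_linFlip (σ : Equiv.Perm (Fin m)) (a : Fin m) (α : Subring.center A) :
    seriesMat m N (Matrix (Fin N) (Fin N) A) (permAction m N σ) *
      toSeries _ (linFlip N α β ε a) =
      toSeries _ (linFlip N α β ε (σ a)) * seriesMat m N _ (permAction m N σ) := by
  have hc := fun q => Subring.mem_center_iff.1 (toSeries_scalarPoly_mem_center (m := m) (N := N)
    (A := A) q)
  rw [toSeries_linFlip, toSeries_linFlip, mul_add, add_mul, hc, ← mul_assoc, hc, mul_assoc,
    permMat_mul_auxFlip, mul_assoc]

theorem isSlotFamily_linFlip : IsSlotFamily (seriesMat m N (Matrix (Fin N) (Fin N) A))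
    fun a k => toSeries _ (linFlip N (α - k • b) β ε a) where
  of_ne i hi a k h1 h2 := by
    rw [adj, seriesMat_mul_linFlip,
      Equiv.swap_apply_of_ne_of_ne (Fin.ne_of_val_ne h1) (Fin.ne_of_val_ne h2)]
  left i hi k := by
    rw [adj, seriesMat_mul_linFlip, Equiv.swap_apply_left]

theorem auxFlip_relations (i : ℕ) (hi : i + 1 < m) :
    let s := seriesMat m N (Matrix (Fin N) (Fin N) A) (adj (permAction m N) i hi)
    let p : PowerSeries (AuxMat m N A) := PowerSeries.C (auxFlip N A ⟨i, by omega⟩)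
    let p' : PowerSeries (AuxMat m N A) := PowerSeries.C (auxFlip N A ⟨i + 1, hi⟩)
    s * p = p' * s ∧ s * p' = p * s ∧ p * p' = p' * s ∧ p' * p = p * s := by
  have hne : (⟨i, by omega⟩ : Fin m) ≠ ⟨i + 1, hi⟩ := by simp
  refine ⟨?_, ?_, ?_, ?_⟩
  · rw [adj, permMat_mul_auxFlip, Equiv.swap_apply_left]
  · rw [adj, permMat_mul_auxFlip, Equiv.swap_apply_right]
  · rw [adj, seriesMat_permAction, ← map_mul, ← map_mul, auxFlip_mul_auxFlip_of_ne hne]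
  · rw [adj, seriesMat_permAction, ← map_mul, ← map_mul, auxFlip_mul_auxFlip_of_ne hne.symm,
      Equiv.swap_comm]

theorem isCovariant_linFlip_prod (hε : ε * ε = b * ε) :
    IsCovariant (seriesMat m N (Matrix (Fin N) (Fin N) A)) fun κ =>
      (List.ofFn fun a => toSeries _ (linFlip N (α - κ a • b) β ε a)).prod := by
  let := scalarAlgebra m N A
  refine isCovariant_prod (F := fun a k => toSeries _ (linFlip N (α - k • b) β ε a))
    isSlotFamily_linFlip fun i hi k l => ?_
  obtain ⟨h1, h2, h3, h4⟩ := auxFlip_relations (N := N) (A := A) i hi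
  have := flip_relation (K := (Subring.center A)[X]) (g := lin α β) (e := C ε) (b := C b) k l
    (by rw [← C_mul, hε, C_mul]) h1 h2 h3 h4
  simp only [Algebra.smul_def (R := (Subring.center A)[X])] at this
  rw [toSeries_linFlip_sub, toSeries_linFlip_sub]
  exact this

theorem isCovariant_linFlip_reverse_prod (hε : ε * ε = -(b * ε)) :
    IsCovariant (seriesMat m N (Matrix (Fin N) (Fin N) A)) fun κ =>
      (List.ofFn fun a => toSeries _ (linFlip N (α - κ a • b) β ε a)).reverse.prod := by
  let := scalarAlgebra m N A
  refine isCovariant_reverse_prod (F := fun a k => toSeries _ (linFlip N (α - k • b) β ε a))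
    isSlotFamily_linFlip fun i hi k l => ?_
  obtain ⟨h1, h2, h3, h4⟩ := auxFlip_relations (N := N) (A := A) i hi
  have := flip_relation_reverse (K := (Subring.center A)[X]) (g := lin α β) (e := C ε)
    (b := C b) k l (by rw [← C_mul, hε, C_neg, C_mul]) h1 h2 h3 h4
  simp only [Algebra.smul_def (R := (Subring.center A)[X])] at this
  rw [toSeries_linFlip_sub, toSeries_linFlip_sub]
  exact this

end Flips

end

noncomputable section

open Polynomial

/-! ### The trace of a product of bilateral series -/

section PartialTranspose

variable {m N : ℕ} {A : Type*} [Ring A]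

/-- Polynomials with central coefficients, as polynomials of scalar operators in the auxiliary
tensor factor. -/
def legPoly (N : ℕ) (A : Type*) [Ring A] :
    (Subring.center A)[X] →+* (Matrix (Fin N) (Fin N) A)[X] :=
  mapRingHom ((Matrix.scalar (Fin N)).comp (Subring.center A).subtype)

/-- Polynomials with central coefficients, as series of scalar operators in the auxiliary tensor
factor. -/
def legSeries (N : ℕ) (A : Type*) [Ring A] :
    (Subring.center A)[X] →+* PowerSeries (Matrix (Fin N) (Fin N) A) :=
  (toSeries _).comp (legPoly N A)

theorem legSeries_C (a : Subring.center A) :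
    legSeries N A (C a) = PowerSeries.C (Matrix.scalar (Fin N) (a : A)) := by
  simp only [legSeries, legPoly, RingHom.comp_apply, coe_mapRingHom, map_C,
    coeToPowerSeries.ringHom_apply, coe_C]
  rfl

theorem legSeries_X : legSeries N A X = PowerSeries.X := by
  simp only [legSeries, legPoly, RingHom.comp_apply, coe_mapRingHom, map_X,
    coeToPowerSeries.ringHom_apply, coe_X]

theorem legSeries_mem_center (q : (Subring.center A)[X]) :
    legSeries N A q ∈ Subring.center (PowerSeries (Matrix (Fin N) (Fin N) A)) := by
  induction q using Polynomial.induction_on' with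
  | add p q hp hq => rw [map_add]; exact add_mem hp hq
  | monomial n a =>
    rw [← C_mul_X_pow_eq_monomial, map_mul, map_pow, legSeries_C, legSeries_X]
    exact mul_mem (C_mem_center (scalar_mem_center a.2)) (pow_mem X_mem_center n)

theorem seriesEquiv_symm_C {n B : Type*} [Ring B] [Fintype n] [DecidableEq n] (M : Matrix n n B) :
    (seriesEquiv n B).symm (PowerSeries.C M) = M.map PowerSeries.C := by
  rw [RingEquiv.symm_apply_eq, seriesEquiv_map_C]

theorem seriesEquiv_symm_scalarPoly (q : (Subring.center A)[X]) :
    (seriesEquiv (Fin m → Fin N) _).symm (toSeries _ (scalarPoly m N A q)) =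
      Matrix.scalar _ (legSeries N A q) := by
  have : ((seriesEquiv (Fin m → Fin N) (Matrix (Fin N) (Fin N) A)).symm.toRingHom.comp
      (toSeries _)).comp (scalarPoly m N A) = (Matrix.scalar _).comp (legSeries N A) := by
    refine Polynomial.ringHom_ext (fun c => ?_) ?_
    · simp only [RingHom.comp_apply, scalarPoly, coe_mapRingHom, map_C,
        coeToPowerSeries.ringHom_apply, coe_C, legSeries_C]
      exact (RingEquiv.symm_apply_eq _).2 (seriesEquiv_scalar_C _).symm
    · simp only [RingHom.comp_apply, scalarPoly, coe_mapRingHom, map_X,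
        coeToPowerSeries.ringHom_apply, coe_X, legSeries_X]
      exact (RingEquiv.symm_apply_eq _).2 seriesEquiv_scalar_X.symm
  exact RingHom.congr_fun this q

/-- The polynomial `α - β u + ε P` as an element of `End ℂ^N ⊗ End ℂ^N ⊗ A[[u]]`, the series
being inside the outer matrix. -/
def legFlip (N : ℕ) (α β ε : Subring.center A) :
    Matrix (Fin N) (Fin N) (PowerSeries (Matrix (Fin N) (Fin N) A)) :=
  Matrix.scalar _ (legSeries N A (lin α β)) +
    Matrix.scalar _ (legSeries N A (C ε)) * (flip N A).map PowerSeries.C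

theorem seriesEquiv_symm_linFlip (α β ε : Subring.center A) (a : Fin m) :
    (seriesEquiv (Fin m → Fin N) _).symm (toSeries _ (linFlip N α β ε a)) =
      slot a (legFlip N α β ε) := by
  rw [toSeries_linFlip, map_add, map_mul, seriesEquiv_symm_scalarPoly, seriesEquiv_symm_scalarPoly,
    seriesEquiv_symm_C, legFlip, ← slotHom_apply, map_add, map_mul, slotHom_apply, slotHom_apply,
    slotHom_apply, slot_scalar, slot_scalar, auxFlip, slot_map]

/-- The partial transpose of the flip is `N` times a projection. -/
theorem transpose_flip_mul_transpose_flip :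
    ((flip N A).map (PowerSeries.C (R := Matrix (Fin N) (Fin N) A))).transpose *
      ((flip N A).map PowerSeries.C).transpose =
      (N : Matrix (Fin N) (Fin N) (PowerSeries (Matrix (Fin N) (Fin N) A))) *
        ((flip N A).map PowerSeries.C).transpose := by
  have e : (flip N A).transpose * (flip N A).transpose =
      (N : TwoMat N A) * (flip N A).transpose := by
    ext1 k l
    rw [Matrix.mul_apply, ← nsmul_eq_mul, Matrix.smul_apply]
    have h1 : ∀ x, (flip N A).transpose k x * (flip N A).transpose x l =
        Matrix.single k l (1 : A) := fun x => by
      change Matrix.single k x (1 : A) * Matrix.single x l 1 = _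
      rw [Matrix.single_mul_single_same, one_mul]
    simp only [h1, Finset.sum_const, Finset.card_univ, Fintype.card_fin]
    rfl
  have := congrArg (PowerSeries.C (R := Matrix (Fin N) (Fin N) A)).mapMatrix e
  rw [map_mul, map_mul, map_natCast] at this
  exact this

theorem transpose_legFlip (α β ε : Subring.center A) : (legFlip N α β ε).transpose =
    Matrix.scalar _ (legSeries N A (lin α β)) +
      Matrix.scalar _ (legSeries N A (C ε)) * ((flip N A).map PowerSeries.C).transpose := by
  ext1 k l
  simp only [legFlip, Matrix.transpose_apply, Matrix.add_apply, Matrix.scalar_apply,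
    Matrix.diagonal_mul, Matrix.diagonal_apply, eq_comm]

theorem smul_add_mul_smul_sub_of_mul_self {K S : Type*} [CommRing K] [Ring S] [Algebra K S] {P : S}
    {x x' e n : K} (hP : P * P = n • P) (he : e * x' - e * x = n * (e * e)) :
    (x • 1 + e • P) * (x' • 1 + (-e) • P) = (x * x') • (1 : S) := by
  have e1 : (x • 1 + e • P) * (x' • 1 + (-e) • P) =
      (x * x') • (1 : S) + (e * x' - e * x - n * (e * e)) • P := by
    simp only [add_mul, mul_add, smul_mul_assoc, mul_smul_comm, one_mul, mul_one, hP]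
    module
  rw [e1, he, sub_self, zero_smul, add_zero]

theorem scalar_legSeries_mul_comm (q : (Subring.center A)[X])
    (M : Matrix (Fin N) (Fin N) (PowerSeries (Matrix (Fin N) (Fin N) A))) :
    (Matrix.scalar (Fin N)).comp (legSeries N A) q * M =
      M * (Matrix.scalar (Fin N)).comp (legSeries N A) q := by
  rw [RingHom.comp_apply]
  have h := Subring.mem_center_iff.1 (legSeries_mem_center (N := N) q)
  ext1 i j
  rw [Matrix.scalar_apply, Matrix.diagonal_mul, Matrix.mul_diagonal]
  exact (h _).symm

/-- The matrices of series as an algebra over the polynomials with central coefficients. -/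
@[reducible]
def legAlgebra (N : ℕ) (A : Type*) [Ring A] : Algebra (Subring.center A)[X]
    (Matrix (Fin N) (Fin N) (PowerSeries (Matrix (Fin N) (Fin N) A))) :=
  ((Matrix.scalar (Fin N)).comp (legSeries N A)).toAlgebra' scalar_legSeries_mul_comm

/-- The partial transposes of the two factors multiply to a scalar. -/
theorem transpose_legFlip_mul {α α' β ε : Subring.center A} (h : ε * (α' - α) = N * (ε * ε)) :
    (legFlip N α β ε).transpose * (legFlip N α' β (-ε)).transpose =
      Matrix.scalar _ (legSeries N A (lin α β * lin α' β)) := by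
  let := legAlgebra N A
  have hε : C ε * lin α' β - C ε * lin α β = (N : (Subring.center A)[X]) * (C ε * C ε) := by
    have := congrArg C h
    simp only [map_mul, map_sub, map_natCast] at this
    rw [← this, lin, lin]
    ring
  have hP := transpose_flip_mul_transpose_flip (N := N) (A := A)
  rw [← map_natCast (algebraMap (Subring.center A)[X] _), ← Algebra.smul_def] at hP
  have key := smul_add_mul_smul_sub_of_mul_self hP hε
  rw [transpose_legFlip, transpose_legFlip, C_neg]
  simp only [Algebra.smul_def (R := (Subring.center A)[X]), mul_one] at key
  exact key

end PartialTranspose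

end

noncomputable section

open Polynomial

section TraceIdentity

variable {m N : ℕ} {A : Type*} [Ring A]

theorem commute_series {f g : PowerSeries A}
    (h : ∀ k l, Commute (PowerSeries.coeff k f) (PowerSeries.coeff l g)) : Commute f g := by
  refine PowerSeries.ext fun n => ?_
  rw [PowerSeries.coeff_mul, PowerSeries.coeff_mul, ← Finset.Nat.sum_antidiagonal_swap]
  exact Finset.sum_congr rfl fun p _ => (h _ _).eq

theorem commute_scalar_flip (a : A) (k l : Fin N) :
    Commute (Matrix.scalar (Fin N) a) (flip N A k l) := by
  change Matrix.scalar (Fin N) a * Matrix.single l k 1 = Matrix.single l k 1 * Matrix.scalar _ a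
  ext p q
  rw [Matrix.scalar_apply, Matrix.diagonal_mul, Matrix.mul_diagonal, Matrix.single_apply]
  split_ifs <;> simp

theorem commute_legFlip {w : PowerSeries (Matrix (Fin N) (Fin N) A)}
    (hw : ∀ k, ∃ a, PowerSeries.coeff k w = Matrix.scalar (Fin N) a) (α β ε : Subring.center A)
    (i j : Fin N) : Commute w (legFlip N α β ε i j) := by
  have hc : ∀ q, Commute w (legSeries N A q) := fun q =>
    Subring.mem_center_iff.1 (legSeries_mem_center q) w
  have hf : Commute w (PowerSeries.C (flip N A i j)) := commute_series fun k l => by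
    obtain ⟨a, ha⟩ := hw k
    rw [ha, PowerSeries.coeff_C]
    split_ifs
    · exact commute_scalar_flip a i j
    · exact Commute.zero_right _
  rw [legFlip, Matrix.add_apply, Matrix.scalar_apply, Matrix.scalar_apply, Matrix.diagonal_mul,
    Matrix.diagonal_apply]
  refine Commute.add_right ?_ ((hc _).mul_right hf)
  split_ifs
  · exact hc _
  · exact Commute.zero_right _

theorem commute_list_prod_apply {n B : Type*} [Fintype n] [DecidableEq n] [Ring B] {w : B}
    {L : List (Matrix n n B)} (h : ∀ M ∈ L, ∀ i j, Commute w (M i j)) (i j : n) :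
    Commute w (L.prod i j) := by
  induction L generalizing i j with
  | nil =>
    rw [List.prod_nil, Matrix.one_apply]
    split_ifs
    · exact Commute.one_right _
    · exact Commute.zero_right _
  | cons M L ih =>
    rw [List.prod_cons, Matrix.mul_apply]
    exact Commute.sum_right _ _ _ fun k _ => (h M (by simp) i k).mul_right
      (ih (fun M' hM' => h M' (by simp [hM'])) k j)

variable [Algebra ℂ A]

/-- The trace of `E A(u) W(u) B(u)`, for a bilateral series `W(u)` absorbed by the projection `E`
and for the ordered products `A(u)` and `B(u)` of the polynomials `α_a - β u + ε P_a`. -/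
theorem trace_lact_ract {κ : Fin m → ℤ} (hκ : ∀ a, κ a ∈ Finset.Ioo (-(m : ℤ)) m)
    {α α' β ε b : Subring.center A} (hε : ε * ε = b * ε) (hα : ε * (α' - α) = N * (ε * ε))
    {D : ℤ → AuxMat m N A} (hD : ∀ d,
      (contentProj N κ).map (algebraMap ℂ (Matrix (Fin N) (Fin N) A)) * D d =
        (contentProj N κ).map (algebraMap ℂ (Matrix (Fin N) (Fin N) A)) * D d *
          (contentProj N κ).map (algebraMap ℂ (Matrix (Fin N) (Fin N) A)))
    (hDs : ∀ d f g, ∃ a, D d f g = Matrix.scalar (Fin N) a) (d : ℤ) :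
    Matrix.trace ((contentProj N κ).map (algebraMap ℂ (Matrix (Fin N) (Fin N) A)) *
      lact _ (List.ofFn fun a => linFlip N (α - κ a • b) β ε a).prod
        (ract (List.ofFn fun a => linFlip N (α' - κ a • b) β (-ε) a).reverse.prod D) d) =
      lact _ (legPoly N A (List.ofFn fun a =>
        lin (α - κ a • b) β * lin (α' - κ a • b) β).prod) (fun d => Matrix.trace
          ((contentProj N κ).map (algebraMap ℂ (Matrix (Fin N) (Fin N) A)) * D d)) d := by
  set E := (contentProj N κ).map (algebraMap ℂ (Matrix (Fin N) (Fin N) A)) with hE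
  set L := (List.ofFn fun a => linFlip N (α - κ a • b) β ε a).prod with hL
  set R := (List.ofFn fun a => linFlip N (α' - κ a • b) β (-ε) a).reverse.prod with hR
  set q := (List.ofFn fun a => lin (α - κ a • b) β * lin (α' - κ a • b) β).prod with hq
  have hL' : toSeries _ L =
      (List.ofFn fun a => toSeries _ (linFlip N (α - κ a • b) β ε a)).prod := by
    rw [hL, map_list_prod, List.map_ofFn]; rfl
  have hR' : toSeries _ R =
      (List.ofFn fun a => toSeries _ (linFlip N (α' - κ a • b) β (-ε) a)).reverse.prod := by
    rw [hR, map_list_prod, List.map_reverse, List.map_ofFn]; rfl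
  set σ := (seriesEquiv (Fin m → Fin N) (Matrix (Fin N) (Fin N) A)).symm with hσ
  have hσL : σ (toSeries _ L) = ((List.finRange m).map fun a =>
      slot a (legFlip N (α - κ a • b) β ε)).prod := by
    rw [hL', List.ofFn_eq_map, map_list_prod, List.map_map]
    simp only [Function.comp_def, hσ, seriesEquiv_symm_linFlip]
  have hσR : σ (toSeries _ R) = ((List.finRange m).map fun a =>
      slot a (legFlip N (α' - κ a • b) β (-ε))).reverse.prod := by
    rw [hR', List.ofFn_eq_map, map_list_prod, List.map_reverse, List.map_map]
    simp only [Function.comp_def, hσ, seriesEquiv_symm_linFlip]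
  set n := L.natDegree + R.natDegree + (legPoly N A q).natDegree with hn
  set W : PowerSeries (AuxMat m N A) := PowerSeries.mk fun k => D (d - n + k) with hW
  have key := trace_projection_mul (E := σ (PowerSeries.C E)) (A := σ (toSeries _ L)) (W := σ W)
    (B := σ (toSeries _ R)) (c := legSeries N A q) ?_ ?_ ?_ ?_ ?_ ?_ ?_
  · have h1 := congrArg (PowerSeries.coeff n) key
    rw [← map_mul, ← map_mul, ← map_mul, ← map_mul, hσ, coeff_trace_seriesEquiv_symm, mul_assoc,
      mul_assoc, ← mul_assoc (toSeries _ L), PowerSeries.coeff_C_mul, hW,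
      coeff_toSeries_mul_mul_toSeries _ _ _ _ (by omega)] at h1
    rw [h1]
    have h2 := coeff_toSeries_mul_mul_toSeries (legPoly N A q) 1
      (fun d => Matrix.trace (E * D d)) d (n := n) (by rw [natDegree_one]; omega)
    have h3 : ract 1 (fun d => Matrix.trace (E * D d)) = fun d => Matrix.trace (E * D d) := by
      funext e
      have := ract_C_mul_X_pow 0 (1 : Matrix (Fin N) (Fin N) A)
        (fun d => Matrix.trace (E * D d)) e
      rw [pow_zero, mul_one, map_one, Nat.cast_zero, sub_zero, mul_one] at this
      exact this
    rw [h3, map_one, mul_one] at h2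
    rw [← h2]
    refine congrArg (PowerSeries.coeff n) (congrArg (_ * ·) (PowerSeries.ext fun k => ?_))
    rw [coeff_trace_seriesEquiv_symm, PowerSeries.coeff_C_mul, PowerSeries.coeff_mk,
      PowerSeries.coeff_mk]
  · intro f g x
    rw [hσ, seriesEquiv_symm_C, Matrix.map_apply, hE, Matrix.map_apply]
    have := Algebra.commutes (A := PowerSeries (Matrix (Fin N) (Fin N) A)) (contentProj N κ f g) x
    rwa [PowerSeries.algebraMap_apply] at this
  · have := contentProj_mul_covariant (isCovariant_linFlip_prod (m := m) (N := N) (α := α) (β := β)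
      hε) hκ
    beta_reduce at this
    rw [← hL', seriesMat_apply] at this
    rw [← map_mul, ← map_mul]
    exact congrArg σ this
  · have := contentProj_mul_covariant (isCovariant_linFlip_reverse_prod (m := m) (N := N) (α := α')
      (β := β) (ε := -ε) (b := b) (by rw [neg_mul_neg, hε, mul_neg, neg_neg])) hκ
    beta_reduce at this
    rw [← hR', seriesMat_apply] at this
    rw [← map_mul, ← map_mul]
    exact congrArg σ this
  · rw [← map_mul, ← map_mul]
    refine congrArg σ (PowerSeries.ext fun k => ?_)
    rw [PowerSeries.coeff_mul_C, PowerSeries.coeff_C_mul, hW, PowerSeries.coeff_mk]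
    exact hD _
  · intro f g f' g'
    rw [hσL]
    refine commute_list_prod_apply (fun M hM i j => ?_) _ _
    obtain ⟨a, -, rfl⟩ := List.mem_map.1 hM
    rw [slot_apply]
    split_ifs
    · refine commute_legFlip (fun k => ?_) _ _ _ _ _
      obtain ⟨c, hc⟩ := hDs (d - n + k) f g
      refine ⟨c, ?_⟩
      rw [hσ, coeff_seriesEquiv_symm, hW, PowerSeries.coeff_mk, hc]
    · exact Commute.zero_right _
  · exact fun x => (Subring.mem_center_iff.1 (legSeries_mem_center q) x).symm
  · rw [hσL, hσR, transpose_slot_list_prod _ (List.nodup_finRange m), ← List.map_reverse,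
      transpose_slot_list_prod _ (List.nodup_reverse.2 (List.nodup_finRange m)), List.map_reverse,
      list_prod_mul_reverse_prod _ _ (fun a => Matrix.scalar (Fin m → Fin N) (legSeries N A
        (lin (α - κ a • b) β * lin (α' - κ a • b) β)))]
    · rw [hq, map_list_prod, map_list_prod, List.ofFn_eq_map, List.map_map, List.map_map]
      rfl
    · intro a
      rw [← slotHom_apply, ← slotHom_apply, ← map_mul, transpose_legFlip_mul, slotHom_apply,
        slot_scalar]
      rw [← hα]
      ring
    · intro a M
      change _ * _ = _ * _
      have h := Subring.mem_center_iff.1 (legSeries_mem_center (N := N) (A := A)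
        (lin (α - κ a • b) β * lin (α' - κ a • b) β))
      ext1 i j
      rw [Matrix.scalar_apply, Matrix.diagonal_mul, Matrix.mul_diagonal]
      exact (h _).symm

end TraceIdentity

end

noncomputable section

open Polynomial

/-! ### The commutator with the trace -/

section LeftAction

variable {R : Type*} [Ring R]

theorem lact_comp_add (f : R[X]) (D : ℤ → R) (d e : ℤ) :
    lact R f (fun k => D (k + e)) d = lact R f D (d + e) := by
  rw [lact_apply, lact_apply]
  simp only [sub_add_eq_add_sub]

theorem lact_mul_const (f : R[X]) (D : ℤ → R) (t : R) (d : ℤ) :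
    lact R f (fun k => D k * t) d = lact R f D d * t := by
  rw [lact_apply, lact_apply, sum_def, sum_def, Finset.sum_mul]
  simp only [mul_assoc]

theorem natDegree_list_prod_le_mul {L : List R[X]} {n : ℕ} (h : ∀ f ∈ L, f.natDegree ≤ n) :
    L.prod.natDegree ≤ L.length * n := by
  induction L with
  | nil => simp
  | cons f L ih =>
    rw [List.prod_cons, List.length_cons, add_mul, one_mul, add_comm]
    exact natDegree_mul_le_of_le (h f (by simp)) (ih fun g hg => h g (by simp [hg]))

theorem reflect_list_prod {L : List R[X]} {n : ℕ} (h : ∀ f ∈ L, f.natDegree ≤ n) :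
    L.prod.reflect (L.length * n) = (L.map (reflect n)).prod := by
  induction L with
  | nil =>
    simp
  | cons f L ih =>
    have h' : ∀ g ∈ L, g.natDegree ≤ n := fun g hg => h g (by simp [hg])
    rw [List.prod_cons, List.length_cons, add_mul, one_mul, add_comm, List.map_cons, List.prod_cons,
      reflect_mul _ _ (h f (by simp)) (natDegree_list_prod_le_mul h'), ih h']

end LeftAction

section TraceAction

variable {m N : ℕ} {A : Type*} [Ring A]

theorem auxScalar_mul_comm (a : Subring.center A) (M : AuxMat m N A) :
    auxScalar m N A a * M = M * auxScalar m N A a := by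
  have h := Subring.mem_center_iff.1 (scalar_mem_center (n := Fin N) a.2)
  change Matrix.scalar _ (Matrix.scalar (Fin N) (a : A)) * M =
    M * Matrix.scalar _ (Matrix.scalar (Fin N) (a : A))
  ext1 i j
  rw [Matrix.scalar_apply, Matrix.diagonal_mul, Matrix.mul_diagonal]
  exact (h _).symm

theorem lact_scalarPoly (E : AuxMat m N A) (f : (Subring.center A)[X]) (D : ℤ → AuxMat m N A)
    (d : ℤ) : Matrix.trace (E * lact _ (scalarPoly m N A f) D d) =
      lact _ (legPoly N A f) (fun e => Matrix.trace (E * D e)) d := by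
  induction f using Polynomial.induction_on' with
  | add p q hp hq =>
    rw [map_add (scalarPoly m N A), map_add (legPoly N A), lact_add_apply, lact_add_apply,
      Pi.add_apply, Pi.add_apply, mul_add,
      Matrix.trace_add, hp, hq]
  | monomial n a =>
    rw [scalarPoly, legPoly, coe_mapRingHom, coe_mapRingHom, map_monomial, map_monomial,
      lact_monomial, lact_monomial]
    change Matrix.trace (E * (auxScalar m N A a * D (d - n))) =
      Matrix.scalar (Fin N) (a : A) * Matrix.trace (E * D (d - n))
    rw [← mul_assoc, ← auxScalar_mul_comm, mul_assoc]
    simp only [auxScalar, RingHom.comp_apply, Matrix.trace, Matrix.diag_apply, Matrix.scalar_apply,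
      Matrix.diagonal_mul, Finset.mul_sum]

theorem natDegree_linFlip_le (α β ε : Subring.center A) (a : Fin m) :
    (linFlip N α β ε a).natDegree ≤ 1 := by
  rw [linFlip]
  refine (natDegree_add_le _ _).trans (max_le ?_ (by simp))
  exact (natDegree_map_le).trans (natDegree_lin_le _ _)

theorem commute_linFlip {a : Fin m} {Z : PowerSeries (AuxMat m N A)}
    (h : Commute (PowerSeries.C (auxFlip N A a)) Z) (α β ε : Subring.center A) :
    Commute (toSeries _ (linFlip N α β ε a)) Z := by
  have hc := fun q => (Subring.mem_center_iff.1 (toSeries_scalarPoly_mem_center (m := m) (N := N)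
    (A := A) q) Z).symm
  rw [toSeries_linFlip]
  exact Commute.add_left (hc _) (Commute.mul_left (hc _) h)

theorem commute_reflect_linFlip {a : Fin m} {Z : PowerSeries (AuxMat m N A)}
    (h : Commute (PowerSeries.C (auxFlip N A a)) Z) (α β ε : Subring.center A) :
    Commute (toSeries _ ((linFlip N α β ε a).reflect 1)) Z := by
  have hc := fun q => (Subring.mem_center_iff.1 (toSeries_scalarPoly_mem_center (m := m) (N := N)
    (A := A) q) Z).symm
  rw [toSeries_reflect_linFlip]
  exact Commute.add_left (hc _) (Commute.mul_left (hc _) h)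

variable [Algebra Base A] [TopologicalSpace A] [PairingAlgebra A]

/-- An operator in the auxiliary tensor factor passes through the product of the series `X_a(u)` and
`Y_a(u⁻¹)` at the expense of polynomial factors. -/
theorem lact_pair_of_isExchange {T : AuxMat m N A} {X' Y' : Fin m → PowerSeries (AuxMat m N A)}
    {q p r : Fin m → (Subring.center A)[X]} {α ρ α' : Fin m → Subring.center A}
    {β ε : Subring.center A}
    (hex : ∀ a, IsExchange T (X' a) (Y' a) (q a) (p a) (r a) (linFlip N (α a) β ε a)
      (linFlip N (ρ a) β (-ε) a) (linFlip N (α' a) β (-ε) a))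
    (hp : ∀ a, (p a).natDegree ≤ 2) (hr : ∀ a, (r a).natDegree ≤ 2)
    (hX : ∀ a c, a ≠ c → Commute (PowerSeries.C (auxFlip N A a)) (X' c))
    (hY : ∀ a c, a ≠ c → Commute (PowerSeries.C (auxFlip N A a)) (Y' c))
    (hnull : Null (List.ofFn Y').reverse.prod) (d : ℤ) :
    lact _ (scalarPoly m N A (List.ofFn fun a => q a * p a).prod)
      (fun e => T * pair (List.ofFn X').prod (List.ofFn Y').reverse.prod e) d =
    lact _ (scalarPoly m N A (List.ofFn r).prod)
      (lact _ (List.ofFn fun a => linFlip N (α a) β ε a).prod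
        (ract (List.ofFn fun a => linFlip N (α' a) β (-ε) a).reverse.prod
          (pair (List.ofFn X').prod (List.ofFn Y').reverse.prod))) d * T := by
  set L := (List.ofFn fun a => linFlip N (α a) β ε a).prod with hL
  set S := (List.ofFn fun a => linFlip N (ρ a) β (-ε) a).reverse.prod with hS
  set B := (List.ofFn fun a => linFlip N (α' a) β (-ε) a).reverse.prod with hB
  set Xp := (List.ofFn X').prod with hXp
  set Yp := (List.ofFn Y').reverse.prod with hYp
  set Q := (List.ofFn q).prod with hQ
  set P := (List.ofFn p).prod with hP
  set Rr := (List.ofFn r).prod with hRr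
  have hcen := fun f => Subring.mem_center_iff.1 (toSeries_scalarPoly_mem_center (m := m) (N := N)
    (A := A) f)
  have hQP : (List.ofFn fun a => q a * p a).prod = Q * P := by
    simp only [hQ, hP, List.prod_ofFn, Finset.prod_mul_distrib]
  have hdeg : ∀ f : Fin m → (Subring.center A)[X], (∀ a, (f a).natDegree ≤ 2) →
      (List.ofFn f).prod.natDegree ≤ m * 2 ∧
      toSeries _ (scalarPoly m N A ((List.ofFn f).prod.reflect (m * 2))) =
        ((List.finRange m).map fun a => toSeries _ (scalarPoly m N A ((f a).reflect 2))).prod := by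
    intro f hf
    have h : ∀ g ∈ List.ofFn f, g.natDegree ≤ 2 := fun g hg => by
      obtain ⟨a, rfl⟩ := (List.mem_ofFn' _ _).1 hg
      exact hf a
    have h1 := natDegree_list_prod_le_mul h
    have h2 := reflect_list_prod h
    rw [List.length_ofFn] at h1 h2
    refine ⟨h1, ?_⟩
    rw [h2, List.ofFn_eq_map, map_list_prod, map_list_prod, List.map_map, List.map_map,
      List.map_map]
    rfl
  have hlin : ∀ γ : Fin m → Subring.center A,
      (List.ofFn fun a => linFlip N (γ a) β (-ε) a).reverse.prod.natDegree ≤ m ∧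
      toSeries _ ((List.ofFn fun a => linFlip N (γ a) β (-ε) a).reverse.prod.reflect m) =
        ((List.finRange m).map fun a =>
          toSeries _ ((linFlip N (γ a) β (-ε) a).reflect 1)).reverse.prod := by
    intro γ
    have h : ∀ g ∈ (List.ofFn fun a => linFlip N (γ a) β (-ε) a).reverse, g.natDegree ≤ 1 :=
      fun g hg => by
        obtain ⟨a, rfl⟩ := (List.mem_ofFn' _ _).1 (List.mem_reverse.1 hg)
        exact natDegree_linFlip_le _ _ _ _
    have h1 := natDegree_list_prod_le_mul h
    have h2 := reflect_list_prod h
    rw [List.length_reverse, List.length_ofFn, mul_one] at h1 h2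
    refine ⟨h1, ?_⟩
    rw [h2, List.map_reverse, map_list_prod, List.map_reverse, List.ofFn_eq_map, List.map_map,
      List.map_map]
    rfl
  -- the two sides of the exchange relations for the ordered products
  have ex1 : toSeries _ (scalarPoly m N A Q) * (PowerSeries.C T * Xp) =
      toSeries _ L * (Xp * (PowerSeries.C T * toSeries _ S)) := by
    have := exchange_list_prod (S := PowerSeries (AuxMat m N A)) (fun a =>
      toSeries_scalarPoly_mem_center (q a)) (fun a => (hex a).left)
      (fun a c h => commute_linFlip (hX a c h) _ _ _)
      (fun a c h => commute_linFlip (hX a c h) _ _ _)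
      (List.nodup_finRange m)
    rw [hQ, hL, hS, hXp]
    simp only [List.ofFn_eq_map, map_list_prod, List.map_reverse, List.map_map]
    exact this
  have ex2 : toSeries _ (scalarPoly m N A (P.reflect (m * 2))) *
      (PowerSeries.C T * (toSeries _ (S.reflect m) * Yp)) =
      toSeries _ (scalarPoly m N A (Rr.reflect (m * 2))) *
        (Yp * (toSeries _ (B.reflect m) * PowerSeries.C T)) := by
    have := exchange_list_reverse_prod (S := PowerSeries (AuxMat m N A)) (fun a =>
      toSeries_scalarPoly_mem_center ((p a).reflect 2))
      (fun a => toSeries_scalarPoly_mem_center ((r a).reflect 2)) (fun a => (hex a).right)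
      (fun a c h => commute_reflect_linFlip (hY a c h) _ _ _)
      (fun a c h => commute_reflect_linFlip (hY a c h) _ _ _) (List.nodup_finRange m)
    rw [(hdeg p hp).2, (hdeg r hr).2, (hlin ρ).2, (hlin α').2, hYp, List.ofFn_eq_map]
    exact this
  have hscal : ∀ f : (Subring.center A)[X], f.natDegree ≤ m * 2 →
      (scalarPoly m N A f).natDegree ≤ m * 2 := fun f hf => natDegree_map_le.trans hf
  have hPnull := hnull.toSeries_mul (scalarPoly m N A (P.reflect (m * 2)))
  have hBnull := hnull.mul_toSeries (B.reflect m)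
  have hmid : ∀ e : ℤ, pair Xp (Yp * (toSeries _ (B.reflect m) * PowerSeries.C T)) e =
      ract B (pair Xp Yp) (e + m) * T := by
    intro e
    rw [← mul_assoc, pair_mul_C_right hBnull, ← pair_mul_toSeries_right hnull B (hlin α').1,
      add_sub_cancel_right]
  -- both sides equal one coefficient of the product of the series in `ex1` and `P Y`
  have e1 : pair (toSeries _ (scalarPoly m N A Q) * (PowerSeries.C T * Xp))
      (toSeries _ (scalarPoly m N A (P.reflect (m * 2))) * Yp) (d - (m * 2 : ℕ)) =
      lact _ (scalarPoly m N A (Q * P)) (fun e => T * pair Xp Yp e) d := by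
    rw [← scalarPoly_reflect, ← pair_mul_toSeries hnull _ (hscal P (hdeg p hp).1), hcen,
      ← mul_assoc, ← map_mul, ← map_mul, mul_comm P, pair_toSeries_mul hnull]
    exact congrArg (fun G => lact _ _ G d) (_root_.funext fun e => pair_C_mul hnull _ _ _)
  have e2 : pair (toSeries _ L * (Xp * (PowerSeries.C T * toSeries _ S)))
      (toSeries _ (scalarPoly m N A (P.reflect (m * 2))) * Yp) (d - (m * 2 : ℕ)) =
      lact _ (scalarPoly m N A Rr) (lact _ L (ract B (pair Xp Yp))) d * T := by
    have hTnull : Null (Yp * (toSeries _ (B.reflect m) * PowerSeries.C T)) := by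
      rw [← mul_assoc]
      exact hBnull.mul_C T
    rw [← mul_assoc Xp, ← mul_assoc (toSeries _ L), ← mul_assoc (toSeries _ L),
      pair_mul_toSeries hPnull _ (hlin ρ).1, pair_mul_C, ← mul_assoc (toSeries _ (reflect m S)),
      hcen, mul_assoc, ← mul_assoc (PowerSeries.C T), hcen, mul_assoc, ex2, ← scalarPoly_reflect]
    have := pair_mul_toSeries hTnull (scalarPoly m N A Rr) (hscal Rr (hdeg r hr).1)
      (toSeries _ L * Xp) (d - m)
    rw [show d - ((m * 2 : ℕ) : ℤ) - m = d - m - (m * 2 : ℕ) by ring, ← this, hcen, ← mul_assoc,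
      ← map_mul, pair_toSeries_mul hTnull, lact_mul_apply]
    rw [show pair Xp (Yp * (toSeries _ (B.reflect m) * PowerSeries.C T)) =
      fun e => ract B (pair Xp Yp) (e + m) * T from _root_.funext hmid]
    have e3 : lact _ L (fun e => ract B (pair Xp Yp) (e + m) * T) =
        fun e => lact _ L (ract B (pair Xp Yp)) (e + m) * T := by
      funext e
      rw [lact_mul_const _ (fun e => ract B (pair Xp Yp) (e + m)), lact_comp_add]
    rw [e3, lact_mul_const _ (fun e => lact _ L (ract B (pair Xp Yp)) (e + m)), lact_comp_add,
      sub_add_cancel]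
  rw [hQP, ← e1, ex1, e2]

variable [Algebra ℂ A]

/-- The commutator of `T` with the trace of `E X(u) Y(u⁻¹)` is annihilated by a product of
polynomials. -/
theorem lact_commutator_trace {T : Matrix (Fin N) (Fin N) A}
    {X' Y' : Fin m → PowerSeries (AuxMat m N A)} {q p r : Fin m → (Subring.center A)[X]}
    {κ : Fin m → ℤ} (hκ : ∀ a, κ a ∈ Finset.Ioo (-(m : ℤ)) m)
    {α α' β ε b : Subring.center A} {ρ : Fin m → Subring.center A}
    (hex : ∀ a, IsExchange (auxLeg m N A T) (X' a) (Y' a) (q a) (p a) (r a)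
      (linFlip N (α - κ a • b) β ε a) (linFlip N (ρ a) β (-ε) a)
      (linFlip N (α' - κ a • b) β (-ε) a))
    (hqp : ∀ a, q a * p a = r a * (lin (α - κ a • b) β * lin (α' - κ a • b) β))
    (hp : ∀ a, (p a).natDegree ≤ 2) (hr : ∀ a, (r a).natDegree ≤ 2)
    (hX : ∀ a c, a ≠ c → Commute (PowerSeries.C (auxFlip N A a)) (X' c))
    (hY : ∀ a c, a ≠ c → Commute (PowerSeries.C (auxFlip N A a)) (Y' c))
    (hnull : Null (List.ofFn Y').reverse.prod)
    (hε : ε * ε = b * ε) (hα : ε * (α' - α) = N * (ε * ε)) {D : ℤ → AuxMat m N A}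
    (hpair : pair (List.ofFn X').prod (List.ofFn Y').reverse.prod = D)
    (hD : ∀ d, (contentProj N κ).map (algebraMap ℂ (Matrix (Fin N) (Fin N) A)) * D d =
        (contentProj N κ).map (algebraMap ℂ (Matrix (Fin N) (Fin N) A)) * D d *
          (contentProj N κ).map (algebraMap ℂ (Matrix (Fin N) (Fin N) A)))
    (hDs : ∀ d f g, ∃ a, D d f g = Matrix.scalar (Fin N) a) :
    let E := (contentProj N κ).map (algebraMap ℂ (Matrix (Fin N) (Fin N) A))
    lact _ (legPoly N A (List.ofFn fun a => q a * p a).prod)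
      (fun d => T * Matrix.trace (E * D d) - Matrix.trace (E * D d) * T) = 0 := by
  intro E
  have hE : ∀ f g x, Commute (E f g) x := fun f g x => by
    rw [show E f g = algebraMap ℂ _ (contentProj N κ f g) from rfl]
    exact Algebra.commutes (A := Matrix (Fin N) (Fin N) A) (contentProj N κ f g) x
  have ht1 : ∀ M : AuxMat m N A, Matrix.trace (E * (auxLeg m N A T * M)) =
      T * Matrix.trace (E * M) := fun M => by
    simp only [auxLeg, Matrix.trace, Matrix.diag_apply, Matrix.scalar_apply, Matrix.mul_apply,
      Matrix.diagonal_apply, ite_mul, zero_mul, Finset.sum_ite_eq, Finset.mem_univ, if_true,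
      Finset.mul_sum]
    refine Finset.sum_congr rfl fun f _ => Finset.sum_congr rfl fun g _ => ?_
    rw [← mul_assoc, (hE f g T).eq, mul_assoc]
  have ht2 : ∀ M : AuxMat m N A, Matrix.trace (E * (M * auxLeg m N A T)) =
      Matrix.trace (E * M) * T := fun M => by
    rw [← mul_assoc]
    simp only [auxLeg, Matrix.trace, Matrix.diag_apply, Matrix.scalar_apply, Matrix.mul_diagonal,
      Finset.sum_mul]
  have hprod : (List.ofFn fun a => q a * p a).prod = (List.ofFn r).prod *
      (List.ofFn fun a => lin (α - κ a • b) β * lin (α' - κ a • b) β).prod := by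
    simp only [hqp, List.prod_ofFn, Finset.prod_mul_distrib]
  have key := fun d => congrArg (fun M => Matrix.trace (E * M))
    (lact_pair_of_isExchange hex hp hr hX hY hnull d)
  simp only [hpair, ht2, lact_scalarPoly, ht1] at key
  have htr := fun d => trace_lact_ract hκ (β := β) hε hα hD hDs d
  funext d
  have h1 : lact _ (legPoly N A (List.ofFn fun a => q a * p a).prod)
      (fun d => T * Matrix.trace (E * D d)) d =
      lact _ (legPoly N A (List.ofFn fun a => q a * p a).prod)
      (fun d => Matrix.trace (E * D d) * T) d := by
    rw [key, lact_mul_const _ (fun d => Matrix.trace (E * D d)), hprod, map_mul, lact_mul_apply]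
    exact congrArg (fun G => lact _ (legPoly N A (List.ofFn r).prod) G d * T)
      (_root_.funext htr)
  rw [Pi.zero_apply, ← sub_eq_zero.2 h1, ← Pi.sub_apply, ← map_sub]
  rfl

end TraceAction

end

noncomputable section

/-! ### Covariance of the products of shifted series -/

section TwoPoint

variable {N : ℕ} {F : Type*} [Ring F] [Algebra Base F] [TopologicalSpace F] [PairingAlgebra F]
  {x y : Fin N → Fin N → ℕ → F}

open scoped PowerSeries.WithPiTopology

/-- The specialization of a double series in two variables at `u + z h` and `u + w h`. -/
def plusEval (F : Type*) [Ring F] [Algebra Base F] [TopologicalSpace F] [PairingAlgebra F]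
    (z w : ℂ) : PowerSeries (PowerSeries F) →+* PowerSeries F :=
  (diagonal.comp (plusShiftHom (isShift_algebraMap (A := PowerSeries F) w))).comp
    (PowerSeries.map (plusShiftHom (isShift_algebraMap z)))

theorem plusEval_C (z w : ℂ) (f : PowerSeries F) :
    plusEval F z w (PowerSeries.C f) = plusShift (algebraMap Base F (hMul z)) f := by
  rw [plusEval, RingHom.comp_apply, PowerSeries.map_C, RingHom.comp_apply, plusShiftHom_C,
    diagonal_C, plusShiftHom_apply]

theorem map_map_C_of_fix {A : Type*} [Ring A] {φ : PowerSeries A →+* PowerSeries A}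
    (h : ∀ b, φ (PowerSeries.C b) = PowerSeries.C b) (f : PowerSeries A) :
    PowerSeries.map φ (PowerSeries.map PowerSeries.C f) = PowerSeries.map PowerSeries.C f := by
  ext1 n
  rw [PowerSeries.coeff_map, PowerSeries.coeff_map, h]

theorem plusEval_map_C (z w : ℂ) (f : PowerSeries F) :
    plusEval F z w (PowerSeries.map PowerSeries.C f) =
      plusShift (algebraMap Base F (hMul w)) f := by
  rw [plusEval, RingHom.comp_apply, map_map_C_of_fix fun b => plusShiftHom_C _ b,
    RingHom.comp_apply, plusShiftHom_apply, algebraMap_series,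
    plusShift_map _ (PowerSeries.WithPiTopology.continuous_C (R := F)) (isShift_algebraMap w),
    diagonal_map_C]

/-- The specialization of a double series in the inverses of two variables at `u + z h` and
`u + w h`. -/
def invEval (F : Type*) [Ring F] [Algebra Base F] [TopologicalSpace F] [PairingAlgebra F]
    (z w : ℂ) : PowerSeries (PowerSeries F) →+* PowerSeries F :=
  (diagonal.comp (invShiftHom (commute_algebraMap (A := PowerSeries F) (hMul w)))).comp
    (PowerSeries.map (invShiftHom (commute_algebraMap (hMul z))))

theorem invEval_C (z w : ℂ) (f : PowerSeries F) :
    invEval F z w (PowerSeries.C f) = invShift (algebraMap Base F (hMul z)) f := by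
  rw [invEval, RingHom.comp_apply, PowerSeries.map_C, RingHom.comp_apply, invShiftHom_C,
    diagonal_C, invShiftHom_apply]

theorem invEval_map_C (z w : ℂ) (f : PowerSeries F) :
    invEval F z w (PowerSeries.map PowerSeries.C f) =
      invShift (algebraMap Base F (hMul w)) f := by
  rw [invEval, RingHom.comp_apply, map_map_C_of_fix fun b => invShiftHom_C _ b,
    RingHom.comp_apply, invShiftHom_apply, algebraMap_series, invShift_map, diagonal_map_C]

theorem hMul_sub_hMul {z w : ℂ} {n : ℤ} (h : z - w = n) : hMul z - hMul w = n • hbar := by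
  rw [hMul, hMul, ← sub_mul, ← map_sub, h, map_intCast, zsmul_eq_mul]

/-- The relation `n [A_{ij}, B_{kl}] = A_{kj} B_{il} - B_{kj} A_{il}`. -/
def IsTwoPoint {S : Type*} [Ring S] (n : ℤ) (A B : Fin N → Fin N → S) : Prop :=
  ∀ i j k l, n • (A i j * B k l - B k l * A i j) = A k j * B i l - B k j * A i l

/-- The relation between two series `T⁺`, divided by `h`, at the points `u + z h` and `u + w h`. -/
theorem IsCritical.plusShift_twoPoint (H : IsCritical x y) {z w : ℂ} {n : ℤ} (h : z - w = n) :
    IsTwoPoint n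
      (fun i j => plusShift (algebraMap Base F (hMul z)) (PowerSeries.mk (tPlusCoeff y i j)))
      (fun i j => plusShift (algebraMap Base F (hMul w)) (PowerSeries.mk (tPlusCoeff y i j))) := by
  intro i j k l
  have e := congrArg (plusEval F z w) (H.rttPlus_series i j k l)
  -- at the two points, the factor `u - v` becomes `(z - w) h`
  have hX : plusEval F z w (PowerSeries.C PowerSeries.X - PowerSeries.X) =
      PowerSeries.C (algebraMap Base F (n • hbar)) := by
    have h1 : plusEval F z w PowerSeries.X =
        PowerSeries.X + PowerSeries.C (algebraMap Base F (hMul w)) := by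
      have := plusEval_map_C (F := F) z w PowerSeries.X
      rw [PowerSeries.map_X] at this
      rw [this, ← plusShiftHom_apply (isShift_algebraMap w), plusShiftHom_X]
    rw [map_sub, h1, plusEval_C, ← plusShiftHom_apply (isShift_algebraMap z), plusShiftHom_X,
      add_sub_add_left_eq_sub, ← map_sub, ← map_sub, hMul_sub_hMul h]
  rw [map_mul, hX] at e
  simp only [map_sub, map_mul, plusEval_C, plusEval_map_C] at e
  beta_reduce
  rw [← e, mk_tPlusCoeff y i j, ← plusShiftHom_apply (isShift_algebraMap z),
    ← plusShiftHom_apply (isShift_algebraMap z), map_add, hbar_smul_eq, map_mul, plusShiftHom_C]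
  have h1 : ∀ f, Commute (plusShiftHom (isShift_algebraMap (A := F) z)
      (if i = j then 1 else 0)) f := fun f => by
    split_ifs
    · rw [map_one]; exact Commute.one_left _
    · rw [map_zero]; exact Commute.zero_left _
  have h2 := fun f => Subring.mem_center_iff.1
    (C_mem_center (algebraMap_mem_center (A := F) hbar)) f
  rw [add_mul, mul_add, (h1 _).eq, add_sub_add_left_eq_sub, ← mul_assoc (plusShift _ _), h2,
    mul_assoc, mul_assoc, ← mul_sub, map_zsmul, map_zsmul, smul_mul_assoc]

theorem IsCritical.invShift_twoPoint (H : IsCritical x y) {z w : ℂ} {n : ℤ} (h : z - w = n) :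
    IsTwoPoint n
      (fun i j => invShift (algebraMap Base F (hMul z)) (PowerSeries.mk (tCoeff x i j)))
      (fun i j => invShift (algebraMap Base F (hMul w)) (PowerSeries.mk (tCoeff x i j))) := by
  intro i j k l
  have e := congrArg (invEval F z w) (H.rtt_series i j k l)
  have hX : invEval F z w PowerSeries.X =
      invShift (algebraMap Base F (hMul w)) PowerSeries.X := by
    have := invEval_map_C (F := F) z w PowerSeries.X
    rwa [PowerSeries.map_X] at this
  simp only [map_sub, map_mul, invEval_C, invEval_map_C, hX] at e
  have hz := one_add_mul_invShift_X (a := algebraMap Base F (hMul z))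
  have hw := one_add_mul_invShift_X (a := algebraMap Base F (hMul w))
  set Xz := invShift (algebraMap Base F (hMul z)) PowerSeries.X
  set Xw := invShift (algebraMap Base F (hMul w)) PowerSeries.X
  set dz := 1 + PowerSeries.C (algebraMap Base F (hMul z)) * PowerSeries.X with hdz
  set dw := 1 + PowerSeries.C (algebraMap Base F (hMul w)) * PowerSeries.X with hdw
  have cw : ∀ f, Commute dw f := commute_one_add_C_mul_X (commute_algebraMap (hMul w))
  have key : ∀ f g : PowerSeries F, (Xw - Xz) * f = Xw * Xz * g →
      PowerSeries.C (algebraMap Base F (n • hbar)) * f = g := by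
    intro f g hfg
    have h1 := congrArg (dz * dw * ·) hfg
    have e1 : dz * dw * (Xw - Xz) =
        PowerSeries.C (algebraMap Base F (n • hbar)) * PowerSeries.X ^ 2 := by
      rw [mul_sub, mul_assoc, hw, ← (cw dz).eq, mul_assoc, hz, ← sub_mul, hdz, hdw,
        add_sub_add_left_eq_sub, ← sub_mul, ← map_sub, ← map_sub, hMul_sub_hMul h, mul_assoc,
        pow_two]
    have e2 : dz * dw * (Xw * Xz) = PowerSeries.X ^ 2 := by
      rw [mul_assoc, ← mul_assoc dw, hw, ← mul_assoc, ← PowerSeries.X_mul, mul_assoc, hz, pow_two]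
    beta_reduce at h1
    rw [← mul_assoc, e1, ← mul_assoc, e2, PowerSeries.X_pow_mul, mul_assoc,
      PowerSeries.X_pow_mul, ← mul_assoc] at h1
    exact PowerSeries.mul_X_pow_cancel h1
  have e' := key _ _ e
  beta_reduce
  rw [← e', mk_tCoeff x i j, ← invShiftHom_apply (commute_algebraMap (hMul z)),
    ← invShiftHom_apply (commute_algebraMap (hMul z)), map_add, hbar_smul_eq, map_mul,
    invShiftHom_C]
  have h1 : ∀ f, Commute (invShiftHom (commute_algebraMap (A := F) (hMul z))
      (if i = j then 1 else 0)) f := fun f => by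
    split_ifs
    · rw [map_one]; exact Commute.one_left _
    · rw [map_zero]; exact Commute.zero_left _
  have h2 := fun f => Subring.mem_center_iff.1
    (C_mem_center (algebraMap_mem_center (A := F) hbar)) f
  rw [add_mul, mul_add, (h1 _).eq, add_sub_add_left_eq_sub, ← mul_assoc (invShift _ _), h2,
    mul_assoc, mul_assoc, ← mul_sub, map_zsmul, map_zsmul, smul_mul_assoc]

end TwoPoint

section SlotFamilies

variable {m N : ℕ} {A : Type*} [Ring A]

theorem seriesEquiv_slot (a : Fin m) (w : Fin N → Fin N → PowerSeries A) :
    seriesEquiv (Fin m → Fin N) A (slot a (Matrix.of w)) = slotSeries a w := by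
  ext k f g
  rw [coeff_seriesEquiv, slot_apply, slotSeries, PowerSeries.coeff_mk, slot_apply]
  split_ifs
  · rfl
  · exact map_zero _

variable [Algebra ℂ A]

theorem seriesEquiv_permMat (σ : Equiv.Perm (Fin m)) :
    seriesEquiv (Fin m → Fin N) A (permMat m N (PowerSeries A) σ) =
      seriesMat m N A (permAction m N σ) := by
  rw [seriesMat_permAction, ← seriesEquiv_map_C]
  congr 1
  ext1 f g
  rw [Matrix.map_apply, permMat_apply, permMat_apply]
  split_ifs <;> simp

theorem seriesMat_mul_slotSeries (σ : Equiv.Perm (Fin m)) (a : Fin m)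
    (w : Fin N → Fin N → PowerSeries A) : seriesMat m N A (permAction m N σ) * slotSeries a w =
      slotSeries (σ a) w * seriesMat m N A (permAction m N σ) := by
  ext1 k
  rw [seriesMat_permAction, PowerSeries.coeff_C_mul, PowerSeries.coeff_mul_C, slotSeries,
    slotSeries, PowerSeries.coeff_mk, PowerSeries.coeff_mk, permMat_mul_slot]

theorem isSlotFamily_slotSeries (w : ℤ → Fin N → Fin N → PowerSeries A) :
    IsSlotFamily (seriesMat m N A) fun a k => slotSeries a (w k) where
  of_ne i hi a k h1 h2 := by
    rw [adj, seriesMat_mul_slotSeries,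
      Equiv.swap_apply_of_ne_of_ne (Fin.ne_of_val_ne h1) (Fin.ne_of_val_ne h2)]
  left i hi k := by
    rw [adj, seriesMat_mul_slotSeries, Equiv.swap_apply_left]

theorem mul_inverse_eq {R : Type*} [Ring R] {s X X' Y Y' : R} (h : s * X = X' * s)
    (hX : X * Y = 1) (hX' : Y' * X' = 1) : s * Y = Y' * s :=
  calc s * Y = Y' * (X' * s) * Y := by rw [← mul_assoc, hX', one_mul]
    _ = Y' * s := by rw [← h, mul_assoc, mul_assoc, hX, mul_one]

theorem IsSlotFamily.inverse {R : Type*} [Ring R] [Algebra ℂ R] {j : TensorMat m N ℂ →ₐ[ℂ] R}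
    {F G : Fin m → ℤ → R} (hF : IsSlotFamily j F) (h1 : ∀ a k, F a k * G a k = 1)
    (h2 : ∀ a k, G a k * F a k = 1) : IsSlotFamily j G where
  of_ne i hi a k h h' := mul_inverse_eq (hF.of_ne i hi a k h h') (h1 a k) (h2 a k)
  left i hi k := mul_inverse_eq (hF.left i hi k) (h1 _ k) (h2 _ k)

/-- The two-point relation, as a relation of operators on the tensor product. -/
theorem IsTwoPoint.slotSeries {n : ℤ} {w w' : Fin N → Fin N → PowerSeries A}
    (h : IsTwoPoint n w w') (i : ℕ) (hi : i + 1 < m) :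
    n • (slotSeries ⟨i, by omega⟩ w * slotSeries ⟨i + 1, hi⟩ w' -
      slotSeries ⟨i + 1, hi⟩ w' * slotSeries ⟨i, by omega⟩ w) =
    seriesMat m N A (adj (permAction m N) i hi) *
        (slotSeries ⟨i, by omega⟩ w * slotSeries ⟨i + 1, hi⟩ w') -
      slotSeries ⟨i + 1, hi⟩ w' * slotSeries ⟨i, by omega⟩ w *
        seriesMat m N A (adj (permAction m N) i hi) := by
  have hne : (⟨i, by omega⟩ : Fin m) ≠ ⟨i + 1, hi⟩ := by simp
  have e : n • (leg0 N _ (Matrix.of w) * leg1 N _ (Matrix.of w') -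
      leg1 N _ (Matrix.of w') * leg0 N _ (Matrix.of w)) =
      flip N (PowerSeries A) * (leg0 N _ (Matrix.of w) * leg1 N _ (Matrix.of w')) -
        leg1 N _ (Matrix.of w') * leg0 N _ (Matrix.of w) * flip N (PowerSeries A) := by
    ext1 k l
    ext1 p q
    rw [Matrix.smul_apply, Matrix.smul_apply, Matrix.sub_apply, Matrix.sub_apply, Matrix.sub_apply,
      Matrix.sub_apply, flip_mul_apply, mul_flip_apply, leg0_mul_leg1_apply, leg0_mul_leg1_apply,
      leg1_mul_leg0_apply, leg1_mul_leg0_apply]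
    exact h p q k l
  have e' := congrArg (fun M => seriesEquiv (Fin m → Fin N) A (twoSlot hne M)) e
  simp only [map_zsmul, map_sub, map_mul, twoSlot_leg0, twoSlot_leg1, twoSlot_flip,
    seriesEquiv_slot, seriesEquiv_permMat] at e'
  exact e'

end SlotFamilies

section Absorption

variable {m N : ℕ} {F : Type*} [Ring F] [Algebra Base F] [TopologicalSpace F] [PairingAlgebra F]
  [Algebra ℂ F] {x y : Fin N → Fin N → ℕ → F}

theorem IsCritical.isCovariant_plusSlot (H : IsCritical x y) :
    IsCovariant (seriesMat m N F) fun κ => (List.ofFn fun a => plusSlot y a (κ a)).prod :=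
  isCovariant_prod (F := fun a (k : ℤ) => plusSlot y a k)
    (isSlotFamily_slotSeries fun k i j =>
      plusShift (algebraMap Base F (hMul k)) (PowerSeries.mk (tPlusCoeff y i j)))
    fun i hi _ _ => (H.plusShift_twoPoint (Int.cast_sub _ _).symm).slotSeries i hi

theorem IsCritical.isCovariant_inverse (H : IsCritical x y) (w : ℂ)
    {Y : Fin m → ℤ → PowerSeries (TensorMat m N F)}
    (h1 : ∀ a (k : ℤ), invSlot x a (k - w) * Y a k = 1)
    (h2 : ∀ a (k : ℤ), Y a k * invSlot x a (k - w) = 1) :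
    IsCovariant (seriesMat m N F) fun κ => (List.ofFn fun a => Y a (κ a)).reverse.prod :=
  isCovariant_reverse_prod (F := Y)
    ((isSlotFamily_slotSeries fun k i j =>
      invShift (algebraMap Base F (hMul (k - w))) (PowerSeries.mk (tCoeff x i j))).inverse h1 h2)
    fun i hi k l => inverse_relation (h1 _ k) (h2 _ k) (h1 _ l) (h2 _ l)
      ((H.invShift_twoPoint (by push_cast; ring)).slotSeries i hi)

end Absorption

end

noncomputable section

open Polynomial Filter Topology

/-! ### Cancellation of polynomial factors -/

section CenterAction

variable {A : Type*} [Ring A]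

/-- The action of the polynomials in `u` with central coefficients on bilateral series. -/
def centerAct (A : Type*) [Ring A] : (Subring.center A)[X] →+* AddMonoid.End (ℤ → A) :=
  (lact A).comp (mapRingHom (Subring.center A).subtype)

theorem centerAct_mul (f g : (Subring.center A)[X]) (s : ℤ → A) :
    centerAct A (f * g) s = centerAct A f (centerAct A g s) := by
  rw [map_mul]; rfl

theorem centerAct_C (a : Subring.center A) (s : ℤ → A) (d : ℤ) :
    centerAct A (C a) s d = a * s d := by
  rw [centerAct, RingHom.comp_apply, coe_mapRingHom, map_C, lact_C]
  rfl

theorem centerAct_X (s : ℤ → A) (d : ℤ) : centerAct A X s d = s (d - 1) := by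
  rw [centerAct, RingHom.comp_apply, coe_mapRingHom, map_X, lact_X]

theorem centerAct_lin (α β : Subring.center A) (s : ℤ → A) (d : ℤ) :
    centerAct A (lin α β) s d = α * s d - β * s (d - 1) := by
  rw [lin, map_sub]
  change centerAct A (C α) s d - centerAct A (C β * X) s d = _
  rw [centerAct_mul, centerAct_C, centerAct_C, centerAct_X]

theorem lact_legPoly_apply {N : ℕ} (f : (Subring.center A)[X])
    (s : ℤ → Matrix (Fin N) (Fin N) A) (d : ℤ) (i j : Fin N) :
    lact _ (legPoly N A f) s d i j = centerAct A f (fun e => s e i j) d := by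
  induction f using Polynomial.induction_on' with
  | add p q hp hq =>
    rw [map_add (legPoly N A), map_add (centerAct A), lact_add_apply, Pi.add_apply,
      Matrix.add_apply, hp, hq]
    rfl
  | monomial n a =>
    rw [legPoly, centerAct, RingHom.comp_apply, coe_mapRingHom, coe_mapRingHom, map_monomial,
      map_monomial, lact_monomial, lact_monomial, RingHom.comp_apply, Matrix.scalar_apply,
      Matrix.diagonal_mul]

/-- The polynomials which act injectively on the bilateral series. -/
def ActsInjectively (f : (Subring.center A)[X]) : Prop :=
  ∀ s, centerAct A f s = 0 → s = 0

theorem ActsInjectively.mul {f g : (Subring.center A)[X]} (hf : ActsInjectively f)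
    (hg : ActsInjectively g) : ActsInjectively (f * g) := fun s hs =>
  hg s (hf _ (by rw [← centerAct_mul, hs]))

theorem ActsInjectively.list_prod {L : List (Subring.center A)[X]}
    (h : ∀ f ∈ L, ActsInjectively f) : ActsInjectively L.prod := by
  induction L with
  | nil =>
    intro s hs
    rw [List.prod_nil, map_one] at hs
    exact hs
  | cons f L ih =>
    rw [List.prod_cons]
    exact (h f (by simp)).mul (ih fun g hg => h g (by simp [hg]))

/-- The polynomial `f² - ε²`, where `ε² = b ε`, acts injectively if so do `f` and `f ± b`. -/
theorem ActsInjectively.sq_sub_sq {f : (Subring.center A)[X]} {ε b : Subring.center A}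
    (hε : ε * ε = b * ε) (hf : ActsInjectively f) (h1 : ActsInjectively (f - C b))
    (h2 : ActsInjectively (f + C b)) : ActsInjectively (f ^ 2 - C ε ^ 2) := by
  intro s hs
  have hε' : C ε * C ε = C b * C ε := by rw [← C_mul, hε, C_mul]
  have e1 : centerAct A ((f - C b) * (f + C b)) (centerAct A (C ε) s) = 0 := by
    rw [← centerAct_mul, show (f - C b) * (f + C b) * C ε = C ε * (f ^ 2 - C ε ^ 2) by
      linear_combination (C ε + C b) * hε', centerAct_mul, hs, map_zero]
  have e2 := h1.mul h2 _ e1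
  refine hf.mul hf _ ?_
  have e3 : centerAct A (f * f - C ε * C ε) s = 0 := by rw [← pow_two, ← pow_two, hs]
  rw [map_sub] at e3
  change centerAct A (f * f) s - centerAct A (C ε * C ε) s = 0 at e3
  rwa [centerAct_mul (C ε), e2, map_zero, sub_zero] at e3

end CenterAction

section SeriesAction

variable {F : Type*} [Ring F] [Algebra Base F]

/-- The polynomials `1 - z c - z u` act injectively, by divisibility by the powers of `z`. -/
theorem actsInjectively_one_sub (c : Subring.center (PowerSeries (Lift F))) :
    ActsInjectively (lin (1 - cX F * c) (cX F)) := by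
  intro s hs
  have h : ∀ d, s d = PowerSeries.X *
      ((c : PowerSeries (Lift F)) * s d + s (d - 1)) := fun d => by
    have := congrFun hs d
    rw [centerAct_lin, Pi.zero_apply] at this
    change (1 - PowerSeries.X * (c : PowerSeries (Lift F))) * s d - PowerSeries.X * s (d - 1) = 0
      at this
    rw [sub_mul, one_mul, sub_sub, sub_eq_zero] at this
    rw [mul_add, ← mul_assoc]
    exact this
  have hn : ∀ (n : ℕ) d, ∃ w, s d = PowerSeries.X ^ n * w := by
    intro n
    induction n with
    | zero => exact fun d => ⟨s d, by rw [pow_zero, one_mul]⟩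
    | succ n ih =>
      intro d
      obtain ⟨w, hw⟩ := ih d
      obtain ⟨w', hw'⟩ := ih (d - 1)
      refine ⟨(c : PowerSeries (Lift F)) * w + w', ?_⟩
      have hc := Subring.mem_center_iff.1 c.2 (PowerSeries.X ^ n)
      rw [h d, hw, hw', ← mul_assoc (c : PowerSeries (Lift F)), ← hc, mul_assoc, ← mul_add,
        ← mul_assoc, pow_succ']
  funext d
  ext1 n
  obtain ⟨w, hw⟩ := hn (n + 1) d
  rw [hw, PowerSeries.coeff_X_pow_mul', if_neg (by omega), Pi.zero_apply, map_zero]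

variable [TopologicalSpace F] [PairingAlgebra F]

/-- The polynomials `z - w h - u` act injectively, by induction on the powers of `z` and by the
topological nilpotency of `h`. -/
theorem actsInjectively_sub (w : ℂ) : ActsInjectively (lin (cX F - cBase F (hMul w)) 1) := by
  intro s hs
  set a := algebraMap Base (Lift F) (hMul (-w)) with ha
  have h : ∀ d, s d = PowerSeries.X * s (d + 1) + PowerSeries.C a * s (d + 1) := fun d => by
    have := congrFun hs (d + 1)
    rw [centerAct_lin, Pi.zero_apply, add_sub_cancel_right] at this
    change (PowerSeries.X - algebraMap Base (PowerSeries (Lift F)) (hMul w)) * s (d + 1) -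
      1 * s d = 0 at this
    rw [one_mul, sub_eq_zero] at this
    rw [← this, ha, hMul_neg, map_neg, map_neg, neg_mul, sub_mul, algebraMap_series,
      sub_eq_add_neg]
  have key : ∀ (k : ℕ) d, PowerSeries.coeff k (s d) = 0 := by
    intro k
    induction k with
    | zero =>
      have h0 : ∀ (n : ℕ) d, PowerSeries.coeff 0 (s d) =
          a ^ n * PowerSeries.coeff 0 (s (d + n)) := by
        intro n
        induction n with
        | zero => intro d; simp
        | succ n ih =>
          intro d
          rw [ih, h (d + n), map_add, PowerSeries.coeff_zero_X_mul, zero_add,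
            PowerSeries.coeff_C_mul, ← mul_assoc, ← pow_succ, add_assoc]
          push_cast
          rfl
      intro d
      refine tendsto_nhds_unique (tendsto_const_nhds (x := PowerSeries.coeff 0 (s d)))
        (((isShift_algebraMap (-w)).tendsto fun n : ℕ =>
          PowerSeries.coeff 0 (s (d + n))).congr fun n => (h0 n d).symm)
    | succ k ihk =>
      have h0 : ∀ (n : ℕ) d, PowerSeries.coeff (k + 1) (s d) =
          a ^ n * PowerSeries.coeff (k + 1) (s (d + n)) := by
        intro n
        induction n with
        | zero => intro d; simp
        | succ n ih =>
          intro d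
          rw [ih, h (d + n), map_add, PowerSeries.coeff_succ_X_mul, ihk, zero_add,
            PowerSeries.coeff_C_mul, ← mul_assoc, ← pow_succ, add_assoc]
          push_cast
          rfl
      intro d
      refine tendsto_nhds_unique (tendsto_const_nhds (x := PowerSeries.coeff (k + 1) (s d)))
        (((isShift_algebraMap (-w)).tendsto fun n : ℕ =>
          PowerSeries.coeff (k + 1) (s (d + n))).congr fun n => (h0 n d).symm)
  funext d
  ext1 k
  rw [key, Pi.zero_apply, map_zero]

end SeriesAction

/-! ### Naturality of the products of series -/

section Naturality

variable {R R' : Type*} [Ring R] [TopologicalSpace R] [Ring R'] [TopologicalSpace R']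

theorem Null.map {Y : PowerSeries R} (hY : Null Y) (φ : R →+* R') (hφ : Continuous φ) :
    Null (PowerSeries.map φ Y) := by
  have := (hφ.tendsto 0).comp hY
  rw [map_zero] at this
  simpa only [Null, PowerSeries.coeff_map, Function.comp_def] using this

theorem zcoeff_map (φ : R →+* R') (Z : PowerSeries R) (e : ℤ) :
    zcoeff (PowerSeries.map φ Z) e = φ (zcoeff Z e) := by
  simp only [zcoeff]
  split_ifs <;> simp

variable [Algebra Base R] [PairingAlgebra R] [T2Space R']

theorem pair_map {Y : PowerSeries R} (hY : Null Y) (φ : R →+* R') (hφ : Continuous φ)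
    (Z : PowerSeries R) (d : ℤ) :
    pair (PowerSeries.map φ Z) (PowerSeries.map φ Y) d = φ (pair Z Y d) := by
  rw [pair, pair, (summable_pair hY Z d).map_tsum φ hφ]
  simp only [zcoeff_map, PowerSeries.coeff_map, map_mul]

/-- If a constant `E` is absorbed by both factors, then it is absorbed by their product. -/
theorem pair_absorb {X Y : PowerSeries R} {E : R} (hY : Null Y)
    (h1 : PowerSeries.C E * X = PowerSeries.C E * X * PowerSeries.C E)
    (h2 : PowerSeries.C E * Y = PowerSeries.C E * Y * PowerSeries.C E) (d : ℤ) :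
    E * pair X Y d = E * pair X Y d * E := by
  have e1 : pair (PowerSeries.C E * X) Y =
      pair (PowerSeries.C E * X) (PowerSeries.C E * Y) := by
    conv_lhs => rw [h1]
    rw [pair_mul_C]
  have e2 : pair (PowerSeries.C E * X) Y d = pair (PowerSeries.C E * X) Y d * E := by
    conv_lhs => rw [e1, h2, pair_mul_C_right (hY.C_mul E)]
    rw [e1]
  rwa [pair_C_mul hY] at e2

end Naturality

end

noncomputable section

open Polynomial Filter Topology

/-! ### The coefficients of the trace commute with the generators -/

section LiftAlgebra

variable {F : Type*} [Ring F] [Algebra Base F] [Algebra ℂ F]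

instance : Algebra ℂ (Lift F) :=
  ((Lift.incl F).toRingHom.comp (algebraMap ℂ F)).toAlgebra' fun c x => by
    change Lift.incl F (algebraMap ℂ F c) * x = x * Lift.incl F (algebraMap ℂ F c)
    refine Lift.ext ?_ ?_
    · rw [Lift.fst_mul, Lift.fst_mul, Lift.fst_incl, Algebra.commutes]
    · rw [Lift.snd_mul, Lift.snd_mul, Lift.fst_incl, Lift.snd_incl, zero_mul, mul_zero, zero_mul,
        mul_zero, smul_zero, Algebra.commutes, add_zero, add_zero, add_zero, zero_add]

theorem constHom_algebraMap_complex (c : ℂ) :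
    constHom F (algebraMap ℂ F c) = algebraMap ℂ (PowerSeries (Lift F)) c := by
  rw [PowerSeries.algebraMap_apply]
  rfl

end LiftAlgebra

section Transfer

open scoped PowerSeries.WithPiTopology

variable {m N : ℕ} {F : Type*} [Ring F] [Algebra Base F] [TopologicalSpace F] [PairingAlgebra F]

theorem continuous_auxIncl : Continuous (auxIncl m N (constHom F)) := by
  refine continuous_pi fun f => continuous_pi fun g => continuous_pi fun i => continuous_pi
    fun j => ?_
  have e : ∀ M : TensorMat m N F, auxIncl m N (constHom F) M f g i j =
      if i = j then constHom F (M f g) else 0 := fun M => by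
    change Matrix.scalar (Fin N) (constHom F (M f g)) i j = _
    rw [Matrix.scalar_apply, Matrix.diagonal_apply]
  simp only [e]
  split_ifs
  · exact continuous_constHom.comp ((continuous_apply g).comp (continuous_apply f))
  · exact continuous_const

theorem commute_flip_seriesIncl {a c : Fin m} (h : a ≠ c) (w : Fin N → Fin N → PowerSeries F) :
    Commute (PowerSeries.C (auxFlip N (PowerSeries (Lift F)) a))
      (seriesIncl m N F (slotSeries c w)) := by
  refine PowerSeries.ext fun k => ?_
  rw [PowerSeries.coeff_C_mul, PowerSeries.coeff_mul_C, seriesIncl, PowerSeries.coeff_map,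
    slotSeries, PowerSeries.coeff_mk, auxIncl, RingHom.mapMatrix_apply, slot_map, auxFlip]
  exact commute_slot h fun i j p q => (commute_scalar_flip _ i j).symm

theorem commute_flip_seriesIncl_inverse {a c : Fin m} (h : a ≠ c)
    {w : Fin N → Fin N → PowerSeries F} {Y : PowerSeries (TensorMat m N F)}
    (h1 : slotSeries c w * Y = 1) (h2 : Y * slotSeries c w = 1) :
    Commute (PowerSeries.C (auxFlip N (PowerSeries (Lift F)) a)) (seriesIncl m N F Y) :=
  mul_inverse_eq (commute_flip_seriesIncl h w)
    (by rw [← map_mul, h1, map_one]) (by rw [← map_mul, h2, map_one])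

theorem hMul_intCast (k : ℤ) : hMul k = k • hbar := by
  rw [hMul, map_intCast, zsmul_eq_mul]

theorem cBase_zsmul (k : ℤ) (b : Base) : cBase F (k • b) = k • cBase F b :=
  Subtype.ext (map_zsmul (algebraMap Base (PowerSeries (Lift F))) k b)

theorem cBase_hMul_intCast (k : ℤ) : cBase F (hMul k) = k • cBase F hbar := by
  rw [hMul_intCast, cBase_zsmul]

theorem cBase_hMul_natCast (n : ℕ) : cBase F (hMul n) = n * cBase F hbar := by
  have := cBase_hMul_intCast (F := F) n
  rwa [Int.cast_natCast, natCast_zsmul, nsmul_eq_mul] at this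

variable [Algebra ℂ F] {x y : Fin N → Fin N → ℕ → F}

theorem auxIncl_map_algebraMap (E : TensorMat m N ℂ) :
    auxIncl m N (constHom F) (E.map (algebraMap ℂ F)) =
      E.map (algebraMap ℂ (Matrix (Fin N) (Fin N) (PowerSeries (Lift F)))) := by
  ext1 f g
  change Matrix.scalar (Fin N) (constHom F (algebraMap ℂ F (E f g))) = algebraMap ℂ _ (E f g)
  rw [constHom_algebraMap_complex]
  rfl

/-- The setting of the commutation theorem: a content vector `κ`, the inverses `Y_a` of the series
`T_a(u + h k - h N / 2)`, and the convergence to zero of the coefficients of their product. -/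
structure IsTraceData (x : Fin N → Fin N → ℕ → F) (κ : Fin m → ℤ)
    (Y : Fin m → ℤ → PowerSeries (TensorMat m N F)) : Prop where
  mem : ∀ a, κ a ∈ Finset.Ioo (-(m : ℤ)) m
  mul_inv : ∀ a (k : ℤ), invSlot x a (k - N / 2) * Y a k = 1
  inv_mul : ∀ a (k : ℤ), Y a k * invSlot x a (k - N / 2) = 1
  null : Null (List.ofFn fun a => Y a (κ a)).reverse.prod

/-- The coefficients of the product of the `T⁺_a(u + h κ_a)` and the `Y_a`. -/
def productCoeff (y : Fin N → Fin N → ℕ → F) (κ : Fin m → ℤ)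
    (Y : Fin m → ℤ → PowerSeries (TensorMat m N F)) : ℤ → TensorMat m N F :=
  pair (List.ofFn fun a => plusSlot y a (κ a)).prod (List.ofFn fun a => Y a (κ a)).reverse.prod

/-- The coefficients of the trace of the product, cut down by the projection `E_κ`. -/
def traceProduct (y : Fin N → Fin N → ℕ → F) (κ : Fin m → ℤ)
    (Y : Fin m → ℤ → PowerSeries (TensorMat m N F)) (d : ℤ) : F :=
  Matrix.trace ((contentProj N κ).map (algebraMap ℂ F) * productCoeff y κ Y d)

variable {κ : Fin m → ℤ} {Y : Fin m → ℤ → PowerSeries (TensorMat m N F)}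

theorem IsTraceData.absorb (hY : IsTraceData x κ Y) (H : IsCritical x y) (d : ℤ) :
    (contentProj N κ).map (algebraMap ℂ F) * productCoeff y κ Y d =
      (contentProj N κ).map (algebraMap ℂ F) * productCoeff y κ Y d *
        (contentProj N κ).map (algebraMap ℂ F) :=
  pair_absorb hY.null (contentProj_mul_covariant H.isCovariant_plusSlot hY.mem)
    (contentProj_mul_covariant (H.isCovariant_inverse _ hY.mul_inv hY.inv_mul) hY.mem) d

theorem IsTraceData.reverse_prod_map (Y : Fin m → ℤ → PowerSeries (TensorMat m N F)) :
    (List.ofFn fun a => seriesIncl m N F (Y a (κ a))).reverse.prod =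
      PowerSeries.map (auxIncl m N (constHom F)) (List.ofFn fun a => Y a (κ a)).reverse.prod := by
  rw [map_list_prod, List.map_reverse, List.map_ofFn]
  rfl

theorem IsTraceData.pair_seriesIncl (hY : IsTraceData x κ Y) :
    pair (List.ofFn fun a => seriesIncl m N F (plusSlot y a (κ a))).prod
      (List.ofFn fun a => seriesIncl m N F (Y a (κ a))).reverse.prod =
      fun d => auxIncl m N (constHom F) (productCoeff y κ Y d) := by
  funext d
  have e : (List.ofFn fun a => seriesIncl m N F (plusSlot y a (κ a))).prod =
      PowerSeries.map (auxIncl m N (constHom F)) (List.ofFn fun a => plusSlot y a (κ a)).prod := by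
    rw [map_list_prod, List.map_ofFn]
    rfl
  rw [e, reverse_prod_map, pair_map hY.null _ continuous_auxIncl]
  rfl

/-- The commutator of `T` with the trace vanishes if `T` satisfies exchange relations with factors
which act injectively. -/
theorem IsTraceData.commute_of_isExchange (hY : IsTraceData x κ Y) (H : IsCritical x y)
    {T : Matrix (Fin N) (Fin N) (PowerSeries (Lift F))}
    {q p r : Fin m → (Subring.center (PowerSeries (Lift F)))[X]}
    {α α' β ε b : Subring.center (PowerSeries (Lift F))}
    {ρ : Fin m → Subring.center (PowerSeries (Lift F))}
    (hex : ∀ a, IsExchange (auxLeg m N _ T) (seriesIncl m N F (plusSlot y a (κ a)))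
      (seriesIncl m N F (Y a (κ a))) (q a) (p a) (r a)
      (linFlip N (α - κ a • b) β ε a) (linFlip N (ρ a) β (-ε) a)
      (linFlip N (α' - κ a • b) β (-ε) a))
    (hqp : ∀ a, q a * p a = r a * (lin (α - κ a • b) β * lin (α' - κ a • b) β))
    (hp : ∀ a, (p a).natDegree ≤ 2) (hr : ∀ a, (r a).natDegree ≤ 2)
    (hε : ε * ε = b * ε) (hα : ε * (α' - α) = N * (ε * ε))
    (hinj : ∀ a, ActsInjectively (q a * p a)) (d : ℤ) (i j : Fin N) :
    Commute (T i j) (constHom F (traceProduct y κ Y d)) := by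
  have key := lact_commutator_trace hY.mem hex hqp hp hr
    (fun a c h => commute_flip_seriesIncl h _)
    (fun a c h => commute_flip_seriesIncl_inverse h (hY.mul_inv c (κ c)) (hY.inv_mul c (κ c)))
    (by rw [IsTraceData.reverse_prod_map]; exact hY.null.map _ continuous_auxIncl) hε hα
    hY.pair_seriesIncl
    (fun d => by
      rw [← auxIncl_map_algebraMap, ← map_mul, ← map_mul, ← hY.absorb H])
    (fun d f g => ⟨constHom F (productCoeff y κ Y d f g), rfl⟩)
  have htr : ∀ d, Matrix.trace ((contentProj N κ).map (algebraMap ℂ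
      (Matrix (Fin N) (Fin N) (PowerSeries (Lift F)))) *
      auxIncl m N (constHom F) (productCoeff y κ Y d)) =
      Matrix.scalar (Fin N) (constHom F (traceProduct y κ Y d)) := by
    intro d
    rw [← auxIncl_map_algebraMap, ← map_mul, traceProduct, Matrix.trace, Matrix.trace, map_sum,
      map_sum]
    rfl
  simp only [htr] at key
  have h0 := ActsInjectively.list_prod (L := List.ofFn fun a => q a * p a) (fun f hf => by
    obtain ⟨a, rfl⟩ := (List.mem_ofFn' _ _).1 hf
    exact hinj a) (fun d => T i j * constHom F (traceProduct y κ Y d) -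
      constHom F (traceProduct y κ Y d) * T i j) (by
    funext d
    have := congrFun (congrFun (congrFun key d) i) j
    rw [lact_legPoly_apply] at this
    simp only [Matrix.sub_apply, Matrix.scalar_apply, Matrix.mul_diagonal,
      Matrix.diagonal_mul] at this
    exact this)
  exact sub_eq_zero.1 (congrFun h0 d)

theorem commute_of_commute_etaSeries {ι : Type*} [DecidableEq ι] {p : ι → ι → PowerSeries F}
    {i j : ι} {τ : F} (h : Commute (etaSeries p i j) (constHom F τ)) (r : ℕ) :
    Commute (PowerSeries.coeff r (p i j)) τ := by
  refine Lift.commute_of_commute_eta ?_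
  have h1 : Commute (if i = j then (1 : PowerSeries (Lift F)) else 0) (constHom F τ) := by
    split_ifs
    · exact Commute.one_left _
    · exact Commute.zero_left _
  have h2 := h.sub_left h1
  rw [etaSeries, add_sub_cancel_left] at h2
  have h3 := congrArg (PowerSeries.coeff r) h2.eq
  simp only [constHom, RingHom.comp_apply, PowerSeries.coeff_mul_C, PowerSeries.coeff_C_mul,
    PowerSeries.coeff_map] at h3
  exact h3

/-- The exchange relations for `1 + η ∑ t^{(r)} v⁻ʳ` have the polynomials `α - κ_a b` and
`α' - κ_a b` with `α' - α = N h v⁻¹`, and `ε = η v⁻¹`. -/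
theorem IsTraceData.commute_t (hN : 1 ≤ N) (hY : IsTraceData x κ Y) (H : IsCritical x y)
    (d : ℤ) (i j : Fin N) (r : ℕ) : Commute (x i j r) (traceProduct y κ Y d) := by
  set α := 1 - cX F * cBase F (hMul (N / 2)) with hα
  set α' := 1 - cX F * cBase F (-hMul (N / 2)) with hα'
  set b := cX F * cBase F hbar with hb
  have e1 : ∀ (c : Base) a, 1 - cX F * cBase F (c + hMul (κ a)) =
      1 - cX F * cBase F c - κ a • b := fun c a => by
    rw [cBase_add, cBase_hMul_intCast, hb]
    simp only [zsmul_eq_mul]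
    ring
  have hex : ∀ a, IsExchange (auxLeg m N _ (Matrix.of (etaT x)))
      (seriesIncl m N F (plusSlot y a (κ a))) (seriesIncl m N F (Y a (κ a)))
      (lin (α - κ a • b) (cX F) * lin (α' - κ a • b) (cX F)) 1 1
      (linFlip N (α - κ a • b) (cX F) (cEta F * cX F) a)
      (linFlip N (α' - κ a • b) (cX F) (-(cEta F * cX F)) a)
      (linFlip N (α' - κ a • b) (cX F) (-(cEta F * cX F)) a) := fun a => by
    rw [hα, hα', ← e1, ← e1]
    exact isExchange_etaT hN H a (κ a) (hY.mul_inv a (κ a)) (hY.inv_mul a (κ a))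
  have key := hY.commute_of_isExchange H hex (fun a => by rw [mul_one, one_mul]) (fun a => by simp)
    (fun a => by simp) (by rw [hb]; linear_combination (cX F) ^ 2 * cEta_mul_cEta (F := F)) (by
      have e2 : cBase F (hMul (N / 2)) + cBase F (hMul (N / 2)) = N * cBase F hbar := by
        rw [← cBase_hMul_natCast, ← cBase_add, ← hMul_add, add_halves]
      rw [hα, hα', cBase_neg]
      linear_combination (cEta F * (cX F) ^ 2) * e2 - (N * (cX F) ^ 2) * cEta_mul_cEta (F := F))
    (fun a => by
      rw [mul_one, hα, hα', ← e1, ← e1]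
      exact (actsInjectively_one_sub _).mul (actsInjectively_one_sub _)) d i j
  -- the index is shifted by one, as `x i j r` is the coefficient of `v⁻ʳ⁻¹`
  have := commute_of_commute_etaSeries (p := fun i j => tailSeries (x i j)) key (r + 1)
  rwa [tailSeries, PowerSeries.coeff_succ_X_mul, PowerSeries.coeff_mk] at this

/-- The exchange relations for `1 - η ∑ t^{(-r)} vʳ⁻¹` have the polynomials `α - κ_a b` and
`α' - κ_a b` with `α' - α = N h`, and `ε = η`. -/
theorem IsTraceData.commute_tPlus (hN : 1 ≤ N) (hY : IsTraceData x κ Y) (H : IsCritical x y)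
    (d : ℤ) (i j : Fin N) (r : ℕ) : Commute (y i j r) (traceProduct y κ Y d) := by
  set α := cX F with hα
  set α' := cX F + cBase F (hMul N) with hα'
  set b := cBase F hbar with hb
  have e1 : ∀ a, cX F - cBase F (hMul (κ a)) = α - κ a • b := fun a => by
    rw [cBase_hMul_intCast]
  have e2 : ∀ a, α' - κ a • b = cX F - cBase F (hMul (κ a)) + cBase F (hMul N) := fun a => by
    rw [hα', cBase_hMul_intCast]
    ring
  have hex : ∀ a, IsExchange (auxLeg m N _ (Matrix.of (etaTPlus y)))
      (seriesIncl m N F (plusSlot y a (κ a))) (seriesIncl m N F (Y a (κ a)))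
      (lin (α - κ a • b) 1 ^ 2 - C (cEta F) ^ 2) (lin (α' - κ a • b) 1 * lin (α - κ a • b) 1)
      (lin (α - κ a • b) 1 ^ 2 - C (cEta F) ^ 2)
      (linFlip N (α - κ a • b) 1 (cEta F) a) (linFlip N (α - κ a • b) 1 (-cEta F) a)
      (linFlip N (α' - κ a • b) 1 (-cEta F) a) := fun a => by
    rw [e2, ← e1]
    exact isExchange_etaTPlus hN H a (κ a) (hY.mul_inv a (κ a)) (hY.inv_mul a (κ a))
  have hinj : ∀ w : ℂ, ActsInjectively (lin (cX F - cBase F (hMul w)) 1) := actsInjectively_sub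
  have hshift : ∀ a (w : ℂ), lin (α - κ a • b) 1 + C (cBase F (hMul w)) =
      lin (cX F - cBase F (hMul (κ a - w))) 1 := fun a w => by
    rw [← e1, sub_eq_add_neg (κ a : ℂ), hMul_add, hMul_neg, cBase_add, cBase_neg, lin, lin]
    simp only [map_sub, map_add, map_neg]
    ring
  have h1 : hMul 1 = hbar := by rw [hMul, map_one, one_mul]
  have key := hY.commute_of_isExchange H hex (fun a => by ring)
    (fun a => natDegree_mul_le_of_le (natDegree_lin_le _ _) (natDegree_lin_le _ _))
    (fun a => (natDegree_sub_le _ _).trans (max_le (natDegree_pow_le_of_le 2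
      (natDegree_lin_le _ _)) (by rw [← C_pow, natDegree_C]; omega)))
    cEta_mul_cEta (by
      rw [hα, hα', cBase_hMul_natCast]
      linear_combination (-(N : Subring.center (PowerSeries (Lift F)))) *
        cEta_mul_cEta (F := F))
    (fun a => by
      -- `f² - η²` divides `f² (f - h) (f + h)`, because `η² = h η`
      refine ActsInjectively.mul (ActsInjectively.sq_sub_sq cEta_mul_cEta ?_ ?_ ?_)
        (ActsInjectively.mul ?_ ?_)
      · rw [← e1]
        exact hinj _
      · rw [← h1, sub_eq_add_neg, ← C_neg, ← cBase_neg, ← hMul_neg, hshift]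
        exact hinj _
      · rw [← h1, hshift]
        exact hinj _
      · have := hshift a N
        rw [e2, e1]
        rw [show lin (α - κ a • b + cBase F (hMul N)) 1 =
          lin (α - κ a • b) 1 + C (cBase F (hMul N)) by rw [lin, lin, C_add]; ring, this]
        exact hinj _
      · rw [← e1]
        exact hinj _) d i j
  have := commute_of_commute_etaSeries (p := fun i j => PowerSeries.mk fun r => -y i j r) key r
  rw [PowerSeries.coeff_mk] at this
  exact Commute.neg_left_iff.1 this

end Transfer

end

noncomputable section

open Filter Topology

/-! ### Series whose coefficients converge to zero -/

section LinearTopology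

variable {R : Type*} [Ring R] [TopologicalSpace R]

theorem isLinearTopology_of_exists
    (h : ∀ U ∈ 𝓝 (0 : R), ∃ J : Ideal R, (J : Set R) ∈ 𝓝 0 ∧ (J : Set R) ⊆ U) :
    IsLinearTopology R R where
  hasBasis_submodule' := ⟨fun U => ⟨fun hU => h U hU, fun ⟨_, hJ, hJU⟩ => mem_of_superset hJ hJU⟩⟩

theorem exists_ideal_subset [IsLinearTopology R R] {U : Set R} (hU : U ∈ 𝓝 0) :
    ∃ J : Ideal R, (J : Set R) ∈ 𝓝 0 ∧ (J : Set R) ⊆ U :=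
  (IsLinearTopology.hasBasis_submodule R (M := R)).mem_iff.1 hU

/-- The matrices with entries in a left ideal. -/
def matrixIdeal (n : Type*) [Fintype n] [DecidableEq n] (J : Ideal R) : Ideal (Matrix n n R) where
  carrier := {M | ∀ i j, M i j ∈ J}
  add_mem' hM hM' i j := add_mem (hM i j) (hM' i j)
  zero_mem' _ _ := zero_mem _
  smul_mem' M M' hM' i j := by
    rw [smul_eq_mul, Matrix.mul_apply]
    exact sum_mem fun k _ => Ideal.mul_mem_left _ _ (hM' k j)

instance {n : Type*} [Fintype n] [DecidableEq n] [IsLinearTopology R R] :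
    IsLinearTopology (Matrix n n R) (Matrix n n R) := by
  refine isLinearTopology_of_exists fun U hU => ?_
  obtain ⟨I, t, ht, hsub⟩ := Filter.mem_pi'.1 ((nhds_pi (a := (0 : n → n → R))).ge hU)
  have h1 : ∀ i, ∃ J : Ideal R, (J : Set R) ∈ 𝓝 0 ∧
      (∀ r : n → R, (∀ j, r j ∈ J) → r ∈ t i) := by
    intro i
    obtain ⟨I', t', ht', hsub'⟩ := Filter.mem_pi'.1 ((nhds_pi (a := (0 : n → R))).ge (ht i))
    choose J hJ hJt using fun j => exists_ideal_subset (ht' j)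
    refine ⟨⨅ j, J j, ?_, fun r hr => hsub' fun j _ => hJt j ?_⟩
    · rw [Submodule.coe_iInf]
      exact (Filter.iInter_mem).2 hJ
    · exact (Submodule.mem_iInf _).1 (hr j) j
  choose J hJ hJt using h1
  refine ⟨matrixIdeal n (⨅ i, J i), ?_, fun M hM => hsub fun i _ => hJt i _ fun j =>
    (Submodule.mem_iInf _).1 (hM i j) i⟩
  have h2 : ((⨅ i, J i : Ideal R) : Set R) ∈ 𝓝 (0 : R) := by
    rw [Submodule.coe_iInf]
    exact (Filter.iInter_mem).2 hJ
  have h3 : ∀ i j, {M : Matrix n n R | M i j ∈ (⨅ i, J i : Ideal R)} ∈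
      𝓝 (0 : Matrix n n R) := fun i j =>
    ((continuous_apply j).comp (continuous_apply i) : Continuous fun M : n → n → R =>
      M i j).continuousAt.preimage_mem_nhds h2
  have h4 := (Filter.iInter_mem).2 fun i => (Filter.iInter_mem).2 (h3 i)
  refine mem_of_superset h4 fun M hM i j => ?_
  exact Set.mem_iInter.1 (Set.mem_iInter.1 hM i) j

theorem null_iff_eventually_mem [IsLinearTopology R R] {Y : PowerSeries R} :
    Null Y ↔ ∀ J : Ideal R, (J : Set R) ∈ 𝓝 0 → ∀ᶠ n in atTop, PowerSeries.coeff n Y ∈ J := by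
  refine ⟨fun h J hJ => h hJ, fun h U hU => ?_⟩
  obtain ⟨J, hJ, hJU⟩ := exists_ideal_subset hU
  exact (h J hJ).mono fun n hn => hJU hn

variable [Algebra Base R] [PairingAlgebra R]

theorem null_one : Null (1 : PowerSeries R) := by
  refine tendsto_const_nhds.congr' ?_
  filter_upwards [eventually_ge_atTop 1] with n hn
  rw [PowerSeries.coeff_one, if_neg (by omega)]

/-- The powers of `h` go to zero uniformly. -/
theorem exists_hbar_pow_smul_mem {U : Set R} (hU : U ∈ 𝓝 0) :
    ∃ n₀, ∀ n ≥ n₀, ∀ x : R, hbar ^ n • x ∈ U := by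
  by_contra h
  push Not at h
  choose n hn x hx using h
  -- the sequence of counterexamples would converge to zero
  have h1 := PairingAlgebra.tendsto_hbar fun k => hbar ^ (n k - k) • x k
  obtain ⟨k, hk⟩ := (h1.eventually hU).exists
  rw [smul_smul, ← pow_add, Nat.add_sub_cancel' (hn k)] at hk
  exact hx k hk

theorem Null.base_smul {Y : PowerSeries R} (hY : Null Y) (b : Base) : Null (b • Y) := by
  rw [Algebra.smul_def, algebraMap_series]
  exact hY.C_mul _

theorem Null.neg {Y : PowerSeries R} (hY : Null Y) : Null (-Y) := by
  have := Tendsto.neg hY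
  rw [neg_zero] at this
  simpa only [Null, map_neg] using this

variable [IsLinearTopology R R]

/-- Left multiples of small elements are small, which disposes of the terms with a large index in
the second factor; the other terms are finitely many, and right multiplication is continuous. -/
theorem Null.mul {X Y : PowerSeries R} (hX : Null X) (hY : Null Y) : Null (X * Y) := by
  refine null_iff_eventually_mem.2 fun J hJ => ?_
  obtain ⟨n₀, h₀⟩ := eventually_atTop.1 (null_iff_eventually_mem.1 hY J hJ)
  have h1 : ∀ j, ∀ᶠ n in atTop, PowerSeries.coeff n X * PowerSeries.coeff j Y ∈ J := fun j => by
    have := Tendsto.mul_const (PowerSeries.coeff j Y) hX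
    rw [zero_mul] at this
    exact this hJ
  have h2 : ∀ᶠ n in atTop, ∀ j ∈ Finset.range n₀,
      PowerSeries.coeff (n - j) X * PowerSeries.coeff j Y ∈ J :=
    (Finset.eventually_all _).2 fun j _ => (tendsto_sub_atTop_nat j).eventually (h1 j)
  filter_upwards [h2] with n hn
  rw [PowerSeries.coeff_mul]
  refine sum_mem fun p hp => ?_
  replace hp := Finset.HasAntidiagonal.mem_antidiagonal.1 hp
  by_cases h : p.2 < n₀
  · have := hn p.2 (Finset.mem_range.2 h)
    rwa [← hp, Nat.add_sub_cancel] at this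
  · exact Ideal.mul_mem_left _ _ (h₀ _ (not_lt.1 h))

theorem Null.pow {Y : PowerSeries R} (hY : Null Y) (n : ℕ) : Null (Y ^ n) := by
  induction n with
  | zero => rw [pow_zero]; exact null_one
  | succ n ih => rw [pow_succ]; exact ih.mul hY

theorem null_list_prod {L : List (PowerSeries R)} (h : ∀ Y ∈ L, Null Y) : Null L.prod := by
  induction L with
  | nil => exact null_one
  | cons Y L ih =>
    rw [List.prod_cons]
    exact (h Y (by simp)).mul (ih fun Y' hY' => h Y' (by simp [hY']))

/-- The inverse of `1 + h W` is the sum of the geometric series modulo each power of `h`. -/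
theorem Null.of_one_add_hbar_smul_mul {W Z : PowerSeries R} (hW : Null W)
    (h : (1 + hbar • W) * Z = 1) : Null Z := by
  have hgeom : ∀ n : ℕ, Z = ∑ k ∈ Finset.range n, (-(hbar • W)) ^ k + (-(hbar • W)) ^ n * Z := by
    intro n
    induction n with
    | zero => simp
    | succ n ih =>
      have e : Z = 1 + -(hbar • W) * Z := by
        rw [neg_mul, ← sub_eq_add_neg, eq_sub_iff_add_eq, ← h, add_mul, one_mul]
      conv_lhs => rw [ih]
      rw [Finset.sum_range_succ, pow_succ, add_assoc]
      congr 1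
      conv_lhs => rw [e]
      rw [mul_add, mul_one, mul_assoc]
  refine null_iff_eventually_mem.2 fun J hJ => ?_
  obtain ⟨n, hn⟩ := exists_hbar_pow_smul_mem hJ
  have hsum : Null (∑ k ∈ Finset.range n, (-(hbar • W)) ^ k) := by
    refine Finset.sum_induction _ _ (fun _ _ ha hb => ha.add hb) null_zero fun k _ => ?_
    exact ((hW.base_smul _).neg).pow k
  filter_upwards [null_iff_eventually_mem.1 hsum J hJ] with k hk
  rw [hgeom n, map_add]
  refine add_mem hk ?_
  rw [← smul_neg, smul_pow, smul_mul_assoc, coeff_base_smul]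
  exact hn n le_rfl _

/-- In a coefficient of the shifted series, the terms with a large index are small by assumption and
the others contain a large power of `h`. -/
theorem Null.invShift {f : PowerSeries R} (hf : Null f) (z : ℂ) :
    Null (invShift (algebraMap Base R (hMul z)) f) := by
  refine null_iff_eventually_mem.2 fun J hJ => ?_
  obtain ⟨n₀, h₀⟩ := eventually_atTop.1 (null_iff_eventually_mem.1 hf J hJ)
  obtain ⟨n₁, h₁⟩ := exists_hbar_pow_smul_mem hJ
  filter_upwards [eventually_ge_atTop (n₀ + n₁)] with k hk
  rw [coeff_invShift]
  refine sum_mem fun i hi => ?_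
  by_cases h : n₀ ≤ i
  · exact Ideal.mul_mem_left _ _ (h₀ i h)
  · have e : (-algebraMap Base R (hMul z)) ^ (k - i) * PowerSeries.coeff i f =
        hbar ^ (k - i) • ((PowerSeries.C (-z) : Base) ^ (k - i) • PowerSeries.coeff i f) := by
      rw [smul_smul, ← map_neg, ← map_pow, ← Algebra.smul_def, ← hMul_neg, hMul, mul_pow, mul_comm]
    rw [mul_assoc, e]
    exact Ideal.mul_mem_left _ _ (h₁ _ (by omega) _)

end LinearTopology

section InverseSeries

variable {m N : ℕ} {F : Type*} [Ring F] [Algebra Base F] [TopologicalSpace F] [PairingAlgebra F]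
  [IsLinearTopology F F] {x : Fin N → Fin N → ℕ → F}

theorem null_slotSeries {w : Fin N → Fin N → PowerSeries F} (hw : ∀ i j, Null (w i j))
    (a : Fin m) : Null (slotSeries a w) := by
  refine tendsto_matrix_iff.2 fun f g => ?_
  simp only [slotSeries, PowerSeries.coeff_mk, slot_apply]
  split_ifs
  · exact hw _ _
  · exact tendsto_const_nhds

theorem null_tailSeries (hx : ∀ i j, Tendsto (x i j) atTop (𝓝 0)) (i j : Fin N) :
    Null (tailSeries (x i j)) := by
  have h : Null (PowerSeries.mk (x i j)) := by
    simpa only [Null, PowerSeries.coeff_mk] using hx i j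
  have := h.X_pow_mul 1
  rwa [pow_one] at this

/-- The shifted series `T_a(u + z h)` is the identity modulo `h`. -/
theorem invSlot_eq (a : Fin m) (z : ℂ) : invSlot x a z =
    1 + hbar • slotSeries a fun i j =>
      invShift (algebraMap Base F (hMul z)) (tailSeries (x i j)) := by
  have e : ∀ i j, invShift (algebraMap Base F (hMul z)) (PowerSeries.mk (tCoeff x i j)) =
      (1 : Matrix (Fin N) (Fin N) (PowerSeries F)) i j +
        hbar • invShift (algebraMap Base F (hMul z)) (tailSeries (x i j)) := fun i j => by
    rw [mk_tCoeff x i j, ← invShiftHom_apply (commute_algebraMap (hMul z)),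
      ← invShiftHom_apply (commute_algebraMap (hMul z)), map_add, hbar_smul_eq, hbar_smul_eq,
      map_mul, invShiftHom_C, Matrix.one_apply]
    congr 1
    split_ifs
    · exact map_one _
    · exact map_zero _
  have h1 : (1 : PowerSeries (TensorMat m N F)) =
      slotSeries a fun i j => (1 : Matrix (Fin N) (Fin N) (PowerSeries F)) i j := by
    rw [← seriesEquiv_slot]
    change _ = seriesEquiv _ F (slotHom a 1)
    rw [map_one, map_one]
  rw [h1, invSlot]
  ext k f g
  simp only [slotSeries, PowerSeries.coeff_mk, map_add, coeff_base_smul, Matrix.add_apply,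
    Matrix.smul_apply, slot_apply, Matrix.of_apply, e]
  split_ifs <;> simp

/-- The coefficients of the inverse of `T_a(u + z h)` converge to zero. -/
theorem null_inverse (hx : ∀ i j, Tendsto (x i j) atTop (𝓝 0)) {a : Fin m} {z : ℂ}
    {Y : PowerSeries (TensorMat m N F)} (h : invSlot x a z * Y = 1) : Null Y := by
  rw [invSlot_eq] at h
  have hn := null_slotSeries (fun i j => (null_tailSeries hx i j).invShift z) a
  exact hn.of_one_add_hbar_smul_mul h

end InverseSeries

end

noncomputable section

open Filter Topology

/-! ### The completed double Yangian -/

section Completed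

variable {N : ℕ} {c : ℂ}

theorem continuous_base_smul_level (b : Base) : Continuous fun x : DYLevel N c => b • x := by
  simp only [Algebra.smul_def]
  exact continuous_const.mul continuous_id

instance : UniformContinuousConstSMul Base (DYLevel N c) where
  uniformContinuous_const_smul b := uniformContinuous_addMonoidHom_of_continuous
    (f := DistribSMul.toAddMonoidHom (DYLevel N c) b) (continuous_base_smul_level b)

/-- The completion map. -/
def completionHom (N : ℕ) (c : ℂ) : DYLevel N c →ₐ[Base] CompletedDY N c :=
  { UniformSpace.Completion.coeRingHom with commutes' := fun _ => rfl }

/-- The closure of the image of `I_p + hⁿ DY_c(gl_N)`. -/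
def closedNbhd (N : ℕ) (c : ℂ) (p n : ℕ) : Set (CompletedDY N c) :=
  closure ((fun x : DYLevel N c => (x : CompletedDY N c)) '' (DYLevel.nbhd N c p n : Set _))

theorem hasBasis_closedNbhd : (𝓝 (0 : CompletedDY N c)).HasBasis (fun _ : ℕ × ℕ => True)
    fun pn => closedNbhd N c pn.1 pn.2 := by
  have h := (DYLevel.isBasis N c).hasBasis_nhds_zero.hasBasis_of_isDenseInducing
    (UniformSpace.Completion.isDenseInducing_coe (α := DYLevel N c))
  rw [UniformSpace.Completion.coe_zero] at h
  exact h

theorem mem_closure_coe (x : CompletedDY N c) :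
    x ∈ closure (Set.range fun x : DYLevel N c => (x : CompletedDY N c)) :=
  UniformSpace.Completion.denseRange_coe x

/-- The closure of the image of `I_p + hⁿ DY_c(gl_N)`, as a left ideal. -/
def closedIdeal (N : ℕ) (c : ℂ) (p n : ℕ) : Ideal (CompletedDY N c) where
  carrier := closedNbhd N c p n
  add_mem' hx hy := by
    refine map_mem_closure₂ continuous_add hx hy ?_
    rintro _ ⟨a, ha, rfl⟩ _ ⟨b, hb, rfl⟩
    exact ⟨a + b, add_mem ha hb, UniformSpace.Completion.coe_add a b⟩
  zero_mem' := subset_closure ⟨0, zero_mem _, UniformSpace.Completion.coe_zero⟩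
  smul_mem' x y hy := by
    refine map_mem_closure₂ continuous_mul (mem_closure_coe x) hy ?_
    rintro _ ⟨a, rfl⟩ _ ⟨b, hb, rfl⟩
    exact ⟨a * b, Ideal.mul_mem_left _ _ hb, UniformSpace.Completion.coe_mul a b⟩

instance : IsLinearTopology (CompletedDY N c) (CompletedDY N c) :=
  isLinearTopology_of_exists fun U hU => by
    obtain ⟨pn, -, h⟩ := hasBasis_closedNbhd.mem_iff.1 hU
    exact ⟨closedIdeal N c pn.1 pn.2, hasBasis_closedNbhd.mem_of_mem trivial, h⟩

theorem hbar_pow_smul_mem_closedNbhd {p n k : ℕ} (h : n ≤ k) (x : CompletedDY N c) :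
    hbar ^ k • x ∈ closedNbhd N c p n := by
  rw [Algebra.smul_def]
  refine map_mem_closure (continuous_const_mul _) (mem_closure_coe x) ?_
  rintro _ ⟨a, rfl⟩
  refine ⟨hbar ^ k • a, DYLevel.hbar_smul_mem h a, ?_⟩
  rw [Algebra.smul_def]
  exact UniformSpace.Completion.coe_mul _ _

instance : PairingAlgebra (CompletedDY N c) where
  summable_mul x y hy := by
    refine NonarchimedeanAddGroup.summable_of_tendsto_cofinite_zero ?_
    rw [Nat.cofinite_eq_atTop]
    exact IsLinearTopology.tendsto_mul_zero_of_right x y hy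
  tendsto_hbar x := hasBasis_closedNbhd.tendsto_right_iff.2 fun pn _ => by
    filter_upwards [eventually_ge_atTop pn.2] with k hk
    exact hbar_pow_smul_mem_closedNbhd hk _

/-- The completed double Yangian as an algebra over `ℂ`. -/
instance : Algebra ℂ (CompletedDY N c) :=
  ((scalar N c).comp PowerSeries.C).toAlgebra' fun z x =>
    Algebra.commutes (PowerSeries.C z : Base) x

/-- The element `t_{ij}^{(r+1)}` of the completed double Yangian. -/
def tHat (N : ℕ) (c : ℂ) (i j : Fin N) (r : ℕ) : CompletedDY N c :=
  completionHom N c (DYLevel.t N c i j r)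

/-- The element `t_{ij}^{(-r-1)}` of the completed double Yangian. -/
def tPlusHat (N : ℕ) (c : ℂ) (i j : Fin N) (r : ℕ) : CompletedDY N c :=
  completionHom N c (DYLevel.tPlus N c i j r)

theorem isCritical_completed (N : ℕ) :
    IsCritical (tHat N (-(N : ℂ))) (tPlusHat N (-(N : ℂ))) :=
  (isCritical_dyLevel N).map (completionHom N _)

theorem tendsto_tHat (i j : Fin N) : Tendsto (tHat N c i j) atTop (𝓝 0) := by
  have h : Tendsto (DYLevel.t N c i j) atTop (𝓝 0) :=
    (DYLevel.isBasis N c).hasBasis_nhds_zero.tendsto_right_iff.2 fun pn _ => by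
      filter_upwards [eventually_ge_atTop pn.1] with r hr
      exact DYLevel.t_mem (by omega) i j
  have h' := (UniformSpace.Completion.continuous_coe (DYLevel N c)).tendsto 0
  rw [UniformSpace.Completion.coe_zero] at h'
  exact h'.comp h

variable {m : ℕ}

theorem tPlusMat_eq (a : Fin m) (z : ℂ) :
    tPlusMat (N := N) c a z = plusSlot (tPlusHat N c) a z := by
  have e : tPlusSeries N c = fun i j => PowerSeries.mk (tPlusCoeff (tPlusHat N c) i j) := by
    funext i j
    refine congrArg PowerSeries.mk (funext fun r => ?_)
    exact map_tPlusCoeff (completionHom N c) _ _ _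
  rw [tPlusMat, e]
  rfl

theorem tMat_eq (a : Fin m) (z : ℂ) : tMat (N := N) c a z = invSlot (tHat N c) a z := by
  have e : tSeries N c = fun i j => PowerSeries.mk (tCoeff (tHat N c) i j) := by
    funext i j
    refine congrArg PowerSeries.mk (funext fun r => ?_)
    exact map_tCoeff (completionHom N c) _ _ _
  rw [tMat, e]
  rfl

theorem tMatInv_mul_tMat (a : Fin m) (z : ℂ) : tMatInv (N := N) c a z * tMat c a z = 1 :=
  PowerSeries.invOfUnit_mul _ _ (constantCoeff_tMat c a z)

theorem isTraceData_tMatInv {κ : Fin m → ℤ} (hκ : ∀ a, κ a ∈ Finset.Ioo (-(m : ℤ)) m) :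
    IsTraceData (tHat N c) κ fun a k => tMatInv c a (k - N / 2) where
  mem := hκ
  mul_inv a k := by rw [← tMat_eq, tMat_mul_tMatInv]
  inv_mul a k := by rw [← tMat_eq, tMatInv_mul_tMat]
  null := null_list_prod fun Y hY => by
    obtain ⟨a, rfl⟩ := (List.mem_ofFn' _ _).1 (List.mem_reverse.1 hY)
    exact null_inverse tendsto_tHat (by rw [← tMat_eq, tMat_mul_tMatInv])

variable {μ : YoungDiagram}

/-- The coefficients of `T̃_μ(u)` converge. -/
theorem hasSum_traceTerm (U : StandardTableau μ) (d : ℤ) :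
    HasSum (traceTerm N c U d) (traceProduct (tPlusHat N c) U.content
      (fun a k => tMatInv c a (k - N / 2)) d) := by
  have hY := isTraceData_tMatInv (N := N) (c := c) U.content_mem
  have h := (summable_pair hY.null (plusProduct N c U) d).hasSum
  let φ : TensorMat μ.card N (CompletedDY N c) →+ CompletedDY N c :=
    (Matrix.traceAddMonoidHom _ _).comp (AddMonoidHom.mulLeft
      ((contentProj N U.content).map (algebraMap ℂ (CompletedDY N c))))
  have hφ : Continuous φ := (continuous_id.matrix_trace).comp (continuous_const_mul _)
  have h1 := h.map φ hφ
  have e1 : φ ∘ (fun l : ℕ => zcoeff (plusProduct N c U) (d + l) *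
      PowerSeries.coeff l (invProduct N c U)) = traceTerm N c U d := by
    funext l
    rw [Function.comp_apply, traceTerm, zcoeff, operator_eq_contentProj]
    split_ifs
    · rw [mul_assoc]
      rfl
    · rw [zero_mul, map_zero]
  have e2 : plusProduct N c U =
      (List.ofFn fun a => plusSlot (tPlusHat N c) a (U.content a)).prod := by
    simp only [plusProduct, tPlusMat_eq]
  have e3 : traceProduct (tPlusHat N c) U.content (fun a k => tMatInv c a (k - N / 2)) d =
      φ (∑' l : ℕ, zcoeff (plusProduct N c U) (d + l) *
        PowerSeries.coeff l (invProduct N c U)) := by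
    rw [traceProduct, productCoeff, ← e2]
    rfl
  rw [e3, ← e1]
  exact h1

theorem proj_genC (N : ℕ) (c : ℂ) :
    DYLevel.proj N c (genC N) = algebraMap Base (DYLevel N c) (PowerSeries.C c) := by
  have h := RingQuot.mkAlgHom_rel Base (LevelRel.level (N := N) (c := c))
  exact h.trans ((RingQuot.mkAlgHom Base (LevelRel N c)).commutes _)

/-- An element which commutes with the generators is central. -/
theorem mem_center_of_commute {τ : CompletedDY N c} (h1 : ∀ i j r, Commute (tHat N c i j r) τ)
    (h2 : ∀ i j r, Commute (tPlusHat N c i j r) τ) :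
    τ ∈ Subring.center (CompletedDY N c) := by
  have hgen : ∀ f : Free N, Commute (completionHom N c (DYLevel.proj N c f)) τ := by
    intro f
    induction f using FreeAlgebra.induction with
    | grade0 a =>
      rw [AlgHom.commutes, AlgHom.commutes]
      exact commute_algebraMap a τ
    | grade1 g =>
      cases g with
      | central =>
        have : DYLevel.proj N c (FreeAlgebra.ι Base Gen.central) = _ := proj_genC N c
        rw [this, AlgHom.commutes]
        exact commute_algebraMap _ τ
      | t i j r => exact h1 i j r
      | tPlus i j r => exact h2 i j r
    | mul a b ha hb => rw [map_mul, map_mul]; exact ha.mul_left hb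
    | add a b ha hb => rw [map_add, map_add]; exact ha.add_left hb
  refine Subring.mem_center_iff.2 fun x => ?_
  induction x using UniformSpace.Completion.induction_on with
  | hp => exact isClosed_eq (continuous_mul_const τ) (continuous_const_mul τ)
  | ih a =>
    obtain ⟨f, rfl⟩ := DYLevel.proj_surjective a
    exact (hgen f).eq

end Completed

end

end DoubleYangian

theorem theorem4p3 (N : ℕ) (hN : 1 ≤ N) (μ : YoungDiagram) (hμ : μ.colLen 0 ≤ N)
    (U : DoubleYangian.StandardTableau μ) (d : ℤ) :
    Summable (DoubleYangian.traceTerm N (-(N : ℂ)) U d) ∧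
      DoubleYangian.traceCoeff N (-(N : ℂ)) U d ∈
        Subring.center (DoubleYangian.CompletedDY N (-(N : ℂ))) := by
  have h := DoubleYangian.hasSum_traceTerm (N := N) (c := -(N : ℂ)) U d
  have hY := DoubleYangian.isTraceData_tMatInv (N := N) (c := -(N : ℂ)) U.content_mem
  have H := DoubleYangian.isCritical_completed N
  refine ⟨h.summable, ?_⟩
  rw [DoubleYangian.traceCoeff, h.tsum_eq]
  exact DoubleYangian.mem_center_of_commute (fun i j r => hY.commute_t hN H d i j r)
    fun i j r => hY.commute_tPlus hN H d i j r
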